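/- Let $0<p<1$, let $\pi_{\mathrm{slab}}$ be a positive continuously differentiable probability density on $\mathbb{R}$, and let $L:\mathbb{R}^d\to(0,\infty)$ be a continuously differentiable likelihood whose integral against the spike-and-slab prior $\prod_{j=1}^d\{p\,\pi_{\mathrm{slab}}(x_j)\,dx_j+(1-p)\,\delta_0(dx_j)\}$ is finite. Let $\pi$ be the posterior (the normalized measure with density $L$ relative to this prior), and assume that the coordinates are independent under $\pi$. Put $w=(1-p)/\{p\,\pi_{\mathrm{slab}}(0)\}$. A zig-zag process with potential $U$ moves with velocity $v\in\{\pm1\}^d$, and the sign of $v_i$ flips at the events of a Poisson process with rate $\max\{0,v_i\partial_iU(x)\}$, with independent clocks for different coordinates. The original sticky sampler $(x_t,v_t)$ is the zig-zag process with $U(x)=-\log\{L(x)\prod_j\pi_{\mathrm{slab}}(x_j)\}$, modified so that a coordinate that reaches $0$ stays at $0$ for an independent exponential time with mean $w$, its velocity being kept, while the other coordinates continue to evolve. The latent sticky sampler is the image of the zig-zag process on the latent density $\tilde x\mapsto L(c(\tilde x))\prod_j p\,\pi_{\mathrm{slab}}(c(\tilde x_j))$ under the map $c$, applied coordinatewise,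 with $c(y)=0$ for $|y|\le w/2$ and $c(y)=y-\operatorname{sign}(y)\,w/2$ for $|y|>w/2$; its sticking time is the deterministic time $w$. Both samplers start from deterministic initial states. Fix a coordinate $i$ and a measurable $f:\mathbb{R}\to\mathbb{R}$ with $\mathbb{E}_\pi|f(x_i)|<\infty$. Fix $a\neq0$ and $b\in\{\pm1\}$. For each sampler let $T_0=\inf\{t\ge0:(x_{i,t},v_{i,t})=(a,b)\}$ (so $T_0=0$ if the sampler starts there) and $T_1=\inf\{t>T_0:(x_{i,t},v_{i,t})=(a,b)\}$, and write $Z=\int_{T_0}^{T_1}f(x_{i,t})\,dt$. Assume that for both samplers $T_0<\infty$ and $T_1<\infty$ almost surely, $\mathbb{E}[T_1-T_0]<\infty$, $\mathbb{E}|Z|<\infty$, $\sup_{T_0\le t\le T_1}\left|\int_{T_0}^tf(x_{i,s})\,ds\right|<\infty$ almost surely, and $0<\operatorname{Var}\{Z-\mu(T_1-T_0)\}<\infty$, where $\mu=\mathbb{E}[Z]/\mathbb{E}[T_1-T_0]$. Then, for each of the two samplers, $\sqrt{\tau}\left\{\tau^{-1}\int_0^\tau f(x_{i,t})\,dt-\mathbb{E}_\pi[f(x_i)]\right\}$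 converges in distribution, as $\tau\to\infty$, to a centered normal distribution, and the variance of the limit (the asymptotic variance of the estimator) for the latent sticky sampler is less than or equal to that for the original sticky sampler. -/

import Mathlib

open MeasureTheory ProbabilityTheory Filter
open scoped ENNReal NNReal Topology

noncomputable section

/-! ### Spike-and-slab target -/

/-- The spike-and-slab prior of one coordinate: with probability `p` a draw from the slab density,
with probability `1 - p` the point `0`. -/
def spikeSlabPrior (p : ℝ) (slab : ℝ → ℝ) : Measure ℝ :=
  ENNReal.ofReal p • (volume.withDensity fun y => ENNReal.ofReal (slab y))
    + ENNReal.ofReal (1 - p) • Measure.dirac 0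

/-- The prior on `ℝ^d`: independent spike-and-slab coordinates. -/
def productPrior (d : ℕ) (p : ℝ) (slab : ℝ → ℝ) : Measure (Fin d → ℝ) :=
  Measure.pi fun _ => spikeSlabPrior p slab

/-- The unnormalized posterior, with density `L` (the likelihood) relative to the prior. -/
def unnormalizedSpikeSlab {d : ℕ} (p : ℝ) (slab : ℝ → ℝ) (L : (Fin d → ℝ) → ℝ) :
    Measure (Fin d → ℝ) :=
  (productPrior d p slab).withDensity fun x => ENNReal.ofReal (L x)

/-- The spike-and-slab posterior. -/
def spikeSlabPosterior {d : ℕ} (p : ℝ) (slab : ℝ → ℝ) (L : (Fin d → ℝ) → ℝ) :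
    Measure (Fin d → ℝ) :=
  (unnormalizedSpikeSlab p slab L Set.univ)⁻¹ • unnormalizedSpikeSlab p slab L

/-- `p` is a nondegenerate slab probability, the slab is a positive `C¹` probability density, and
the likelihood is positive, `C¹`, and has a finite integral against the prior. -/
structure IsSpikeSlabModel {d : ℕ} (p : ℝ) (slab : ℝ → ℝ) (L : (Fin d → ℝ) → ℝ) : Prop where
  p_pos : 0 < p
  p_lt_one : p < 1
  slab_pos : ∀ y, 0 < slab y
  slab_contDiff : ContDiff ℝ 1 slab
  slab_integrable : Integrable slab
  slab_integral : ∫ y, slab y = 1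
  likelihood_pos : ∀ x, 0 < L x
  likelihood_contDiff : ContDiff ℝ 1 L
  likelihood_integrable : Integrable L (productPrior d p slab)

/-- The mean sticking duration, which is also the width of the latent universe. -/
def stickWidth (p : ℝ) (slab : ℝ → ℝ) : ℝ := (1 - p) / (p * slab 0)

/-- The potential of the density part of the posterior (up to an additive constant). -/
def slabPotential {d : ℕ} (slab : ℝ → ℝ) (L : (Fin d → ℝ) → ℝ) (x : Fin d → ℝ) : ℝ :=
  -Real.log (L x * ∏ j, slab (x j))

/-! ### Latent universe -/

/-- Collapsing the latent universe `[-w/2, w/2]` to `0`. -/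
def collapse (w y : ℝ) : ℝ := if |y| ≤ w / 2 then 0 else y - Real.sign y * (w / 2)

/-- The continuous density representing the prior of one coordinate: the slab part, with a plateau
of width `w` and of the height of the slab part at `0` inserted in the middle. -/
def latentPrior (p : ℝ) (slab : ℝ → ℝ) (y : ℝ) : ℝ :=
  p * slab (collapse (stickWidth p slab) y)

/-- The unnormalized posterior density of the latent parameter. -/
def latentDensity {d : ℕ} (p : ℝ) (slab : ℝ → ℝ) (L : (Fin d → ℝ) → ℝ) (y : Fin d → ℝ) : ℝ :=
  L (fun j => collapse (stickWidth p slab) (y j)) * ∏ j, latentPrior p slab (y j)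

/-- The potential of the latent density (up to an additive constant). -/
def latentPotential {d : ℕ} (p : ℝ) (slab : ℝ → ℝ) (L : (Fin d → ℝ) → ℝ) (y : Fin d → ℝ) : ℝ :=
  -Real.log (latentDensity p slab L y)

/-! ### Zig-zag dynamics -/

/-- The rate `max {0, v_i ∂_i U(x)}` at which coordinate `i` of the velocity flips. -/
def zigzagRate {d : ℕ} (U : (Fin d → ℝ) → ℝ) (i : Fin d) (x v : Fin d → ℝ) : ℝ :=
  max 0 (v i * deriv (fun y => U (Function.update x i y)) (x i))

/-- The number of points in `[0, c]` of the point process on the half-line with successive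
interarrival times `E 0, E 1, …`. For independent unit exponential interarrival times this is a
unit rate Poisson process. -/
def arrivalCount (E : ℕ → ℝ) (c : ℝ) : ℕ :=
  Set.ncard {k : ℕ | ∑ j ∈ Finset.range (k + 1), E j ≤ c}

variable {Ω : Type*} [MeasurableSpace Ω]

/-- `(X, V)` is a zig-zag process with potential `U`, started at `(x₀, v₀)`. The flips of the `i`-th
velocity are the Poisson events with rate `zigzagRate U i (X t) (V t)`: the number of them up to
time `t` is a unit rate Poisson process run up to the integrated rate, and the Poisson processes of
different coordinates are independent. -/
def IsZigZag {d : ℕ} (P : Measure Ω) (U : (Fin d → ℝ) → ℝ) (x₀ v₀ : Fin d → ℝ)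
    (X V : ℝ → Ω → Fin d → ℝ) : Prop :=
  (∀ i, v₀ i = 1 ∨ v₀ i = -1) ∧
  (∀ t, Measurable (X t)) ∧ (∀ t, Measurable (V t)) ∧
  ∃ E : Fin d → ℕ → Ω → ℝ,
    (∀ i k, HasLaw (E i k) (expMeasure 1) P) ∧
    iIndepFun (fun q : Fin d × ℕ => E q.1 q.2) P ∧
    ∀ᵐ ω ∂P, ∀ t, 0 ≤ t → ∀ i,
      X t ω i = x₀ i + ∫ s in (0 : ℝ)..t, V s ω i ∧
      V t ω i = v₀ i * (-1) ^ arrivalCount (fun k => E i k ω)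
        (∫ s in (0 : ℝ)..t, zigzagRate U i (X s ω) (V s ω))

/-- `(X, V)` is the latent sticky sampler: the image, under collapsing the latent universe, of a
zig-zag process on the latent density, started at the latent state `(y₀, v₀)`. -/
def IsLatentStickySampler {d : ℕ} (P : Measure Ω) (p : ℝ) (slab : ℝ → ℝ) (L : (Fin d → ℝ) → ℝ)
    (y₀ v₀ : Fin d → ℝ) (X V : ℝ → Ω → Fin d → ℝ) : Prop :=
  ∃ Y : ℝ → Ω → Fin d → ℝ,
    IsZigZag P (latentPotential p slab L) y₀ v₀ Y V ∧
    ∀ t ω i, X t ω i = collapse (stickWidth p slab) (Y t ω i)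

/-- The infimum of a set of nonnegative times; `∞` for the empty set. -/
def firstTime (S : Set ℝ) : ℝ≥0∞ := ⨅ t ∈ S, ENNReal.ofReal t

/-- The time of the `k`-th arrival at `0` of a coordinate with trajectory `x` that stays at `0` for
the time `D k` after its `k`-th arrival. -/
def stickTime (x : ℝ → ℝ) (D : ℕ → ℝ) : ℕ → ℝ≥0∞
  | 0 => firstTime {t | 0 ≤ t ∧ x t = 0}
  | k + 1 => firstTime {t | 0 ≤ t ∧ x t = 0 ∧
      ∃ u, u < t ∧ stickTime x D k + ENNReal.ofReal (D k) < ENNReal.ofReal u ∧ x u ≠ 0}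

/-- The set of times at which the coordinate is stuck at `0`. -/
def stuckSet (x : ℝ → ℝ) (D : ℕ → ℝ) : Set ℝ :=
  {t | 0 ≤ t ∧ ∃ k, stickTime x D k ≤ ENNReal.ofReal t ∧
    ENNReal.ofReal t < stickTime x D k + ENNReal.ofReal (D k)}

/-- `(X, V)` is the original sticky sampler, started at `(x₀, v₀)`: a coordinate that is not stuck
follows the zig-zag dynamics for the density part of the posterior; upon reaching `0` it sticks
there, with its velocity frozen, for an exponential time with mean `stickWidth p slab`, and then
proceeds with the same velocity. The exponential clocks behind the velocity flips (`E`) and the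
sticking times (`F`) are all independent. -/
def IsOriginalStickySampler {d : ℕ} (P : Measure Ω) (p : ℝ) (slab : ℝ → ℝ)
    (L : (Fin d → ℝ) → ℝ) (x₀ v₀ : Fin d → ℝ) (X V : ℝ → Ω → Fin d → ℝ) : Prop :=
  (∀ i, v₀ i = 1 ∨ v₀ i = -1) ∧
  (∀ t, Measurable (X t)) ∧ (∀ t, Measurable (V t)) ∧
  ∃ E F : Fin d → ℕ → Ω → ℝ,
    (∀ i k, HasLaw (E i k) (expMeasure 1) P) ∧
    (∀ i k, HasLaw (F i k) (expMeasure 1) P) ∧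
    iIndepFun (Sum.elim (fun q : Fin d × ℕ => E q.1 q.2) (fun q : Fin d × ℕ => F q.1 q.2)) P ∧
    ∀ᵐ ω ∂P, ∀ t, 0 ≤ t → ∀ i,
      let moving : Set ℝ :=
        (stuckSet (fun s => X s ω i) (fun k => stickWidth p slab * F i k ω))ᶜ
      X t ω i = x₀ i + ∫ s in (0 : ℝ)..t, moving.indicator (fun s => V s ω i) s ∧
      V t ω i = v₀ i * (-1) ^ arrivalCount (fun k => E i k ω)
        (∫ s in (0 : ℝ)..t,
          moving.indicator (fun s => zigzagRate (slabPotential slab L) i (X s ω) (V s ω)) s)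

/-! ### Regeneration and asymptotic variance of a real-valued process with a velocity -/

/-- First time `T₀ ≥ 0` at which the state is `(a, b)`; it is `0` if this is the initial state. -/
def regenTime₀ (x v : ℝ → Ω → ℝ) (a b : ℝ) (ω : Ω) : ℝ≥0∞ :=
  firstTime {t | 0 ≤ t ∧ x t ω = a ∧ v t ω = b}

/-- First time `T₁` after `T₀` at which the state is again `(a, b)`. -/
def regenTime₁ (x v : ℝ → Ω → ℝ) (a b : ℝ) (ω : Ω) : ℝ≥0∞ :=
  firstTime {t | 0 ≤ t ∧ regenTime₀ x v a b ω < ENNReal.ofReal t ∧ x t ω = a ∧ v t ω = b}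

/-- The cycle length `T₁ - T₀`. -/
def cycleLength (x v : ℝ → Ω → ℝ) (a b : ℝ) (ω : Ω) : ℝ :=
  (regenTime₁ x v a b ω).toReal - (regenTime₀ x v a b ω).toReal

/-- The integral of `f (x t)` over the cycle from `T₀` to `T₁`. -/
def cycleIntegral (f : ℝ → ℝ) (x v : ℝ → Ω → ℝ) (a b : ℝ) (ω : Ω) : ℝ :=
  ∫ t in (regenTime₀ x v a b ω).toReal..(regenTime₁ x v a b ω).toReal, f (x t ω)

/-- The mean of the cycle integral divided by the mean of the cycle length. -/
def cycleMean (P : Measure Ω) (f : ℝ → ℝ) (x v : ℝ → Ω → ℝ) (a b : ℝ) : ℝ :=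
  (∫ ω, cycleIntegral f x v a b ω ∂P) / ∫ ω, cycleLength x v a b ω ∂P

/-- The regularity conditions on the regeneration times given by the visits to `(a, b)`. -/
structure RegenerationConditions (P : Measure Ω) (f : ℝ → ℝ) (x v : ℝ → Ω → ℝ) (a b : ℝ) :
    Prop where
  time₀_finite : ∀ᵐ ω ∂P, regenTime₀ x v a b ω < ∞
  time₁_finite : ∀ᵐ ω ∂P, regenTime₁ x v a b ω < ∞
  length_integrable : Integrable (cycleLength x v a b) P
  integral_integrable : Integrable (cycleIntegral f x v a b) P
  bounded_in_cycle : ∀ᵐ ω ∂P,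
    BddAbove ((fun t => |∫ s in (regenTime₀ x v a b ω).toReal..t, f (x s ω)|) ''
      Set.Icc (regenTime₀ x v a b ω).toReal (regenTime₁ x v a b ω).toReal)
  memLp_two : MemLp
    (fun ω => cycleIntegral f x v a b ω - cycleMean P f x v a b * cycleLength x v a b ω) 2 P
  variance_pos :
    0 < Var[fun ω => cycleIntegral f x v a b ω - cycleMean P f x v a b * cycleLength x v a b ω; P]

/-- `σ2` is the asymptotic variance of the time average `τ⁻¹ ∫₀^τ f (x t) dt` as an estimator of
`m`: the error multiplied by `√τ` converges in distribution to `N(0, σ2)` as `τ → ∞`. -/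
def HasAsymptoticVariance (P : Measure Ω) [IsProbabilityMeasure P] (f : ℝ → ℝ) (x : ℝ → Ω → ℝ)
    (m : ℝ) (σ2 : ℝ≥0) : Prop :=
  TendstoInDistribution
    (fun (τ : ℝ) (ω : Ω) => √τ * (τ⁻¹ * (∫ t in (0 : ℝ)..τ, f (x t ω)) - m))
    atTop (id : ℝ → ℝ) (fun _ => P) (gaussianReal 0 σ2)

end

noncomputable section

/-! ### The event chain of a one-dimensional sticky zig-zag process -/

/-! Independence of the coordinates under the posterior forces the likelihood to factorize
(`density_mul_density_exchange`, `likelihood_update`). In both samplers the flip rate of coordinate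
`i` then depends on that coordinate alone, through the derivative `φ` of the one-dimensional
potential `u = coordPotential`. On the plateau of the latent density the rate vanishes, so the
latent coordinate crosses it at unit speed without a flip and its image rests at 0 for exactly the
time `w`. Hence both coordinates are run by the same event chain `chainStep` on pairs (position,
velocity), driven by independent unit exponential clocks, and they differ only in the law κ of the
sticking times: exponential with mean `w`, or the Dirac mass at `w` (the two lemmas
`exists_followsChain`).

A step of the chain ends at a flip, at 0, at `a`, or after unit time, so visits to `(a, b)` are
events of the chain. Lack of memory of the clocks (`lintegral_step`) gives the strong Markov
property at these visits (`lintegral_cycle`), and the cycles are independent and identically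
distributed. Let C be the length of a cycle, Z the integral of `f` over it, and m the posterior
mean. Once E Z = m E C is known, `regenerative_clt` yields a normal limit with variance Var(Z - mC)
/ E C (`followsChain_clt`).

The identity E Z = m E C is `integral_cycleGain_eq`. For centred continuous F with compact support
one solves the Poisson equation of the zig-zag generator on each side of 0, with a jump at 0 that
balances the mean sticking time. The solution telescopes over a cycle, so the mean integral of F
over a cycle is 0 (`integral_cycleGain_eq_zero`). Consequently the mean occupation measure of a
cycle is proportional to the density exp(-u) plus an atom of mass w exp(-u(0)) at 0
(`smul_cycleOccupation`), and this is the marginal of the posterior up to a factor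
(`exists_map_posterior`). Only the mean of κ enters.

For the comparison, sticking stops the clocks of the coordinate and keeps its velocity. The sequence
of states therefore does not depend on the sticking times, and for fixed clocks Z and C are affine
in them. Replacing the sticking times by their mean `w` amounts to taking the conditional
expectation given the clocks. It leaves E C unchanged (`integral_cycleGain_dirac`) and, by Jensen's
inequality, does not increase the second moment of the centred variable Z - mC
(`lintegral_sq_cycleGain_dirac_le`). -/

/-- A stream of residual exponential clocks together with a stream of sticking times. -/
abbrev ClockStream : Type := (ℕ → ℝ) × (ℕ → ℝ)

/-- The rate at which the velocity `v` flips at `x`. -/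
def flipRate (φ : ℝ → ℝ) (x v : ℝ) : ℝ := max 0 (v * φ x)

/-- The rate integrated along the ray that starts from `s`. -/
def cumRate (φ : ℝ → ℝ) (s : ℝ × ℝ) (t : ℝ) : ℝ :=
  ∫ r in (0 : ℝ)..t, flipRate φ (s.1 + s.2 * r) s.2

/-- The travelling time to `c`, if `c` lies ahead, and `1` otherwise. -/
def timeAhead (s : ℝ × ℝ) (c : ℝ) : ℝ := if 0 < (c - s.1) * s.2 then (c - s.1) * s.2 else 1

/-- The time after which a step of the event chain ends if no flip occurs. -/
def horizon (a : ℝ) (s : ℝ × ℝ) : ℝ := min 1 (min (timeAhead s 0) (timeAhead s a))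

/-- The clock `e` rings before the horizon is reached. -/
def FlipsFirst (φ : ℝ → ℝ) (a : ℝ) (s : ℝ × ℝ) (e : ℝ) : Prop := e < cumRate φ s (horizon a s)

/-- The step ends by sticking at `0`. -/
def SticksAtZero (φ : ℝ → ℝ) (a : ℝ) (s : ℝ × ℝ) (e : ℝ) : Prop :=
  ¬ FlipsFirst φ a s e ∧ s.1 + s.2 * horizon a s = 0

open Classical in
/-- The time during which the process moves in a step. -/
def flightTime (φ : ℝ → ℝ) (a : ℝ) (s : ℝ × ℝ) (e : ℝ) : ℝ :=
  if FlipsFirst φ a s e then sInf {t | 0 ≤ t ∧ e ≤ cumRate φ s t} else horizon a s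

open Classical in
/-- The state after a step. -/
def nextState (φ : ℝ → ℝ) (a : ℝ) (s : ℝ × ℝ) (e : ℝ) : ℝ × ℝ :=
  (s.1 + s.2 * flightTime φ a s e, if FlipsFirst φ a s e then -s.2 else s.2)

/-- A sequence without its first term. -/
def seqTail (e : ℕ → ℝ) : ℕ → ℝ := fun k => e (k + 1)

/-- A sequence with a new first term. -/
def seqCons (x : ℝ) (e : ℕ → ℝ) : ℕ → ℝ := fun k => Nat.casesOn k x e

open Classical in
/-- The clocks after a step. -/
def nextClocks (φ : ℝ → ℝ) (a : ℝ) (s : ℝ × ℝ) (e : ℕ → ℝ) : ℕ → ℝ :=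
  if FlipsFirst φ a s (e 0) then seqTail e
  else seqCons (e 0 - cumRate φ s (horizon a s)) (seqTail e)

open Classical in
/-- The streams after a step. -/
def nextStream (φ : ℝ → ℝ) (a : ℝ) (s : ℝ × ℝ) (ξ : ClockStream) : ClockStream :=
  (nextClocks φ a s ξ.1, if SticksAtZero φ a s (ξ.1 0) then seqTail ξ.2 else ξ.2)

open Classical in
/-- The time spent at `0` at the end of a step. -/
def stickDuration (φ : ℝ → ℝ) (a : ℝ) (s : ℝ × ℝ) (ξ : ClockStream) : ℝ :=
  if SticksAtZero φ a s (ξ.1 0) then ξ.2 0 else 0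

/-- A step of the event chain. -/
def chainStep (φ : ℝ → ℝ) (a : ℝ) (q : (ℝ × ℝ) × ClockStream) : (ℝ × ℝ) × ClockStream :=
  (nextState φ a q.1 (q.2.1 0), nextStream φ a q.1 q.2)

/-- The integral over a step of a function with primitive `Φ` and with value `c` at `0`. -/
def stepGain (φ : ℝ → ℝ) (a : ℝ) (Φ : ℝ → ℝ) (c : ℝ) (q : (ℝ × ℝ) × ClockStream) : ℝ :=
  q.1.2 * (Φ (nextState φ a q.1 (q.2.1 0)).1 - Φ q.1.1) + c * stickDuration φ a q.1 q.2

/-! #### Elementary properties -/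

variable {φ : ℝ → ℝ} {a : ℝ}

lemma flipRate_nonneg (x v : ℝ) : 0 ≤ flipRate φ x v := le_max_left _ _

lemma continuous_flipRate_ray (hφ : Continuous φ) (s : ℝ × ℝ) :
    Continuous fun r : ℝ => flipRate φ (s.1 + s.2 * r) s.2 := by
  unfold flipRate; fun_prop

lemma continuous_cumRate (hφ : Continuous φ) :
    Continuous fun p : (ℝ × ℝ) × ℝ => cumRate φ p.1 p.2 := by
  unfold cumRate
  refine intervalIntegral.continuous_parametric_intervalIntegral_of_continuous
    (f := fun (p : (ℝ × ℝ) × ℝ) r => flipRate φ (p.1.1 + p.1.2 * r) p.1.2) ?_ continuous_snd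
  unfold flipRate; fun_prop

lemma continuous_cumRate_right (hφ : Continuous φ) (s : ℝ × ℝ) : Continuous (cumRate φ s) :=
  (continuous_cumRate hφ).comp (by fun_prop : Continuous fun t : ℝ => (s, t))

lemma cumRate_zero (s : ℝ × ℝ) : cumRate φ s 0 = 0 := by simp [cumRate]

lemma cumRate_mono (hφ : Continuous φ) (s : ℝ × ℝ) : Monotone (cumRate φ s) := by
  intro t u htu
  have h : ∀ b c, IntervalIntegrable (fun r => flipRate φ (s.1 + s.2 * r) s.2) volume b c :=
    fun b c => (continuous_flipRate_ray hφ s).intervalIntegrable b c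
  have := intervalIntegral.integral_interval_sub_left (h 0 u) (h 0 t)
  have h2 : 0 ≤ ∫ r in t..u, flipRate φ (s.1 + s.2 * r) s.2 :=
    intervalIntegral.integral_nonneg htu fun r _ => flipRate_nonneg _ _
  unfold cumRate; linarith

lemma cumRate_nonneg (hφ : Continuous φ) (s : ℝ × ℝ) {t : ℝ} (ht : 0 ≤ t) : 0 ≤ cumRate φ s t := by
  simpa [cumRate_zero] using cumRate_mono hφ s ht

/-- The default 1 for a point that does not lie ahead keeps this time positive and never shortens
`horizon`, which is capped at 1 anyway. -/
lemma timeAhead_pos (s : ℝ × ℝ) (c : ℝ) : 0 < timeAhead s c := by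
  unfold timeAhead; split_ifs with h
  · exact h
  · exact one_pos

lemma horizon_pos (s : ℝ × ℝ) : 0 < horizon a s := by
  simp [horizon, timeAhead_pos]

/-- The cap ends every step after bounded time, even if neither 0 nor `a` lies ahead and the clock
never rings. -/
lemma horizon_le_one (s : ℝ × ℝ) : horizon a s ≤ 1 := min_le_left _ _

lemma horizon_le_zero (s : ℝ × ℝ) : horizon a s ≤ timeAhead s 0 :=
  (min_le_right _ _).trans (min_le_left _ _)

/-- Stopping at `a` turns each passage through `a` into an event, so that the visits to `(a, b)` can
be read off the chain. -/
lemma horizon_le_target (s : ℝ × ℝ) : horizon a s ≤ timeAhead s a :=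
  (min_le_right _ _).trans (min_le_right _ _)

lemma measurable_timeAhead (c : ℝ) : Measurable fun s : ℝ × ℝ => timeAhead s c := by
  unfold timeAhead
  exact Measurable.ite (measurableSet_lt (by fun_prop) (by fun_prop)) (by fun_prop) (by fun_prop)

lemma measurable_horizon : Measurable (horizon a) :=
  measurable_const.min ((measurable_timeAhead 0).min (measurable_timeAhead a))

lemma measurable_cumRate_horizon (hφ : Continuous φ) :
    Measurable fun s : ℝ × ℝ => cumRate φ s (horizon a s) :=
  (continuous_cumRate hφ).measurable.comp (measurable_id.prodMk measurable_horizon)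

lemma measurableSet_flipsFirst (hφ : Continuous φ) :
    MeasurableSet {p : (ℝ × ℝ) × ℝ | FlipsFirst φ a p.1 p.2} :=
  measurableSet_lt measurable_snd ((measurable_cumRate_horizon hφ).comp measurable_fst)

lemma measurableSet_sticksAtZero (hφ : Continuous φ) :
    MeasurableSet {p : (ℝ × ℝ) × ℝ | SticksAtZero φ a p.1 p.2} := by
  refine (measurableSet_flipsFirst hφ).compl.inter ?_
  have h : Measurable fun p : (ℝ × ℝ) × ℝ => horizon a p.1 := measurable_horizon.comp measurable_fst
  exact measurableSet_eq_fun (f := fun p : (ℝ × ℝ) × ℝ => p.1.1 + p.1.2 * horizon a p.1)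
    (measurable_fst.fst.add (measurable_fst.snd.mul h)) measurable_const

lemma flightTime_of_not_flipsFirst {s : ℝ × ℝ} {e : ℝ} (h : ¬ FlipsFirst φ a s e) :
    flightTime φ a s e = horizon a s := if_neg h

lemma flightTime_nonneg (s : ℝ × ℝ) (e : ℝ) : 0 ≤ flightTime φ a s e := by
  unfold flightTime; split_ifs
  · exact Real.sInf_nonneg fun t ht => ht.1
  · exact (horizon_pos s).le

/-- The flight time is the generalized inverse of the continuous monotone integrated rate, and its
infimum is attained; questions on flight times become questions on `cumRate`. -/
lemma flightTime_le_iff_of_flipsFirst (hφ : Continuous φ) {s : ℝ × ℝ} {e : ℝ}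
    (h : FlipsFirst φ a s e) {c : ℝ} (hc : 0 ≤ c) :
    flightTime φ a s e ≤ c ↔ e ≤ cumRate φ s c := by
  rw [flightTime, if_pos h]
  set S := {t | 0 ≤ t ∧ e ≤ cumRate φ s t} with hS
  have hbdd : BddBelow S := ⟨0, fun t ht => ht.1⟩
  constructor
  · intro hle
    have hclosed : IsClosed S :=
      isClosed_Ici.inter (isClosed_le continuous_const (continuous_cumRate_right hφ s))
    have hne : S.Nonempty := ⟨horizon a s, (horizon_pos s).le, le_of_lt h⟩
    have := hclosed.csInf_mem hne hbdd
    exact this.2.trans (cumRate_mono hφ s hle)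
  · intro hle
    exact csInf_le hbdd ⟨hc, hle⟩

lemma flightTime_le_horizon (hφ : Continuous φ) (s : ℝ × ℝ) (e : ℝ) :
    flightTime φ a s e ≤ horizon a s := by
  by_cases h : FlipsFirst φ a s e
  · exact (flightTime_le_iff_of_flipsFirst hφ h (horizon_pos s).le).2 h.le
  · rw [flightTime_of_not_flipsFirst h]

lemma cumRate_flightTime (hφ : Continuous φ) {s : ℝ × ℝ} {e : ℝ} (he : 0 ≤ e)
    (h : FlipsFirst φ a s e) : cumRate φ s (flightTime φ a s e) = e := by
  have h0 := flightTime_nonneg (φ := φ) (a := a) s e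
  refine le_antisymm ?_ ((flightTime_le_iff_of_flipsFirst hφ h h0).1 le_rfl)
  obtain ⟨t, ht, hte⟩ := intermediate_value_Icc h0
    (continuous_cumRate_right hφ s).continuousOn
    (show e ∈ Set.Icc _ _ from ⟨by rwa [cumRate_zero],
      (flightTime_le_iff_of_flipsFirst hφ h h0).1 le_rfl⟩)
  have := (flightTime_le_iff_of_flipsFirst hφ h ht.1).2 hte.ge
  exact (cumRate_mono hφ s this).trans hte.le

/-- Without a flip the equivalence fails only if the clock ties with the rate integrated up to the
horizon and this rate vanishes between `c` and the horizon. The last hypothesis excludes that. -/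
lemma lt_flightTime_iff (hφ : Continuous φ) {s : ℝ × ℝ} {e c : ℝ} (hc : 0 ≤ c)
    (hch : c < horizon a s) (he : e ≠ cumRate φ s (horizon a s) ∨ cumRate φ s c ≠ e) :
    c < flightTime φ a s e ↔ cumRate φ s c < e := by
  by_cases h : FlipsFirst φ a s e
  · rw [← not_le, flightTime_le_iff_of_flipsFirst hφ h hc, not_le]
  · rw [flightTime_of_not_flipsFirst h]
    have h1 : cumRate φ s (horizon a s) ≤ e := not_lt.1 h
    have h2 := cumRate_mono hφ s hch.le
    refine ⟨fun _ => lt_of_le_of_ne (h2.trans h1) ?_, fun _ => hch⟩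
    rintro h3
    rcases he with he | he
    · exact he (le_antisymm (h3 ▸ h2) h1)
    · exact he h3

lemma flightTime_pos (hφ : Continuous φ) {s : ℝ × ℝ} {e : ℝ} (he : 0 < e) :
    0 < flightTime φ a s e :=
  (lt_flightTime_iff hφ le_rfl (horizon_pos s) (Or.inr (by rw [cumRate_zero]; exact he.ne))).2
    (by rwa [cumRate_zero])

lemma flightTime_lt_horizon (hφ : Continuous φ) {s : ℝ × ℝ} {e : ℝ} (he : 0 ≤ e)
    (h : FlipsFirst φ a s e) : flightTime φ a s e < horizon a s := by
  refine lt_of_le_of_ne (flightTime_le_horizon hφ s e) fun h' => ?_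
  have := cumRate_flightTime hφ he h
  rw [h'] at this
  exact absurd h (by rw [FlipsFirst, this]; exact lt_irrefl _)

lemma measurable_flightTime (hφ : Continuous φ) :
    Measurable fun p : (ℝ × ℝ) × ℝ => flightTime φ a p.1 p.2 := by
  refine measurable_of_Iic fun c => ?_
  by_cases hc : 0 ≤ c
  · have : (fun p : (ℝ × ℝ) × ℝ => flightTime φ a p.1 p.2) ⁻¹' Set.Iic c =
        {p | horizon a p.1 ≤ c} ∪ ({p | FlipsFirst φ a p.1 p.2} ∩ {p | p.2 ≤ cumRate φ p.1 c}) := by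
      ext p
      simp only [Set.mem_preimage, Set.mem_Iic, Set.mem_union, Set.mem_ofPred_eq, Set.mem_inter_iff]
      by_cases h : FlipsFirst φ a p.1 p.2
      · rw [flightTime_le_iff_of_flipsFirst hφ h hc]
        refine ⟨fun h' => Or.inr ⟨h, h'⟩, ?_⟩
        rintro (h' | h')
        · exact h.le.trans (cumRate_mono hφ _ h')
        · exact h'.2
      · rw [flightTime_of_not_flipsFirst h]; simp [h]
    rw [this]
    have h1 : Measurable fun p : (ℝ × ℝ) × ℝ => horizon a p.1 := measurable_horizon.comp measurable_fst
    have h2 : Measurable fun p : (ℝ × ℝ) × ℝ => cumRate φ p.1 c :=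
      ((continuous_cumRate hφ).comp (by fun_prop : Continuous fun p : (ℝ × ℝ) × ℝ => (p.1, c))).measurable
    exact (measurableSet_le h1 measurable_const).union
      ((measurableSet_flipsFirst hφ).inter (measurableSet_le measurable_snd h2))
  · convert MeasurableSet.empty
    ext p
    simp only [Set.mem_preimage, Set.mem_Iic, Set.mem_empty_iff_false, iff_false, not_le]
    exact (not_le.1 hc).trans_le (flightTime_nonneg _ _)

lemma measurable_nextState (hφ : Continuous φ) :
    Measurable fun p : (ℝ × ℝ) × ℝ => nextState φ a p.1 p.2 := by
  refine Measurable.prodMk ?_ ?_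
  · exact measurable_fst.fst.add (measurable_fst.snd.mul (measurable_flightTime hφ))
  · exact Measurable.ite (measurableSet_flipsFirst hφ) measurable_fst.snd.neg measurable_fst.snd

lemma measurable_seqTail : Measurable seqTail :=
  measurable_pi_lambda _ fun k => measurable_pi_apply (k + 1)

lemma measurable_seqCons : Measurable fun p : ℝ × (ℕ → ℝ) => seqCons p.1 p.2 := by
  refine measurable_pi_lambda _ fun k => ?_
  cases k with
  | zero => exact measurable_fst
  | succ k => exact (measurable_pi_apply k).comp measurable_snd

@[simp] lemma seqCons_zero (x : ℝ) (e : ℕ → ℝ) : seqCons x e 0 = x := rfl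

@[simp] lemma seqCons_succ (x : ℝ) (e : ℕ → ℝ) (k : ℕ) : seqCons x e (k + 1) = e k := rfl

@[simp] lemma seqTail_seqCons (x : ℝ) (e : ℕ → ℝ) : seqTail (seqCons x e) = e := rfl

lemma measurable_firstClock :
    Measurable fun q : (ℝ × ℝ) × ClockStream => (q.1, q.2.1 0) :=
  measurable_fst.prodMk ((measurable_pi_apply 0).comp measurable_snd.fst)

lemma measurable_nextStream (hφ : Continuous φ) :
    Measurable fun q : (ℝ × ℝ) × ClockStream => nextStream φ a q.1 q.2 := by
  refine Measurable.prodMk ?_ ?_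
  · refine Measurable.ite (measurable_firstClock (measurableSet_flipsFirst hφ))
      (measurable_seqTail.comp measurable_snd.fst) ?_
    refine measurable_seqCons.comp (Measurable.prodMk ?_ (measurable_seqTail.comp measurable_snd.fst))
    exact ((measurable_pi_apply 0).comp measurable_snd.fst).sub
      ((measurable_cumRate_horizon hφ).comp measurable_fst)
  · exact Measurable.ite (measurable_firstClock (measurableSet_sticksAtZero hφ))
      (measurable_seqTail.comp measurable_snd.snd) measurable_snd.snd

lemma measurable_stickDuration (hφ : Continuous φ) :
    Measurable fun q : (ℝ × ℝ) × ClockStream => stickDuration φ a q.1 q.2 :=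
  Measurable.ite (measurable_firstClock (measurableSet_sticksAtZero hφ))
    ((measurable_pi_apply 0).comp measurable_snd.snd) measurable_const

lemma measurable_chainStep (hφ : Continuous φ) : Measurable (chainStep φ a) :=
  ((measurable_nextState hφ).comp measurable_firstClock).prodMk (measurable_nextStream hφ)

lemma measurable_stepGain (hφ : Continuous φ) {Φ : ℝ → ℝ} (hΦ : Measurable Φ) (c : ℝ) :
    Measurable (stepGain φ a Φ c) := by
  have h1 : Measurable fun q : (ℝ × ℝ) × ClockStream => Φ (nextState φ a q.1 (q.2.1 0)).1 :=
    hΦ.comp ((measurable_nextState hφ).comp measurable_firstClock).fst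
  have h2 : Measurable fun q : (ℝ × ℝ) × ClockStream => Φ q.1.1 := hΦ.comp measurable_fst.fst
  exact (measurable_fst.snd.mul (h1.sub h2)).add ((measurable_stickDuration hφ).const_mul c)

end

noncomputable section

/-! ### The law of the streams and the Markov property of the event chain -/

instance isProbabilityMeasure_expMeasure_one : IsProbabilityMeasure (expMeasure 1) :=
  isProbabilityMeasure_expMeasure one_pos

/-- The law of a sequence of independent variables with the law `κ`. -/
def seqLaw (κ : Measure ℝ) [IsProbabilityMeasure κ] : Measure (ℕ → ℝ) :=
  Measure.infinitePi fun _ => κ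

instance (κ : Measure ℝ) [IsProbabilityMeasure κ] : IsProbabilityMeasure (seqLaw κ) := by
  unfold seqLaw; infer_instance

/-- The law of independent unit exponential clocks and independent sticking times of law `κ`. -/
def streamLaw (κ : Measure ℝ) [IsProbabilityMeasure κ] : Measure ClockStream :=
  (seqLaw (expMeasure 1)).prod (seqLaw κ)

instance (κ : Measure ℝ) [IsProbabilityMeasure κ] : IsProbabilityMeasure (streamLaw κ) := by
  unfold streamLaw; infer_instance

/-- A finite index set lies in an initial segment, and padding a box with the whole space does not
change it. Boxes over initial segments, which suit inductions, thus determine the product measure.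
-/
lemma eq_infinitePi_nat {E : Type*} [MeasurableSpace E] {κ : Measure E} [IsProbabilityMeasure κ]
    {ν : Measure (ℕ → E)} (h : ∀ (n : ℕ) (t : ℕ → Set E), (∀ i, MeasurableSet (t i)) →
      ν (Set.pi (Finset.range n : Set ℕ) t) = ∏ i ∈ Finset.range n, κ (t i)) :
    ν = Measure.infinitePi fun _ => κ := by
  refine Measure.eq_infinitePi (μ := fun _ : ℕ => κ) fun s t ht => ?_
  classical
  obtain ⟨n, hn⟩ := s.exists_nat_subset_range
  set t' : ℕ → Set E := fun i => if i ∈ s then t i else Set.univ with ht'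
  have ht'm : ∀ i, MeasurableSet (t' i) := fun i => by
    simp only [ht']; split_ifs with h
    · exact ht i
    · exact MeasurableSet.univ
  have h1 : Set.pi (s : Set ℕ) t = Set.pi (Finset.range n : Set ℕ) t' := by
    ext e
    simp only [Set.mem_pi, Finset.mem_coe, ht']
    refine ⟨fun h i _ => ?_, fun h i hi => ?_⟩
    · split_ifs with his
      · exact h i his
      · trivial
    · simpa [hi] using h i (hn hi)
  have h2 : ∏ i ∈ s, κ (t i) = ∏ i ∈ Finset.range n, κ (t' i) := by
    rw [← Finset.prod_subset hn (f := fun i => κ (t' i))]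
    · refine Finset.prod_congr rfl fun i hi => by simp [ht', hi]
    · intro i _ hi; simp [ht', hi]
  rw [h1, h2, h n t' ht'm]

/-- The shift structure of the product measure: it lets the first clock be integrated out while the
later ones stay untouched, as in `lintegral_seqLaw`. -/
lemma map_seqCons (κ : Measure ℝ) [IsProbabilityMeasure κ] :
    (κ.prod (seqLaw κ)).map (fun p => seqCons p.1 p.2) = seqLaw κ := by
  refine eq_infinitePi_nat fun n t ht => ?_
  have hm : MeasurableSet (Set.pi (Finset.range n : Set ℕ) t) :=
    MeasurableSet.pi (Finset.countable_toSet _) fun i _ => ht i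
  rw [Measure.map_apply measurable_seqCons hm]
  cases n with
  | zero => simp
  | succ n =>
    have h3 : (fun p : ℝ × (ℕ → ℝ) => seqCons p.1 p.2) ⁻¹'
        (Set.pi (Finset.range (n + 1) : Set ℕ) t) =
        t 0 ×ˢ Set.pi (Finset.range n : Set ℕ) (fun i => t (i + 1)) := by
      ext p
      simp only [Set.mem_preimage, Set.mem_pi, Finset.mem_coe, Finset.mem_range, Set.mem_prod]
      refine ⟨fun h => ⟨h 0 (Nat.succ_pos _), fun i hi => h (i + 1) (by omega)⟩, fun h i hi => ?_⟩
      cases i with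
      | zero => exact h.1
      | succ i => exact h.2 i (by omega)
    rw [h3, Measure.prod_prod, Finset.prod_range_succ', mul_comm]
    congr 1
    exact Measure.infinitePi_pi (μ := fun _ : ℕ => κ) (s := Finset.range n) fun i _ => ht (i + 1)

lemma lintegral_seqLaw (κ : Measure ℝ) [IsProbabilityMeasure κ] {g : (ℕ → ℝ) → ℝ≥0∞}
    (hg : Measurable g) :
    ∫⁻ e, g e ∂seqLaw κ = ∫⁻ x, ∫⁻ e, g (seqCons x e) ∂seqLaw κ ∂κ := by
  conv_lhs => rw [← map_seqCons κ]
  rw [lintegral_map hg measurable_seqCons, lintegral_prod _ (by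
    exact (hg.comp measurable_seqCons).aemeasurable)]

/-- Lack of memory of the exponential distribution. -/
lemma lintegral_exp_memoryless {c : ℝ} (hc : 0 ≤ c) {g : ℝ → ℝ≥0∞} (hg : Measurable g) :
    ∫⁻ x in Set.Ici c, g (x - c) ∂expMeasure 1 =
      ENNReal.ofReal (Real.exp (-c)) * ∫⁻ x, g x ∂expMeasure 1 := by
  have hd : Measurable (exponentialPDF 1) := (measurable_exponentialPDFReal 1).ennreal_ofReal
  have h0 : (expMeasure 1) = volume.withDensity (exponentialPDF 1) := rfl
  rw [h0, ← lintegral_indicator measurableSet_Ici, lintegral_withDensity_eq_lintegral_mul _ hd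
    (by exact (hg.comp (measurable_id.sub_const c)).indicator measurableSet_Ici),
    lintegral_withDensity_eq_lintegral_mul _ hd hg, ← lintegral_const_mul _ (hd.mul hg),
    ← lintegral_add_right_eq_self _ c]
  -- After the translation by `c` the claim is pointwise: exp(-(y+c)) = exp(-c) exp(-y) for y ≥ 0,
  -- and both sides vanish for y < 0.
  refine lintegral_congr fun y => ?_
  simp only [Pi.mul_apply]
  by_cases hy : 0 ≤ y
  · rw [Set.indicator_of_mem (by simpa using hy), exponentialPDF_of_nonneg (by linarith),
      exponentialPDF_of_nonneg hy, add_sub_cancel_right, ← mul_assoc,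
      ← ENNReal.ofReal_mul (Real.exp_pos _).le, one_mul, one_mul, one_mul, one_mul, ← Real.exp_add]
    congr 3; ring
  · rw [Set.indicator_of_notMem (by simpa using hy), exponentialPDF_of_neg (not_le.1 hy)]
    simp

lemma expMeasure_Ici {c : ℝ} (hc : 0 ≤ c) :
    expMeasure 1 (Set.Ici c) = ENNReal.ofReal (Real.exp (-c)) := by
  simpa using lintegral_exp_memoryless hc (g := fun _ => 1) measurable_const

lemma expMeasure_singleton (c : ℝ) : expMeasure 1 {c} = 0 :=
  withDensity_absolutelyContinuous volume (exponentialPDF 1) (by simp)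

variable {φ : ℝ → ℝ} {a : ℝ} (κ : Measure ℝ) [IsProbabilityMeasure κ]

lemma lintegral_streamLaw {g : ClockStream → ℝ≥0∞} (hg : Measurable g) :
    ∫⁻ ξ, g ξ ∂streamLaw κ =
      ∫⁻ x, ∫⁻ ξ, g (seqCons x ξ.1, ξ.2) ∂streamLaw κ ∂expMeasure 1 := by
  have hc : Measurable fun p : ℝ × ClockStream => g (seqCons p.1 p.2.1, p.2.2) :=
    hg.comp ((measurable_seqCons.comp (measurable_fst.prodMk measurable_snd.fst)).prodMk
      measurable_snd.snd)
  unfold streamLaw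
  rw [lintegral_prod _ hg.aemeasurable, lintegral_seqLaw _ hg.lintegral_prod_right']
  refine lintegral_congr fun x => ?_
  rw [lintegral_prod _ (by exact (hc.comp measurable_prodMk_left).aemeasurable)]

open Classical in
/-- The integral of a function of the outcome of a step and of the remaining streams. -/
lemma lintegral_step_formula (hφ : Continuous φ) (s : ℝ × ℝ)
    {G : ((ℝ × ℝ) × ℝ) × ClockStream → ℝ≥0∞} (hG : Measurable G) :
    ∫⁻ ξ, G ((nextState φ a s (ξ.1 0), stickDuration φ a s ξ), nextStream φ a s ξ) ∂streamLaw κ =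
      ∫⁻ x in Set.Iio (cumRate φ s (horizon a s)),
        ∫⁻ ξ, G (((s.1 + s.2 * flightTime φ a s x, -s.2), 0), ξ) ∂streamLaw κ ∂expMeasure 1 +
      ENNReal.ofReal (Real.exp (-cumRate φ s (horizon a s))) *
        ∫⁻ D, ∫⁻ ξ, G (((s.1 + s.2 * horizon a s, s.2),
          if s.1 + s.2 * horizon a s = 0 then D 0 else 0), ξ) ∂streamLaw κ ∂seqLaw κ := by
  set Λ := cumRate φ s (horizon a s) with hΛ
  have hΛ0 : 0 ≤ Λ := cumRate_nonneg hφ s (horizon_pos s).le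
  have hft : Measurable fun x : ℝ => flightTime φ a s x :=
    (measurable_flightTime hφ).comp (measurable_const.prodMk measurable_id)
  set o : (ℕ → ℝ) → (ℝ × ℝ) × ℝ := fun D => ((s.1 + s.2 * horizon a s, s.2),
          if s.1 + s.2 * horizon a s = 0 then D 0 else 0) with ho
  have hom : Measurable o := by
    refine measurable_const.prodMk ?_
    split_ifs
    · exact measurable_pi_apply 0
    · exact measurable_const
  -- The sticking times that remain if no flip occurs: one is used up exactly if the flight ends at
  -- 0.
  set T : (ℕ → ℝ) → (ℕ → ℝ) := fun D => if s.1 + s.2 * horizon a s = 0 then seqTail D else D with hT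
  have hTm : Measurable T := by
    simp only [hT]; split_ifs
    · exact measurable_seqTail
    · exact measurable_id
  have hflow : Measurable fun ξ : ClockStream =>
      G ((nextState φ a s (ξ.1 0), stickDuration φ a s ξ), nextStream φ a s ξ) := by
    refine hG.comp (Measurable.prodMk (Measurable.prodMk ?_ ?_) ?_)
    · exact (measurable_nextState hφ).comp
        (measurable_const.prodMk ((measurable_pi_apply 0).comp measurable_fst))
    · exact (measurable_stickDuration hφ).comp (measurable_const.prodMk measurable_id)
    · exact (measurable_nextStream hφ).comp (measurable_const.prodMk measurable_id)
  -- The sticking time that is used is independent of the later ones, so the tail may be replaced by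
  -- an independent copy.
  have hTD : ∀ H : ((ℝ × ℝ) × ℝ) × (ℕ → ℝ) → ℝ≥0∞, Measurable H →
      ∫⁻ D, H (o D, T D) ∂seqLaw κ = ∫⁻ D, ∫⁻ D', H (o D, D') ∂seqLaw κ ∂seqLaw κ := by
    intro H hH
    by_cases hz : s.1 + s.2 * horizon a s = 0
    · have e1 : ∀ D, o D = ((s.1 + s.2 * horizon a s, s.2), D 0) := fun D => by simp [ho, hz]
      have e2 : ∀ D, T D = seqTail D := fun D => by simp [hT, hz]
      simp only [e1, e2]
      rw [lintegral_seqLaw κ, lintegral_seqLaw κ]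
      · simp
      · exact Measurable.lintegral_prod_right' (f := fun p : (ℕ → ℝ) × (ℕ → ℝ) =>
          H (((s.1 + s.2 * horizon a s, s.2), p.1 0), p.2)) (hH.comp (by fun_prop))
      · exact hH.comp (((measurable_const.prodMk (measurable_pi_apply 0))).prodMk measurable_seqTail)
    · have e1 : ∀ D, o D = ((s.1 + s.2 * horizon a s, s.2), 0) := fun D => by simp [ho, hz]
      have e2 : ∀ D, T D = D := fun D => by simp [hT, hz]
      simp only [e1, e2]
      simp
  have hlt : ∀ x < Λ, ∀ ξ : ClockStream, G ((nextState φ a s (seqCons x ξ.1 0),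
      stickDuration φ a s (seqCons x ξ.1, ξ.2)), nextStream φ a s (seqCons x ξ.1, ξ.2)) =
      G (((s.1 + s.2 * flightTime φ a s x, -s.2), 0), ξ) := by
    intro x hx ξ
    have hf : FlipsFirst φ a s x := hx
    have hs : ¬ SticksAtZero φ a s x := fun h => h.1 hf
    simp [nextState, stickDuration, nextStream, nextClocks, hf, hs]
  have hge : ∀ x, Λ ≤ x → ∀ ξ : ClockStream, G ((nextState φ a s (seqCons x ξ.1 0),
      stickDuration φ a s (seqCons x ξ.1, ξ.2)), nextStream φ a s (seqCons x ξ.1, ξ.2)) =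
      G (o ξ.2, (seqCons (x - Λ) ξ.1, T ξ.2)) := by
    intro x hx ξ
    have hf : ¬ FlipsFirst φ a s x := not_lt.2 hx
    have hs : SticksAtZero φ a s x ↔ s.1 + s.2 * horizon a s = 0 := by simp [SticksAtZero, hf]
    simp [nextState, stickDuration, nextStream, nextClocks, hf, hs, o, T,
      flightTime_of_not_flipsFirst hf, Λ]
  have hg' : Measurable fun p : ℝ × ClockStream => G (o p.2.2, (seqCons p.1 p.2.1, T p.2.2)) :=
    hG.comp ((hom.comp measurable_snd.snd).prodMk ((measurable_seqCons.comp
      (measurable_fst.prodMk measurable_snd.fst)).prodMk (hTm.comp measurable_snd.snd)))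
  have hg2 : Measurable fun ξ : ClockStream => G (o ξ.2, (ξ.1, T ξ.2)) :=
    hG.comp ((hom.comp measurable_snd).prodMk (measurable_fst.prodMk (hTm.comp measurable_snd)))
  -- Split at the clock value Λ. Below it a flip consumes the clock and leaves the others untouched;
  -- above it lack of memory makes the residual clock a fresh one, at the price of the survival
  -- probability exp(-Λ).
  rw [lintegral_streamLaw κ hflow, ← lintegral_add_compl _ (measurableSet_Iio (a := Λ)), Set.compl_Iio]
  congr 1
  · exact setLIntegral_congr_fun measurableSet_Iio fun x hx => lintegral_congr fun ξ => hlt x hx ξ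
  · rw [setLIntegral_congr_fun measurableSet_Ici fun x hx => lintegral_congr fun ξ => hge x hx ξ,
      lintegral_exp_memoryless hΛ0 (g := fun y => ∫⁻ ξ, G (o ξ.2, (seqCons y ξ.1, T ξ.2)) ∂streamLaw κ)
        hg'.lintegral_prod_right', ← lintegral_streamLaw κ hg2]
    congr 1
    unfold streamLaw
    rw [lintegral_prod_symm _ hg2.aemeasurable]
    have hH : Measurable fun p : ((ℝ × ℝ) × ℝ) × (ℕ → ℝ) =>
        ∫⁻ e, G (p.1, (e, p.2)) ∂seqLaw (expMeasure 1) :=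
      Measurable.lintegral_prod_right' (f := fun q : (((ℝ × ℝ) × ℝ) × (ℕ → ℝ)) × (ℕ → ℝ) =>
        G (q.1.1, (q.2, q.1.2))) (hG.comp (by fun_prop))
    rw [hTD _ hH]
    refine lintegral_congr fun D => ?_
    rw [lintegral_prod_symm _ (by exact (hG.comp measurable_prodMk_left).aemeasurable)]

/-- The outcome of a step is independent of the remaining streams, which have the law of the
original ones. -/
lemma lintegral_step (hφ : Continuous φ) (s : ℝ × ℝ)
    {G : ((ℝ × ℝ) × ℝ) × ClockStream → ℝ≥0∞} (hG : Measurable G) :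
    ∫⁻ ξ, G ((nextState φ a s (ξ.1 0), stickDuration φ a s ξ), nextStream φ a s ξ) ∂streamLaw κ =
      ∫⁻ ξ, ∫⁻ ξ', G ((nextState φ a s (ξ.1 0), stickDuration φ a s ξ), ξ') ∂streamLaw κ
        ∂streamLaw κ := by
  have hK : Measurable fun p : ((ℝ × ℝ) × ℝ) × ClockStream => ∫⁻ ξ', G (p.1, ξ') ∂streamLaw κ :=
    hG.lintegral_prod_right'.comp measurable_fst
  -- In `lintegral_step_formula` the remaining streams are already integrated against their own law,
  -- so `G` and its average over the streams give the same value.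
  rw [lintegral_step_formula κ hφ s hG, lintegral_step_formula κ hφ s hK]
  simp

end

noncomputable section

/-! ### Visits to a state and cycles of the event chain -/

variable {φ : ℝ → ℝ} {a : ℝ}

open Classical in
/-- The number of visits to `z` in the steps `1, …, n` of the chain. -/
def visitCount (φ : ℝ → ℝ) (a : ℝ) (z : ℝ × ℝ) (n : ℕ) (q : (ℝ × ℝ) × ClockStream) : ℕ :=
  ∑ k ∈ Finset.range n, if ((chainStep φ a)^[k + 1] q).1 = z then 1 else 0

/-- The sum of the gains of the first `n` steps. -/
def totalGain (φ : ℝ → ℝ) (a : ℝ) (Φ : ℝ → ℝ) (c : ℝ) (n : ℕ) (q : (ℝ × ℝ) × ClockStream) : ℝ :=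
  ∑ k ∈ Finset.range n, stepGain φ a Φ c ((chainStep φ a)^[k] q)

/-- The chain visits `z` after at least one step. -/
def Visits (φ : ℝ → ℝ) (a : ℝ) (z : ℝ × ℝ) (q : (ℝ × ℝ) × ClockStream) : Prop :=
  ∃ n, ((chainStep φ a)^[n + 1] q).1 = z

/-- The number of steps until the chain visits `z` after at least one step. -/
def visitIndex (φ : ℝ → ℝ) (a : ℝ) (z : ℝ × ℝ) (q : (ℝ × ℝ) × ClockStream) : ℕ :=
  sInf {n | ((chainStep φ a)^[n + 1] q).1 = z} + 1

/-- The gain until the visit to `z`. -/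
def cycleGain (φ : ℝ → ℝ) (a : ℝ) (z : ℝ × ℝ) (Φ : ℝ → ℝ) (c : ℝ) (q : (ℝ × ℝ) × ClockStream) : ℝ :=
  totalGain φ a Φ c (visitIndex φ a z q) q

/-- The streams that remain after the visit to `z`. -/
def streamAtVisit (φ : ℝ → ℝ) (a : ℝ) (z : ℝ × ℝ) (q : (ℝ × ℝ) × ClockStream) : ClockStream :=
  ((chainStep φ a)^[visitIndex φ a z q] q).2

lemma measurable_iterate_chainStep (hφ : Continuous φ) (n : ℕ) :
    Measurable ((chainStep φ a)^[n]) := (measurable_chainStep hφ).iterate n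

lemma measurableSet_visit (hφ : Continuous φ) (z : ℝ × ℝ) (n : ℕ) :
    MeasurableSet {q | ((chainStep φ a)^[n] q).1 = z} :=
  (measurable_iterate_chainStep hφ n).fst (measurableSet_singleton z)

lemma measurable_visitCount (hφ : Continuous φ) (z : ℝ × ℝ) (n : ℕ) :
    Measurable (visitCount φ a z n) := by
  unfold visitCount
  exact Finset.measurable_fun_sum _ fun k _ =>
    Measurable.ite (measurableSet_visit hφ z (k + 1)) measurable_const measurable_const

lemma measurable_totalGain (hφ : Continuous φ) {Φ : ℝ → ℝ} (hΦ : Measurable Φ) (c : ℝ) (n : ℕ) :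
    Measurable (totalGain φ a Φ c n) := by
  unfold totalGain
  exact Finset.measurable_fun_sum _ fun k _ =>
    (measurable_stepGain hφ hΦ c).comp (measurable_iterate_chainStep hφ k)

/-- The right-hand side involves only what is known after `n` steps, so the index is a stopping
time; expressed by the number of visits it becomes a condition on `chainRecord`. -/
lemma visitIndex_eq_iff {z : ℝ × ℝ} {q : (ℝ × ℝ) × ClockStream} (hq : Visits φ a z q) (n : ℕ) :
    visitIndex φ a z q = n ↔ visitCount φ a z n q = 1 ∧ ((chainStep φ a)^[n] q).1 = z := by
  classical
  have hmem : ((chainStep φ a)^[visitIndex φ a z q] q).1 = z := Nat.sInf_mem hq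
  have hlt : ∀ k, k + 1 < visitIndex φ a z q → ((chainStep φ a)^[k + 1] q).1 ≠ z := fun k hk =>
    Nat.notMem_of_lt_sInf (s := {n | ((chainStep φ a)^[n + 1] q).1 = z}) (by
      unfold visitIndex at hk; omega)
  have hcount : ∀ n, n + 1 ≤ visitIndex φ a z q → visitCount φ a z n q = 0 := fun n hn => by
    refine Finset.sum_eq_zero fun k hk => if_neg (hlt k ?_)
    have := Finset.mem_range.1 hk; omega
  obtain ⟨m, hm⟩ : ∃ m, visitIndex φ a z q = m + 1 := ⟨_, rfl⟩
  have hone : visitCount φ a z (m + 1) q = 1 := by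
    have : visitCount φ a z (m + 1) q = visitCount φ a z m q + 1 := by
      rw [visitCount, Finset.sum_range_succ, if_pos (hm ▸ hmem)]; rfl
    rw [this, hcount m hm.ge]
  constructor
  · rintro rfl
    exact ⟨hm ▸ hone, hmem⟩
  · rintro ⟨h1, h2⟩
    rcases lt_trichotomy n (m + 1) with h | h | h
    · rw [hcount n (by omega)] at h1; omega
    · omega
    · obtain ⟨k, rfl⟩ : ∃ k, n = k + 1 := ⟨n - 1, by omega⟩
      have h3 : visitCount φ a z (k + 1) q = visitCount φ a z k q + 1 := by
        rw [visitCount, Finset.sum_range_succ, if_pos h2]; rfl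
      have h4 : visitCount φ a z (m + 1) q ≤ visitCount φ a z k q :=
        Finset.sum_le_sum_of_subset (Finset.range_mono (by omega))
      omega

lemma lt_visitIndex_iff {z : ℝ × ℝ} {q : (ℝ × ℝ) × ClockStream} (hq : Visits φ a z q) (n : ℕ) :
    n < visitIndex φ a z q ↔ visitCount φ a z n q = 0 := by
  classical
  constructor
  · intro h
    refine Finset.sum_eq_zero fun k hk => if_neg ?_
    exact Nat.notMem_of_lt_sInf (s := {n | ((chainStep φ a)^[n + 1] q).1 = z}) (by
      have := Finset.mem_range.1 hk; unfold visitIndex at h; omega)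
  · intro h
    by_contra hlt
    have h1 := ((visitIndex_eq_iff hq _).1 rfl).1
    have : visitCount φ a z (visitIndex φ a z q) q ≤ visitCount φ a z n q :=
      Finset.sum_le_sum_of_subset (Finset.range_mono (not_lt.1 hlt))
    omega

lemma measurableSet_visits (hφ : Continuous φ) (z : ℝ × ℝ) :
    MeasurableSet {q | Visits φ a z q} := by
  have : {q | Visits φ a z q} = ⋃ n, {q | ((chainStep φ a)^[n + 1] q).1 = z} := by
    ext q; simp [Visits]
  rw [this]
  exact MeasurableSet.iUnion fun n => measurableSet_visit hφ z (n + 1)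

lemma measurable_visitIndex (hφ : Continuous φ) (z : ℝ × ℝ) :
    Measurable (visitIndex φ a z) := by
  refine measurable_to_countable' fun n => ?_
  have : visitIndex φ a z ⁻¹' {n} = ({q | Visits φ a z q} ∩ ({q | visitCount φ a z n q = 1} ∩
      {q | ((chainStep φ a)^[n] q).1 = z})) ∪ ({q | Visits φ a z q}ᶜ ∩ {_q | n = 1}) := by
    ext q
    by_cases hq : Visits φ a z q
    · simp [hq, visitIndex_eq_iff hq]
    -- Without a visit the infimum of the empty set is 0, and the index takes the default value 1.
    · have h1 : visitIndex φ a z q = 1 := by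
        have : {n | ((chainStep φ a)^[n + 1] q).1 = z} = ∅ := by
          ext n; simpa using fun h => hq ⟨n, h⟩
        rw [visitIndex, this, Nat.sInf_empty]
      simp [hq, h1, eq_comm]
  rw [this]
  exact ((measurableSet_visits hφ z).inter ((measurable_visitCount hφ z n
    (measurableSet_singleton 1)).inter (measurableSet_visit hφ z n))).union
    ((measurableSet_visits hφ z).compl.inter (MeasurableSet.const _))

lemma measurable_eval_index {α β : Type*} [MeasurableSpace α] [MeasurableSpace β] {N : α → ℕ}
    (hN : Measurable N) {g : ℕ → α → β} (hg : ∀ n, Measurable (g n)) :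
    Measurable fun x => g (N x) x :=
  (measurable_from_prod_countable_right (f := fun p : ℕ × α => g p.1 p.2) hg).comp
    (hN.prodMk measurable_id)

lemma measurable_cycleGain (hφ : Continuous φ) (z : ℝ × ℝ) {Φ : ℝ → ℝ} (hΦ : Measurable Φ) (c : ℝ) :
    Measurable (cycleGain φ a z Φ c) :=
  measurable_eval_index (measurable_visitIndex hφ z) fun n => measurable_totalGain hφ hΦ c n

lemma measurable_streamAtVisit (hφ : Continuous φ) (z : ℝ × ℝ) :
    Measurable (streamAtVisit φ a z) :=
  measurable_eval_index (measurable_visitIndex hφ z)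
    fun n => (measurable_iterate_chainStep hφ n).snd

/-! ### The Markov property after a fixed number of steps and at a visit -/

variable (κ : Measure ℝ) [IsProbabilityMeasure κ] {ι : Type*}

/-- The state, the number of visits and the gains after `n` steps. -/
def chainRecord (φ : ℝ → ℝ) (a : ℝ) (z : ℝ × ℝ) (Φ : ι → ℝ → ℝ) (c : ι → ℝ) (n : ℕ)
    (q : (ℝ × ℝ) × ClockStream) : (ℝ × ℝ) × ℕ × (ι → ℝ) :=
  (((chainStep φ a)^[n] q).1, visitCount φ a z n q, fun i => totalGain φ a (Φ i) (c i) n q)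

lemma measurable_chainRecord (hφ : Continuous φ) (z : ℝ × ℝ) {Φ : ι → ℝ → ℝ}
    (hΦ : ∀ i, Measurable (Φ i)) (c : ι → ℝ) (n : ℕ) : Measurable (chainRecord φ a z Φ c n) :=
  (measurable_iterate_chainStep hφ n).fst.prodMk ((measurable_visitCount hφ z n).prodMk
    (measurable_pi_lambda _ fun i => measurable_totalGain hφ (hΦ i) (c i) n))

/-- The record after `n` steps is independent of the remaining streams, which have the law of the
original ones. -/
theorem lintegral_chainRecord (hφ : Continuous φ) (s z : ℝ × ℝ) {Φ : ι → ℝ → ℝ}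
    (hΦ : ∀ i, Measurable (Φ i)) (c : ι → ℝ) (n : ℕ)
    {G : ((ℝ × ℝ) × ℕ × (ι → ℝ)) × ClockStream → ℝ≥0∞} (hG : Measurable G) :
    ∫⁻ ξ, G (chainRecord φ a z Φ c n (s, ξ), ((chainStep φ a)^[n] (s, ξ)).2) ∂streamLaw κ =
      ∫⁻ ξ, ∫⁻ ξ', G (chainRecord φ a z Φ c n (s, ξ), ξ') ∂streamLaw κ ∂streamLaw κ := by
  classical
  induction n generalizing G with
  | zero => simp [chainRecord, visitCount, totalGain]
  | succ n ih =>
    -- The new record is a function of the old record and of the outcome of one step.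
    set upd : ((ℝ × ℝ) × ℕ × (ι → ℝ)) → (ℝ × ℝ) × ℝ → (ℝ × ℝ) × ℕ × (ι → ℝ) := fun R o =>
      (o.1, R.2.1 + (if o.1 = z then 1 else 0),
        fun i => R.2.2 i + (R.1.2 * (Φ i o.1.1 - Φ i R.1.1) + c i * o.2)) with hupd
    have hupdm : Measurable fun p : ((ℝ × ℝ) × ℕ × (ι → ℝ)) × ((ℝ × ℝ) × ℝ) => upd p.1 p.2 := by
      refine measurable_snd.fst.prodMk (Measurable.prodMk ?_ (measurable_pi_lambda _ fun i => ?_))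
      · exact measurable_fst.snd.fst.add (Measurable.ite
          (measurable_snd.fst (measurableSet_singleton z)) measurable_const measurable_const)
      · have h1 := (hΦ i).comp (measurable_snd.fst.fst :
          Measurable fun p : ((ℝ × ℝ) × ℕ × (ι → ℝ)) × ((ℝ × ℝ) × ℝ) => p.2.1.1)
        have h2 := (hΦ i).comp (measurable_fst.fst.fst :
          Measurable fun p : ((ℝ × ℝ) × ℕ × (ι → ℝ)) × ((ℝ × ℝ) × ℝ) => p.1.1.1)
        exact ((measurable_pi_apply i).comp measurable_fst.snd.snd).add
          ((measurable_fst.fst.snd.mul (h1.sub h2)).add (measurable_snd.snd.const_mul (c i)))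
    have hrec : ∀ ξ, chainRecord φ a z Φ c (n + 1) (s, ξ) =
        upd (chainRecord φ a z Φ c n (s, ξ))
          (nextState φ a ((chainStep φ a)^[n] (s, ξ)).1 (((chainStep φ a)^[n] (s, ξ)).2.1 0),
            stickDuration φ a ((chainStep φ a)^[n] (s, ξ)).1 ((chainStep φ a)^[n] (s, ξ)).2) := by
      intro ξ
      simp only [chainRecord, upd, visitCount, totalGain, Finset.sum_range_succ, stepGain,
        Function.iterate_succ_apply', chainStep]
    have hstr : ∀ ξ, ((chainStep φ a)^[n + 1] (s, ξ)).2 =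
        nextStream φ a ((chainStep φ a)^[n] (s, ξ)).1 ((chainStep φ a)^[n] (s, ξ)).2 := by
      intro ξ; rw [Function.iterate_succ_apply']; rfl
    set out : (ℝ × ℝ) × ClockStream → (ℝ × ℝ) × ℝ := fun q =>
      (nextState φ a q.1 (q.2.1 0), stickDuration φ a q.1 q.2) with hout
    have houtm : Measurable out :=
      ((measurable_nextState hφ).comp measurable_firstClock).prodMk (measurable_stickDuration hφ)
    have hcomp : Measurable fun p : ((ℝ × ℝ) × ℕ × (ι → ℝ)) × ClockStream =>
        upd p.1 (out (p.1.1, p.2)) :=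
      hupdm.comp (measurable_fst.prodMk (houtm.comp (measurable_fst.fst.prodMk measurable_snd)))
    have hG1 : Measurable fun p : ((ℝ × ℝ) × ℕ × (ι → ℝ)) × ClockStream =>
        G (upd p.1 (out (p.1.1, p.2)), nextStream φ a p.1.1 p.2) :=
      hG.comp (hcomp.prodMk ((measurable_nextStream hφ).comp (measurable_fst.fst.prodMk measurable_snd)))
    have hG2 : Measurable fun p : ((ℝ × ℝ) × ℕ × (ι → ℝ)) × ClockStream =>
        ∫⁻ ξ', G (upd p.1 (out (p.1.1, p.2)), ξ') ∂streamLaw κ :=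
      Measurable.lintegral_prod_right' (f := fun p : (((ℝ × ℝ) × ℕ × (ι → ℝ)) × ClockStream) ×
        ClockStream => G (upd p.1.1 (out (p.1.1.1, p.1.2)), p.2))
        (hG.comp ((hcomp.comp measurable_fst).prodMk measurable_snd))
    simp only [hrec, hstr]
    -- By induction the streams after `n` steps may be taken fresh for the left side and for its
    -- averaged form; `lintegral_step` then compares the two for a fixed record.
    have e1 := ih hG1
    have e2 := ih hG2
    refine e1.trans (Eq.trans ?_ e2.symm)
    refine lintegral_congr fun ξ => ?_
    refine lintegral_step κ hφ ((chainStep φ a)^[n] (s, ξ)).1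
      (G := fun p => G (upd (chainRecord φ a z Φ c n (s, ξ)) p.1, p.2)) ?_
    exact hG.comp ((hupdm.comp (measurable_const.prodMk measurable_fst)).prodMk measurable_snd)

/-- The gains up to the visit to `z` are independent of the remaining streams, which have the law
of the original ones. -/
theorem lintegral_cycle (hφ : Continuous φ) (s z : ℝ × ℝ) {Φ : ι → ℝ → ℝ}
    (hΦ : ∀ i, Measurable (Φ i)) (c : ι → ℝ) (hvis : ∀ᵐ ξ ∂streamLaw κ, Visits φ a z (s, ξ))
    {G : (ι → ℝ) × ClockStream → ℝ≥0∞} (hG : Measurable G) :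
    ∫⁻ ξ, G (fun i => cycleGain φ a z (Φ i) (c i) (s, ξ), streamAtVisit φ a z (s, ξ)) ∂streamLaw κ =
      ∫⁻ ξ, ∫⁻ ξ', G (fun i => cycleGain φ a z (Φ i) (c i) (s, ξ), ξ') ∂streamLaw κ
        ∂streamLaw κ := by
  classical
  -- Almost surely `first` holds for the record of exactly one `n`, the index of the visit, and
  -- there the gains of the cycle are components of the record. Both sides become series over `n`
  -- that agree termwise by `lintegral_chainRecord`.
  set first : ((ℝ × ℝ) × ℕ × (ι → ℝ)) → Prop := fun R => R.2.1 = 1 ∧ R.1 = z with hfirst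
  have hfm : MeasurableSet {R : (ℝ × ℝ) × ℕ × (ι → ℝ) | first R} :=
    (measurable_snd.fst (measurableSet_singleton 1)).inter
      (measurable_fst (measurableSet_singleton z))
  have hGn : ∀ n : ℕ, Measurable fun p : ((ℝ × ℝ) × ℕ × (ι → ℝ)) × ClockStream =>
      if first p.1 then G (p.1.2.2, p.2) else 0 := fun n =>
    Measurable.ite (measurable_fst hfm) (hG.comp (measurable_fst.snd.snd.prodMk measurable_snd))
      measurable_const
  have hrm : ∀ n, Measurable fun ξ : ClockStream => chainRecord φ a z Φ c n (s, ξ) := fun n =>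
    (measurable_chainRecord hφ z hΦ c n).comp measurable_prodMk_left
  have hL : ∫⁻ ξ, G (fun i => cycleGain φ a z (Φ i) (c i) (s, ξ), streamAtVisit φ a z (s, ξ))
      ∂streamLaw κ = ∑' n, ∫⁻ ξ, (if first (chainRecord φ a z Φ c n (s, ξ)) then
        G ((chainRecord φ a z Φ c n (s, ξ)).2.2, ((chainStep φ a)^[n] (s, ξ)).2) else 0)
        ∂streamLaw κ := by
    rw [← lintegral_tsum fun n => ?_]
    · refine lintegral_congr_ae ?_
      filter_upwards [hvis] with ξ hξ
      rw [tsum_eq_single (visitIndex φ a z (s, ξ))]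
      · rw [if_pos]
        · rfl
        · exact (visitIndex_eq_iff hξ _).1 rfl
      · intro n hn
        have hne : ¬ first (chainRecord φ a z Φ c n (s, ξ)) := fun h =>
          hn ((visitIndex_eq_iff hξ n).2 h).symm
        simp [hne]
    · exact ((hGn n).comp ((hrm n).prodMk
        ((measurable_iterate_chainStep hφ n).comp measurable_prodMk_left).snd)).aemeasurable
  have hR : ∫⁻ ξ, ∫⁻ ξ', G (fun i => cycleGain φ a z (Φ i) (c i) (s, ξ), ξ') ∂streamLaw κ
      ∂streamLaw κ = ∑' n, ∫⁻ ξ, ∫⁻ ξ', (if first (chainRecord φ a z Φ c n (s, ξ)) then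
        G ((chainRecord φ a z Φ c n (s, ξ)).2.2, ξ') else 0) ∂streamLaw κ ∂streamLaw κ := by
    rw [← lintegral_tsum fun n => ?_]
    · refine lintegral_congr_ae ?_
      filter_upwards [hvis] with ξ hξ
      rw [tsum_eq_single (visitIndex φ a z (s, ξ))]
      · refine lintegral_congr fun ξ' => ?_
        rw [if_pos]
        · rfl
        · exact (visitIndex_eq_iff hξ _).1 rfl
      · intro n hn
        have hne : ¬ first (chainRecord φ a z Φ c n (s, ξ)) := fun h =>
          hn ((visitIndex_eq_iff hξ n).2 h).symm
        simp [hne]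
    · exact ((hGn n).lintegral_prod_right'.comp (hrm n)).aemeasurable
  rw [hL, hR]
  exact tsum_congr fun n => lintegral_chainRecord κ hφ s z hΦ c n (hGn n)

end

noncomputable section

/-! ### Independence of successive cycles -/

section Cycles

variable {S E : Type*} [MeasurableSpace S] [MeasurableSpace E] {P : Measure S}
  [IsProbabilityMeasure P] {W : S → E} {R : S → S}

/-- If the remainder `R` is independent of `W` and has the original law, then the successive values
of `W` are independent and identically distributed. -/
lemma map_iterate_eq_infinitePi (hW : Measurable W) (hR : Measurable R)
    (h : ∀ G : E × S → ℝ≥0∞, Measurable G →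
      ∫⁻ ξ, G (W ξ, R ξ) ∂P = ∫⁻ ξ, ∫⁻ ξ', G (W ξ, ξ') ∂P ∂P) :
    have := Measure.isProbabilityMeasure_map (μ := P) hW.aemeasurable
    P.map (fun ξ j => W (R^[j] ξ)) = Measure.infinitePi fun _ : ℕ => P.map W := by
  have := Measure.isProbabilityMeasure_map (μ := P) hW.aemeasurable
  have hm : Measurable fun ξ => fun j => W (R^[j] ξ) :=
    measurable_pi_lambda _ fun j => hW.comp (hR.iterate j)
  refine eq_infinitePi_nat fun n t ht => ?_
  have hbox : ∀ (n : ℕ) (t : ℕ → Set E), (∀ i, MeasurableSet (t i)) →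
      MeasurableSet (Set.pi (Finset.range n : Set ℕ) t) := fun n t ht =>
    MeasurableSet.pi (Finset.countable_toSet _) fun i _ => ht i
  rw [Measure.map_apply hm (hbox n t ht)]
  induction n generalizing t with
  | zero => simp
  | succ n ih =>
    set A := (fun ξ => fun j => W (R^[j] ξ)) ⁻¹' (Set.pi (Finset.range n : Set ℕ) fun i => t (i + 1))
    have hA : MeasurableSet A := hm (hbox n _ fun i => ht (i + 1))
    have hset : (fun ξ => fun j => W (R^[j] ξ)) ⁻¹' (Set.pi (Finset.range (n + 1) : Set ℕ) t) =
        W ⁻¹' (t 0) ∩ R ⁻¹' A := by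
      ext ξ
      simp only [Set.mem_preimage, Set.mem_pi, Finset.mem_coe, Finset.mem_range, Set.mem_inter_iff, A]
      refine ⟨fun h => ⟨h 0 (Nat.succ_pos _), fun i hi => h (i + 1) (by omega)⟩, fun h i hi => ?_⟩
      cases i with
      | zero => exact h.1
      | succ i => exact h.2 i (by omega)
    -- The hypothesis applied to the indicator of `t 0 ×ˢ A` splits off the first factor; `A` is the
    -- event for the shifted sequence, which the induction covers.
    have hG : Measurable ((t 0 ×ˢ A).indicator (1 : E × S → ℝ≥0∞)) :=
      measurable_one.indicator ((ht 0).prod hA)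
    have key := h _ hG
    rw [hset, Finset.prod_range_succ', ← ih (fun i => t (i + 1)) (fun i => ht (i + 1)),
      Measure.map_apply hW (ht 0), mul_comm]
    have e1 : ∫⁻ ξ, (t 0 ×ˢ A).indicator (1 : E × S → ℝ≥0∞) (W ξ, R ξ) ∂P =
        P (W ⁻¹' (t 0) ∩ R ⁻¹' A) := by
      rw [← lintegral_indicator_one ((hW (ht 0)).inter (hR hA))]
      refine lintegral_congr fun ξ => ?_
      have : (W ξ, R ξ) ∈ t 0 ×ˢ A ↔ ξ ∈ W ⁻¹' (t 0) ∩ R ⁻¹' A := Iff.rfl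
      by_cases hh : ξ ∈ W ⁻¹' (t 0) ∩ R ⁻¹' A
      · rw [Set.indicator_of_mem hh, Set.indicator_of_mem (this.2 hh)]; rfl
      · rw [Set.indicator_of_notMem hh, Set.indicator_of_notMem (mt this.1 hh)]
    have e2 : ∀ ξ, ∫⁻ ξ', (t 0 ×ˢ A).indicator (1 : E × S → ℝ≥0∞) (W ξ, ξ') ∂P =
        (W ⁻¹' (t 0)).indicator (fun _ => P A) ξ := by
      intro ξ
      by_cases hξ : W ξ ∈ t 0
      · rw [Set.indicator_of_mem (by exact hξ), ← lintegral_indicator_one hA]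
        refine lintegral_congr fun ξ' => ?_
        by_cases hh : ξ' ∈ A
        · rw [Set.indicator_of_mem hh, Set.indicator_of_mem (by exact ⟨hξ, hh⟩)]; rfl
        · rw [Set.indicator_of_notMem hh, Set.indicator_of_notMem fun h => hh h.2]
      · rw [Set.indicator_of_notMem (by exact hξ)]
        simp [hξ]
    rw [← e1, key]
    simp only [e2]
    rw [lintegral_indicator (hW (ht 0)), setLIntegral_const, mul_comm]

end Cycles

end

noncomputable section

/-! ### Maximal inequality and renewal bound -/

/-- The `n`-th renewal time of the sequence with delay `(V 0).1` and cycle lengths `(V (n + 1)).1`. -/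
def renewalTime {Ω : Type*} (V : ℕ → Ω → ℝ × ℝ × ℝ) (n : ℕ) (ω : Ω) : ℝ :=
  ∑ k ∈ Finset.range (n + 1), (V k ω).1

lemma renewalTime_succ {Ω : Type*} (V : ℕ → Ω → ℝ × ℝ × ℝ) (n : ℕ) (ω : Ω) :
    renewalTime V (n + 1) ω = renewalTime V n ω + (V (n + 1) ω).1 :=
  Finset.sum_range_succ _ _

/-- Used wherever an event on the first renewals meets later cycle lengths: at the first renewal
after a given time, and for the cycle that covers a given time. -/
lemma indepFun_past_future {Ω E : Type*} [MeasurableSpace Ω] [MeasurableSpace E]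
    {P : Measure Ω} {V : ℕ → Ω → E} (hm : ∀ n, Measurable (V n))
    (hind : iIndepFun V P) {m n : ℕ} :
    IndepFun (fun ω (k : Finset.range m) => V k ω) (fun ω (k : Finset.Ico m n) => V k ω) P := by
  refine hind.indepFun_finset _ _ ?_ hm
  rw [Finset.disjoint_left]; intro i hi hi'
  simp only [Finset.mem_range, Finset.mem_Ico] at hi hi'; omega

section Renewal

variable {Ω : Type*} [MeasurableSpace Ω] {P : Measure Ω} [IsProbabilityMeasure P]

/-- Kolmogorov's maximal inequality for centered identically distributed summands. -/
lemma kolmogorov_maximal {Y : ℕ → Ω → ℝ} (hm : ∀ n, Measurable (Y n)) (hind : iIndepFun Y P)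
    (h2 : ∀ n, MemLp (Y n) 2 P) (h0 : ∀ n, ∫ ω, Y n ω ∂P = 0) {v : ℝ}
    (hv : ∀ n, Var[Y n; P] = v) (K : ℕ) {x : ℝ} (hx : 0 < x) :
    P.real {ω | ∃ k ≤ K, x ≤ |∑ j ∈ Finset.range k, Y j ω|} ≤ K * v / x ^ 2 := by
  set S : ℕ → Ω → ℝ := fun k ω => ∑ j ∈ Finset.range k, Y j ω with hS
  have hSm : ∀ k, Measurable (S k) := fun k => Finset.measurable_fun_sum _ fun j _ => hm j
  have hS2 : ∀ k, MemLp (S k) 2 P := fun k => memLp_finsetSum _ fun j _ => h2 j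
  -- `A k` is the event that the level is reached for the first time at `k`; these events are
  -- disjoint and make up the event in question.
  set A : ℕ → Set Ω := fun k => {ω | x ≤ |S k ω| ∧ ∀ j < k, |S j ω| < x} with hA
  have hAm : ∀ k, MeasurableSet (A k) := fun k => by
    have : A k = {ω | x ≤ |S k ω|} ∩ ⋂ j ∈ Finset.range k, {ω | |S j ω| < x} := by
      ext ω; simp [A]
    rw [this]
    exact (measurableSet_le measurable_const (hSm k).abs).inter
      (Finset.measurableSet_biInter _ fun j _ => measurableSet_lt (hSm j).abs measurable_const)
  have hdisj : ∀ i j, i ≠ j → Disjoint (A i) (A j) := by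
    intro i j hij
    rw [Set.disjoint_left]
    rintro ω ⟨h1, h1'⟩ ⟨h2, h2'⟩
    rcases lt_or_gt_of_ne hij with h | h
    · exact absurd h1 (not_le.2 (h2' i h))
    · exact absurd h2 (not_le.2 (h1' j h))
  have hsub : {ω | ∃ k ≤ K, x ≤ |S k ω|} = ⋃ k ∈ Finset.range (K + 1), A k := by
    classical
    ext ω
    simp only [Set.mem_ofPred_eq, Set.mem_iUnion, Finset.mem_range, exists_prop]
    constructor
    · rintro ⟨k, hk, hkx⟩
      have hex : ∃ k, x ≤ |S k ω| := ⟨k, hkx⟩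
      refine ⟨Nat.find hex, ?_, Nat.find_spec hex, fun j hj => not_le.1 (Nat.find_min hex hj)⟩
      exact Nat.lt_succ_of_le ((Nat.find_min' hex hkx).trans hk)
    · rintro ⟨k, hk, h, _⟩
      exact ⟨k, Nat.le_of_lt_succ hk, h⟩
  -- on `A k` the square of the final sum dominates
  have hcross : ∀ k ≤ K, x ^ 2 * P.real (A k) ≤ ∫ ω in A k, S K ω ^ 2 ∂P := by
    intro k hk
    have hdiff : ∀ ω, S K ω - S k ω = ∑ j ∈ Finset.Ico k K, Y j ω := fun ω => by
      rw [Finset.sum_Ico_eq_sub _ hk]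
    have hindep : IndepFun (fun ω => (A k).indicator (fun ω => S k ω) ω)
        (fun ω => S K ω - S k ω) P := by
      have hd : Disjoint (Finset.range k) (Finset.Ico k K) := by
        rw [Finset.disjoint_left]; intro i hi hi'
        simp only [Finset.mem_range, Finset.mem_Ico] at hi hi'; omega
      have hi := hind.indepFun_finset (Finset.range k) (Finset.Ico k K) hd hm
      set g : ℕ → ((Finset.range k) → ℝ) → ℝ := fun j y =>
        ∑ i : Finset.range k, if (i : ℕ) < j then y i else 0 with hg
      have hgm : ∀ j, Measurable (g j) := fun j =>
        Finset.measurable_fun_sum _ fun i _ => by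
          split_ifs
          · exact measurable_pi_apply i
          · exact measurable_const
      have hgS : ∀ j ≤ k, ∀ ω, g j (fun i => Y i ω) = S j ω := by
        intro j hj ω
        rw [hg, hS]
        simp only
        rw [Finset.sum_coe_sort (Finset.range k) (fun i => if i < j then Y i ω else 0),
          ← Finset.sum_filter]
        congr 1
        ext i; simp only [Finset.mem_filter, Finset.mem_range]; omega
      set B : Set ((Finset.range k) → ℝ) := {y | x ≤ |g k y| ∧ ∀ j < k, |g j y| < x} with hB
      have hBm : MeasurableSet B := by
        have : B = {y | x ≤ |g k y|} ∩ ⋂ j ∈ Finset.range k, {y | |g j y| < x} := by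
          ext ω; simp [B]
        rw [this]
        exact (measurableSet_le measurable_const (hgm k).abs).inter
          (Finset.measurableSet_biInter _ fun j _ => measurableSet_lt (hgm j).abs measurable_const)
      have := hi.comp (φ := B.indicator (g k)) (ψ := fun y => ∑ i, y i)
        ((hgm k).indicator hBm) (Finset.measurable_fun_sum _ fun i _ => measurable_pi_apply i)
      refine this.congr (.of_forall fun ω => ?_) (.of_forall fun ω => ?_)
      · have hmem : (fun i : Finset.range k => Y i ω) ∈ B ↔ ω ∈ A k := by
          simp only [B, A, Set.mem_ofPred_eq, hgS k le_rfl]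
          refine and_congr_right fun _ => forall₂_congr fun j hj => ?_
          rw [hgS j hj.le]
        simp only [Function.comp]
        by_cases h : ω ∈ A k
        · rw [Set.indicator_of_mem h, Set.indicator_of_mem (hmem.2 h), hgS k le_rfl]
        · rw [Set.indicator_of_notMem h, Set.indicator_of_notMem (mt hmem.1 h)]
      · simp only [Function.comp]
        rw [hdiff, Finset.sum_coe_sort (Finset.Ico k K) (fun i => Y i ω)]
    have hd2 : MemLp (fun ω => S K ω - S k ω) 2 P := (hS2 K).sub (hS2 k)
    have hk2 : MemLp (fun ω => (A k).indicator (fun ω => S k ω) ω) 2 P := (hS2 k).indicator (hAm k)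
    -- The increment after `k` is centred and independent of `A k` and `S k`, so the cross term has
    -- mean zero.
    have hz : ∫ ω, (A k).indicator (fun ω => S k ω) ω * (S K ω - S k ω) ∂P = 0 := by
      rw [hindep.integral_fun_mul_eq_mul_integral hk2.aestronglyMeasurable hd2.aestronglyMeasurable]
      have : ∫ ω, (S K ω - S k ω) ∂P = 0 := by
        simp only [hdiff]
        rw [integral_finsetSum _ fun j _ => (h2 j).integrable (by norm_num)]
        exact Finset.sum_eq_zero fun j _ => h0 j
      rw [this, mul_zero]
    have hz' : ∫ ω in A k, S k ω * (S K ω - S k ω) ∂P = 0 := by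
      rw [← hz, ← integral_indicator (hAm k)]
      refine integral_congr_ae (.of_forall fun ω => ?_)
      by_cases h : ω ∈ A k <;> simp [h]
    have hi1 : IntegrableOn (fun ω => S k ω ^ 2) (A k) P := ((hS2 k).integrable_sq).integrableOn
    have hi2 : IntegrableOn (fun ω => 2 * (S k ω * (S K ω - S k ω))) (A k) P :=
      (((hS2 k).integrable_mul hd2).const_mul 2).integrableOn
    have hi3 : IntegrableOn (fun ω => (S K ω - S k ω) ^ 2) (A k) P := (hd2.integrable_sq).integrableOn
    have hi12 : IntegrableOn (fun ω => S k ω ^ 2 + 2 * (S k ω * (S K ω - S k ω))) (A k) P :=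
      hi1.add hi2
    have e : ∀ ω, S K ω ^ 2 = S k ω ^ 2 + 2 * (S k ω * (S K ω - S k ω)) + (S K ω - S k ω) ^ 2 :=
      fun ω => by ring
    simp only [e]
    rw [integral_add (f := fun ω => S k ω ^ 2 + 2 * (S k ω * (S K ω - S k ω))) hi12 hi3,
      integral_add hi1 hi2, integral_const_mul, hz', mul_zero, add_zero]
    have h3 : 0 ≤ ∫ ω in A k, (S K ω - S k ω) ^ 2 ∂P := integral_nonneg fun ω => sq_nonneg _
    have h4 : x ^ 2 * P.real (A k) ≤ ∫ ω in A k, S k ω ^ 2 ∂P := by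
      have := setIntegral_mono_on (f := fun _ => x ^ 2) (g := fun ω => S k ω ^ 2) (μ := P)
        (integrable_const _).integrableOn hi1 (hAm k) (fun ω hω => by
          have := hω.1
          rw [← sq_abs (S k ω)]; gcongr)
      rw [setIntegral_const, smul_eq_mul, mul_comm] at this
      exact this
    linarith
  have hvar : ∫ ω, S K ω ^ 2 ∂P = K * v := by
    have h1 : Var[S K; P] = K * v := by
      have := IndepFun.variance_sum (X := Y) (s := Finset.range K) (μ := P) (fun i _ => h2 i)
        (fun i _ j _ hij => hind.indepFun hij)
      have e : S K = ∑ i ∈ Finset.range K, Y i := by ext ω; simp [S]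
      rw [e, this]; simp [hv]
    have h3 : ∫ ω, S K ω ∂P = 0 := by
      simp only [hS]
      rw [integral_finsetSum _ fun j _ => (h2 j).integrable (by norm_num)]
      exact Finset.sum_eq_zero fun j _ => h0 j
    rw [← h1, variance_of_integral_eq_zero (hSm K).aemeasurable h3]
  rw [hsub, le_div_iff₀ (by positivity), mul_comm]
  have hfin : P.real (⋃ k ∈ Finset.range (K + 1), A k) = ∑ k ∈ Finset.range (K + 1), P.real (A k) :=
    measureReal_biUnion_finset (fun i _ j _ hij => hdisj i j hij) fun k _ => hAm k
  rw [hfin, Finset.mul_sum]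
  calc ∑ k ∈ Finset.range (K + 1), x ^ 2 * P.real (A k)
      ≤ ∑ k ∈ Finset.range (K + 1), ∫ ω in A k, S K ω ^ 2 ∂P :=
        Finset.sum_le_sum fun k hk => hcross k (Nat.le_of_lt_succ (Finset.mem_range.1 hk))
    _ = ∫ ω in ⋃ k ∈ Finset.range (K + 1), A k, S K ω ^ 2 ∂P := by
        rw [integral_biUnion_finset _ (fun k _ => hAm k) (fun i _ j _ hij => hdisj i j hij)
          (fun k _ => ((hS2 K).integrable_sq).integrableOn)]
    _ ≤ ∫ ω, S K ω ^ 2 ∂P :=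
        setIntegral_le_integral (hS2 K).integrable_sq (.of_forall fun ω => sq_nonneg _)
    _ = K * v := hvar

/-! ### The mean number of renewals in a unit interval -/

lemma measurable_renewalTime {V : ℕ → Ω → ℝ × ℝ × ℝ} (hm : ∀ n, Measurable (V n)) (n : ℕ) :
    Measurable (renewalTime V n) :=
  Finset.measurable_fun_sum _ fun k _ => (hm k).fst

/-- The probability that `n` cycles take at most unit time decays geometrically. -/
lemma measure_sum_lengths_le {V : ℕ → Ω → ℝ × ℝ × ℝ} (hm : ∀ n, Measurable (V n))
    (hind : iIndepFun V P) (hid : ∀ n, IdentDistrib (V (n + 1)) (V 1) P P)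
    (hpos : ∀ᵐ ω ∂P, 0 < (V 1 ω).1) :
    ∃ r : ℝ≥0∞, r < 1 ∧ ∀ m n, m ≤ n →
      P {ω | renewalTime V n ω - renewalTime V m ω ≤ 1} ≤ ENNReal.ofReal (Real.exp 1) * r ^ (n - m) := by
  -- Chernoff's bound with exponent -1: ρ is the mean of exp(-C) for a cycle length C, which is
  -- below 1 because C is positive. The factor e comes from the level 1.
  set ρ := mgf (fun ω => (V 1 ω).1) P (-1) with hρ
  have hint : Integrable (fun ω => Real.exp (-1 * (V 1 ω).1)) P := by
    refine Integrable.of_bound (C := 1) (((hm 1).fst.const_mul _).exp.aestronglyMeasurable) ?_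
    filter_upwards [hpos] with ω hω
    rw [Real.norm_eq_abs, abs_of_pos (Real.exp_pos _)]
    exact Real.exp_le_one_iff.2 (by linarith)
  have hρ1 : ρ < 1 := by
    have h1 : 0 < ∫ ω, (1 - Real.exp (-1 * (V 1 ω).1)) ∂P := by
      rw [integral_pos_iff_support_of_nonneg_ae]
      · rw [pos_iff_ne_zero]
        intro h
        have h2 : ∀ᵐ ω ∂P, ω ∉ Function.support fun ω => 1 - Real.exp (-1 * (V 1 ω).1) :=
          measure_eq_zero_iff_ae_notMem.1 h
        obtain ⟨ω, h3, h4⟩ := (hpos.and h2).exists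
        apply h4
        rw [Function.mem_support]
        have : Real.exp (-1 * (V 1 ω).1) < 1 := 
          (Real.exp_lt_exp.2 (by linarith)).trans_eq Real.exp_zero
        linarith
      · filter_upwards [hpos] with ω hω
        have : Real.exp (-1 * (V 1 ω).1) < 1 := 
          (Real.exp_lt_exp.2 (by linarith)).trans_eq Real.exp_zero
        simp only [Pi.zero_apply]; linarith
      · exact (integrable_const _).sub hint
    rw [integral_sub (integrable_const _) hint] at h1
    simp only [integral_const, probReal_univ, smul_eq_mul, mul_one, sub_pos] at h1
    exact h1
  have hρ0 : 0 ≤ ρ := mgf_nonneg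
  refine ⟨ENNReal.ofReal ρ, by simpa using hρ1, fun m n hmn => ?_⟩
  -- The difference of renewal times involves only indices from m + 1 ≥ 1 on; the delay, whose law
  -- may differ, does not enter.
  set s := Finset.Ico (m + 1) (n + 1) with hs
  have hX : iIndepFun (fun k ω => (V k ω).1) P := hind.comp (fun _ => Prod.fst) fun _ => measurable_fst
  have hsum : ∀ ω, renewalTime V n ω - renewalTime V m ω = (∑ k ∈ s, fun ω => (V k ω).1) ω := by
    intro ω
    rw [Finset.sum_apply, hs, Finset.sum_Ico_eq_sub _ (by omega)]
    rfl
  have hidk : ∀ k ∈ s, mgf (fun ω => (V k ω).1) P (-1) = ρ := fun k hk => by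
    obtain ⟨j, rfl⟩ : ∃ j, k = j + 1 := ⟨k - 1, by
      have := (Finset.mem_Ico.1 hk).1; omega⟩
    exact mgf_congr_of_identDistrib _ _ ((hid j).comp measurable_fst) _
  have hmgf : mgf (∑ k ∈ s, fun ω => (V k ω).1) P (-1) = ρ ^ (n - m) := by
    rw [hX.mgf_sum fun k => (hm k).fst, Finset.prod_congr rfl hidk, Finset.prod_const, hs,
      Nat.card_Ico, Nat.add_sub_add_right]
  have hintk : ∀ k ∈ s, Integrable (fun ω => Real.exp (-1 * (V k ω).1)) P := fun k hk => by
    obtain ⟨j, rfl⟩ : ∃ j, k = j + 1 := ⟨k - 1, by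
      have := (Finset.mem_Ico.1 hk).1; omega⟩
    have hu : Measurable fun x : ℝ × ℝ × ℝ => Real.exp (-1 * x.1) := by fun_prop
    exact ((hid j).comp hu).integrable_iff.2 hint
  have h := measure_le_le_exp_mul_mgf (μ := P) (X := ∑ k ∈ s, fun ω => (V k ω).1) 1
    (t := -1) (by norm_num) (hX.integrable_exp_mul_sum (fun k => (hm k).fst) hintk)
  rw [hmgf, neg_neg, one_mul] at h
  simp only [hsum]
  rw [← ENNReal.ofReal_pow hρ0, ← ENNReal.ofReal_mul (Real.exp_pos _).le]
  rw [← ofReal_measureReal]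
  exact ENNReal.ofReal_le_ofReal h

/-- The expected number of renewals in an interval of unit length is bounded. -/
lemma exists_renewal_bound {V : ℕ → Ω → ℝ × ℝ × ℝ} (hm : ∀ n, Measurable (V n))
    (hind : iIndepFun V P) (hid : ∀ n, IdentDistrib (V (n + 1)) (V 1) P P)
    (hpos : ∀ᵐ ω ∂P, 0 < (V 1 ω).1) :
    ∃ B : ℝ≥0∞, B < ∞ ∧ ∀ t, ∑' n, P {ω | t < renewalTime V n ω ∧ renewalTime V n ω ≤ t + 1} ≤ B := by
  obtain ⟨r, hr1, hr⟩ := measure_sum_lengths_le hm hind hid hpos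
  -- The bound is e times the geometric series of `r`. Renewals in the window are counted from the
  -- first renewal after `t`, whose index is `m` on the event `A m`.
  refine ⟨ENNReal.ofReal (Real.exp 1) * (1 - r)⁻¹, ENNReal.mul_lt_top ENNReal.ofReal_lt_top
    (ENNReal.inv_lt_top.2 (tsub_pos_of_lt hr1)), fun t => ?_⟩
  set A : ℕ → Set Ω := fun m => {ω | t < renewalTime V m ω ∧ ∀ j < m, renewalTime V j ω ≤ t} with hA
  have hAm : ∀ k, MeasurableSet (A k) := fun k => by
    have : A k = {ω | t < renewalTime V k ω} ∩ ⋂ j ∈ Finset.range k, {ω | renewalTime V j ω ≤ t} := by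
      ext ω; simp [A]
    rw [this]
    exact (measurableSet_lt measurable_const (measurable_renewalTime hm k)).inter
      (Finset.measurableSet_biInter _ fun j _ =>
        measurableSet_le (measurable_renewalTime hm j) measurable_const)
  have hdisj : Pairwise (Function.onFun Disjoint A) := by
    intro i j hij
    rw [Function.onFun, Set.disjoint_left]
    rintro ω ⟨h1, h1'⟩ ⟨h2, h2'⟩
    rcases lt_or_gt_of_ne hij with h | h
    · exact absurd h1 (not_lt.2 (h2' i h))
    · exact absurd h2 (not_lt.2 (h1' j h))
  have hsum : ∑' m, P (A m) ≤ 1 := by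
    rw [← measure_iUnion hdisj hAm]; exact prob_le_one
  -- `A m` depends on the entries up to `m` and the difference of renewal times on later ones, so
  -- the probability factorizes.
  have hfirst : ∀ n m, m ≤ n → P (A m ∩ {ω | renewalTime V n ω - renewalTime V m ω ≤ 1}) ≤
      P (A m) * (ENNReal.ofReal (Real.exp 1) * r ^ (n - m)) := by
    intro n m hmn
    have hi := indepFun_past_future hm hind (m := m + 1) (n := n + 1)
    set g : ℕ → ((Finset.range (m + 1)) → ℝ × ℝ × ℝ) → ℝ := fun j y =>
      ∑ i : Finset.range (m + 1), if (i : ℕ) < j + 1 then (y i).1 else 0 with hg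
    have hgm : ∀ j, Measurable (g j) := fun j =>
      Finset.measurable_fun_sum _ fun i _ => by
        split_ifs
        · exact (measurable_pi_apply i).fst
        · exact measurable_const
    have hgS : ∀ j ≤ m, ∀ ω, g j (fun i => V i ω) = renewalTime V j ω := by
      intro j hj ω
      rw [hg, renewalTime]
      simp only
      rw [Finset.sum_coe_sort (Finset.range (m + 1)) (fun i => if i < j + 1 then (V i ω).1 else 0),
        ← Finset.sum_filter]
      congr 1
      ext i; simp only [Finset.mem_filter, Finset.mem_range]; omega
    set B : Set ((Finset.range (m + 1)) → ℝ × ℝ × ℝ) := {y | t < g m y ∧ ∀ j < m, g j y ≤ t} with hB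
    have hBm : MeasurableSet B := by
      have : B = {y | t < g m y} ∩ ⋂ j ∈ Finset.range m, {y | g j y ≤ t} := by
        ext ω; simp [B]
      rw [this]
      exact (measurableSet_lt measurable_const (hgm m)).inter
        (Finset.measurableSet_biInter _ fun j _ => measurableSet_le (hgm j) measurable_const)
    set B' : Set ((Finset.Ico (m + 1) (n + 1)) → ℝ × ℝ × ℝ) := {y | ∑ i, (y i).1 ≤ 1} with hB'
    have hBm' : MeasurableSet B' :=
      measurableSet_le (Finset.measurable_fun_sum _ fun i _ => (measurable_pi_apply i).fst)
        measurable_const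
    have e1 : A m = (fun ω (k : Finset.range (m + 1)) => V k ω) ⁻¹' B := by
      ext ω
      simp only [A, B, Set.mem_preimage, Set.mem_ofPred_eq, hgS m le_rfl]
      refine and_congr_right fun _ => forall₂_congr fun j hj => ?_
      rw [hgS j hj.le]
    have e2 : {ω | renewalTime V n ω - renewalTime V m ω ≤ 1} =
        (fun ω (k : Finset.Ico (m + 1) (n + 1)) => V k ω) ⁻¹' B' := by
      ext ω
      simp only [B', Set.mem_preimage, Set.mem_ofPred_eq]
      rw [Finset.sum_coe_sort (Finset.Ico (m + 1) (n + 1)) (fun i => (V i ω).1),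
        Finset.sum_Ico_eq_sub _ (by omega)]
      rfl
    calc P (A m ∩ {ω | renewalTime V n ω - renewalTime V m ω ≤ 1})
        = P (A m) * P {ω | renewalTime V n ω - renewalTime V m ω ≤ 1} := by
          rw [e2, e1]; exact hi.measure_inter_preimage_eq_mul _ _ hBm hBm'
      _ ≤ _ := by gcongr; exact hr m n hmn
  have hn : ∀ n, P {ω | t < renewalTime V n ω ∧ renewalTime V n ω ≤ t + 1} ≤
      ∑' m, if m ≤ n then P (A m) * (ENNReal.ofReal (Real.exp 1) * r ^ (n - m)) else 0 := by
    classical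
    intro n
    have hsub : {ω | t < renewalTime V n ω ∧ renewalTime V n ω ≤ t + 1} ⊆
        ⋃ m, if m ≤ n then A m ∩ {ω | renewalTime V n ω - renewalTime V m ω ≤ 1} else ∅ := by
      rintro ω ⟨h1, h2⟩
      have hex : ∃ k, t < renewalTime V k ω := ⟨n, h1⟩
      refine Set.mem_iUnion.2 ⟨Nat.find hex, ?_⟩
      rw [if_pos (Nat.find_min' hex h1)]
      refine ⟨⟨Nat.find_spec hex, fun j hj => not_lt.1 (Nat.find_min hex hj)⟩, ?_⟩
      have := Nat.find_spec hex
      simp only [Set.mem_ofPred_eq]; linarith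
    refine (measure_mono hsub).trans ((measure_iUnion_le _).trans (ENNReal.tsum_le_tsum fun m => ?_))
    split_ifs with h
    · exact hfirst n m h
    · simp
  refine (ENNReal.tsum_le_tsum hn).trans ?_
  rw [ENNReal.tsum_comm]
  have hinner : ∀ m, ∑' n, (if m ≤ n then P (A m) * (ENNReal.ofReal (Real.exp 1) * r ^ (n - m)) else 0)
      = P (A m) * (ENNReal.ofReal (Real.exp 1) * (1 - r)⁻¹) := by
    intro m
    rw [← ENNReal.tsum_geometric, ← ENNReal.tsum_mul_left, ← ENNReal.tsum_mul_left]
    rw [← (add_left_injective m).tsum_eq]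
    · refine tsum_congr fun k => ?_
      simp
    · intro n hn
      rw [Function.mem_support] at hn
      have : m ≤ n := by by_contra h; simp [h] at hn
      exact ⟨n - m, by simp [this]⟩
  simp only [hinner]
  rw [ENNReal.tsum_mul_right]
  calc (∑' i, P (A i)) * (ENNReal.ofReal (Real.exp 1) * (1 - r)⁻¹)
      ≤ 1 * (ENNReal.ofReal (Real.exp 1) * (1 - r)⁻¹) := by gcongr
    _ = _ := one_mul _

end Renewal

end

noncomputable section

/-! ### The central limit theorem for regenerative processes -/

section RegenerativeCLT

variable {Ω : Type*} [MeasurableSpace Ω] {P : Measure Ω} [IsProbabilityMeasure P]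

lemma tendsto_measure_ge_atTop {Z : Ω → ℝ} (hZ : Measurable Z) :
    Tendsto (fun K : ℝ => P {ω | K ≤ Z ω}) atTop (𝓝 0) := by
  have h := tendsto_measure_iInter_atTop (μ := P) (s := fun K : ℝ => {ω | K ≤ Z ω})
    (fun K => (measurableSet_le measurable_const hZ).nullMeasurableSet)
    (fun K K' hKK' ω hω => le_trans hKK' hω) ⟨0, measure_ne_top _ _⟩
  have he : ⋂ K : ℝ, {ω | K ≤ Z ω} = ∅ := by
    ext ω
    simp only [Set.mem_iInter, Set.mem_ofPred_eq, Set.mem_empty_iff_false, iff_false, not_forall, not_le]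
    exact ⟨Z ω + 1, by linarith⟩
  rwa [he, measure_empty] at h

/-- The series counts the natural numbers below `x`. It turns the sum over the possible ages of the
covering cycle into an integral weighted by length plus one. -/
lemma tsum_indicator_lt_le {x : ℝ} (hx : 0 < x) :
    ∑' k : ℕ, (if (k : ℝ) < x then (1 : ℝ≥0∞) else 0) ≤ ENNReal.ofReal (x + 1) := by
  rw [tsum_eq_sum (s := Finset.range ⌈x⌉₊)]
  · calc ∑ k ∈ Finset.range ⌈x⌉₊, (if (k : ℝ) < x then (1 : ℝ≥0∞) else 0)
        ≤ ∑ k ∈ Finset.range ⌈x⌉₊, 1 := Finset.sum_le_sum fun k _ => by split_ifs <;> simp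
      _ = ENNReal.ofReal ⌈x⌉₊ := by simp
      _ ≤ _ := ENNReal.ofReal_le_ofReal (Nat.ceil_lt_add_one hx.le).le
  · intro k hk
    rw [if_neg]
    rw [Finset.mem_range, not_lt, Nat.ceil_le] at hk
    exact not_lt.2 hk

/-- The functional `g` of the cycle that covers the time `τ` is tight in `τ`. -/
lemma exists_covering_cycle_bound {V : ℕ → Ω → ℝ × ℝ × ℝ} (hm : ∀ n, Measurable (V n))
    (hind : iIndepFun V P) (hid : ∀ n, IdentDistrib (V (n + 1)) (V 1) P P)
    (hpos : ∀ᵐ ω ∂P, 0 < (V 1 ω).1) (hint : Integrable (fun ω => (V 1 ω).1) P)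
    {g : ℝ × ℝ × ℝ → ℝ} (hg : Measurable g) :
    ∃ β : ℝ → ℝ≥0∞, Tendsto β atTop (𝓝 0) ∧ ∀ K τ, P {ω | ∃ n, renewalTime V n ω ≤ τ ∧
      τ < renewalTime V (n + 1) ω ∧ K ≤ g (V (n + 1) ω)} ≤ β K := by
  obtain ⟨B, hB, hBt⟩ := exists_renewal_bound hm hind hid hpos
  -- The covering cycle is biased by its length, hence this weight. Its integral over {K ≤ g} tends
  -- to 0 because the length is integrable; no moment of `g` is needed.
  set F : Ω → ℝ≥0∞ := fun ω => ENNReal.ofReal ((V 1 ω).1 + 1) with hF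
  have hFfin : ∫⁻ ω, F ω ∂P ≠ ∞ := by
    have := (hint.add (integrable_const (1 : ℝ))).lintegral_lt_top
    exact this.ne
  refine ⟨fun K => B * ∫⁻ ω in {ω | K ≤ g (V 1 ω)}, F ω ∂P, ?_, fun K τ => ?_⟩
  · have h := tendsto_setLIntegral_zero (μ := P) (f := F) hFfin
      (tendsto_measure_ge_atTop (P := P) (hg.comp (hm 1)))
    have h2 := ENNReal.Tendsto.const_mul h (Or.inr hB.ne)
    rw [mul_zero] at h2
    exact h2
  · set D : ℕ → Set (ℝ × ℝ × ℝ) := fun k => {y | (k : ℝ) < y.1 ∧ K ≤ g y} with hD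
    have hDm : ∀ k, MeasurableSet (D k) := fun k =>
      (measurableSet_lt measurable_const measurable_fst).inter (measurableSet_le measurable_const hg)
    -- Here `k` is the integer part of the age of the covering cycle at time τ: the cycle starts in
    -- a window of unit length and lasts longer than `k`.
    have hsub : {ω | ∃ n, renewalTime V n ω ≤ τ ∧ τ < renewalTime V (n + 1) ω ∧ K ≤ g (V (n + 1) ω)} ⊆
        ⋃ n, ⋃ k : ℕ, ({ω | τ - k - 1 < renewalTime V n ω ∧ renewalTime V n ω ≤ τ - k - 1 + 1} ∩
          V (n + 1) ⁻¹' D k) := by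
      rintro ω ⟨n, h1, h2, h3⟩
      rw [renewalTime_succ] at h2
      have hfl := Nat.floor_le (sub_nonneg.2 h1)
      have hfl2 := Nat.lt_floor_add_one (τ - renewalTime V n ω)
      refine Set.mem_iUnion₂.2 ⟨n, ⌊τ - renewalTime V n ω⌋₊, ⟨?_, ?_⟩, ?_, h3⟩
      · linarith
      · linarith
      · linarith
    have hindn : ∀ n, IndepFun (renewalTime V n) (V (n + 1)) P := by
      intro n
      have hi := indepFun_past_future hm hind (m := n + 1) (n := n + 2)
      have hmem : n + 1 ∈ Finset.Ico (n + 1) (n + 2) := by simp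
      have hpm : Measurable fun y : (Finset.Ico (n + 1) (n + 2)) → ℝ × ℝ × ℝ => y ⟨n + 1, hmem⟩ :=
        measurable_pi_apply _
      have := hi.comp (φ := fun y : (Finset.range (n + 1)) → ℝ × ℝ × ℝ => ∑ i, (y i).1)
        (ψ := fun y : (Finset.Ico (n + 1) (n + 2)) → ℝ × ℝ × ℝ => y ⟨n + 1, hmem⟩)
        (Finset.measurable_fun_sum _ fun i _ => (measurable_pi_apply i).fst) hpm
      refine this.congr (.of_forall fun ω => ?_) (.of_forall fun ω => rfl)
      simp only [Function.comp]
      rw [Finset.sum_coe_sort (Finset.range (n + 1)) (fun i => (V i ω).1)]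
      rfl
    have hprod : ∀ n (k : ℕ), P ({ω | τ - k - 1 < renewalTime V n ω ∧ renewalTime V n ω ≤ τ - k - 1 + 1} ∩
        V (n + 1) ⁻¹' D k) = P {ω | τ - k - 1 < renewalTime V n ω ∧
          renewalTime V n ω ≤ τ - k - 1 + 1} * P (V 1 ⁻¹' D k) := by
      intro n k
      have h1 := (hindn n).measure_inter_preimage_eq_mul (Set.Ioc (τ - k - 1) (τ - k - 1 + 1)) (D k)
        measurableSet_Ioc (hDm k)
      have h2 := (hid n).measure_mem_eq (hDm k)
      rw [h2] at h1
      exact h1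
    refine (measure_mono hsub).trans ((measure_iUnion_le _).trans ?_)
    refine (ENNReal.tsum_le_tsum fun n => measure_iUnion_le _).trans ?_
    simp only [hprod]
    rw [ENNReal.tsum_comm]
    simp only [ENNReal.tsum_mul_right]
    calc ∑' k : ℕ, (∑' n, P {ω | τ - k - 1 < renewalTime V n ω ∧
            renewalTime V n ω ≤ τ - k - 1 + 1}) * P (V 1 ⁻¹' D k)
        ≤ ∑' k : ℕ, B * P (V 1 ⁻¹' D k) := ENNReal.tsum_le_tsum fun k => by gcongr; exact hBt _
      _ = B * ∑' k : ℕ, P (V 1 ⁻¹' D k) := ENNReal.tsum_mul_left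
      _ ≤ B * ∫⁻ ω in {ω | K ≤ g (V 1 ω)}, F ω ∂P := by
        gcongr
        have hgm : MeasurableSet {ω | K ≤ g (V 1 ω)} := measurableSet_le measurable_const (hg.comp (hm 1))
        have e : ∀ k : ℕ, P (V 1 ⁻¹' D k) =
            ∫⁻ ω in {ω | K ≤ g (V 1 ω)}, (if (k : ℝ) < (V 1 ω).1 then 1 else 0) ∂P := by
          intro k
          have hk : MeasurableSet {ω | (k : ℝ) < (V 1 ω).1} :=
            measurableSet_lt measurable_const (hm 1).fst
          have h1 : (fun ω => if (k : ℝ) < (V 1 ω).1 then (1 : ℝ≥0∞) else 0) =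
              Set.indicator {ω | (k : ℝ) < (V 1 ω).1} 1 := by
            ext ω; simp [Set.indicator_apply]
          rw [h1, lintegral_indicator_one hk, Measure.restrict_apply hk]
          rfl
        simp only [e]
        rw [← lintegral_tsum]
        · refine lintegral_mono_ae ?_
          filter_upwards [ae_restrict_of_ae hpos] with ω hω
          exact tsum_indicator_lt_le hω
        · intro k
          exact (Measurable.ite (measurableSet_lt measurable_const (hm 1).fst) measurable_const
            measurable_const).aemeasurable

/-- Anscombe's condition: a random number of summands may replace a deterministic one. -/
lemma tendsto_measure_random_sum_sub {Y : ℕ → Ω → ℝ} (hm : ∀ n, Measurable (Y n)) (hind : iIndepFun Y P)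
    (h2 : ∀ n, MemLp (Y n) 2 P) (h0 : ∀ n, ∫ ω, Y n ω ∂P = 0) {v : ℝ}
    (hv : ∀ n, Var[Y n; P] = v) {c : ℝ} (hc : 0 < c) {J : ℝ → Ω → ℕ}
    (hJ : ∀ δ > 0, Tendsto (fun τ => P {ω | δ * τ < |(J τ ω : ℝ) - c * τ|}) atTop (𝓝 0))
    {ε : ℝ} (hε : 0 < ε) :
    Tendsto (fun τ => P {ω | ε * √τ ≤ |∑ k ∈ Finset.range (J τ ω), Y k ω -
      ∑ k ∈ Finset.range ⌊c * τ⌋₊, Y k ω|}) atTop (𝓝 0) := by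
  have hv0 : 0 ≤ v := hv 0 ▸ variance_nonneg _ _
  rw [ENNReal.tendsto_nhds_zero]
  intro η hη
  obtain ⟨η', hη'0, hη'⟩ : ∃ η' : ℝ, 0 < η' ∧ ENNReal.ofReal η' ≤ η := by
    rcases eq_or_ne η ∞ with rfl | h
    · exact ⟨1, one_pos, le_top⟩
    · exact ⟨η.toReal, ENNReal.toReal_pos hη.ne' h, ENNReal.ofReal_toReal_le⟩
  -- Chosen so that the maximal inequality for at most 4δτ summands at the level ε√τ/2 gives η'/2;
  -- the denominator uses v + 1 so that v = 0 is allowed.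
  set δ : ℝ := η' * ε ^ 2 / (32 * (v + 1)) with hδ
  have hδ0 : 0 < δ := by positivity
  have e1 := (ENNReal.tendsto_nhds_zero.1 (hJ δ hδ0)) (ENNReal.ofReal (η' / 2)) (by simpa using hη'0)
  filter_upwards [e1, eventually_ge_atTop (1 / δ), eventually_gt_atTop 0] with τ h1 hτ hτ0
  -- Off an event of small probability both numbers of summands lie in the window of length `L` that
  -- starts at `m`. The two sums then differ by two partial sums started at `m`, one of which must
  -- exceed half of the level.
  set m := ⌊(c - δ) * τ⌋₊ with hmdef
  set L := ⌈2 * δ * τ⌉₊ + 1 with hL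
  have hsq : 0 < √τ := Real.sqrt_pos.2 hτ0
  have hsub : {ω | ε * √τ ≤ |∑ k ∈ Finset.range (J τ ω), Y k ω -
      ∑ k ∈ Finset.range ⌊c * τ⌋₊, Y k ω|} ⊆ {ω | δ * τ < |(J τ ω : ℝ) - c * τ|} ∪
      {ω | ∃ k ≤ L, ε * √τ / 2 ≤ |∑ j ∈ Finset.range k, Y (m + j) ω|} := by
    intro ω hω
    by_cases hJω : δ * τ < |(J τ ω : ℝ) - c * τ|
    · exact Or.inl hJω
    right
    rw [not_lt, abs_le] at hJω
    have hshift : ∀ n : ℕ, m ≤ n → ∑ k ∈ Finset.range n, Y k ω =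
        ∑ k ∈ Finset.range m, Y k ω + ∑ j ∈ Finset.range (n - m), Y (m + j) ω := by
      intro n hn
      conv_lhs => rw [← Nat.add_sub_cancel' hn]
      rw [Finset.sum_range_add]
    have hml : (c - δ) * τ - 1 < m := Nat.sub_one_lt_floor _
    have hrange : ∀ n : ℕ, (n : ℝ) ≤ c * τ + δ * τ → n - m ≤ L := by
      intro n hn
      have h3 : (2 * δ * τ) ≤ ⌈2 * δ * τ⌉₊ := Nat.le_ceil _
      have h4 : (n : ℝ) < ((L + m : ℕ) : ℝ) + 1 := by
        rw [hL]; push_cast; nlinarith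
      have h5 : n < L + m + 1 := by exact_mod_cast h4
      omega
    have hJm : m ≤ J τ ω := by
      rcases le_or_gt 0 ((c - δ) * τ) with hp | hp
      · have h3 : (m : ℝ) ≤ (c - δ) * τ := Nat.floor_le hp
        have : (m : ℝ) ≤ (J τ ω : ℝ) := by nlinarith
        exact_mod_cast this
      · rw [hmdef, Nat.floor_of_nonpos hp.le]; exact Nat.zero_le _
    have hnm : m ≤ ⌊c * τ⌋₊ := Nat.floor_mono (by nlinarith)
    have hn1 : (⌊c * τ⌋₊ : ℝ) ≤ c * τ := Nat.floor_le (by positivity)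
    have hω' : ε * √τ ≤ |∑ k ∈ Finset.range (J τ ω), Y k ω -
      ∑ k ∈ Finset.range ⌊c * τ⌋₊, Y k ω| := hω
    rw [hshift _ hJm, hshift _ hnm, add_sub_add_left_eq_sub] at hω'
    by_contra hcon
    simp only [Set.mem_ofPred_eq, not_exists, not_and, not_le] at hcon
    have c1 := hcon (J τ ω - m) (hrange (J τ ω) (by linarith [hJω.2]))
    have c2 := hcon (⌊c * τ⌋₊ - m) (hrange ⌊c * τ⌋₊ (by nlinarith))
    have := abs_sub (∑ j ∈ Finset.range (J τ ω - m), Y (m + j) ω)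
      (∑ j ∈ Finset.range (⌊c * τ⌋₊ - m), Y (m + j) ω)
    linarith
  refine (measure_mono hsub).trans ((measure_union_le _ _).trans ?_)
  have hk := kolmogorov_maximal (P := P) (Y := fun j => Y (m + j)) (fun j => hm _)
    (hind.precomp (add_right_injective m)) (fun j => h2 _) (fun j => h0 _) (fun j => hv _) L
    (x := ε * √τ / 2) (by positivity)
  have hk2 : (L : ℝ) * v / (ε * √τ / 2) ^ 2 ≤ η' / 2 := by
    rw [div_le_iff₀ (by positivity), div_pow, mul_pow, Real.sq_sqrt hτ0.le]
    have h3 : (⌈2 * δ * τ⌉₊ : ℝ) < 2 * δ * τ + 1 := Nat.ceil_lt_add_one (by positivity)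
    have h4 : 1 ≤ δ * τ := by rwa [div_le_iff₀ hδ0, mul_comm] at hτ
    have h5 : (L : ℝ) ≤ 4 * (δ * τ) := by rw [hL]; push_cast; linarith
    have h6 : δ * (32 * (v + 1)) = η' * ε ^ 2 := by rw [hδ]; field_simp
    have h7 : (L : ℝ) * v ≤ 4 * (δ * τ) * (v + 1) := by
      apply mul_le_mul h5 (by linarith) hv0 (by positivity)
    calc (L : ℝ) * v ≤ 4 * (δ * τ) * (v + 1) := h7
      _ = δ * (32 * (v + 1)) * τ / 8 := by ring
      _ = η' / 2 * (ε ^ 2 * τ / 2 ^ 2) := by rw [h6]; ring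
  calc _ ≤ ENNReal.ofReal (η' / 2) + ENNReal.ofReal (η' / 2) := by
        refine add_le_add h1 ?_
        rw [← ofReal_measureReal]
        exact ENNReal.ofReal_le_ofReal (hk.trans hk2)
    _ = ENNReal.ofReal η' := by
        rw [← ENNReal.ofReal_add (by positivity) (by positivity), add_halves]
    _ ≤ η := hη'

/-- The law of large numbers for the renewal times. -/
lemma ae_tendsto_renewalTime_div {Ω : Type*} [MeasurableSpace Ω] {P : Measure Ω}
    {V : ℕ → Ω → ℝ × ℝ × ℝ}
    (hind : iIndepFun V P) (hid : ∀ n, IdentDistrib (V (n + 1)) (V 1) P P)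
    (hint : Integrable (fun ω => (V 1 ω).1) P) :
    ∀ᵐ ω ∂P, Tendsto (fun n : ℕ => renewalTime V n ω / n) atTop (𝓝 (∫ ω, (V 1 ω).1 ∂P)) := by
  have hX : iIndepFun (fun k ω => (V (k + 1) ω).1) P :=
    (hind.precomp (add_left_injective 1)).comp (fun _ => Prod.fst) fun _ => measurable_fst
  have hlln := strong_law_ae_real (fun k ω => (V (k + 1) ω).1) hint
    (fun i j hij => hX.indepFun hij) fun i => (hid i).comp measurable_fst
  filter_upwards [hlln] with ω hω
  have h0 : Tendsto (fun n : ℕ => (V 0 ω).1 / n) atTop (𝓝 0) := tendsto_const_div_atTop_nhds_zero_nat _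
  have h1 := hω.add h0
  rw [add_zero] at h1
  refine h1.congr fun n => ?_
  rw [renewalTime, Finset.sum_range_succ', add_div]

/-- The number of cycles completed by the time `τ` grows like `τ` divided by the mean length. -/
lemma tendsto_measure_cycleCount {V : ℕ → Ω → ℝ × ℝ × ℝ} (hm : ∀ n, Measurable (V n))
    (hind : iIndepFun V P) (hid : ∀ n, IdentDistrib (V (n + 1)) (V 1) P P)
    (hpos : ∀ᵐ ω ∂P, ∀ n, 0 < (V (n + 1) ω).1) (hint : Integrable (fun ω => (V 1 ω).1) P)
    {m : ℝ} (hmean : ∫ ω, (V 1 ω).1 ∂P = m) (hm0 : 0 < m) {J : ℝ → Ω → ℕ}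
    (hJ : ∀ᵐ ω ∂P, ∀ τ, renewalTime V 0 ω ≤ τ →
      renewalTime V (J τ ω) ω ≤ τ ∧ τ < renewalTime V (J τ ω + 1) ω)
    {δ : ℝ} (hδ : 0 < δ) :
    Tendsto (fun τ => P {ω | δ * τ < |(J τ ω : ℝ) - m⁻¹ * τ|}) atTop (𝓝 0) := by
  have hT : TendstoInMeasure P (fun (n : ℕ) ω => renewalTime V n ω / n) atTop fun _ => m :=
    tendstoInMeasure_of_tendsto_ae
      (fun n => ((measurable_renewalTime hm n).div_const _).aestronglyMeasurable)
      (hmean ▸ ae_tendsto_renewalTime_div hind hid hint)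
  rw [tendstoInMeasure_iff_norm] at hT
  set c := m⁻¹ with hc
  have hc0 : 0 < c := inv_pos.2 hm0
  have hmono : ∀ᵐ ω ∂P, Monotone fun n => renewalTime V n ω := by
    filter_upwards [hpos] with ω hω
    refine monotone_nat_of_le_succ fun n => ?_
    rw [renewalTime_succ]; linarith [hω n]
  have hup : Tendsto (fun τ : ℝ => ⌈(c + δ) * τ⌉₊) atTop atTop :=
    tendsto_nat_ceil_atTop.comp (tendsto_id.const_mul_atTop (by positivity))
  -- More than (c+δ)τ cycles by time τ force the quotient of the renewal time by its index, at index
  -- ⌈(c+δ)τ⌉, to be at most 1/(c+δ), which is below the mean by ε₁.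
  set ε₁ := m - 1 / (c + δ) with hε₁
  have hε₁0 : 0 < ε₁ := by
    rw [hε₁, sub_pos, div_lt_iff₀ (by positivity)]
    have : m * c = 1 := mul_inv_cancel₀ hm0.ne'
    nlinarith
  have h1 := (hT ε₁ hε₁0).comp hup
  have h0 : Tendsto (fun τ : ℝ => P {ω | τ ≤ renewalTime V 0 ω}) atTop (𝓝 0) :=
    tendsto_measure_ge_atTop (measurable_renewalTime hm 0)
  have h2 : Tendsto (fun τ : ℝ => P {ω | (J τ ω : ℝ) < (c - δ) * τ ∧ renewalTime V 0 ω ≤ τ})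
      atTop (𝓝 0) := by
    rcases le_or_gt c δ with hcδ | hcδ
    · refine tendsto_const_nhds.congr' ?_
      filter_upwards [eventually_ge_atTop 0] with τ hτ
      symm
      convert measure_empty (μ := P)
      ext ω
      simp only [Set.mem_ofPred_eq, Set.mem_empty_iff_false, iff_false, not_and]
      intro h
      have : (c - δ) * τ ≤ 0 := mul_nonpos_of_nonpos_of_nonneg (by linarith) hτ
      have h3 : (0 : ℝ) ≤ J τ ω := Nat.cast_nonneg _
      linarith
    · have hcd : 0 < c - δ := by linarith
      -- Fewer than (c-δ)τ cycles force this quotient above 1/(c-δ/2) at index ⌊(c-δ)τ⌋ + 1; the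
      -- slack δ/2 absorbs the rounding once τ ≥ 2/δ.
      set ε₂ := 1 / (c - δ / 2) - m with hε₂
      have hcd2 : 0 < c - δ / 2 := by linarith
      have hε₂0 : 0 < ε₂ := by
        rw [hε₂, sub_pos, lt_div_iff₀ hcd2]
        have : m * c = 1 := mul_inv_cancel₀ hm0.ne'
        nlinarith
      have hk : Tendsto (fun τ : ℝ => ⌊(c - δ) * τ⌋₊ + 1) atTop atTop :=
        tendsto_atTop_mono (fun _ => Nat.le_succ _)
          (tendsto_nat_floor_atTop.comp (tendsto_id.const_mul_atTop hcd))
      refine tendsto_of_tendsto_of_tendsto_of_le_of_le' tendsto_const_nhds ((hT ε₂ hε₂0).comp hk)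
        (.of_forall fun _ => zero_le) ?_
      filter_upwards [eventually_ge_atTop (2 / δ)] with τ hτ
      have hτ0 : 0 < τ := lt_of_lt_of_le (by positivity) hτ
      refine measure_mono_ae ?_
      filter_upwards [hJ, hmono] with ω hω hmω h
      have h' : (J τ ω : ℝ) < (c - δ) * τ ∧ renewalTime V 0 ω ≤ τ := h
      change ε₂ ≤ ‖_‖
      set k := ⌊(c - δ) * τ⌋₊ + 1 with hkdef
      have hJk : J τ ω + 1 ≤ k := by
        have := Nat.le_floor h'.1.le
        omega
      have hTk : τ < renewalTime V k ω := (hω τ h'.2).2.trans_le (hmω hJk)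
      have hk1 : (k : ℝ) ≤ (c - δ / 2) * τ := by
        have h3 : (⌊(c - δ) * τ⌋₊ : ℝ) ≤ (c - δ) * τ := Nat.floor_le (by positivity)
        have h4 : 2 ≤ τ * δ := (div_le_iff₀ hδ).1 hτ
        rw [hkdef]; push_cast; nlinarith
      have hk0 : (0 : ℝ) < k := by rw [hkdef]; positivity
      refine le_trans ?_ (le_abs_self _)
      rw [hε₂]
      refine sub_le_sub_right ?_ _
      rw [div_le_div_iff₀ hcd2 hk0]
      nlinarith
  have h3 : Tendsto (fun τ : ℝ => P {ω | (c + δ) * τ < (J τ ω : ℝ) ∧ renewalTime V 0 ω ≤ τ})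
      atTop (𝓝 0) := by
    refine tendsto_of_tendsto_of_tendsto_of_le_of_le' tendsto_const_nhds h1
      (.of_forall fun _ => zero_le) ?_
    filter_upwards [eventually_gt_atTop 0] with τ hτ0
    refine measure_mono_ae ?_
    filter_upwards [hJ, hmono] with ω hω hmω h
    have h' : (c + δ) * τ < (J τ ω : ℝ) ∧ renewalTime V 0 ω ≤ τ := h
    change ε₁ ≤ ‖_‖
    set k := ⌈(c + δ) * τ⌉₊ with hkdef
    have hJk : k ≤ J τ ω := Nat.ceil_le.2 h'.1.le
    have hTk : renewalTime V k ω ≤ τ := (hmω hJk).trans (hω τ h'.2).1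
    have hk1 : (c + δ) * τ ≤ k := Nat.le_ceil _
    have hk0 : (0 : ℝ) < k := lt_of_lt_of_le (by positivity) hk1
    refine le_trans ?_ (neg_le_abs _)
    rw [hε₁, neg_sub]
    refine sub_le_sub_left ?_ _
    rw [div_le_div_iff₀ hk0 (by positivity)]
    nlinarith
  have hsum := (h0.add h2).add h3
  simp only [add_zero] at hsum
  refine tendsto_of_tendsto_of_tendsto_of_le_of_le tendsto_const_nhds hsum (fun _ => zero_le)
    fun τ => ?_
  refine le_trans (measure_mono ?_) ((measure_union_le _ _).trans
    (add_le_add (measure_union_le _ _) le_rfl))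
  intro ω hω
  rcases le_total τ (renewalTime V 0 ω) with h | h
  · exact Or.inl (Or.inl h)
  · have hω' : δ * τ < |(J τ ω : ℝ) - c * τ| := hω
    rcases lt_abs.1 hω' with h4 | h4
    · exact Or.inr ⟨by linarith, h⟩
    · exact Or.inl (Or.inr ⟨by linarith, h⟩)

/-- The central limit theorem for the integral `I` of a regenerative process. The delay, the first
integral and a bound for it are the components of `V 0`; the lengths of the cycles, the integrals
over the cycles and bounds for the partial integrals are the components of `V (n + 1)`. -/
theorem regenerative_clt {V : ℕ → Ω → ℝ × ℝ × ℝ} (hm : ∀ n, Measurable (V n))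
    (hind : iIndepFun V P) (hid : ∀ n, IdentDistrib (V (n + 1)) (V 1) P P)
    (hpos : ∀ᵐ ω ∂P, 0 < (V 1 ω).1) (hint : Integrable (fun ω => (V 1 ω).1) P) {μ : ℝ}
    (h2 : MemLp (fun ω => (V 1 ω).2.1 - μ * (V 1 ω).1) 2 P)
    (hmean : ∫ ω, ((V 1 ω).2.1 - μ * (V 1 ω).1) ∂P = 0) {I : ℝ → Ω → ℝ}
    (hI : ∀ τ, AEMeasurable (I τ) P)
    (hfirst : ∀ᵐ ω ∂P, |I (renewalTime V 0 ω) ω| ≤ (V 0 ω).2.2)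
    (hcycle : ∀ᵐ ω ∂P, ∀ n, I (renewalTime V (n + 1) ω) ω - I (renewalTime V n ω) ω = (V (n + 1) ω).2.1)
    (hbound : ∀ᵐ ω ∂P, ∀ n τ, renewalTime V n ω ≤ τ → τ ≤ renewalTime V (n + 1) ω →
      |I τ ω - I (renewalTime V n ω) ω| ≤ (V (n + 1) ω).2.2) :
    TendstoInDistribution (fun (τ : ℝ) ω => √τ * (τ⁻¹ * I τ ω - μ)) atTop (id : ℝ → ℝ) (fun _ => P)
      (gaussianReal 0 (Var[fun ω => (V 1 ω).2.1 - μ * (V 1 ω).1; P] / ∫ ω, (V 1 ω).1 ∂P).toNNReal) := by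
  set m := ∫ ω, (V 1 ω).1 ∂P with hmdef
  set Y : ℕ → Ω → ℝ := fun n ω => (V (n + 1) ω).2.1 - μ * (V (n + 1) ω).1 with hY
  set g : ℝ × ℝ × ℝ → ℝ := fun y => y.2.2 + |μ| * |y.1| with hg
  have hgm : Measurable g := measurable_snd.snd.add (measurable_fst.abs.const_mul _)
  have hum : Measurable fun y : ℝ × ℝ × ℝ => y.2.1 - μ * y.1 :=
    measurable_snd.fst.sub (measurable_fst.const_mul _)
  have hm0 : 0 < m := by
    rw [hmdef, integral_pos_iff_support_of_nonneg_ae (hpos.mono fun ω h => h.le) hint, pos_iff_ne_zero]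
    intro h
    obtain ⟨ω, h3, h4⟩ := (hpos.and (measure_eq_zero_iff_ae_notMem.1 h)).exists
    exact h4 (Function.mem_support.2 h3.ne')
  have hposn : ∀ᵐ ω ∂P, ∀ n, 0 < (V (n + 1) ω).1 := by
    refine ae_all_iff.2 fun n => ?_
    have hs : MeasurableSet {y : ℝ × ℝ × ℝ | 0 < y.1} := measurableSet_lt measurable_const measurable_fst
    exact (hid n).symm.ae_snd hs hpos
  have hmono : ∀ᵐ ω ∂P, Monotone fun n => renewalTime V n ω := by
    filter_upwards [hposn] with ω hω
    refine monotone_nat_of_le_succ fun n => ?_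
    rw [renewalTime_succ]; linarith [hω n]
  have hinf : ∀ᵐ ω ∂P, Tendsto (fun n => renewalTime V n ω) atTop atTop := by
    filter_upwards [ae_tendsto_renewalTime_div hind hid hint] with ω hω
    have h := (tendsto_natCast_atTop_atTop (R := ℝ)).atTop_mul_pos hm0 hω
    refine h.congr' ?_
    filter_upwards [eventually_gt_atTop 0] with n hn
    have : (n : ℝ) ≠ 0 := by positivity
    field_simp
  -- The number of cycles completed by time τ: subtracting 1 turns the first renewal after τ into
  -- the last one up to τ. Before the end of the delay the value does not matter.
  set J : ℝ → Ω → ℕ := fun τ ω => sInf {n | τ < renewalTime V n ω} - 1 with hJdef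
  have hJ : ∀ᵐ ω ∂P, ∀ τ, renewalTime V 0 ω ≤ τ →
      renewalTime V (J τ ω) ω ≤ τ ∧ τ < renewalTime V (J τ ω + 1) ω := by
    filter_upwards [hinf] with ω hω τ hτ
    have hne : {n | τ < renewalTime V n ω}.Nonempty := (hω.eventually_gt_atTop τ).exists
    have hmem := Nat.sInf_mem hne
    have hne0 : sInf {n | τ < renewalTime V n ω} ≠ 0 := fun h0 => by
      rw [h0] at hmem; exact absurd hmem (not_lt.2 hτ)
    have hJ1 : J τ ω + 1 = sInf {n | τ < renewalTime V n ω} := Nat.succ_pred_eq_of_ne_zero hne0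
    refine ⟨?_, hJ1 ▸ hmem⟩
    have : J τ ω ∉ {n | τ < renewalTime V n ω} := Nat.notMem_of_lt_sInf (by omega)
    exact not_lt.1 this
  have hYm : ∀ n, Measurable (Y n) := fun n => hum.comp (hm (n + 1))
  have hYind : iIndepFun Y P :=
    (hind.precomp (add_left_injective 1)).comp (fun _ y => y.2.1 - μ * y.1) fun _ => hum
  have hYid : ∀ n, IdentDistrib (Y n) (Y 0) P P := fun n => (hid n).comp hum
  have hY2 : ∀ n, MemLp (Y n) 2 P := fun n => (hYid n).memLp_iff.2 h2
  have hY0 : ∀ n, ∫ ω, Y n ω ∂P = 0 := fun n => (hYid n).integral_eq.trans hmean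
  set v := Var[Y 0; P] with hv
  have hYv : ∀ n, Var[Y n; P] = v := fun n => (hYid n).variance_eq
  have hv0 : 0 ≤ v := variance_nonneg _ _
  -- the sum of a deterministic number of cycles
  set X : ℝ → Ω → ℝ := fun τ ω => (√τ)⁻¹ * ∑ k ∈ Finset.range ⌊m⁻¹ * τ⌋₊, Y k ω with hX
  have hfl : Tendsto (fun τ : ℝ => ⌊m⁻¹ * τ⌋₊) atTop atTop :=
    tendsto_nat_floor_atTop.comp (tendsto_id.const_mul_atTop (inv_pos.2 hm0))
  have hclt : TendstoInDistribution X atTop (id : ℝ → ℝ) (fun _ => P)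
      (gaussianReal 0 (v / m).toNNReal) := by
    have h1 : TendstoInDistribution (fun (n : ℕ) ω => (√(n : ℝ))⁻¹ * ∑ k ∈ Finset.range n, Y k ω) atTop
        (id : ℝ → ℝ) (fun _ => P) (gaussianReal 0 v.toNNReal) := by
      have h := tendstoInDistribution_inv_sqrt_mul_sum_sub (P := P) (P' := gaussianReal 0 v.toNNReal)
        (Y := id) (X := Y) ⟨aemeasurable_id, by rw [Measure.map_id]⟩ (hY2 0) hYind hYid
      simpa [hY0 0] using h
    have h2 : TendstoInDistribution (fun (τ : ℝ) ω => (√(⌊m⁻¹ * τ⌋₊ : ℝ))⁻¹ *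
        ∑ k ∈ Finset.range ⌊m⁻¹ * τ⌋₊, Y k ω) atTop (id : ℝ → ℝ) (fun _ => P)
        (gaussianReal 0 v.toNNReal) :=
      ⟨fun τ => h1.forall_aemeasurable _, aemeasurable_id, h1.tendsto.comp hfl⟩
    -- Slutsky's theorem with this factor rescales the variance `v` of the central limit theorem in
    -- the number of cycles to `v / m` in the time.
    have hfac : Tendsto (fun τ : ℝ => √(⌊m⁻¹ * τ⌋₊ : ℝ) / √τ) atTop (𝓝 √(m⁻¹)) := by
      refine ((tendsto_nat_floor_mul_div_atTop (inv_pos.2 hm0).le).sqrt).congr fun τ => ?_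
      rw [Real.sqrt_div (Nat.cast_nonneg _)]
    have hfacm : TendstoInMeasure P (fun (τ : ℝ) (_ : Ω) => √(⌊m⁻¹ * τ⌋₊ : ℝ) / √τ) atTop
        fun _ => √(m⁻¹) := by
      rw [tendstoInMeasure_iff_norm]
      intro ε hε
      refine tendsto_const_nhds.congr' ?_
      filter_upwards [Metric.tendsto_nhds.1 hfac ε hε] with τ hτ
      rw [Real.dist_eq] at hτ
      have h0 : {ω : Ω | ε ≤ ‖√(⌊m⁻¹ * τ⌋₊ : ℝ) / √τ - √(m⁻¹)‖} = ∅ := by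
        ext ω
        exact iff_of_false (not_le.2 hτ) (Set.notMem_empty ω)
      rw [h0, measure_empty]
    have h3 := h2.continuous_comp_prodMk_of_tendstoInMeasure_const (g := fun p : ℝ × ℝ => p.1 * p.2)
      (by fun_prop) hfacm fun _ => aemeasurable_const
    have hXeq : (fun (τ : ℝ) ω => (√(⌊m⁻¹ * τ⌋₊ : ℝ))⁻¹ *
        (∑ k ∈ Finset.range ⌊m⁻¹ * τ⌋₊, Y k ω) * (√(⌊m⁻¹ * τ⌋₊ : ℝ) / √τ)) = X := by
      ext τ ω
      simp only [hX]
      generalize ⌊m⁻¹ * τ⌋₊ = N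
      rcases Nat.eq_zero_or_pos N with h | h
      · simp [h]
      · have : √(N : ℝ) ≠ 0 := (Real.sqrt_pos.2 (by exact_mod_cast h)).ne'
        rw [mul_comm (√(N : ℝ))⁻¹, mul_assoc, mul_comm, div_eq_mul_inv, inv_mul_cancel_left₀ this]
    have hXm : ∀ τ, AEMeasurable (X τ) P := fun τ =>
      ((Finset.measurable_fun_sum _ fun k _ => hYm k).const_mul _).aemeasurable
    refine ⟨hXm, aemeasurable_id, ?_⟩
    have h3' : TendstoInDistribution X atTop (fun x : ℝ => id x * √(m⁻¹)) (fun _ => P)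
        (gaussianReal 0 v.toNNReal) := by
      rw [← hXeq]; exact h3
    have hlim : (gaussianReal 0 v.toNNReal).map (fun x : ℝ => id x * √(m⁻¹)) =
        (gaussianReal 0 (v / m).toNNReal).map id := by
      rw [Measure.map_id]
      simp only [id]
      rw [gaussianReal_map_mul_const, mul_zero]
      congr 1
      ext
      rw [NNReal.coe_mul, Real.coe_toNNReal _ hv0, Real.coe_toNNReal _ (by positivity)]
      simp only [NNReal.coe_mk]
      rw [Real.sq_sqrt (by positivity), inv_mul_eq_div]
    have hl : (⟨_, Measure.isProbabilityMeasure_map h3'.aemeasurable_limit⟩ : ProbabilityMeasure ℝ) =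
        ⟨_, Measure.isProbabilityMeasure_map aemeasurable_id⟩ := Subtype.ext hlim
    have h4 := h3'.tendsto
    rw [hl] at h4
    exact h4
  refine tendstoInDistribution_of_tendstoInMeasure_sub (X := X) _ _ hclt ?_ fun τ => by
    exact (((hI τ).const_mul _).sub_const _).const_mul _
  rw [tendstoInMeasure_iff_norm]
  intro ε hε
  -- Four exceptional events have vanishing probability: the delay is not over, the delay
  -- contributes too much, Anscombe's difference is large, or the covering cycle contributes too
  -- much.
  obtain ⟨β, hβ, hβP⟩ := exists_covering_cycle_bound hm hind hid hpos hint hgm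
  have hcount := fun δ (hδ : 0 < δ) =>
    tendsto_measure_cycleCount hm hind hid hposn hint rfl hm0 hJ hδ
  have hans := tendsto_measure_random_sum_sub hYm hYind hY2 hY0 hYv (inv_pos.2 hm0) hcount
    (ε := ε / 3) (by positivity)
  have hsqrt : Tendsto (fun τ : ℝ => ε / 3 * √τ) atTop atTop :=
    Real.tendsto_sqrt_atTop.const_mul_atTop (by positivity)
  have hz1 : Tendsto (fun τ : ℝ => P {ω | τ ≤ renewalTime V 0 ω}) atTop (𝓝 0) :=
    tendsto_measure_ge_atTop (measurable_renewalTime hm 0)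
  have hz2 : Tendsto (fun τ : ℝ => P {ω | ε / 3 * √τ ≤ g (V 0 ω)}) atTop (𝓝 0) :=
    (tendsto_measure_ge_atTop (hgm.comp (hm 0))).comp hsqrt
  have hz3 := hβ.comp hsqrt
  have hall := ((hz1.add hz2).add hans).add hz3
  simp only [add_zero] at hall
  refine tendsto_of_tendsto_of_tendsto_of_le_of_le' tendsto_const_nhds hall
    (.of_forall fun _ => zero_le) ?_
  filter_upwards [eventually_gt_atTop 0] with τ hτ
  refine le_trans (measure_mono_ae ?_) ((measure_union_le _ _).trans (add_le_add
    ((measure_union_le _ _).trans (add_le_add (measure_union_le _ _) le_rfl)) (hβP (ε / 3 * √τ) τ)))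
  filter_upwards [hJ, hposn, hfirst, hcycle, hbound] with ω hJω hposω hf hc hb hω
  have hω' : ε ≤ |√τ * (τ⁻¹ * I τ ω - μ) - X τ ω| := by
    have h : ε ≤ ‖√τ * (τ⁻¹ * I τ ω - μ) - X τ ω - 0‖ := hω
    rwa [sub_zero] at h
  by_contra hcon
  have hcon' : ¬ (ω ∈ (({ω | τ ≤ renewalTime V 0 ω} ∪ {ω | ε / 3 * √τ ≤ g (V 0 ω)}) ∪
      {ω | ε / 3 * √τ ≤ |∑ k ∈ Finset.range (J τ ω), Y k ω - ∑ k ∈ Finset.range ⌊m⁻¹ * τ⌋₊, Y k ω|}) ∪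
      {ω | ∃ n, renewalTime V n ω ≤ τ ∧ τ < renewalTime V (n + 1) ω ∧ ε / 3 * √τ ≤ g (V (n + 1) ω)}) := hcon
  simp only [Set.mem_union, Set.mem_ofPred_eq, not_or, not_le, not_exists, not_and] at hcon'
  obtain ⟨⟨⟨c1, c2⟩, c3⟩, c4⟩ := hcon'
  obtain ⟨hJ1, hJ2⟩ := hJω τ c1.le
  have c5 := c4 _ hJ1 hJ2
  have hsq : 0 < √τ := Real.sqrt_pos.2 hτ
  -- decomposition at the renewal times
  have htel : ∀ n, I (renewalTime V n ω) ω - μ * renewalTime V n ω =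
      I (renewalTime V 0 ω) ω - μ * renewalTime V 0 ω + ∑ k ∈ Finset.range n, Y k ω := by
    intro n
    induction n with
    | zero => simp
    | succ n ih =>
      rw [Finset.sum_range_succ, ← add_assoc, ← ih]
      have h1 := hc n
      have h2 := renewalTime_succ V n ω
      simp only [Y]
      linear_combination h1 - μ * h2
  have hrem : |I τ ω - I (renewalTime V (J τ ω) ω) ω - μ * (τ - renewalTime V (J τ ω) ω)| ≤
      g (V (J τ ω + 1) ω) := by
    refine (abs_sub _ _).trans (add_le_add (hb _ τ hJ1 hJ2.le) ?_)
    rw [abs_mul]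
    have h1 := renewalTime_succ V (J τ ω) ω
    have h2 := hposω (J τ ω)
    rw [abs_of_nonneg (sub_nonneg.2 hJ1), abs_of_pos h2]
    exact mul_le_mul_of_nonneg_left (by linarith) (abs_nonneg _)
  have hfst : |I (renewalTime V 0 ω) ω - μ * renewalTime V 0 ω| ≤ g (V 0 ω) := by
    refine (abs_sub _ _).trans (add_le_add hf ?_)
    rw [abs_mul]
    simp [renewalTime]
  -- The error splits into the delay, the difference of the random and the deterministic sum, and
  -- the incomplete last cycle. Off the exceptional events each is below a third of ε√τ.
  have hid1 : √τ * (τ⁻¹ * I τ ω - μ) - X τ ω = (√τ)⁻¹ *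
      ((I (renewalTime V 0 ω) ω - μ * renewalTime V 0 ω) +
      (∑ k ∈ Finset.range (J τ ω), Y k ω - ∑ k ∈ Finset.range ⌊m⁻¹ * τ⌋₊, Y k ω) +
      (I τ ω - I (renewalTime V (J τ ω) ω) ω - μ * (τ - renewalTime V (J τ ω) ω))) := by
    have h1 := htel (J τ ω)
    have h2 : √τ * (τ⁻¹ * I τ ω - μ) = (√τ)⁻¹ * (I τ ω - μ * τ) := by
      have h3 : τ = √τ * √τ := (Real.mul_self_sqrt hτ.le).symm
      have h4 : √τ * τ⁻¹ = (√τ)⁻¹ := by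
        conv_lhs => rw [h3]
        rw [Real.sqrt_mul_self hsq.le]; field_simp
      have h5 : √τ = (√τ)⁻¹ * τ := by
        conv_rhs => rw [h3]
        rw [Real.sqrt_mul_self hsq.le]; field_simp
      calc √τ * (τ⁻¹ * I τ ω - μ) = (√τ * τ⁻¹) * I τ ω - √τ * μ := by ring
        _ = (√τ)⁻¹ * I τ ω - ((√τ)⁻¹ * τ) * μ := by rw [h4, ← h5]
        _ = _ := by ring
    rw [h2, hX]
    have h6 : I τ ω - μ * τ = (I (renewalTime V 0 ω) ω - μ * renewalTime V 0 ω) +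
      ∑ k ∈ Finset.range (J τ ω), Y k ω +
      (I τ ω - I (renewalTime V (J τ ω) ω) ω - μ * (τ - renewalTime V (J τ ω) ω)) := by linarith
    rw [h6]; ring
  rw [hid1, abs_mul, abs_of_pos (inv_pos.2 hsq), inv_mul_eq_div, le_div_iff₀ hsq] at hω'
  have := abs_add_three (I (renewalTime V 0 ω) ω - μ * renewalTime V 0 ω)
    (∑ k ∈ Finset.range (J τ ω), Y k ω - ∑ k ∈ Finset.range ⌊m⁻¹ * τ⌋₊, Y k ω)
    (I τ ω - I (renewalTime V (J τ ω) ω) ω - μ * (τ - renewalTime V (J τ ω) ω))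
  linarith

end RegenerativeCLT

end

noncomputable section

/-! ### The law of a step -/

variable {φ : ℝ → ℝ} {a : ℝ}

lemma hasDerivAt_cumRate (hφ : Continuous φ) (s : ℝ × ℝ) (t : ℝ) :
    HasDerivAt (cumRate φ s) (flipRate φ (s.1 + s.2 * t) s.2) t :=
  ((continuous_flipRate_ray hφ s).integral_hasStrictDerivAt 0 t).hasDerivAt

/-- The density of the flip time. -/
def flipDensity (φ : ℝ → ℝ) (s : ℝ × ℝ) (t : ℝ) : ℝ :=
  flipRate φ (s.1 + s.2 * t) s.2 * Real.exp (-cumRate φ s t)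

lemma continuous_flipDensity (hφ : Continuous φ) (s : ℝ × ℝ) : Continuous (flipDensity φ s) :=
  (continuous_flipRate_ray hφ s).mul (continuous_cumRate_right hφ s).neg.rexp

lemma flipDensity_nonneg (s : ℝ × ℝ) (t : ℝ) : 0 ≤ flipDensity φ s t :=
  mul_nonneg (flipRate_nonneg _ _) (Real.exp_pos _).le

lemma expMeasure_Iic {c : ℝ} (hc : 0 ≤ c) :
    expMeasure 1 (Set.Iic c) = ENNReal.ofReal (1 - Real.exp (-c)) := by
  have h : expMeasure 1 (Set.Iic c) = expMeasure 1 (Set.Ici c)ᶜ := by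
    rw [Set.compl_Ici]
    refine measure_congr ?_
    have h0 : ∀ᵐ x ∂expMeasure 1, x ≠ c := by
      rw [ae_iff]; simpa using expMeasure_singleton c
    filter_upwards [h0] with x hx
    exact propext ⟨fun h => lt_of_le_of_ne h hx, fun h => le_of_lt h⟩
  rw [h, prob_compl_eq_one_sub measurableSet_Ici, expMeasure_Ici hc,
    ENNReal.ofReal_sub _ (Real.exp_pos _).le, ENNReal.ofReal_one]

lemma measurable_flightTime_right (hφ : Continuous φ) (s : ℝ × ℝ) :
    Measurable (flightTime φ a s) :=
  (measurable_flightTime hφ).comp (measurable_const.prodMk measurable_id)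

/-- The flight time inverts the integrated rate Λ, so a flip occurs by time c, up to the horizon,
with probability 1 - exp(-Λ(c)); differentiation gives `flipDensity`. -/
lemma map_flightTime (hφ : Continuous φ) (s : ℝ × ℝ) :
    ((expMeasure 1).restrict (Set.Iio (cumRate φ s (horizon a s)))).map (flightTime φ a s) =
      (volume.restrict (Set.Ioc 0 (horizon a s))).withDensity
        fun t => ENNReal.ofReal (flipDensity φ s t) := by
  have hT := measurable_flightTime_right (a := a) hφ s
  refine Measure.ext_of_Iic _ _ fun c => ?_
  rw [Measure.map_apply hT measurableSet_Iic, Measure.restrict_apply (hT measurableSet_Iic),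
    withDensity_apply _ measurableSet_Iic, Measure.restrict_restrict measurableSet_Iic]
  by_cases hc : 0 ≤ c
  · have hc' : 0 ≤ min c (horizon a s) := le_min hc (horizon_pos s).le
    have hset : Set.Iic c ∩ Set.Ioc 0 (horizon a s) = Set.Ioc 0 (min c (horizon a s)) := by
      ext t; simp only [Set.mem_inter_iff, Set.mem_Iic, Set.mem_Ioc, le_min_iff]; tauto
    have hd : ∀ t, HasDerivAt (fun t => -Real.exp (-cumRate φ s t)) (flipDensity φ s t) t := fun t => by
      refine ((hasDerivAt_cumRate hφ s t).neg.exp).neg.congr_deriv ?_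
      simp only [flipDensity, Pi.neg_apply]; ring
    rw [hset, ← ofReal_integral_eq_lintegral_ofReal
      ((continuous_flipDensity hφ s).integrableOn_Ioc) (.of_forall fun t => flipDensity_nonneg s t),
      ← intervalIntegral.integral_of_le hc',
      intervalIntegral.integral_eq_sub_of_hasDerivAt (fun t _ => hd t)
        ((continuous_flipDensity hφ s).intervalIntegrable _ _), cumRate_zero, neg_zero, Real.exp_zero,
      neg_sub_neg, ← expMeasure_Iic (cumRate_nonneg hφ s hc')]
    refine measure_congr ?_
    -- A tie between the clock and the horizon is a null event, so strict and weak inequalities may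
    -- be interchanged.
    have h0 : ∀ᵐ x ∂expMeasure 1, x ≠ cumRate φ s (horizon a s) := by
      rw [ae_iff]; simpa using expMeasure_singleton (cumRate φ s (horizon a s))
    filter_upwards [h0] with x hx
    refine propext ⟨fun h => ?_, fun h => ?_⟩
    · have hf : FlipsFirst φ a s x := h.2
      exact (flightTime_le_iff_of_flipsFirst hφ hf hc').1 (le_min h.1 (flightTime_le_horizon hφ s x))
    · have hle : x ≤ cumRate φ s (min c (horizon a s)) := h
      have hf : FlipsFirst φ a s x :=
        lt_of_le_of_ne (hle.trans (cumRate_mono hφ s (min_le_right _ _))) hx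
      exact ⟨((flightTime_le_iff_of_flipsFirst hφ hf hc').2 hle).trans (min_le_left _ _), hf⟩
  · have h1 : flightTime φ a s ⁻¹' Set.Iic c = ∅ := by
      ext x; simp only [Set.mem_preimage, Set.mem_Iic, Set.mem_empty_iff_false, iff_false, not_le]
      exact (not_le.1 hc).trans_le (flightTime_nonneg _ _)
    have h2 : Set.Iic c ∩ Set.Ioc 0 (horizon a s) = ∅ := by
      ext t; simp only [Set.mem_inter_iff, Set.mem_Iic, Set.mem_Ioc, Set.mem_empty_iff_false, iff_false]
      intro h; exact hc (h.2.1.le.trans h.1)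
    rw [h1, h2]; simp

/-- The state reached at time `t` of a flight, after a flip. -/
def flipOutcome (s : ℝ × ℝ) (t : ℝ) : (ℝ × ℝ) × ℝ := ((s.1 + s.2 * t, -s.2), 0)

open Classical in
/-- The state reached at the horizon, and the time spent at `0` if the sticking time is `D`. -/
def horizonOutcome (a : ℝ) (s : ℝ × ℝ) (D : ℝ) : (ℝ × ℝ) × ℝ :=
  ((s.1 + s.2 * horizon a s, s.2), if s.1 + s.2 * horizon a s = 0 then D else 0)

lemma measurable_flipOutcome (s : ℝ × ℝ) : Measurable (flipOutcome s) := by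
  unfold flipOutcome; fun_prop

lemma measurable_horizonOutcome (s : ℝ × ℝ) : Measurable (horizonOutcome a s) := by
  unfold horizonOutcome
  split_ifs <;> fun_prop

/-- The outcome of a step. -/
def stepOutcome (φ : ℝ → ℝ) (a : ℝ) (s : ℝ × ℝ) (ξ : ClockStream) : (ℝ × ℝ) × ℝ :=
  (nextState φ a s (ξ.1 0), stickDuration φ a s ξ)

lemma measurable_stepOutcome (hφ : Continuous φ) :
    Measurable fun q : (ℝ × ℝ) × ClockStream => stepOutcome φ a q.1 q.2 :=
  ((measurable_nextState hφ).comp measurable_firstClock).prodMk (measurable_stickDuration hφ)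

variable (κ : Measure ℝ) [IsProbabilityMeasure κ]

/-- Reads `lintegral_step_formula` as a law: a part with density for the flips, and the surviving
mass at the horizon, which carries a sticking time only if the horizon lies at 0. -/
lemma map_stepOutcome (hφ : Continuous φ) (s : ℝ × ℝ) :
    (streamLaw κ).map (stepOutcome φ a s) =
      ((volume.restrict (Set.Ioc 0 (horizon a s))).withDensity
        fun t => ENNReal.ofReal (flipDensity φ s t)).map (flipOutcome s) +
      ENNReal.ofReal (Real.exp (-cumRate φ s (horizon a s))) • κ.map (horizonOutcome a s) := by
  have hm : Measurable (stepOutcome φ a s) :=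
    (measurable_stepOutcome hφ).comp (measurable_const.prodMk measurable_id)
  refine Measure.ext_of_lintegral _ fun G hG => ?_
  have h := lintegral_step_formula (a := a) κ hφ s (hG.comp measurable_fst)
  simp only [Function.comp_def, lintegral_const, measure_univ, mul_one] at h
  rw [lintegral_map hG hm, lintegral_add_measure, lintegral_smul_measure,
    lintegral_map hG (measurable_horizonOutcome s), ← map_flightTime hφ,
    Measure.map_map (measurable_flipOutcome s) (measurable_flightTime_right hφ s),
    lintegral_map hG ((measurable_flipOutcome s).comp (measurable_flightTime_right hφ s))]
  refine h.trans ?_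
  congr 1
  rw [lintegral_seqLaw κ, smul_eq_mul]
  · simp only [seqCons_zero, lintegral_const, measure_univ, mul_one]
    congr 1
  · refine hG.comp (measurable_const.prodMk ?_)
    split_ifs
    · exact measurable_pi_apply 0
    · exact measurable_const

lemma integral_stepOutcome (hφ : Continuous φ) (s : ℝ × ℝ) {G : (ℝ × ℝ) × ℝ → ℝ}
    (hG : Measurable G)
    (h1 : IntegrableOn (fun t => flipDensity φ s t * G (flipOutcome s t)) (Set.Ioc 0 (horizon a s)))
    (h2 : Integrable (fun D => G (horizonOutcome a s D)) κ) :
    Integrable (fun ξ => G (stepOutcome φ a s ξ)) (streamLaw κ) ∧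
    ∫ ξ, G (stepOutcome φ a s ξ) ∂streamLaw κ =
      (∫ t in (0 : ℝ)..horizon a s, flipDensity φ s t * G (flipOutcome s t)) +
      Real.exp (-cumRate φ s (horizon a s)) * ∫ D, G (horizonOutcome a s D) ∂κ := by
  have hm : Measurable (stepOutcome φ a s) :=
    (measurable_stepOutcome hφ).comp (measurable_const.prodMk measurable_id)
  have hd : Measurable fun t => ENNReal.ofReal (flipDensity φ s t) :=
    (continuous_flipDensity hφ s).measurable.ennreal_ofReal
  have htop : ∀ᵐ t ∂volume.restrict (Set.Ioc 0 (horizon a s)),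
      ENNReal.ofReal (flipDensity φ s t) < ∞ := .of_forall fun t => ENNReal.ofReal_lt_top
  have hr : ∀ t, (ENNReal.ofReal (flipDensity φ s t)).toReal • G (flipOutcome s t) =
      flipDensity φ s t * G (flipOutcome s t) := fun t => by
    rw [ENNReal.toReal_ofReal (flipDensity_nonneg s t), smul_eq_mul]
  have i1 : Integrable G (((volume.restrict (Set.Ioc 0 (horizon a s))).withDensity
        fun t => ENNReal.ofReal (flipDensity φ s t)).map (flipOutcome s)) := by
    rw [integrable_map_measure hG.aestronglyMeasurable (measurable_flipOutcome s).aemeasurable,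
      integrable_withDensity_iff_integrable_smul' hd htop]
    simp only [Function.comp_def, hr]
    exact h1
  have i2 : Integrable G (ENNReal.ofReal (Real.exp (-cumRate φ s (horizon a s))) •
      κ.map (horizonOutcome a s)) := by
    refine Integrable.smul_measure ?_ ENNReal.ofReal_ne_top
    rwa [integrable_map_measure hG.aestronglyMeasurable (measurable_horizonOutcome s).aemeasurable]
  constructor
  · have : Integrable G ((streamLaw κ).map (stepOutcome φ a s)) := by
      rw [map_stepOutcome κ hφ]; exact i1.add_measure i2
    exact (integrable_map_measure hG.aestronglyMeasurable hm.aemeasurable).1 this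
  · rw [← integral_map hm.aemeasurable hG.aestronglyMeasurable, map_stepOutcome κ hφ,
      integral_add_measure i1 i2, integral_smul_measure,
      integral_map (measurable_flipOutcome s).aemeasurable hG.aestronglyMeasurable,
      integral_map (measurable_horizonOutcome s).aemeasurable hG.aestronglyMeasurable,
      integral_withDensity_eq_integral_toReal_smul hd htop,
      intervalIntegral.integral_of_le (horizon_pos s).le,
      ENNReal.toReal_ofReal (Real.exp_pos _).le, smul_eq_mul]
    simp only [hr]

/-- The flight time stopped at the horizon, under a function with derivative `n`. -/
lemma integral_flipDensity_mul (hφ : Continuous φ) (s : ℝ × ℝ) {m n : ℝ → ℝ}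
    (hm : ∀ t, HasDerivAt m (n t) t) (hn : Continuous n) (hm0 : m 0 = 0) (ℓ : ℝ) :
    (∫ t in (0 : ℝ)..ℓ, flipDensity φ s t * m t) + Real.exp (-cumRate φ s ℓ) * m ℓ =
      ∫ t in (0 : ℝ)..ℓ, n t * Real.exp (-cumRate φ s t) := by
  have hmc : Continuous m := continuous_iff_continuousAt.2 fun t => (hm t).continuousAt
  have hE : Continuous fun t => Real.exp (-cumRate φ s t) := (continuous_cumRate_right hφ s).neg.rexp
  -- Integration by parts: the derivative of the survival function exp(-Λ) is minus the flip
  -- density.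
  have hd : ∀ t, HasDerivAt (fun t => Real.exp (-cumRate φ s t) * m t)
      (n t * Real.exp (-cumRate φ s t) - flipDensity φ s t * m t) t := fun t => by
    refine ((hasDerivAt_cumRate hφ s t).neg.exp.mul (hm t)).congr_deriv ?_
    simp only [flipDensity, Pi.neg_apply]; ring
  have i1 : IntervalIntegrable (fun t => n t * Real.exp (-cumRate φ s t)) volume 0 ℓ :=
    (hn.mul hE).intervalIntegrable 0 ℓ
  have i2 : IntervalIntegrable (fun t => flipDensity φ s t * m t) volume 0 ℓ :=
    ((continuous_flipDensity hφ s).mul hmc).intervalIntegrable 0 ℓ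
  have h := intervalIntegral.integral_eq_sub_of_hasDerivAt (fun t _ => hd t) (i1.sub i2)
  rw [intervalIntegral.integral_sub i1 i2] at h
  simp only [hm0, mul_zero, sub_zero] at h
  linarith

end

noncomputable section

/-! ### Poisson equation of the one-dimensional process -/

variable {φ u F : ℝ → ℝ} {a : ℝ}

/-- The difference of the solutions of the Poisson equation for the two velocities. -/
def poissonDiff (u F : ℝ → ℝ) (C x : ℝ) : ℝ :=
  Real.exp (u x) * (C + 2 * ∫ r in (0 : ℝ)..x, F r * Real.exp (-u r))

/-- A solution of the Poisson equation on one side of `0`. -/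
def poissonSol (φ u F : ℝ → ℝ) (C c v x : ℝ) : ℝ :=
  c + (∫ r in (0 : ℝ)..x, (F r + max 0 (φ r) * poissonDiff u F C r)) - (1 - v) / 2 * poissonDiff u F C x

/-- Let Δ be the difference of the solutions for v = 1 and v = -1. Subtracting h'(x,v) = vF +
λ(x,v)Δ for the two velocities, and using λ(x,1) - λ(x,-1) = φ(x), gives Δ' = φΔ + 2F, which the
integrating factor exp(-u) solves. -/
lemma hasDerivAt_poissonDiff (hu : ∀ x, HasDerivAt u (φ x) x) (hF : Continuous F) (C x : ℝ) :
    HasDerivAt (poissonDiff u F C) (φ x * poissonDiff u F C x + 2 * F x) x := by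
  have huc : Continuous u := continuous_iff_continuousAt.2 fun t => (hu t).continuousAt
  have h1 : HasDerivAt (fun x => ∫ r in (0 : ℝ)..x, F r * Real.exp (-u r)) (F x * Real.exp (-u x)) x :=
    ((hF.mul huc.neg.rexp).integral_hasStrictDerivAt 0 x).hasDerivAt
  refine ((hu x).exp.mul ((h1.const_mul 2).const_add C)).congr_deriv ?_
  have : Real.exp (u x) * Real.exp (-u x) = 1 := by rw [← Real.exp_add]; simp
  unfold poissonDiff
  linear_combination (2 * F x) * this

lemma continuous_poissonDiff (hu : ∀ x, HasDerivAt u (φ x) x) (hF : Continuous F) (C : ℝ) :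
    Continuous (poissonDiff u F C) :=
  continuous_iff_continuousAt.2 fun x => (hasDerivAt_poissonDiff hu hF C x).continuousAt

/-- Combined with `poissonSol_neg` this is the Poisson equation v h'(x,v) + λ(x,v)(h(x,-v) - h(x,v))
= F(x). -/
lemma hasDerivAt_poissonSol (hφ : Continuous φ) (hu : ∀ x, HasDerivAt u (φ x) x) (hF : Continuous F)
    (C c : ℝ) {v : ℝ} (hv : v = 1 ∨ v = -1) (x : ℝ) :
    HasDerivAt (poissonSol φ u F C c v)
      (v * F x + flipRate φ x v * poissonDiff u F C x) x := by
  have hc : Continuous fun r => F r + max 0 (φ r) * poissonDiff u F C r :=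
    hF.add ((continuous_const.max hφ).mul (continuous_poissonDiff hu hF C))
  have h1 := (hc.integral_hasStrictDerivAt 0 x).hasDerivAt
  refine ((h1.const_add c).sub ((hasDerivAt_poissonDiff hu hF C x).const_mul ((1 - v) / 2))).congr_deriv ?_
  rcases hv with rfl | rfl
  · simp [flipRate]
  -- For velocity -1 the positive part of φ has to be traded for its negative part; the term φΔ from
  -- the derivative of Δ compensates.
  · have : max 0 (φ x) = φ x + max 0 (-φ x) := by
      rcases le_total 0 (φ x) with h | h
      · rw [max_eq_right h, max_eq_left (by linarith)]; ring
      · rw [max_eq_left h, max_eq_right (by linarith)]; ring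
    simp only [flipRate, neg_one_mul, this]
    ring

lemma poissonSol_neg (φ u F : ℝ → ℝ) (C c v x : ℝ) :
    poissonSol φ u F C c (-v) x = poissonSol φ u F C c v x - v * poissonDiff u F C x := by
  unfold poissonSol; ring

/-! ### Solutions on the two sides of 0, joined by a jump -/

/-- The state lies to the right of `0`, or at `0` about to move to the right. -/
def OnRight (s : ℝ × ℝ) : Prop := 0 < s.1 ∨ (s.1 = 0 ∧ 0 < s.2)

lemma measurableSet_onRight : MeasurableSet {s | OnRight s} :=
  (measurableSet_lt measurable_const measurable_fst).union
    ((measurable_fst (measurableSet_singleton 0)).inter (measurableSet_lt measurable_const measurable_snd))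

/-- The integral of a function from `0`. -/
def primitive (F : ℝ → ℝ) (x : ℝ) : ℝ := ∫ r in (0 : ℝ)..x, F r

lemma hasDerivAt_primitive (hF : Continuous F) (x : ℝ) : HasDerivAt (primitive F) (F x) x :=
  (hF.integral_hasStrictDerivAt 0 x).hasDerivAt

lemma continuous_primitive (hF : Continuous F) : Continuous (primitive F) :=
  continuous_iff_continuousAt.2 fun x => (hasDerivAt_primitive hF x).continuousAt

/-- The change of a solution of the Poisson equation along a flight, less the integral of `F`. -/
def poissonRay (φ u F : ℝ → ℝ) (C c : ℝ) (s : ℝ × ℝ) (t : ℝ) : ℝ :=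
  poissonSol φ u F C c s.2 (s.1 + s.2 * t) - poissonSol φ u F C c s.2 s.1 -
    s.2 * (primitive F (s.1 + s.2 * t) - primitive F s.1)

/-- Along a flight F cancels. What is left grows at the flip rate times vΔ, which is in the mean
what the flips take away in `stepDefect_flipOutcome`. -/
lemma hasDerivAt_poissonRay (hφ : Continuous φ) (hu : ∀ x, HasDerivAt u (φ x) x) (hF : Continuous F)
    (C c : ℝ) {s : ℝ × ℝ} (hs : s.2 = 1 ∨ s.2 = -1) (t : ℝ) :
    HasDerivAt (poissonRay φ u F C c s)
      (flipRate φ (s.1 + s.2 * t) s.2 * (s.2 * poissonDiff u F C (s.1 + s.2 * t))) t := by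
  have hray : HasDerivAt (fun t => s.1 + s.2 * t) s.2 t := by
    simpa using ((hasDerivAt_id t).const_mul s.2).const_add s.1
  have h1 := (hasDerivAt_poissonSol hφ hu hF C c hs (s.1 + s.2 * t)).comp t hray
  have h2 := (hasDerivAt_primitive hF (s.1 + s.2 * t)).comp t hray
  refine ((h1.sub_const (poissonSol φ u F C c s.2 s.1)).sub
    ((h2.sub_const (primitive F s.1)).const_mul s.2)).congr_deriv ?_
  ring

lemma poissonRay_zero (φ u F : ℝ → ℝ) (C c : ℝ) (s : ℝ × ℝ) : poissonRay φ u F C c s 0 = 0 := by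
  simp [poissonRay]

open Classical in
/-- A solution of the Poisson equation; `j` is its jump across `0`. -/
def poissonGlobal (φ u F : ℝ → ℝ) (CL CR j : ℝ) (s : ℝ × ℝ) : ℝ :=
  if OnRight s then poissonSol φ u F CR j s.2 s.1 else poissonSol φ u F CL 0 s.2 s.1

open Classical in
/-- The constant for the side of the state. -/
def sideConst (CL CR : ℝ) (s : ℝ × ℝ) : ℝ := if OnRight s then CR else CL

lemma poissonGlobal_eq (φ u F : ℝ → ℝ) (CL CR j : ℝ) (s : ℝ × ℝ) :
    poissonGlobal φ u F CL CR j s =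
      poissonSol φ u F (sideConst CL CR s) (sideConst 0 j s) s.2 s.1 := by
  unfold poissonGlobal sideConst; split_ifs <;> rfl

lemma sideConst_congr {CL CR : ℝ} {s s' : ℝ × ℝ} (h : OnRight s ↔ OnRight s') :
    sideConst CL CR s = sideConst CL CR s' := by
  by_cases h1 : OnRight s
  · simp [sideConst, h1, h.1 h1]
  · simp [sideConst, h1, show ¬ OnRight s' from fun h2 => h1 (h.2 h2)]

/-- A flight does not cross 0, because the horizon stops it there. The branch of `poissonGlobal` is
thus that of the starting state, where a start at 0 is classified by its velocity. -/
lemma ray_sign {s : ℝ × ℝ} (hs : s.2 = 1 ∨ s.2 = -1) {t : ℝ} (ht0 : 0 < t)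
    (ht : t < horizon a s) : (0 < s.1 + s.2 * t ∧ OnRight s) ∨ (s.1 + s.2 * t < 0 ∧ ¬ OnRight s) := by
  have h := ht.trans_le (horizon_le_zero s)
  unfold timeAhead at h
  unfold OnRight
  rcases hs with hs | hs <;> rw [hs] at h ⊢ <;> split_ifs at h with h1
  · right; exact ⟨by linarith, by rintro (h2 | h2) <;> linarith⟩
  · left
    have : 0 ≤ s.1 := by linarith
    refine ⟨by linarith, ?_⟩
    rcases this.lt_or_eq with h2 | h2
    · exact Or.inl h2
    · exact Or.inr ⟨h2.symm, one_pos⟩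
  · left; exact ⟨by linarith, Or.inl (by linarith)⟩
  · right; exact ⟨by linarith, by rintro (h2 | h2) <;> linarith⟩

/-- At the horizon there is a third possibility, the arrival at 0. The state reached then belongs to
the opposite side, since `OnRight` decides at 0 by the velocity. -/
lemma horizon_sign {s : ℝ × ℝ} (hs : s.2 = 1 ∨ s.2 = -1) :
    (0 < s.1 + s.2 * horizon a s ∧ OnRight s) ∨ (s.1 + s.2 * horizon a s < 0 ∧ ¬ OnRight s) ∨
      (s.1 + s.2 * horizon a s = 0 ∧ ((s.2 = 1 ∧ ¬ OnRight s) ∨ (s.2 = -1 ∧ OnRight s))) := by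
  have h := horizon_le_zero (a := a) s
  have h0 := horizon_pos (a := a) s
  unfold timeAhead at h
  unfold OnRight
  rcases hs with hs | hs <;> rw [hs] at h ⊢ <;> split_ifs at h with h1
  · right
    rcases h.lt_or_eq with h2 | h2
    · left; exact ⟨by linarith, by rintro (h2 | h2) <;> linarith⟩
    · right; exact ⟨by linarith, Or.inl ⟨rfl, by rintro (h2 | h2) <;> linarith⟩⟩
  · left
    have : 0 ≤ s.1 := by linarith
    refine ⟨by linarith, ?_⟩
    rcases this.lt_or_eq with h2 | h2
    · exact Or.inl h2
    · exact Or.inr ⟨h2.symm, one_pos⟩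
  · rcases h.lt_or_eq with h2 | h2
    · left; exact ⟨by linarith, Or.inl (by linarith)⟩
    · right; right; exact ⟨by linarith, Or.inr ⟨rfl, Or.inl (by linarith)⟩⟩
  · right; left; exact ⟨by linarith, by rintro (h2 | h2) <;> linarith⟩

/-- The deviation of a step from the martingale property. -/
def stepDefect (φ u F : ℝ → ℝ) (CL CR j : ℝ) (s : ℝ × ℝ) (o : (ℝ × ℝ) × ℝ) : ℝ :=
  poissonGlobal φ u F CL CR j o.1 - poissonGlobal φ u F CL CR j s -
    (s.2 * (primitive F o.1.1 - primitive F s.1) + F 0 * o.2)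

/-- A flip happens on the side where the flight started, so it changes the solution by -vΔ for the
same constants. -/
lemma stepDefect_flipOutcome (φ u F : ℝ → ℝ) (CL CR j : ℝ) {s : ℝ × ℝ} (hs : s.2 = 1 ∨ s.2 = -1)
    {t : ℝ} (ht0 : 0 < t) (ht : t < horizon a s) :
    stepDefect φ u F CL CR j s (flipOutcome s t) =
      poissonRay φ u F (sideConst CL CR s) (sideConst 0 j s) s t -
        s.2 * poissonDiff u F (sideConst CL CR s) (s.1 + s.2 * t) := by
  have hside : OnRight (s.1 + s.2 * t, -s.2) ↔ OnRight s := by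
    rcases ray_sign hs ht0 ht with h | h
    · exact iff_of_true (Or.inl h.1) h.2
    · refine iff_of_false ?_ h.2
      rintro (h2 | h2)
      · exact absurd h2 (not_lt.2 h.1.le)
      · exact absurd h2.1 h.1.ne
  simp only [stepDefect, flipOutcome, poissonGlobal_eq, poissonRay, sideConst_congr hside,
    poissonSol_neg]
  ring

-- On arrival at 0 the branch changes. For velocity 1 the solution jumps by F(0)w. For velocity -1
-- it jumps by -F(0)w + exp(u(0))(CR - CL), and `hj` makes this F(0)w as well. The defect thus
-- contains F(0)(w - D), whose mean vanishes if the sticking time D has mean w.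
open Classical in
lemma stepDefect_horizonOutcome {CL CR w : ℝ} (hj : CR - CL = 2 * (F 0 * w) * Real.exp (-u 0))
    {s : ℝ × ℝ} (hs : s.2 = 1 ∨ s.2 = -1) (D : ℝ) :
    stepDefect φ u F CL CR (F 0 * w) s (horizonOutcome a s D) =
      poissonRay φ u F (sideConst CL CR s) (sideConst 0 (F 0 * w) s) s (horizon a s) +
        if s.1 + s.2 * horizon a s = 0 then F 0 * (w - D) else 0 := by
  have hj' : Real.exp (u 0) * CR - Real.exp (u 0) * CL = 2 * (F 0 * w) := by
    have : Real.exp (u 0) * Real.exp (-u 0) = 1 := by rw [← Real.exp_add]; simp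
    rw [← mul_sub, hj]
    linear_combination (2 * (F 0 * w)) * this
  rcases horizon_sign (a := a) hs with h | h | h
  · have hside : OnRight (s.1 + s.2 * horizon a s, s.2) ↔ OnRight s := iff_of_true (Or.inl h.1) h.2
    simp only [stepDefect, horizonOutcome, poissonGlobal_eq, poissonRay, sideConst_congr hside,
      if_neg h.1.ne']
    ring
  · have hside : OnRight (s.1 + s.2 * horizon a s, s.2) ↔ OnRight s := by
      refine iff_of_false ?_ h.2
      rintro (h2 | h2)
      · exact absurd h2 (not_lt.2 h.1.le)
      · exact absurd h2.1 h.1.ne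
    simp only [stepDefect, horizonOutcome, poissonGlobal_eq, poissonRay, sideConst_congr hside,
      if_neg h.1.ne]
    ring
  · obtain ⟨h0, ⟨hv, hr⟩ | ⟨hv, hr⟩⟩ := h
    · have hside : OnRight (0, s.2) := Or.inr ⟨rfl, by rw [hv]; exact one_pos⟩
      simp only [stepDefect, horizonOutcome, poissonGlobal_eq, poissonRay, h0, if_true]
      simp only [sideConst, hside, hr, if_false, if_true]
      simp only [hv, poissonSol, intervalIntegral.integral_same]
      ring
    · have hside : ¬ OnRight (0, s.2) := by
        rintro (h2 | h2)
        · exact lt_irrefl _ h2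
        · have := h2.2; simp only [hv] at this; linarith
      simp only [stepDefect, horizonOutcome, poissonGlobal_eq, poissonRay, h0, if_true]
      simp only [sideConst, hside, hr, if_false, if_true]
      simp only [hv, poissonSol, poissonDiff, intervalIntegral.integral_same]
      linarith

end

noncomputable section

/-! ### The mean defect of a step -/

variable {φ u F : ℝ → ℝ} {a : ℝ} (κ : Measure ℝ) [IsProbabilityMeasure κ]

/-- The formula for the defect of a flip holds only in the open flight, where the side is
determined; the endpoints are null. -/
lemma integral_stepOutcome_of_eq (hφ : Continuous φ) (s : ℝ × ℝ) {G : (ℝ × ℝ) × ℝ → ℝ}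
    (hG : Measurable G) {g : ℝ → ℝ} (hg : Continuous g)
    (heq : ∀ t, 0 < t → t < horizon a s → G (flipOutcome s t) = g t)
    (h2 : Integrable (fun D => G (horizonOutcome a s D)) κ) :
    Integrable (fun ξ => G (stepOutcome φ a s ξ)) (streamLaw κ) ∧
    ∫ ξ, G (stepOutcome φ a s ξ) ∂streamLaw κ =
      (∫ t in (0 : ℝ)..horizon a s, flipDensity φ s t * g t) +
      Real.exp (-cumRate φ s (horizon a s)) * ∫ D, G (horizonOutcome a s D) ∂κ := by
  have hc : Continuous fun t => flipDensity φ s t * g t := (continuous_flipDensity hφ s).mul hg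
  have he : Set.EqOn (fun t => flipDensity φ s t * G (flipOutcome s t))
      (fun t => flipDensity φ s t * g t) (Set.Ioo 0 (horizon a s)) := fun t ht => by
    simp only [heq t ht.1 ht.2]
  have h := integral_stepOutcome κ hφ s hG (by
    rw [integrableOn_Ioc_iff_integrableOn_Ioo, integrableOn_congr_fun he measurableSet_Ioo,
      ← integrableOn_Ioc_iff_integrableOn_Ioo]
    exact hc.integrableOn_Ioc) h2
  refine ⟨h.1, h.2.trans ?_⟩
  congr 1
  rw [intervalIntegral.integral_of_le (horizon_pos s).le, intervalIntegral.integral_of_le (horizon_pos s).le,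
    integral_Ioc_eq_integral_Ioo, integral_Ioc_eq_integral_Ioo, setIntegral_congr_fun measurableSet_Ioo he]

/-- The duration of a step. -/
def stepTime (s : ℝ × ℝ) (o : (ℝ × ℝ) × ℝ) : ℝ := s.2 * (o.1.1 - s.1) + o.2

lemma stepTime_flipOutcome {s : ℝ × ℝ} (hs : s.2 = 1 ∨ s.2 = -1) (t : ℝ) :
    stepTime s (flipOutcome s t) = t := by
  rcases hs with h | h <;> simp [stepTime, flipOutcome, h]

open Classical in
lemma stepTime_horizonOutcome {s : ℝ × ℝ} (hs : s.2 = 1 ∨ s.2 = -1) (D : ℝ) :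
    stepTime s (horizonOutcome a s D) =
      horizon a s + if s.1 + s.2 * horizon a s = 0 then D else 0 := by
  rcases hs with h | h <;> simp [stepTime, horizonOutcome, h]

open Classical in
lemma integral_stepTime (hφ : Continuous φ) {s : ℝ × ℝ} (hs : s.2 = 1 ∨ s.2 = -1)
    (hκ : Integrable id κ) :
    Integrable (fun ξ => stepTime s (stepOutcome φ a s ξ)) (streamLaw κ) ∧
    ∫ ξ, stepTime s (stepOutcome φ a s ξ) ∂streamLaw κ =
      (∫ t in (0 : ℝ)..horizon a s, Real.exp (-cumRate φ s t)) +
      Real.exp (-cumRate φ s (horizon a s)) *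
        if s.1 + s.2 * horizon a s = 0 then ∫ D, D ∂κ else 0 := by
  have hm : Measurable (stepTime s) := by unfold stepTime; fun_prop
  have hκ' : Integrable (fun D : ℝ => D) κ := hκ
  have hi : Integrable (fun D => if s.1 + s.2 * horizon a s = 0 then D else (0 : ℝ)) κ := by
    split_ifs
    · exact hκ'
    · exact integrable_zero _ _ _
  have h := integral_stepOutcome_of_eq (a := a) κ hφ s hm continuous_id
    (fun t _ _ => stepTime_flipOutcome hs t) (by
      simp only [stepTime_horizonOutcome hs]
      exact (integrable_const _).add hi)
  refine ⟨h.1, h.2.trans ?_⟩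
  have h3 := integral_flipDensity_mul hφ s (m := id) (n := fun _ => 1) (fun t => hasDerivAt_id t)
    continuous_const rfl (horizon a s)
  simp only [one_mul, id] at h3
  simp only [stepTime_horizonOutcome hs, id]
  rw [integral_add (integrable_const _) hi, mul_add, ← add_assoc]
  simp only [integral_const, probReal_univ, one_smul]
  rw [h3]
  congr 2
  split_ifs <;> simp

lemma measurable_poissonGlobal (hφ : Continuous φ) (hu : ∀ x, HasDerivAt u (φ x) x)
    (hF : Continuous F) (CL CR j : ℝ) : Measurable (poissonGlobal φ u F CL CR j) := by
  have h : ∀ C c, Measurable fun s : ℝ × ℝ => poissonSol φ u F C c s.2 s.1 := fun C c => by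
    have hc : Continuous fun r => F r + max 0 (φ r) * poissonDiff u F C r :=
      hF.add ((continuous_const.max hφ).mul (continuous_poissonDiff hu hF C))
    have h1 : Continuous fun x => ∫ r in (0 : ℝ)..x, (F r + max 0 (φ r) * poissonDiff u F C r) :=
      intervalIntegral.continuous_primitive (fun _ _ => hc.intervalIntegrable _ _) 0
    have h2 := continuous_poissonDiff hu hF C
    unfold poissonSol
    fun_prop
  exact Measurable.ite measurableSet_onRight (h _ _) (h _ _)

lemma measurable_stepDefect (hφ : Continuous φ) (hu : ∀ x, HasDerivAt u (φ x) x)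
    (hF : Continuous F) (CL CR j : ℝ) :
    Measurable fun p : (ℝ × ℝ) × ((ℝ × ℝ) × ℝ) => stepDefect φ u F CL CR j p.1 p.2 := by
  have h1 := measurable_poissonGlobal hφ hu hF CL CR j
  have h2 := (continuous_primitive hF).measurable
  unfold stepDefect
  fun_prop

section Defect

variable {CL CR w : ℝ}

/-- The mean of the defect of a step is zero, and its absolute mean is dominated by the mean
duration of the step. -/
lemma integral_stepDefect (hφ : Continuous φ) (hu : ∀ x, HasDerivAt u (φ x) x)
    (hF : Continuous F) (hκ : Integrable id κ) (hκw : ∫ D, D ∂κ = w) (hκ0 : ∀ᵐ D ∂κ, 0 ≤ D)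
    (hj : CR - CL = 2 * (F 0 * w) * Real.exp (-u 0)) {K : ℝ}
    {s : ℝ × ℝ} (hs : s.2 = 1 ∨ s.2 = -1)
    (hK : ∀ t, 0 ≤ t → t ≤ horizon a s → flipRate φ (s.1 + s.2 * t) s.2 *
      |poissonDiff u F (sideConst CL CR s) (s.1 + s.2 * t)| ≤ K) :
    ∫ ξ, stepDefect φ u F CL CR (F 0 * w) s (stepOutcome φ a s ξ) ∂streamLaw κ = 0 ∧
    Integrable (fun ξ => stepDefect φ u F CL CR (F 0 * w) s (stepOutcome φ a s ξ)) (streamLaw κ) ∧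
    ∫ ξ, |stepDefect φ u F CL CR (F 0 * w) s (stepOutcome φ a s ξ)| ∂streamLaw κ ≤
      (2 * K + 2 * |F 0|) * ∫ ξ, stepTime s (stepOutcome φ a s ξ) ∂streamLaw κ := by
  classical
  have hκ' : Integrable (fun D : ℝ => D) κ := hκ
  have hm : Measurable (stepDefect φ u F CL CR (F 0 * w) s) :=
    (measurable_stepDefect hφ hu hF CL CR _).comp (measurable_const.prodMk measurable_id)
  set C := sideConst CL CR s
  set c := sideConst 0 (F 0 * w) s
  set ℓ := horizon a s with hℓ
  have hℓ0 : 0 ≤ ℓ := (horizon_pos s).le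
  set R := poissonRay φ u F C c s with hR
  set d : ℝ → ℝ := fun t => s.2 * poissonDiff u F C (s.1 + s.2 * t) with hd
  have hdc : Continuous d :=
    continuous_const.mul ((continuous_poissonDiff hu hF C).comp (by fun_prop))
  have hRd := hasDerivAt_poissonRay hφ hu hF C c hs
  have hRc : Continuous R := continuous_iff_continuousAt.2 fun t => (hRd t).continuousAt
  have hn : Continuous fun t => flipRate φ (s.1 + s.2 * t) s.2 * d t :=
    (continuous_flipRate_ray hφ s).mul hdc
  have hdabs : ∀ t, |d t| = |poissonDiff u F C (s.1 + s.2 * t)| := fun t => by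
    rcases hs with h | h <;> simp [hd, h]
  have hE : Continuous fun t => Real.exp (-cumRate φ s t) := (continuous_cumRate_right hφ s).neg.rexp
  have hdens := continuous_flipDensity hφ s
  have hK0 : 0 ≤ K := (mul_nonneg (flipRate_nonneg _ _) (abs_nonneg _)).trans (hK 0 le_rfl hℓ0)
  -- `R` starts at 0, and its derivative, flip rate times vΔ, is bounded by `K` along the flight.
  have hRK : ∀ t ∈ Set.Icc 0 ℓ, |R t| ≤ K * t := by
    intro t ht
    have := norm_image_sub_le_of_norm_deriv_le_segment' (f := R) (C := K)
      (fun x _ => (hRd x).hasDerivWithinAt) (fun x hx => by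
        rw [Real.norm_eq_abs, abs_mul, abs_of_nonneg (flipRate_nonneg _ _)]
        exact (hdabs x).symm ▸ hK x hx.1 hx.2.le) t ht
    simpa [hR, poissonRay_zero] using this
  have hflip : ∀ t, 0 < t → t < ℓ → stepDefect φ u F CL CR (F 0 * w) s (flipOutcome s t) = R t - d t :=
    fun t h0 h1 => stepDefect_flipOutcome φ u F CL CR _ hs h0 h1
  have hhor := stepDefect_horizonOutcome (φ := φ) (a := a) hj hs
  have hw0 : 0 ≤ w := hκw ▸ integral_nonneg_of_ae hκ0
  have hi : Integrable (fun D => if s.1 + s.2 * ℓ = 0 then F 0 * (w - D) else 0) κ := by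
    split_ifs
    · exact ((integrable_const _).sub hκ').const_mul _
    · exact integrable_zero _ _ _
  have hi2 : Integrable (fun D => stepDefect φ u F CL CR (F 0 * w) s (horizonOutcome a s D)) κ := by
    simp only [hhor]
    exact (integrable_const _).add hi
  have h1 := integral_stepOutcome_of_eq (a := a) κ hφ s hm (hRc.sub hdc) hflip hi2
  have h2 := integral_stepOutcome_of_eq (a := a) κ hφ s hm.norm (hRc.sub hdc).norm
    (fun t h0 h1 => by rw [hflip t h0 h1]; rfl) hi2.norm
  refine ⟨?_, h1.1, ?_⟩
  · rw [h1.2]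
    simp only [hhor]
    rw [integral_add (integrable_const _) hi]
    have h3 : ∫ D, (if s.1 + s.2 * ℓ = 0 then F 0 * (w - D) else 0) ∂κ = 0 := by
      split_ifs
      · rw [integral_const_mul, integral_sub (integrable_const _) hκ', hκw]; simp
      · simp
    rw [h3]
    simp only [integral_const, probReal_univ, one_smul, add_zero, mul_sub, Pi.sub_apply]
    -- Integration by parts turns the mean of the ray term into the integral of λvΔ exp(-Λ), which
    -- is also the mean of the flip term; the two cancel.
    have h4 := integral_flipDensity_mul hφ s hRd hn (poissonRay_zero φ u F C c s) ℓ
    have h5 : ∫ t in (0 : ℝ)..ℓ, flipDensity φ s t * d t =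
        ∫ t in (0 : ℝ)..ℓ, flipRate φ (s.1 + s.2 * t) s.2 * d t * Real.exp (-cumRate φ s t) :=
      intervalIntegral.integral_congr fun t _ => by simp only [flipDensity]; ring
    have h6 : ∫ t in (0 : ℝ)..ℓ, (flipDensity φ s t * R t - flipDensity φ s t * d t) =
        (∫ t in (0 : ℝ)..ℓ, flipDensity φ s t * R t) - ∫ t in (0 : ℝ)..ℓ, flipDensity φ s t * d t :=
      intervalIntegral.integral_sub ((hdens.mul hRc).intervalIntegrable _ _)
        ((hdens.mul hdc).intervalIntegrable _ _)
    rw [h6, h5]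
    linarith
  · have h3 := (integral_stepTime (a := a) κ hφ hs hκ).2
    simp only [Real.norm_eq_abs] at h2
    rw [h2.2, h3, hκw]
    have h4 := integral_flipDensity_mul hφ s (m := fun t => K * t) (n := fun _ => K)
      (fun t => by simpa using (hasDerivAt_id t).const_mul K) continuous_const (mul_zero K) ℓ
    rw [intervalIntegral.integral_const_mul] at h4
    -- The ray term is at most `K * t` and the flip term has density at most K exp(-Λ). Each
    -- contributes `K` times the mean flight time, whence 2K; the bound |w - D| ≤ w + D accounts for
    -- 2|F 0|.
    have h5 : ∫ t in (0 : ℝ)..ℓ, flipDensity φ s t * |(R - d) t| ≤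
        ∫ t in (0 : ℝ)..ℓ, (flipDensity φ s t * (K * t) + K * Real.exp (-cumRate φ s t)) := by
      refine intervalIntegral.integral_mono_on hℓ0
        ((hdens.mul (hRc.sub hdc).abs).intervalIntegrable _ _)
        (((hdens.mul (by fun_prop)).add (continuous_const.mul hE)).intervalIntegrable _ _) fun t ht => ?_
      have e1 : |(R - d) t| ≤ K * t + |d t| :=
        (abs_sub _ _).trans (add_le_add (hRK t ht) le_rfl)
      have e2 : flipDensity φ s t * |d t| ≤ K * Real.exp (-cumRate φ s t) := by
        have := mul_le_mul_of_nonneg_right (hK t ht.1 ht.2) (Real.exp_pos (-cumRate φ s t)).le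
        rw [hdabs]; unfold flipDensity
        linarith
      nlinarith [mul_le_mul_of_nonneg_left e1 (flipDensity_nonneg (φ := φ) s t)]
    have h6 : ∫ t in (0 : ℝ)..ℓ, (flipDensity φ s t * (K * t) + K * Real.exp (-cumRate φ s t)) =
        (∫ t in (0 : ℝ)..ℓ, flipDensity φ s t * (K * t)) + K * ∫ t in (0 : ℝ)..ℓ, Real.exp (-cumRate φ s t) := by
      rw [← intervalIntegral.integral_const_mul]
      exact intervalIntegral.integral_add ((hdens.mul (by fun_prop)).intervalIntegrable _ _)
        ((continuous_const.mul hE).intervalIntegrable _ _)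
    have h7 : ∫ D, |stepDefect φ u F CL CR (F 0 * w) s (horizonOutcome a s D)| ∂κ ≤
        K * ℓ + 2 * |F 0| * (if s.1 + s.2 * ℓ = 0 then w else 0) := by
      have e1 : ∀ᵐ D ∂κ, |stepDefect φ u F CL CR (F 0 * w) s (horizonOutcome a s D)| ≤
          K * ℓ + |F 0| * (if s.1 + s.2 * ℓ = 0 then w + D else 0) := by
        filter_upwards [hκ0] with D hD
        rw [hhor]
        refine (abs_add_le _ _).trans (add_le_add (hRK ℓ ⟨hℓ0, le_rfl⟩) ?_)
        rw [← hℓ]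
        split_ifs
        · rw [abs_mul]
          refine mul_le_mul_of_nonneg_left ?_ (abs_nonneg _)
          rw [abs_le]; constructor <;> linarith
        · simp
      have e2 : Integrable (fun D => if s.1 + s.2 * ℓ = 0 then w + D else 0) κ := by
        split_ifs
        · exact (integrable_const _).add hκ'
        · exact integrable_zero _ _ _
      refine (integral_mono_ae hi2.norm ((integrable_const (K * ℓ)).add (e2.const_mul |F 0|)) e1).trans ?_
      have e3 : ∫ D, (K * ℓ + |F 0| * (if s.1 + s.2 * ℓ = 0 then w + D else 0)) ∂κ =
          K * ℓ + |F 0| * ∫ D, (if s.1 + s.2 * ℓ = 0 then w + D else 0) ∂κ := by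
        rw [integral_add (integrable_const _) (e2.const_mul _), integral_const, probReal_univ, one_smul]
        exact congrArg (K * ℓ + ·) (integral_const_mul |F 0| _)
      refine e3.le.trans ?_
      split_ifs
      · rw [integral_add (integrable_const _) hκ', hκw]; simp; linarith
      · simp
    have hE1 : 0 < Real.exp (-cumRate φ s ℓ) := Real.exp_pos _
    have h8 := mul_le_mul_of_nonneg_left h7 hE1.le
    have hI0 : 0 ≤ ∫ t in (0 : ℝ)..ℓ, Real.exp (-cumRate φ s t) :=
      intervalIntegral.integral_nonneg hℓ0 fun t _ => (Real.exp_pos _).le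
    have hF0 := abs_nonneg (F 0)
    have hw1 : 0 ≤ (if s.1 + s.2 * ℓ = 0 then w else 0) := by split_ifs <;> simp [hw0]
    generalize (if s.1 + s.2 * ℓ = 0 then w else 0) = W at *
    generalize (∫ t in (0 : ℝ)..ℓ, Real.exp (-cumRate φ s t)) = A at *
    generalize (Real.exp (-cumRate φ s ℓ)) = B at *
    have m1 := mul_nonneg hF0 hI0
    have m2 := mul_nonneg hK0 (mul_nonneg hE1.le hw1)
    nlinarith

end Defect

end

noncomputable section

/-! ### Stationarity of the occupation measure of a cycle -/

variable {φ u F : ℝ → ℝ} {a : ℝ} (κ : Measure ℝ) [IsProbabilityMeasure κ]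

lemma nextState_snd {s : ℝ × ℝ} (hs : s.2 = 1 ∨ s.2 = -1) (e : ℝ) :
    (nextState φ a s e).2 = 1 ∨ (nextState φ a s e).2 = -1 := by
  unfold nextState
  split_ifs
  · rcases hs with h | h <;> simp [h]
  · exact hs

lemma iterate_chainStep_snd {q : (ℝ × ℝ) × ClockStream} (hq : q.1.2 = 1 ∨ q.1.2 = -1) (n : ℕ) :
    ((chainStep φ a)^[n] q).1.2 = 1 ∨ ((chainStep φ a)^[n] q).1.2 = -1 := by
  induction n with
  | zero => exact hq
  | succ n ih => rw [Function.iterate_succ_apply']; exact nextState_snd ih _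

lemma iterate_chainStep_nonneg {q : (ℝ × ℝ) × ClockStream} (hq : ∀ k, 0 ≤ q.2.2 k) (n k : ℕ) :
    0 ≤ ((chainStep φ a)^[n] q).2.2 k := by
  induction n generalizing k with
  | zero => exact hq k
  | succ n ih =>
    rw [Function.iterate_succ_apply']
    simp only [chainStep, nextStream]
    split_ifs
    · exact ih (k + 1)
    · exact ih k

lemma ae_seqLaw {p : ℝ → Prop} (h : ∀ᵐ x ∂κ, p x) : ∀ᵐ e ∂seqLaw κ, ∀ k, p (e k) := by
  refine ae_all_iff.2 fun k => ?_
  have hm : Measure.map (fun e : ℕ → ℝ => e k) (seqLaw κ) = κ :=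
    Measure.infinitePi_map_eval (μ := fun _ : ℕ => κ) k
  rw [← hm] at h
  exact ae_of_ae_map (measurable_pi_apply k).aemeasurable h

lemma ae_streamLaw {p q : ℝ → Prop} (h : ∀ᵐ x ∂expMeasure 1, p x) (h' : ∀ᵐ x ∂κ, q x) :
    ∀ᵐ ξ ∂streamLaw κ, (∀ k, p (ξ.1 k)) ∧ ∀ k, q (ξ.2 k) :=
  (Measure.quasiMeasurePreserving_fst.ae (ae_seqLaw _ h)).and
    (Measure.quasiMeasurePreserving_snd.ae (ae_seqLaw κ h'))

lemma stepGain_eq (Φ : ℝ → ℝ) (c : ℝ) (q : (ℝ × ℝ) × ClockStream) :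
    stepGain φ a Φ c q = q.1.2 * (Φ (stepOutcome φ a q.1 q.2).1.1 - Φ q.1.1) +
      c * (stepOutcome φ a q.1 q.2).2 := rfl

lemma stepGain_id_eq (q : (ℝ × ℝ) × ClockStream) :
    stepGain φ a id 1 q = stepTime q.1 (stepOutcome φ a q.1 q.2) := by
  rw [stepGain_eq]; simp [stepTime]

lemma stepGain_id_eq_flightTime {q : (ℝ × ℝ) × ClockStream} (hq : q.1.2 = 1 ∨ q.1.2 = -1) :
    stepGain φ a id 1 q = flightTime φ a q.1 (q.2.1 0) + stickDuration φ a q.1 q.2 := by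
  rcases hq with h | h <;> simp [stepGain, nextState, h]

lemma stickDuration_nonneg {s : ℝ × ℝ} {ξ : ClockStream} (h : 0 ≤ ξ.2 0) :
    0 ≤ stickDuration φ a s ξ := by
  unfold stickDuration; split_ifs <;> simp [h]

lemma stepGain_id_nonneg {q : (ℝ × ℝ) × ClockStream} (hq : q.1.2 = 1 ∨ q.1.2 = -1)
    (h : 0 ≤ q.2.2 0) : 0 ≤ stepGain φ a id 1 q := by
  rw [stepGain_id_eq_flightTime hq]
  exact add_nonneg (flightTime_nonneg _ _) (stickDuration_nonneg h)

/-- A function of the state and of the remaining streams before the visit to `z` has mean zero if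
it has mean zero for every state. -/
lemma integral_before_visit_eq_zero (hφ : Continuous φ) {s z : ℝ × ℝ} (hs : s.2 = 1 ∨ s.2 = -1)
    {g : (ℝ × ℝ) × ClockStream → ℝ} (hg : Measurable g)
    (h0 : ∀ s' : ℝ × ℝ, (s'.2 = 1 ∨ s'.2 = -1) → ∫ ξ, g (s', ξ) ∂streamLaw κ = 0) (n : ℕ) :
    ∫ ξ, (if visitCount φ a z n (s, ξ) = 0 then g ((chainStep φ a)^[n] (s, ξ)) else 0)
      ∂streamLaw κ = 0 := by
  -- With the empty index set `Fin 0` the record keeps only the state and the number of visits.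
  set rec : ClockStream → (ℝ × ℝ) × ℕ × (Fin 0 → ℝ) := fun ξ =>
    chainRecord φ a z (fun _ : Fin 0 => id) (fun _ => 0) n (s, ξ) with hrec
  have hrm : Measurable rec :=
    (measurable_chainRecord hφ z (fun _ => measurable_id) _ n).comp measurable_prodMk_left
  have hqm : Measurable fun ξ => ((chainStep φ a)^[n] (s, ξ)).2 :=
    ((measurable_iterate_chainStep hφ n).comp measurable_prodMk_left).snd
  have hlaw : (streamLaw κ).map (fun ξ => (rec ξ, ((chainStep φ a)^[n] (s, ξ)).2)) =
      ((streamLaw κ).map rec).prod (streamLaw κ) := by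
    refine Measure.ext_of_lintegral _ fun G hG => ?_
    rw [lintegral_map hG (hrm.prodMk hqm), lintegral_prod _ hG.aemeasurable,
      lintegral_map hG.lintegral_prod_right' hrm]
    exact lintegral_chainRecord κ hφ s z (fun _ => measurable_id) _ n hG
  set h : ((ℝ × ℝ) × ℕ × (Fin 0 → ℝ)) × ClockStream → ℝ := fun p =>
    if p.1.2.1 = 0 then g (p.1.1, p.2) else 0 with hh
  have hm : Measurable h := by
    refine Measurable.ite (measurable_fst.snd.fst (measurableSet_singleton 0)) ?_ measurable_const
    exact hg.comp (measurable_fst.fst.prodMk measurable_snd)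
  have h1 : ∫ ξ, (if visitCount φ a z n (s, ξ) = 0 then g ((chainStep φ a)^[n] (s, ξ)) else 0)
      ∂streamLaw κ = ∫ ξ, h (rec ξ, ((chainStep φ a)^[n] (s, ξ)).2) ∂streamLaw κ := rfl
  rw [h1, ← integral_map (φ := fun ξ => (rec ξ, ((chainStep φ a)^[n] (s, ξ)).2))
    (hrm.prodMk hqm).aemeasurable hm.aestronglyMeasurable, hlaw]
  -- Fubini integrates the fresh streams first, for a fixed state. If the function is not
  -- integrable, the Bochner integral is 0 by convention.
  by_cases hi : Integrable h (((streamLaw κ).map rec).prod (streamLaw κ))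
  · rw [integral_prod _ hi]
    rw [integral_map hrm.aemeasurable
      (by exact hm.stronglyMeasurable.integral_prod_right.aestronglyMeasurable)]
    refine integral_eq_zero_of_ae (.of_forall fun ξ => ?_)
    simp only [hh, Pi.zero_apply]
    split_ifs
    · exact h0 _ (iterate_chainStep_snd (q := (s, ξ)) hs n)
    · simp
  · exact integral_undef hi

/-- If the conditional mean of `g` is dominated by the conditional mean of `g'`, then so are the
sums before the visit to `z`. -/
lemma lintegral_before_visit_mono (hφ : Continuous φ) {s z : ℝ × ℝ} (hs : s.2 = 1 ∨ s.2 = -1)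
    {g g' : (ℝ × ℝ) × ClockStream → ℝ≥0∞} (hg : Measurable g) (hg' : Measurable g')
    (h0 : ∀ s' : ℝ × ℝ, (s'.2 = 1 ∨ s'.2 = -1) →
      ∫⁻ ξ, g (s', ξ) ∂streamLaw κ ≤ ∫⁻ ξ, g' (s', ξ) ∂streamLaw κ) (n : ℕ) :
    ∫⁻ ξ, (if visitCount φ a z n (s, ξ) = 0 then g ((chainStep φ a)^[n] (s, ξ)) else 0)
      ∂streamLaw κ ≤
    ∫⁻ ξ, (if visitCount φ a z n (s, ξ) = 0 then g' ((chainStep φ a)^[n] (s, ξ)) else 0)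
      ∂streamLaw κ := by
  have key : ∀ g : (ℝ × ℝ) × ClockStream → ℝ≥0∞, Measurable g →
      ∫⁻ ξ, (if visitCount φ a z n (s, ξ) = 0 then g ((chainStep φ a)^[n] (s, ξ)) else 0)
        ∂streamLaw κ = ∫⁻ ξ, ∫⁻ ξ', (if visitCount φ a z n (s, ξ) = 0 then
          g (((chainStep φ a)^[n] (s, ξ)).1, ξ') else 0) ∂streamLaw κ ∂streamLaw κ := by
    intro g hg
    refine lintegral_chainRecord κ hφ s z (Φ := fun _ : Fin 0 => id) (fun _ => measurable_id)
      (fun _ => 0) n (G := fun p => if p.1.2.1 = 0 then g (p.1.1, p.2) else 0) ?_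
    refine Measurable.ite (measurable_fst.snd.fst (measurableSet_singleton 0)) ?_ measurable_const
    exact hg.comp (measurable_fst.fst.prodMk measurable_snd)
  rw [key g hg, key g' hg']
  refine lintegral_mono fun ξ => ?_
  split_ifs
  · exact h0 _ (iterate_chainStep_snd (q := (s, ξ)) hs n)
  · simp

/-- A sum up to a random index becomes a series whose terms are cut off by events known at step `n`,
so that expectations can be taken termwise. -/
lemma tsum_before_visit {z : ℝ × ℝ} {q : (ℝ × ℝ) × ClockStream} (hq : Visits φ a z q) {M : Type*}
    [AddCommMonoid M] [TopologicalSpace M] (g : ℕ → M) :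
    ∑' n, (if visitCount φ a z n q = 0 then g n else 0) =
      ∑ n ∈ Finset.range (visitIndex φ a z q), g n := by
  rw [tsum_eq_sum (s := Finset.range (visitIndex φ a z q))]
  · refine Finset.sum_congr rfl fun n hn => if_pos ?_
    exact (lt_visitIndex_iff hq n).1 (Finset.mem_range.1 hn)
  · intro n hn
    refine if_neg fun h => hn (Finset.mem_range.2 ((lt_visitIndex_iff hq n).2 h))

lemma iterate_visitIndex_fst {z : ℝ × ℝ} {q : (ℝ × ℝ) × ClockStream} (hq : Visits φ a z q) :
    ((chainStep φ a)^[visitIndex φ a z q] q).1 = z :=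
  Nat.sInf_mem hq

/-- The mean of the gain of a cycle is zero for a centered continuous function with compact support. -/
theorem integral_cycleGain_eq_zero (hφ : Continuous φ) (hu : ∀ x, HasDerivAt u (φ x) x)
    (hF : Continuous F) {B : ℝ} (hB : 0 ≤ B) (hFB : ∀ x, B ≤ |x| → F x = 0)
    {w : ℝ} (hκ : Integrable id κ) (hκw : ∫ D, D ∂κ = w) (hκ0 : ∀ᵐ D ∂κ, 0 ≤ D)
    (hcent : (∫ x in (-B)..B, F x * Real.exp (-u x)) + F 0 * w * Real.exp (-u 0) = 0)
    {z : ℝ × ℝ} (hz : z.2 = 1 ∨ z.2 = -1) (hvis : ∀ᵐ ξ ∂streamLaw κ, Visits φ a z (z, ξ))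
    (hC : Integrable (fun ξ => cycleGain φ a z id 1 (z, ξ)) (streamLaw κ)) :
    ∫ ξ, cycleGain φ a z (primitive F) (F 0) (z, ξ) ∂streamLaw κ = 0 := by
  have huc : Continuous u := continuous_iff_continuousAt.2 fun t => (hu t).continuousAt
  have hFu : Continuous fun x => F x * Real.exp (-u x) := hF.mul huc.neg.rexp
  have hFi : ∀ b c, IntervalIntegrable (fun x => F x * Real.exp (-u x)) volume b c := fun b c =>
    hFu.intervalIntegrable b c
  -- The constants make the difference of the two solutions vanish outside [-B, B]. The centring of
  -- `F` is then exactly the jump condition `hj` at 0.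
  set CR := -(2 * ∫ x in (0 : ℝ)..B, F x * Real.exp (-u x)) with hCR
  set CL := 2 * ∫ x in (-B)..0, F x * Real.exp (-u x) with hCL
  have hj : CR - CL = 2 * (F 0 * w) * Real.exp (-u 0) := by
    have := intervalIntegral.integral_add_adjacent_intervals (hFi (-B) 0) (hFi 0 B)
    rw [hCR, hCL]; linarith
  have hRzero : ∀ x, B ≤ x → poissonDiff u F CR x = 0 := by
    intro x hx
    have h1 := intervalIntegral.integral_add_adjacent_intervals (hFi 0 B) (hFi B x)
    have h2 : ∫ x in B..x, F x * Real.exp (-u x) = 0 := by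
      refine intervalIntegral.integral_zero_ae (.of_forall fun y hy => ?_)
      rw [Set.uIoc_of_le hx] at hy
      rw [hFB y (hy.1.le.trans (le_abs_self y)), zero_mul]
    unfold poissonDiff
    rw [← h1, h2, hCR]; ring
  have hLzero : ∀ x, x ≤ -B → poissonDiff u F CL x = 0 := by
    intro x hx
    have h1 := intervalIntegral.integral_add_adjacent_intervals (hFi 0 (-B)) (hFi (-B) x)
    have h2 : ∫ x in (-B)..x, F x * Real.exp (-u x) = 0 := by
      refine intervalIntegral.integral_zero_ae (.of_forall fun y hy => ?_)
      rw [Set.uIoc_of_ge hx] at hy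
      rw [hFB y (by rw [abs_of_nonpos (by linarith [hy.2])]; linarith [hy.2]), zero_mul]
    have h3 := intervalIntegral.integral_symm (μ := volume) (f := fun x => F x * Real.exp (-u x)) 0 (-B)
    unfold poissonDiff
    rw [← h1, h2, hCL, h3]; ring
  have hbd : ∀ C : ℝ, ∃ K, ∀ x ∈ Set.Icc (-B) B, ∀ v : ℝ, v = 1 ∨ v = -1 →
      flipRate φ x v * |poissonDiff u F C x| ≤ K := by
    intro C
    obtain ⟨K, hK⟩ := (isCompact_Icc (a := -B) (b := B)).exists_bound_of_continuousOn
      (f := fun x => |φ x| * |poissonDiff u F C x|)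
      (hφ.abs.mul (continuous_poissonDiff hu hF C).abs).continuousOn
    refine ⟨K, fun x hx v hv => le_trans ?_ ((le_abs_self _).trans (hK x hx))⟩
    refine mul_le_mul_of_nonneg_right (max_le (abs_nonneg _) ?_) (abs_nonneg _)
    rcases hv with rfl | rfl
    · simpa using le_abs_self (φ x)
    · simpa using neg_le_abs (φ x)
  obtain ⟨KR, hKR⟩ := hbd CR
  obtain ⟨KL, hKL⟩ := hbd CL
  -- The flip rate may be unbounded, but its product with Δ is bounded, because Δ vanishes far out
  -- on either side.
  set K := max (max KR KL) 0 with hKdef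
  have hK : ∀ s : ℝ × ℝ, (s.2 = 1 ∨ s.2 = -1) → ∀ t, 0 ≤ t → t ≤ horizon a s →
      flipRate φ (s.1 + s.2 * t) s.2 * |poissonDiff u F (sideConst CL CR s) (s.1 + s.2 * t)| ≤ K := by
    intro s hs
    have hopen : ∀ t, 0 < t → t < horizon a s → flipRate φ (s.1 + s.2 * t) s.2 *
        |poissonDiff u F (sideConst CL CR s) (s.1 + s.2 * t)| ≤ K := by
      intro t ht0 ht
      rcases ray_sign hs ht0 ht with h | h
      · rw [sideConst, if_pos h.2]
        rcases le_total B (s.1 + s.2 * t) with hx | hx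
        · rw [hRzero _ hx]; simp [hKdef]
        · exact (hKR _ ⟨by linarith, hx⟩ _ hs).trans ((le_max_left _ _).trans (le_max_left _ _))
      · rw [sideConst, if_neg h.2]
        rcases le_total (s.1 + s.2 * t) (-B) with hx | hx
        · rw [hLzero _ hx]; simp [hKdef]
        · exact (hKL _ ⟨hx, by linarith⟩ _ hs).trans ((le_max_right _ _).trans (le_max_left _ _))
    have hcont : Continuous fun t => flipRate φ (s.1 + s.2 * t) s.2 *
        |poissonDiff u F (sideConst CL CR s) (s.1 + s.2 * t)| :=
      (continuous_flipRate_ray hφ s).mul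
        ((continuous_poissonDiff hu hF _).comp (by fun_prop : Continuous fun t => s.1 + s.2 * t)).abs
    -- The side is known only inside the flight; continuity extends the bound to the two endpoints.
    have hcl : closure (Set.Ioo 0 (horizon a s)) ⊆ {t | flipRate φ (s.1 + s.2 * t) s.2 *
        |poissonDiff u F (sideConst CL CR s) (s.1 + s.2 * t)| ≤ K} :=
      closure_minimal (fun t ht => hopen t ht.1 ht.2) (isClosed_le hcont continuous_const)
    rw [closure_Ioo (horizon_pos s).ne] at hcl
    exact fun t h0 h1 => hcl ⟨h0, h1⟩
  set g : (ℝ × ℝ) × ClockStream → ℝ := fun q =>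
    stepDefect φ u F CL CR (F 0 * w) q.1 (stepOutcome φ a q.1 q.2) with hg
  have hgm : Measurable g := (measurable_stepDefect hφ hu hF CL CR _).comp
    (measurable_fst.prodMk (measurable_stepOutcome hφ))
  have htm : Measurable (stepGain φ a id 1) := measurable_stepGain hφ measurable_id 1
  have hdef := fun (s : ℝ × ℝ) (hs : s.2 = 1 ∨ s.2 = -1) =>
    integral_stepDefect (a := a) κ hφ hu hF hκ hκw hκ0 hj hs (hK s hs)
  set c := 2 * K + 2 * |F 0| with hc
  have hc0 : 0 ≤ c := by
    have : 0 ≤ K := le_max_right _ _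
    positivity
  have hnn := ae_streamLaw κ (p := fun _ => True) (by simp) hκ0
  have hdom : ∀ s : ℝ × ℝ, (s.2 = 1 ∨ s.2 = -1) → ∫⁻ ξ, ‖g (s, ξ)‖ₑ ∂streamLaw κ ≤
      ∫⁻ ξ, ENNReal.ofReal c * ENNReal.ofReal (stepGain φ a id 1 (s, ξ)) ∂streamLaw κ := by
    intro s hs
    obtain ⟨-, h2, h3⟩ := hdef s hs
    have h4 := (integral_stepTime (a := a) κ hφ hs hκ).1
    rw [lintegral_const_mul _ (by exact (htm.comp measurable_prodMk_left).ennreal_ofReal),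
      ← ofReal_integral_eq_lintegral_ofReal (by simpa only [stepGain_id_eq] using h4)
        (hnn.mono fun ξ h => stepGain_id_nonneg (q := (s, ξ)) hs (h.2 0)),
      ← ENNReal.ofReal_mul hc0, ← ofReal_integral_norm_eq_lintegral_enorm h2]
    refine ENNReal.ofReal_le_ofReal ?_
    simpa only [stepGain_id_eq, Real.norm_eq_abs] using h3
  -- The absolute means of the defects sum to at most `c` times the mean cycle length, which is
  -- finite. Sum and mean may be exchanged without any bound on the solution itself.
  have hsum : ∑' n, ∫⁻ ξ, ‖(if visitCount φ a z n (z, ξ) = 0 then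
      g ((chainStep φ a)^[n] (z, ξ)) else 0)‖ₑ ∂streamLaw κ ≠ ∞ := by
    refine ne_top_of_le_ne_top (b := ENNReal.ofReal c * ∫⁻ ξ,
      ENNReal.ofReal (cycleGain φ a z id 1 (z, ξ)) ∂streamLaw κ)
      (ENNReal.mul_ne_top ENNReal.ofReal_ne_top hC.lintegral_lt_top.ne) ?_
    have h1 : ∀ n, ∫⁻ ξ, ‖(if visitCount φ a z n (z, ξ) = 0 then
        g ((chainStep φ a)^[n] (z, ξ)) else 0)‖ₑ ∂streamLaw κ ≤
        ∫⁻ ξ, (if visitCount φ a z n (z, ξ) = 0 then ENNReal.ofReal c *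
          ENNReal.ofReal (stepGain φ a id 1 ((chainStep φ a)^[n] (z, ξ))) else 0) ∂streamLaw κ := by
      intro n
      refine le_trans (le_of_eq (lintegral_congr fun ξ => ?_)) (lintegral_before_visit_mono κ hφ hz
        (g := fun q => ‖g q‖ₑ) (g' := fun q => ENNReal.ofReal c * ENNReal.ofReal (stepGain φ a id 1 q))
        hgm.enorm (htm.ennreal_ofReal.const_mul _) hdom n)
      split_ifs <;> simp
    refine (ENNReal.tsum_le_tsum h1).trans ?_
    rw [← lintegral_tsum fun n => ?_, ← lintegral_const_mul _
      (by exact ((measurable_cycleGain hφ z measurable_id 1).comp measurable_prodMk_left).ennreal_ofReal)]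
    · refine le_of_eq (lintegral_congr_ae ?_)
      filter_upwards [hvis, hnn] with ξ hξ hξ0
      rw [tsum_before_visit hξ (fun n => ENNReal.ofReal c *
        ENNReal.ofReal (stepGain φ a id 1 ((chainStep φ a)^[n] (z, ξ)))), ← Finset.mul_sum]
      congr 1
      rw [← ENNReal.ofReal_sum_of_nonneg fun n _ => ?_]
      · rfl
      · exact stepGain_id_nonneg (iterate_chainStep_snd (q := (z, ξ)) hz n)
          (iterate_chainStep_nonneg (q := (z, ξ)) hξ0.2 n 0)
    · refine (Measurable.ite (((measurable_visitCount hφ z n).comp measurable_prodMk_left)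
        (measurableSet_singleton 0)) ?_ measurable_const).aemeasurable
      exact ((htm.comp ((measurable_iterate_chainStep hφ n).comp
        measurable_prodMk_left)).ennreal_ofReal).const_mul _
  have hint := integral_tsum (μ := streamLaw κ) (f := fun n ξ => if visitCount φ a z n (z, ξ) = 0 then
      g ((chainStep φ a)^[n] (z, ξ)) else 0) (fun n => by
        refine (Measurable.ite (((measurable_visitCount hφ z n).comp measurable_prodMk_left)
          (measurableSet_singleton 0)) ?_ measurable_const).aestronglyMeasurable
        exact hgm.comp ((measurable_iterate_chainStep hφ n).comp measurable_prodMk_left)) hsum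
  have hzero : ∀ n, ∫ ξ, (if visitCount φ a z n (z, ξ) = 0 then
      g ((chainStep φ a)^[n] (z, ξ)) else 0) ∂streamLaw κ = 0 := fun n =>
    integral_before_visit_eq_zero κ hφ hz hgm (fun s hs => (hdef s hs).1) n
  simp only [hzero, tsum_zero] at hint
  refine neg_eq_zero.1 ?_
  rw [← integral_neg]
  refine Eq.trans ?_ hint
  refine integral_congr_ae ?_
  filter_upwards [hvis] with ξ hξ
  rw [tsum_before_visit hξ (fun n => g ((chainStep φ a)^[n] (z, ξ)))]
  -- The cycle leads from `z` back to `z`, so the solution telescopes to 0 and the sum of the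
  -- defects is minus the gain of the cycle.
  set H := poissonGlobal φ u F CL CR (F 0 * w) with hH
  have hgn : ∀ n, g ((chainStep φ a)^[n] (z, ξ)) = H ((chainStep φ a)^[n + 1] (z, ξ)).1 -
      H ((chainStep φ a)^[n] (z, ξ)).1 - stepGain φ a (primitive F) (F 0) ((chainStep φ a)^[n] (z, ξ)) := by
    intro n
    rw [Function.iterate_succ_apply', stepGain_eq]; rfl
  simp only [hgn]
  rw [Finset.sum_sub_distrib, Finset.sum_range_sub (fun n => H ((chainStep φ a)^[n] (z, ξ)).1),
    iterate_visitIndex_fst hξ]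
  simp [cycleGain, totalGain]

end

noncomputable section

/-! ### The occupation measure of a cycle -/

variable {φ u : ℝ → ℝ} {a : ℝ} (κ : Measure ℝ) [IsProbabilityMeasure κ]

/-- The set of streams and of times of the flight of step `n` of a cycle. -/
def flightRegion (φ : ℝ → ℝ) (a : ℝ) (z : ℝ × ℝ) (n : ℕ) : Set (ClockStream × ℝ) :=
  {p | visitCount φ a z n (z, p.1) = 0 ∧ 0 < p.2 ∧
    p.2 ≤ flightTime φ a ((chainStep φ a)^[n] (z, p.1)).1 (((chainStep φ a)^[n] (z, p.1)).2.1 0)}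

/-- The position during the flight of step `n`. -/
def flightPosition (φ : ℝ → ℝ) (a : ℝ) (z : ℝ × ℝ) (n : ℕ) (p : ClockStream × ℝ) : ℝ :=
  ((chainStep φ a)^[n] (z, p.1)).1.1 + ((chainStep φ a)^[n] (z, p.1)).1.2 * p.2

open Classical in
/-- The mean time spent in a set during a cycle. -/
def cycleOccupation (φ : ℝ → ℝ) (a : ℝ) (z : ℝ × ℝ) : Measure ℝ :=
  Measure.sum (fun n => (((streamLaw κ).prod volume).restrict (flightRegion φ a z n)).map
    (flightPosition φ a z n)) +
  (∑' n, ∫⁻ ξ, (if visitCount φ a z n (z, ξ) = 0 then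
    ENNReal.ofReal (stickDuration φ a ((chainStep φ a)^[n] (z, ξ)).1 ((chainStep φ a)^[n] (z, ξ)).2)
    else 0) ∂streamLaw κ) • Measure.dirac 0

lemma mem_flightRegion {z : ℝ × ℝ} {n : ℕ} {ξ : ClockStream} {r : ℝ} :
    (ξ, r) ∈ flightRegion φ a z n ↔ visitCount φ a z n (z, ξ) = 0 ∧
      r ∈ Set.Ioc 0 (flightTime φ a ((chainStep φ a)^[n] (z, ξ)).1
        (((chainStep φ a)^[n] (z, ξ)).2.1 0)) := Iff.rfl

lemma measurable_flightPosition (hφ : Continuous φ) (z : ℝ × ℝ) (n : ℕ) :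
    Measurable (flightPosition φ a z n) := by
  have h : Measurable fun p : ClockStream × ℝ => (chainStep φ a)^[n] (z, p.1) :=
    (measurable_iterate_chainStep hφ n).comp (measurable_prodMk_left.comp measurable_fst)
  exact h.fst.fst.add (h.fst.snd.mul measurable_snd)

lemma measurableSet_flightRegion (hφ : Continuous φ) (z : ℝ × ℝ) (n : ℕ) :
    MeasurableSet (flightRegion φ a z n) := by
  have h : Measurable fun p : ClockStream × ℝ => (chainStep φ a)^[n] (z, p.1) :=
    (measurable_iterate_chainStep hφ n).comp (measurable_prodMk_left.comp measurable_fst)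
  have h1 : Measurable fun p : ClockStream × ℝ => visitCount φ a z n (z, p.1) :=
    (measurable_visitCount hφ z n).comp (measurable_prodMk_left.comp measurable_fst)
  exact (h1 (measurableSet_singleton 0)).inter ((measurableSet_lt measurable_const measurable_snd).inter
    (measurableSet_le measurable_snd ((measurable_flightTime hφ).comp (measurable_firstClock.comp h))))

/-- The integral over a step of a nonnegative function. -/
def stepIntegral (φ : ℝ → ℝ) (a : ℝ) (g : ℝ → ℝ≥0∞) (q : (ℝ × ℝ) × ClockStream) : ℝ≥0∞ :=
  (∫⁻ r in Set.Ioc 0 (flightTime φ a q.1 (q.2.1 0)), g (q.1.1 + q.1.2 * r)) +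
    ENNReal.ofReal (stickDuration φ a q.1 q.2) * g 0

/-- Tonelli's theorem: the region of each flight is cut off by the event that `z` has not been
visited yet, so the sum over all flights stops at the visit. -/
lemma lintegral_cycleOccupation (hφ : Continuous φ) {z : ℝ × ℝ}
    (hvis : ∀ᵐ ξ ∂streamLaw κ, Visits φ a z (z, ξ)) {g : ℝ → ℝ≥0∞} (hg : Measurable g) :
    ∫⁻ x, g x ∂cycleOccupation κ φ a z = ∫⁻ ξ, ∑ n ∈ Finset.range (visitIndex φ a z (z, ξ)),
      stepIntegral φ a g ((chainStep φ a)^[n] (z, ξ)) ∂streamLaw κ := by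
  classical
  have hq : ∀ n, Measurable fun ξ : ClockStream => (chainStep φ a)^[n] (z, ξ) := fun n =>
    (measurable_iterate_chainStep hφ n).comp measurable_prodMk_left
  have hcount : ∀ n, MeasurableSet {ξ : ClockStream | visitCount φ a z n (z, ξ) = 0} := fun n =>
    ((measurable_visitCount hφ z n).comp measurable_prodMk_left) (measurableSet_singleton 0)
  have hst : ∀ n, Measurable fun ξ => if visitCount φ a z n (z, ξ) = 0 then
      ENNReal.ofReal (stickDuration φ a ((chainStep φ a)^[n] (z, ξ)).1 ((chainStep φ a)^[n] (z, ξ)).2)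
      else 0 := fun n =>
    Measurable.ite (hcount n) ((measurable_stickDuration hφ).comp (hq n)).ennreal_ofReal measurable_const
  have hfl : ∀ n, Measurable fun p : ClockStream × ℝ =>
      (flightRegion φ a z n).indicator (fun p => g (flightPosition φ a z n p)) p := fun n =>
    (hg.comp (measurable_flightPosition hφ z n)).indicator (measurableSet_flightRegion hφ z n)
  have hsplit : ∀ n ξ, (if visitCount φ a z n (z, ξ) = 0 then
      stepIntegral φ a g ((chainStep φ a)^[n] (z, ξ)) else 0) =
      (∫⁻ r, (flightRegion φ a z n).indicator (fun p => g (flightPosition φ a z n p)) (ξ, r)) +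
      (if visitCount φ a z n (z, ξ) = 0 then
      ENNReal.ofReal (stickDuration φ a ((chainStep φ a)^[n] (z, ξ)).1 ((chainStep φ a)^[n] (z, ξ)).2)
      else 0) * g 0 := by
    intro n ξ
    split_ifs with h
    · unfold stepIntegral
      congr 1
      rw [← lintegral_indicator measurableSet_Ioc]
      refine lintegral_congr fun r => ?_
      simp only [Set.indicator_apply, mem_flightRegion, h, true_and, flightPosition]
    · rw [zero_mul, add_zero]
      simp only [Set.indicator_apply, mem_flightRegion, h, false_and, if_false, lintegral_zero]
  have hR : ∫⁻ ξ, ∑ n ∈ Finset.range (visitIndex φ a z (z, ξ)),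
      stepIntegral φ a g ((chainStep φ a)^[n] (z, ξ)) ∂streamLaw κ =
      ∫⁻ ξ, ∑' n, ((∫⁻ r, (flightRegion φ a z n).indicator (fun p => g (flightPosition φ a z n p)) (ξ, r)) +
      (if visitCount φ a z n (z, ξ) = 0 then
      ENNReal.ofReal (stickDuration φ a ((chainStep φ a)^[n] (z, ξ)).1 ((chainStep φ a)^[n] (z, ξ)).2)
      else 0) * g 0) ∂streamLaw κ := by
    refine lintegral_congr_ae ?_
    filter_upwards [hvis] with ξ hξ
    rw [← tsum_before_visit hξ]
    exact tsum_congr fun n => hsplit n ξ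
  rw [hR, lintegral_tsum fun n => by
    exact ((hfl n).lintegral_prod_right'.add ((hst n).mul_const _)).aemeasurable]
  rw [tsum_congr fun n => lintegral_add_left (hfl n).lintegral_prod_right' _, ENNReal.tsum_add]
  unfold cycleOccupation
  rw [lintegral_add_measure, lintegral_sum_measure, lintegral_smul_measure, lintegral_dirac' _ hg,
    smul_eq_mul, ← ENNReal.tsum_mul_right]
  congr 1
  · refine tsum_congr fun n => ?_
    rw [lintegral_map hg (measurable_flightPosition hφ z n),
      ← lintegral_indicator (measurableSet_flightRegion hφ z n), lintegral_prod _ (hfl n).aemeasurable]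
  · exact tsum_congr fun n => (lintegral_mul_const _ (hst n)).symm

lemma primitive_sub {f : ℝ → ℝ} (hf : ∀ b c, IntervalIntegrable f volume b c) (x y : ℝ) :
    primitive f y - primitive f x = ∫ r in x..y, f r :=
  intervalIntegral.integral_interval_sub_left (hf 0 y) (hf 0 x)

/-- A ray has velocity ±1, so time integrals along it are signed differences of primitives; this is
the reason for the form of `stepGain`. -/
lemma primitive_ray {f : ℝ → ℝ} (hf : ∀ b c, IntervalIntegrable f volume b c) {s : ℝ × ℝ}
    (hs : s.2 = 1 ∨ s.2 = -1) (t : ℝ) :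
    s.2 * (primitive f (s.1 + s.2 * t) - primitive f s.1) = ∫ r in (0 : ℝ)..t, f (s.1 + s.2 * r) := by
  rw [primitive_sub hf]
  rcases hs with h | h <;> rw [h]
  · simp only [one_mul]
    rw [intervalIntegral.integral_comp_add_left]; simp
  · simp only [neg_one_mul, ← sub_eq_add_neg]
    rw [intervalIntegral.integral_comp_sub_left, intervalIntegral.integral_symm]; simp

lemma intervalIntegrable_ray {f : ℝ → ℝ} (hf : ∀ b c, IntervalIntegrable f volume b c) {s : ℝ × ℝ}
    (hs : s.2 = 1 ∨ s.2 = -1) (b c : ℝ) :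
    IntervalIntegrable (fun r => f (s.1 + s.2 * r)) volume b c := by
  rcases hs with h | h <;> rw [h]
  · simp only [one_mul]
    have := (hf (s.1 + b) (s.1 + c)).comp_add_left s.1
    simpa using this
  · simp only [neg_one_mul, ← sub_eq_add_neg]
    have := (hf (s.1 - b) (s.1 - c)).comp_sub_left s.1
    simpa using this

lemma stepGain_primitive {f : ℝ → ℝ} (hf : ∀ b c, IntervalIntegrable f volume b c)
    {q : (ℝ × ℝ) × ClockStream} (hq : q.1.2 = 1 ∨ q.1.2 = -1) :
    stepGain φ a (primitive f) (f 0) q =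
      (∫ r in (0 : ℝ)..flightTime φ a q.1 (q.2.1 0), f (q.1.1 + q.1.2 * r)) +
        f 0 * stickDuration φ a q.1 q.2 := by
  unfold stepGain
  rw [← primitive_ray hf hq]; rfl

lemma stepIntegral_ofReal {f : ℝ → ℝ} (hf : ∀ b c, IntervalIntegrable f volume b c)
    (hf0 : ∀ x, 0 ≤ f x) {q : (ℝ × ℝ) × ClockStream} (hq : q.1.2 = 1 ∨ q.1.2 = -1)
    (hD : 0 ≤ q.2.2 0) :
    stepIntegral φ a (fun x => ENNReal.ofReal (f x)) q =
      ENNReal.ofReal (stepGain φ a (primitive f) (f 0) q) := by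
  have ht := flightTime_nonneg (φ := φ) (a := a) q.1 (q.2.1 0)
  rw [stepGain_primitive hf hq, ENNReal.ofReal_add
    (intervalIntegral.integral_nonneg ht fun r _ => hf0 _)
    (mul_nonneg (hf0 0) (stickDuration_nonneg hD)), ENNReal.ofReal_mul (hf0 0),
    intervalIntegral.integral_of_le ht, ofReal_integral_eq_lintegral_ofReal
      ((intervalIntegrable_iff_integrableOn_Ioc_of_le ht).1 (intervalIntegrable_ray hf hq _ _))
      (.of_forall fun r => hf0 _), mul_comm (ENNReal.ofReal (f 0))]
  rfl

lemma stepGain_nonneg {f : ℝ → ℝ} (hf : ∀ b c, IntervalIntegrable f volume b c)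
    (hf0 : ∀ x, 0 ≤ f x) {q : (ℝ × ℝ) × ClockStream} (hq : q.1.2 = 1 ∨ q.1.2 = -1)
    (hD : 0 ≤ q.2.2 0) : 0 ≤ stepGain φ a (primitive f) (f 0) q := by
  rw [stepGain_primitive hf hq]
  exact add_nonneg (intervalIntegral.integral_nonneg (flightTime_nonneg _ _) fun r _ => hf0 _)
    (mul_nonneg (hf0 0) (stickDuration_nonneg hD))

lemma totalGain_nonneg {f : ℝ → ℝ} (hf : ∀ b c, IntervalIntegrable f volume b c)
    (hf0 : ∀ x, 0 ≤ f x) {q : (ℝ × ℝ) × ClockStream} (hq : q.1.2 = 1 ∨ q.1.2 = -1)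
    (hD : ∀ k, 0 ≤ q.2.2 k) (n : ℕ) : 0 ≤ totalGain φ a (primitive f) (f 0) n q :=
  Finset.sum_nonneg fun k _ => stepGain_nonneg hf hf0 (iterate_chainStep_snd hq k)
    (iterate_chainStep_nonneg hD k 0)

lemma measurable_primitive {f : ℝ → ℝ} (hf : ∀ b c, IntervalIntegrable f volume b c) :
    Measurable (primitive f) :=
  (intervalIntegral.continuous_primitive hf 0).measurable

lemma lintegral_cycleOccupation_ofReal (hφ : Continuous φ) {z : ℝ × ℝ} (hz : z.2 = 1 ∨ z.2 = -1)
    (hvis : ∀ᵐ ξ ∂streamLaw κ, Visits φ a z (z, ξ)) (hκ0 : ∀ᵐ D ∂κ, 0 ≤ D) {f : ℝ → ℝ}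
    (hfm : Measurable f) (hf : ∀ b c, IntervalIntegrable f volume b c) (hf0 : ∀ x, 0 ≤ f x) :
    ∫⁻ x, ENNReal.ofReal (f x) ∂cycleOccupation κ φ a z =
      ∫⁻ ξ, ENNReal.ofReal (cycleGain φ a z (primitive f) (f 0) (z, ξ)) ∂streamLaw κ := by
  rw [lintegral_cycleOccupation κ hφ hvis hfm.ennreal_ofReal]
  refine lintegral_congr_ae ?_
  filter_upwards [ae_streamLaw κ (p := fun _ => True) (by simp) hκ0] with ξ hξ
  unfold cycleGain totalGain
  rw [ENNReal.ofReal_sum_of_nonneg fun n _ => ?_]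
  · exact Finset.sum_congr rfl fun n _ => stepIntegral_ofReal hf hf0
      (iterate_chainStep_snd (q := (z, ξ)) hz n) (iterate_chainStep_nonneg (q := (z, ξ)) hξ.2 n 0)
  · exact stepGain_nonneg hf hf0
      (iterate_chainStep_snd (q := (z, ξ)) hz n) (iterate_chainStep_nonneg (q := (z, ξ)) hξ.2 n 0)

lemma integrable_cycleGain_of_nonneg (hφ : Continuous φ) {z : ℝ × ℝ} (hz : z.2 = 1 ∨ z.2 = -1)
    (hvis : ∀ᵐ ξ ∂streamLaw κ, Visits φ a z (z, ξ)) (hκ0 : ∀ᵐ D ∂κ, 0 ≤ D) {f : ℝ → ℝ}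
    (hfm : Measurable f) (hf : ∀ b c, IntervalIntegrable f volume b c) (hf0 : ∀ x, 0 ≤ f x)
    (hfi : Integrable f (cycleOccupation κ φ a z)) :
    Integrable (fun ξ => cycleGain φ a z (primitive f) (f 0) (z, ξ)) (streamLaw κ) ∧
    ∫ ξ, cycleGain φ a z (primitive f) (f 0) (z, ξ) ∂streamLaw κ = ∫ x, f x ∂cycleOccupation κ φ a z := by
  have hm : Measurable fun ξ => cycleGain φ a z (primitive f) (f 0) (z, ξ) :=
    (measurable_cycleGain hφ z (measurable_primitive hf) _).comp measurable_prodMk_left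
  have h0 : 0 ≤ᵐ[streamLaw κ] fun ξ => cycleGain φ a z (primitive f) (f 0) (z, ξ) := by
    filter_upwards [ae_streamLaw κ (p := fun _ => True) (by simp) hκ0] with ξ hξ
    exact totalGain_nonneg (q := (z, ξ)) hf hf0 hz hξ.2 _
  have h := lintegral_cycleOccupation_ofReal κ hφ hz hvis hκ0 hfm hf hf0
  constructor
  · refine ⟨hm.aestronglyMeasurable, ?_⟩
    rw [hasFiniteIntegral_iff_ofReal h0, ← h, ← hasFiniteIntegral_iff_ofReal (.of_forall hf0)]
    exact hfi.2
  · rw [integral_eq_lintegral_of_nonneg_ae h0 hm.aestronglyMeasurable, ← h,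
      integral_eq_lintegral_of_nonneg_ae (.of_forall hf0) hfm.aestronglyMeasurable]

lemma stepGain_primitive_sub {f g : ℝ → ℝ} (hf : ∀ b c, IntervalIntegrable f volume b c)
    (hg : ∀ b c, IntervalIntegrable g volume b c) (q : (ℝ × ℝ) × ClockStream) :
    stepGain φ a (primitive fun x => f x - g x) (f 0 - g 0) q =
      stepGain φ a (primitive f) (f 0) q - stepGain φ a (primitive g) (g 0) q := by
  have : ∀ x, primitive (fun x => f x - g x) x = primitive f x - primitive g x := fun x =>
    intervalIntegral.integral_sub (hf 0 x) (hg 0 x)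
  simp only [stepGain, this]; ring

lemma totalGain_primitive_sub {f g : ℝ → ℝ} (hf : ∀ b c, IntervalIntegrable f volume b c)
    (hg : ∀ b c, IntervalIntegrable g volume b c) (n : ℕ) (q : (ℝ × ℝ) × ClockStream) :
    totalGain φ a (primitive fun x => f x - g x) (f 0 - g 0) n q =
      totalGain φ a (primitive f) (f 0) n q - totalGain φ a (primitive g) (g 0) n q := by
  simp only [totalGain, stepGain_primitive_sub hf hg, Finset.sum_sub_distrib]

/-- Positive and negative parts reduce to the nonnegative case, where `cycleGain` is compared with
the occupation measure by Lebesgue integrals; integrability over the cycle comes out as a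
conclusion. -/
lemma integral_cycleGain (hφ : Continuous φ) {z : ℝ × ℝ} (hz : z.2 = 1 ∨ z.2 = -1)
    (hvis : ∀ᵐ ξ ∂streamLaw κ, Visits φ a z (z, ξ)) (hκ0 : ∀ᵐ D ∂κ, 0 ≤ D) {f : ℝ → ℝ}
    (hfm : Measurable f) (hf : ∀ b c, IntervalIntegrable f volume b c)
    (hfi : Integrable f (cycleOccupation κ φ a z)) :
    Integrable (fun ξ => cycleGain φ a z (primitive f) (f 0) (z, ξ)) (streamLaw κ) ∧
    ∫ ξ, cycleGain φ a z (primitive f) (f 0) (z, ξ) ∂streamLaw κ = ∫ x, f x ∂cycleOccupation κ φ a z := by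
  set fp : ℝ → ℝ := fun x => max (f x) 0 with hfp
  set fn : ℝ → ℝ := fun x => max (-f x) 0 with hfn
  have hdec : ∀ x, f x = fp x - fn x := fun x => by
    simp only [hfp, hfn]
    rcases le_total 0 (f x) with h | h
    · rw [max_eq_left h, max_eq_right (by linarith)]; ring
    · rw [max_eq_right h, max_eq_left (by linarith)]; ring
  have ip : ∀ b c, IntervalIntegrable fp volume b c := fun b c => ⟨(hf b c).1.pos_part, (hf b c).2.pos_part⟩
  have in_ : ∀ b c, IntervalIntegrable fn volume b c := fun b c => ⟨(hf b c).1.neg_part, (hf b c).2.neg_part⟩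
  have h1 := integrable_cycleGain_of_nonneg κ hφ hz hvis hκ0 (f := fp) (hfm.max measurable_const) ip
    (fun x => le_max_right _ _) hfi.pos_part
  have h2 := integrable_cycleGain_of_nonneg κ hφ hz hvis hκ0 (f := fn) (hfm.neg.max measurable_const) in_
    (fun x => le_max_right _ _) hfi.neg_part
  have hfe : f = fun x => fp x - fn x := funext hdec
  have hg : ∀ ξ, cycleGain φ a z (primitive f) (f 0) (z, ξ) =
      cycleGain φ a z (primitive fp) (fp 0) (z, ξ) - cycleGain φ a z (primitive fn) (fn 0) (z, ξ) := by
    intro ξ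
    conv_lhs => rw [hfe]
    exact totalGain_primitive_sub ip in_ _ _
  simp only [hg]
  refine ⟨h1.1.sub h2.1, ?_⟩
  rw [integral_sub h1.1 h2.1, h1.2, h2.2]
  conv_rhs => rw [hfe]
  exact (integral_sub hfi.pos_part hfi.neg_part).symm

lemma primitive_one : primitive (fun _ => 1) = id := by
  ext x; simp [primitive]

/-! ### Proportionality of occupation measure and stationary measure -/

/-- The measure with a density and an atom at `0`. -/
def densityWithAtom (u : ℝ → ℝ) (w : ℝ) : Measure ℝ :=
  (volume.withDensity fun x => ENNReal.ofReal (Real.exp (-u x))) +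
    ENNReal.ofReal (w * Real.exp (-u 0)) • Measure.dirac 0

lemma cycleOccupation_univ (hφ : Continuous φ) {z : ℝ × ℝ} (hz : z.2 = 1 ∨ z.2 = -1)
    (hvis : ∀ᵐ ξ ∂streamLaw κ, Visits φ a z (z, ξ)) (hκ0 : ∀ᵐ D ∂κ, 0 ≤ D) :
    cycleOccupation κ φ a z Set.univ =
      ∫⁻ ξ, ENNReal.ofReal (cycleGain φ a z id 1 (z, ξ)) ∂streamLaw κ := by
  have := lintegral_cycleOccupation_ofReal κ hφ hz hvis hκ0 (f := fun _ => 1) measurable_const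
    (fun b c => intervalIntegrable_const) (fun _ => zero_le_one)
  rw [primitive_one] at this
  simpa using this

lemma integral_densityWithAtom (hu : Continuous u) {w : ℝ} (hw : 0 ≤ w) {F : ℝ → ℝ} (hF : Measurable F)
    (hFu : Integrable fun x => F x * Real.exp (-u x)) :
    Integrable F (densityWithAtom u w) ∧
    ∫ x, F x ∂densityWithAtom u w = (∫ x, F x * Real.exp (-u x)) + F 0 * w * Real.exp (-u 0) := by
  have hd : Measurable fun x => ENNReal.ofReal (Real.exp (-u x)) := hu.neg.rexp.measurable.ennreal_ofReal
  have htop : ∀ᵐ x : ℝ, ENNReal.ofReal (Real.exp (-u x)) < ∞ := .of_forall fun x => ENNReal.ofReal_lt_top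
  have hr : ∀ x, (ENNReal.ofReal (Real.exp (-u x))).toReal • F x = F x * Real.exp (-u x) := fun x => by
    rw [ENNReal.toReal_ofReal (Real.exp_pos _).le, smul_eq_mul, mul_comm]
  have i1 : Integrable F (volume.withDensity fun x => ENNReal.ofReal (Real.exp (-u x))) := by
    rw [integrable_withDensity_iff_integrable_smul' hd htop]
    simpa only [hr] using hFu
  have i2 : Integrable F (ENNReal.ofReal (w * Real.exp (-u 0)) • Measure.dirac 0) :=
    (integrable_dirac' hF.stronglyMeasurable (by simp)).smul_measure ENNReal.ofReal_ne_top
  refine ⟨i1.add_measure i2, ?_⟩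
  unfold densityWithAtom
  rw [integral_add_measure i1 i2, integral_smul_measure, integral_dirac,
    integral_withDensity_eq_integral_toReal_smul hd htop,
    ENNReal.toReal_ofReal (mul_nonneg hw (Real.exp_pos _).le), smul_eq_mul]
  simp only [hr]
  ring

/-- The occupation measure of a cycle is proportional to the stationary measure. -/
theorem smul_cycleOccupation (hφ : Continuous φ) (hu : ∀ x, HasDerivAt u (φ x) x)
    {w : ℝ} (hw : 0 < w) (hκ : Integrable id κ) (hκw : ∫ D, D ∂κ = w) (hκ0 : ∀ᵐ D ∂κ, 0 ≤ D)
    [IsFiniteMeasure (densityWithAtom u w)]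
    {z : ℝ × ℝ} (hz : z.2 = 1 ∨ z.2 = -1) (hvis : ∀ᵐ ξ ∂streamLaw κ, Visits φ a z (z, ξ))
    (hC : Integrable (fun ξ => cycleGain φ a z id 1 (z, ξ)) (streamLaw κ)) :
    ∃ k : ℝ≥0∞, k ≠ ∞ ∧ cycleOccupation κ φ a z = k • densityWithAtom u w := by
  have huc : Continuous u := continuous_iff_continuousAt.2 fun t => (hu t).continuousAt
  set m := densityWithAtom u w with hm
  set ν := cycleOccupation κ φ a z with hν
  have : IsFiniteMeasure ν := ⟨by
    rw [hν, cycleOccupation_univ κ hφ hz hvis hκ0]; exact hC.lintegral_lt_top⟩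
  have hint : ∀ F : CompactlySupportedContinuousMap ℝ ℝ, (Integrable F m ∧ ∫ x, F x ∂m =
      (∫ x, F x * Real.exp (-u x)) + F 0 * w * Real.exp (-u 0)) ∧ Integrable F ν ∧
      ∫ ξ, cycleGain φ a z (primitive F) (F 0) (z, ξ) ∂streamLaw κ = ∫ x, F x ∂ν := by
    intro F
    have hFc : Continuous F := F.continuous
    have hFν : Integrable F ν := hFc.integrable_of_hasCompactSupport F.hasCompactSupport
    refine ⟨integral_densityWithAtom huc hw.le hFc.measurable ?_, hFν, ?_⟩
    · exact (hFc.mul huc.neg.rexp).integrable_of_hasCompactSupport F.hasCompactSupport.mul_right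
    · exact (integral_cycleGain κ hφ hz hvis hκ0 hFc.measurable
        (fun b c => hFc.intervalIntegrable b c) hFν).2
  -- Two functionals on compactly supported functions: where the first vanishes, so does the second.
  -- Hence they are proportional, and the measures are too.
  have hcent : ∀ F : CompactlySupportedContinuousMap ℝ ℝ, ∫ x, F x ∂m = 0 → ∫ x, F x ∂ν = 0 := by
    intro F hF0
    obtain ⟨⟨h1, h2⟩, h3, h4⟩ := hint F
    have hFc : Continuous F := F.continuous
    obtain ⟨B, hB0, hB⟩ := F.hasCompactSupport.isCompact.isBounded.subset_closedBall_lt 0 0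
    have hFB : ∀ x, B + 1 ≤ |x| → F x = 0 := by
      intro x hx
      by_contra hne
      have := hB (subset_tsupport _ (Function.mem_support.2 hne))
      rw [mem_closedBall_zero_iff, Real.norm_eq_abs] at this
      linarith
    rw [← h4]
    refine integral_cycleGain_eq_zero κ hφ hu hFc (B := B + 1) (by linarith) hFB hκ hκw hκ0 ?_ hz hvis hC
    rw [intervalIntegral.integral_eq_integral_of_support_subset, ← h2, hF0]
    intro x hx
    have hx' : F x ≠ 0 := fun h => Function.mem_support.1 hx (by simp [h])
    have : |x| < B + 1 := not_le.1 fun h => hx' (hFB x h)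
    exact ⟨(abs_lt.1 this).1, (abs_lt.1 this).2.le⟩
  -- a test function with positive mean
  obtain ⟨T, hT⟩ : ∃ T : CompactlySupportedContinuousMap ℝ ℝ, ∀ x, T x = max 0 (1 - |x|) := by
    refine ⟨⟨⟨fun x => max 0 (1 - |x|), by fun_prop⟩, ?_⟩, fun x => rfl⟩
    refine HasCompactSupport.of_support_subset_isCompact (isCompact_Icc (a := (-1 : ℝ)) (b := 1)) ?_
    intro x hx
    have : 0 < 1 - |x| := by
      by_contra h
      exact Function.mem_support.1 hx (max_eq_left (not_lt.1 h))
    exact abs_le.1 (by linarith)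
  have hT0 : ∀ x, 0 ≤ T x := fun x => by rw [hT]; exact le_max_left _ _
  have hTm : 0 < ∫ x, T x ∂m := by
    rw [(hint T).1.2, hT 0]
    have : 0 ≤ ∫ x, T x * Real.exp (-u x) := integral_nonneg fun x => mul_nonneg (hT0 x) (Real.exp_pos _).le
    have h2 : 0 < w * Real.exp (-u 0) := mul_pos hw (Real.exp_pos _)
    simp only [abs_zero, sub_zero, max_eq_right zero_le_one, one_mul]
    linarith
  set mT := ∫ x, T x ∂m with hmT
  have hνT : 0 ≤ ∫ x, T x ∂ν := integral_nonneg hT0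
  refine ⟨ENNReal.ofReal ((∫ x, T x ∂ν) / mT), ENNReal.ofReal_ne_top, ?_⟩
  have : IsFiniteMeasure (ENNReal.ofReal ((∫ x, T x ∂ν) / mT) • m) :=
    ⟨by simpa using ENNReal.mul_lt_top ENNReal.ofReal_lt_top (measure_lt_top m _)⟩
  refine Measure.ext_of_integral_eq_on_compactlySupported fun F => ?_
  rw [integral_smul_measure, ENNReal.toReal_ofReal (by positivity), smul_eq_mul]
  -- This combination of `F` and the test function `T` is centred by construction.
  have h := hcent (mT • F - (∫ x, F x ∂m) • T) (by
    simp only [CompactlySupportedContinuousMap.coe_sub, CompactlySupportedContinuousMap.coe_smul,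
      Pi.sub_apply, Pi.smul_apply, smul_eq_mul]
    rw [integral_sub ((hint F).1.1.const_mul _) ((hint T).1.1.const_mul _), integral_const_mul,
      integral_const_mul]; ring)
  simp only [CompactlySupportedContinuousMap.coe_sub, CompactlySupportedContinuousMap.coe_smul,
      Pi.sub_apply, Pi.smul_apply, smul_eq_mul] at h
  rw [integral_sub ((hint F).2.1.const_mul _) ((hint T).2.1.const_mul _), integral_const_mul,
      integral_const_mul] at h
  field_simp
  linarith

/-- The mean gain of a cycle is the mean length of the cycle multiplied by the stationary mean. -/
theorem integral_cycleGain_eq (hφ : Continuous φ) (hu : ∀ x, HasDerivAt u (φ x) x)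
    {w : ℝ} (hw : 0 < w) (hκ : Integrable id κ) (hκw : ∫ D, D ∂κ = w) (hκ0 : ∀ᵐ D ∂κ, 0 ≤ D)
    [IsFiniteMeasure (densityWithAtom u w)]
    {z : ℝ × ℝ} (hz : z.2 = 1 ∨ z.2 = -1) (hvis : ∀ᵐ ξ ∂streamLaw κ, Visits φ a z (z, ξ))
    (hC : Integrable (fun ξ => cycleGain φ a z id 1 (z, ξ)) (streamLaw κ)) {f : ℝ → ℝ}
    (hfm : Measurable f) (hf : ∀ b c, IntervalIntegrable f volume b c)
    (hfi : Integrable f (densityWithAtom u w)) :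
    Integrable (fun ξ => cycleGain φ a z (primitive f) (f 0) (z, ξ)) (streamLaw κ) ∧
    (densityWithAtom u w).real Set.univ * ∫ ξ, cycleGain φ a z (primitive f) (f 0) (z, ξ) ∂streamLaw κ =
      (∫ ξ, cycleGain φ a z id 1 (z, ξ) ∂streamLaw κ) * ∫ x, f x ∂densityWithAtom u w := by
  obtain ⟨k, hk, hocc⟩ := smul_cycleOccupation (a := a) κ hφ hu hw hκ hκw hκ0 hz hvis hC
  have h1 := integral_cycleGain κ hφ hz hvis hκ0 hfm hf (by rw [hocc]; exact hfi.smul_measure hk)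
  have h2 := integral_cycleGain κ hφ hz hvis hκ0 (f := fun _ => 1) measurable_const
    (fun b c => intervalIntegrable_const) (by rw [hocc]; exact (integrable_const _).smul_measure hk)
  rw [primitive_one] at h2
  refine ⟨h1.1, ?_⟩
  -- The unknown factor `k` appears in the mean gain and in the mean length alike.
  rw [h1.2, h2.2, hocc, integral_smul_measure, integral_smul_measure]
  simp
  ring

end

noncomputable section

/-! ### Dependence on the sticking times -/

variable {φ : ℝ → ℝ} {a : ℝ}

/-- The state and the clocks of the chain do not depend on the sticking times, which are only
shifted. -/
lemma iterate_chainStep_sticks (s : ℝ × ℝ) (e : ℕ → ℝ) (n : ℕ) :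
    ∃ (s' : ℝ × ℝ) (e' : ℕ → ℝ) (k : ℕ), ∀ D : ℕ → ℝ,
      (chainStep φ a)^[n] (s, (e, D)) = (s', (e', fun j => D (k + j))) := by
  induction n with
  | zero => exact ⟨s, e, 0, fun D => by simp⟩
  | succ n ih =>
    obtain ⟨s', e', k, h⟩ := ih
    -- Whether a step sticks is decided by the state and the clock alone.
    by_cases hst : SticksAtZero φ a s' (e' 0)
    · refine ⟨nextState φ a s' (e' 0), nextClocks φ a s' e', k + 1, fun D => ?_⟩
      rw [Function.iterate_succ_apply', h]
      simp only [chainStep, nextStream, hst, if_true]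
      congr 2; ext j; simp only [seqTail]; congr 1; ring
    · refine ⟨nextState φ a s' (e' 0), nextClocks φ a s' e', k, fun D => ?_⟩
      rw [Function.iterate_succ_apply', h]
      simp only [chainStep, nextStream, hst, if_false]

/-- Sticking delays the visits but leaves the sequence of states unchanged. -/
lemma visitIndex_sticks (s z : ℝ × ℝ) (e D D' : ℕ → ℝ) :
    visitIndex φ a z (s, (e, D)) = visitIndex φ a z (s, (e, D')) := by
  unfold visitIndex
  congr 2
  ext n
  obtain ⟨s', e', k, h⟩ := iterate_chainStep_sticks (φ := φ) (a := a) s e (n + 1)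
  simp only [Set.mem_ofPred_eq, h]

variable (κ : Measure ℝ) [IsProbabilityMeasure κ]

lemma integral_seqLaw_eval (hκ : Integrable id κ) (k : ℕ) :
    Integrable (fun D : ℕ → ℝ => D k) (seqLaw κ) ∧ ∫ D, D k ∂seqLaw κ = ∫ x, x ∂κ := by
  have hm : Measure.map (fun e : ℕ → ℝ => e k) (seqLaw κ) = κ :=
    Measure.infinitePi_map_eval (μ := fun _ : ℕ => κ) k
  have hp : AEMeasurable (fun e : ℕ → ℝ => e k) (seqLaw κ) := (measurable_pi_apply k).aemeasurable
  constructor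
  · have : Integrable id ((seqLaw κ).map fun e : ℕ → ℝ => e k) := by rwa [hm]
    exact this.comp_aemeasurable hp
  · conv_rhs => rw [← hm]
    exact (integral_map hp measurable_id.aestronglyMeasurable).symm

/-- A step uses at most one sticking time, and linearly, so averaging over the sticking times
amounts to inserting the mean. -/
lemma integral_stepGain_sticks (hκ : Integrable id κ) (s : ℝ × ℝ) (e : ℕ → ℝ) (Φ : ℝ → ℝ)
    (c : ℝ) (n : ℕ) :
    Integrable (fun D => stepGain φ a Φ c ((chainStep φ a)^[n] (s, (e, D)))) (seqLaw κ) ∧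
    ∫ D, stepGain φ a Φ c ((chainStep φ a)^[n] (s, (e, D))) ∂seqLaw κ =
      stepGain φ a Φ c ((chainStep φ a)^[n] (s, (e, fun _ => ∫ x, x ∂κ))) := by
  obtain ⟨s', e', k, h⟩ := iterate_chainStep_sticks (φ := φ) (a := a) s e n
  by_cases hst : SticksAtZero φ a s' (e' 0)
  · have hg : ∀ D : ℕ → ℝ, stepGain φ a Φ c ((chainStep φ a)^[n] (s, (e, D))) =
        s'.2 * (Φ (nextState φ a s' (e' 0)).1 - Φ s'.1) + c * D k := fun D => by
      rw [h]; simp [stepGain, stickDuration, hst]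
    simp only [hg]
    obtain ⟨h1, h2⟩ := integral_seqLaw_eval κ hκ k
    refine ⟨(integrable_const _).add (h1.const_mul c), ?_⟩
    rw [integral_add (integrable_const _) (h1.const_mul c), integral_const_mul c, h2]
    simp
  · have hg : ∀ D : ℕ → ℝ, stepGain φ a Φ c ((chainStep φ a)^[n] (s, (e, D))) =
        s'.2 * (Φ (nextState φ a s' (e' 0)).1 - Φ s'.1) := fun D => by
      rw [h]; simp [stepGain, stickDuration, hst]
    simp only [hg]
    exact ⟨integrable_const _, by simp⟩

/-- For fixed clocks the number of steps in the cycle is fixed, so the gain is a finite sum of steps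
that are affine in the sticking times. -/
lemma integral_cycleGain_sticks (hκ : Integrable id κ) (s z : ℝ × ℝ) (e : ℕ → ℝ) (Φ : ℝ → ℝ)
    (c : ℝ) :
    Integrable (fun D => cycleGain φ a z Φ c (s, (e, D))) (seqLaw κ) ∧
    ∫ D, cycleGain φ a z Φ c (s, (e, D)) ∂seqLaw κ =
      cycleGain φ a z Φ c (s, (e, fun _ => ∫ x, x ∂κ)) := by
  have h := integral_stepGain_sticks (φ := φ) (a := a) κ hκ s e Φ c
  have hN : ∀ D, visitIndex φ a z (s, (e, D)) = visitIndex φ a z (s, (e, fun _ => ∫ x, x ∂κ)) :=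
    fun D => visitIndex_sticks s z e D _
  simp only [cycleGain, totalGain, hN]
  refine ⟨integrable_finsetSum _ fun n _ => (h n).1, ?_⟩
  rw [integral_finsetSum _ fun n _ => (h n).1]
  exact Finset.sum_congr rfl fun n _ => (h n).2

lemma seqLaw_dirac (w : ℝ) : seqLaw (Measure.dirac w) = Measure.dirac fun _ => w  :=
  Measure.infinitePi_dirac _

lemma lintegral_streamLaw_dirac (w : ℝ) {g : ClockStream → ℝ≥0∞} (hg : Measurable g) :
    ∫⁻ ξ, g ξ ∂streamLaw (Measure.dirac w) = ∫⁻ e, g (e, fun _ => w) ∂seqLaw (expMeasure 1) := by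
  unfold streamLaw
  rw [lintegral_prod _ hg.aemeasurable, seqLaw_dirac]
  exact lintegral_congr fun e => lintegral_dirac' _ (hg.comp measurable_prodMk_left)

/-- Replacing the sticking times by their mean decreases the second moments of the combinations of
the gains of a cycle. -/
theorem lintegral_sq_cycleGain_dirac_le (hφ : Continuous φ) (hκ : Integrable id κ) (z : ℝ × ℝ)
    {Φ : ℝ → ℝ} (hΦ : Measurable Φ) (c μ : ℝ) :
    ∫⁻ ξ, ‖cycleGain φ a z Φ c (z, ξ) - μ * cycleGain φ a z id 1 (z, ξ)‖ₑ ^ 2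
      ∂streamLaw (Measure.dirac (∫ x, x ∂κ)) ≤
    ∫⁻ ξ, ‖cycleGain φ a z Φ c (z, ξ) - μ * cycleGain φ a z id 1 (z, ξ)‖ₑ ^ 2 ∂streamLaw κ := by
  set Y : ClockStream → ℝ := fun ξ => cycleGain φ a z Φ c (z, ξ) - μ * cycleGain φ a z id 1 (z, ξ) with hY
  have hYm : Measurable Y := ((measurable_cycleGain hφ z hΦ c).comp measurable_prodMk_left).sub
    (((measurable_cycleGain hφ z measurable_id 1).comp measurable_prodMk_left).const_mul μ)
  have hsq : Measurable fun ξ => ‖Y ξ‖ₑ ^ 2 := hYm.enorm.pow_const 2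
  rw [lintegral_streamLaw_dirac _ hsq]
  unfold streamLaw
  rw [lintegral_prod _ hsq.aemeasurable]
  refine lintegral_mono fun e => ?_
  obtain ⟨h1, h2⟩ := integral_cycleGain_sticks (φ := φ) (a := a) κ hκ z z e Φ c
  obtain ⟨h3, h4⟩ := integral_cycleGain_sticks (φ := φ) (a := a) κ hκ z z e id 1
  have hmean : Y (e, fun _ => ∫ x, x ∂κ) = ∫ D, Y (e, D) ∂seqLaw κ := by
    simp only [hY]
    rw [integral_sub h1 (h3.const_mul μ), integral_const_mul, h2, h4]
  -- Jensen's inequality for the square, for fixed clocks `e`, in the form of the monotonicity of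
  -- Lebesgue norms on a probability space.
  have hle : ‖∫ D, Y (e, D) ∂seqLaw κ‖ₑ ≤ eLpNorm (fun D => Y (e, D)) 2 (seqLaw κ) := by
    refine (enorm_integral_le_lintegral_enorm _).trans ?_
    rw [← eLpNorm_one_eq_lintegral_enorm]
    exact eLpNorm_le_eLpNorm_of_exponent_le (by norm_num)
      (by exact (hYm.comp measurable_prodMk_left).aestronglyMeasurable)
  calc ‖Y (e, fun _ => ∫ x, x ∂κ)‖ₑ ^ 2 ≤ eLpNorm (fun D => Y (e, D)) 2 (seqLaw κ) ^ 2 := by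
        rw [hmean]; gcongr
    _ = ∫⁻ D, ‖Y (e, D)‖ₑ ^ 2 ∂seqLaw κ := by
        have := eLpNorm_nnreal_pow_eq_lintegral (μ := seqLaw κ) (f := fun D => Y (e, D)) (p := 2) two_ne_zero
        simpa using this

/-- Replacing the sticking times by their mean does not change the mean gain of a cycle. -/
theorem integral_cycleGain_dirac (hφ : Continuous φ) (hκ : Integrable id κ) (z : ℝ × ℝ)
    {Φ : ℝ → ℝ} (hΦ : Measurable Φ) (c : ℝ)
    (hi : Integrable (fun ξ => cycleGain φ a z Φ c (z, ξ)) (streamLaw κ)) :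
    ∫ ξ, cycleGain φ a z Φ c (z, ξ) ∂streamLaw (Measure.dirac (∫ x, x ∂κ)) =
      ∫ ξ, cycleGain φ a z Φ c (z, ξ) ∂streamLaw κ := by
  have hm : Measurable fun ξ => cycleGain φ a z Φ c (z, ξ) :=
    (measurable_cycleGain hφ z hΦ c).comp measurable_prodMk_left
  have hlaw : streamLaw (Measure.dirac (∫ x, x ∂κ)) =
      (seqLaw (expMeasure 1)).map fun e => (e, fun _ => ∫ x, x ∂κ) := by
    refine Measure.ext_of_lintegral _ fun g hg => ?_
    rw [lintegral_streamLaw_dirac _ hg, lintegral_map hg measurable_prodMk_right]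
  rw [hlaw, integral_map measurable_prodMk_right.aemeasurable hm.aestronglyMeasurable]
  unfold streamLaw at hi ⊢
  -- For fixed clocks the inner integral over the sticking times is the value at their mean.
  rw [integral_prod _ hi]
  exact integral_congr_ae (.of_forall fun e => (integral_cycleGain_sticks κ hκ z z e Φ c).2.symm)

end

noncomputable section

/-! ### Trajectories that follow the event chain -/

variable {φ : ℝ → ℝ} {a : ℝ}

/-- The time of the `n`-th event, if the chain starts at time `θ`. -/
def eventTime (φ : ℝ → ℝ) (a θ : ℝ) (q : (ℝ × ℝ) × ClockStream) (n : ℕ) : ℝ :=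
  θ + totalGain φ a id 1 n q

/-- The flight time of the step that starts from `q`. -/
def flightOf (φ : ℝ → ℝ) (a : ℝ) (q : (ℝ × ℝ) × ClockStream) : ℝ := flightTime φ a q.1 (q.2.1 0)

/-- The sticking time of the step that starts from `q`. -/
def stickOf (φ : ℝ → ℝ) (a : ℝ) (q : (ℝ × ℝ) × ClockStream) : ℝ := stickDuration φ a q.1 q.2

/-- The trajectory `(x, v)` stays at `0` until `θ` and then follows the event chain. -/
structure FollowsChain (φ : ℝ → ℝ) (a : ℝ) (x v : ℝ → ℝ) (θ : ℝ) (q : (ℝ × ℝ) × ClockStream) :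
    Prop where
  start_nonneg : 0 ≤ θ
  velocity : q.1.2 = 1 ∨ q.1.2 = -1
  start_zero : ∀ s, 0 ≤ s → s < θ → x s = 0
  flight : ∀ n s, eventTime φ a θ q n ≤ s →
    s < eventTime φ a θ q n + flightOf φ a ((chainStep φ a)^[n] q) →
    x s = ((chainStep φ a)^[n] q).1.1 + ((chainStep φ a)^[n] q).1.2 * (s - eventTime φ a θ q n) ∧
    v s = ((chainStep φ a)^[n] q).1.2
  stuck : ∀ n s, eventTime φ a θ q n + flightOf φ a ((chainStep φ a)^[n] q) ≤ s →
    s < eventTime φ a θ q (n + 1) → x s = 0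
  flight_pos : ∀ n, 0 < flightOf φ a ((chainStep φ a)^[n] q)
  stick_nonneg : ∀ n, 0 ≤ stickOf φ a ((chainStep φ a)^[n] q)
  unbounded : Tendsto (eventTime φ a θ q) atTop atTop

lemma eventTime_succ (θ : ℝ) {q : (ℝ × ℝ) × ClockStream} (hq : q.1.2 = 1 ∨ q.1.2 = -1) (n : ℕ) :
    eventTime φ a θ q (n + 1) = eventTime φ a θ q n +
      (flightOf φ a ((chainStep φ a)^[n] q) + stickOf φ a ((chainStep φ a)^[n] q)) := by
  unfold eventTime totalGain
  rw [Finset.sum_range_succ, stepGain_id_eq_flightTime (iterate_chainStep_snd hq n)]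
  simp only [flightOf, stickOf]; ring

lemma firstTime_eq {S : Set ℝ} {m : ℝ} (hm : m ∈ S) (h : ∀ s ∈ S, m ≤ s) :
    firstTime S = ENNReal.ofReal m :=
  le_antisymm (iInf₂_le m hm) (le_iInf₂ fun s hs => ENNReal.ofReal_le_ofReal (h s hs))

lemma nonempty_of_firstTime_lt_top {S : Set ℝ} (h : firstTime S < ∞) : S.Nonempty := by
  by_contra hne
  rw [Set.not_nonempty_iff_eq_empty] at hne
  simp [firstTime, hne] at h

namespace FollowsChain

variable {x v : ℝ → ℝ} {θ : ℝ} {q : (ℝ × ℝ) × ClockStream}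

lemma strictMono (h : FollowsChain φ a x v θ q) : StrictMono (eventTime φ a θ q) := by
  refine strictMono_nat_of_lt_succ fun n => ?_
  rw [eventTime_succ θ h.velocity]
  linarith [h.flight_pos n, h.stick_nonneg n]

lemma eventTime_zero : eventTime φ a θ q 0 = θ := by simp [eventTime, totalGain]

lemma eventTime_nonneg (h : FollowsChain φ a x v θ q) (n : ℕ) : 0 ≤ eventTime φ a θ q n := by
  have := h.strictMono.monotone (Nat.zero_le n)
  rw [eventTime_zero] at this
  exact h.start_nonneg.trans this

lemma exists_step (h : FollowsChain φ a x v θ q) {s : ℝ} (hs : θ ≤ s) :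
    ∃ n, eventTime φ a θ q n ≤ s ∧ s < eventTime φ a θ q (n + 1) := by
  classical
  have hex : ∃ n, s < eventTime φ a θ q n := (h.unbounded.eventually_gt_atTop s).exists
  have h1 := Nat.find_spec hex
  have h0 : Nat.find hex ≠ 0 := fun h0 => by
    rw [h0, eventTime_zero] at h1; linarith
  obtain ⟨n, hn⟩ := Nat.exists_eq_succ_of_ne_zero h0
  refine ⟨n, not_lt.1 (Nat.find_min hex (by omega)), ?_⟩
  rw [hn] at h1; exact h1

/-- The trajectory is at `(a, b)` exactly at the events at which the chain is at `(a, b)`. -/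
lemma visit_iff (h : FollowsChain φ a x v θ q) (ha : a ≠ 0) {b s : ℝ} (hs : 0 ≤ s) :
    (x s = a ∧ v s = b) ↔ ∃ n, s = eventTime φ a θ q n ∧ ((chainStep φ a)^[n] q).1 = (a, b) := by
  constructor
  · rintro ⟨hx, hv⟩
    rcases lt_or_ge s θ with h1 | h1
    · exact absurd (hx.symm.trans (h.start_zero s hs h1)) ha
    · obtain ⟨n, h2, h3⟩ := h.exists_step h1
      rcases lt_or_ge s (eventTime φ a θ q n + flightOf φ a ((chainStep φ a)^[n] q)) with h4 | h4
      · obtain ⟨h5, h6⟩ := h.flight n s h2 h4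
        rcases h2.lt_or_eq with h7 | h7
        -- At a visit strictly inside a flight, `a` would lie ahead at a distance shorter than the
        -- flight, whereas the horizon ends the flight at `a`.
        · exfalso
          set s' := ((chainStep φ a)^[n] q).1 with hs'
          have hv' : s'.2 = 1 ∨ s'.2 = -1 := iterate_chainStep_snd h.velocity n
          have h8 : (a - s'.1) * s'.2 = s - eventTime φ a θ q n := by
            have h11 : a - s'.1 = s'.2 * (s - eventTime φ a θ q n) := by linarith
            rw [h11]; rcases hv' with h | h <;> rw [h] <;> ring
          have h9 : timeAhead s' a = s - eventTime φ a θ q n := by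
            rw [timeAhead, h8, if_pos (by linarith)]
          have h10 : flightOf φ a ((chainStep φ a)^[n] q) ≤ horizon a s' := by
            unfold flightOf flightTime
            split_ifs with hf
            · by_contra hcon
              have : flightTime φ a s' (((chainStep φ a)^[n] q).2.1 0) ≤ horizon a s' := by
                rw [flightTime, if_pos hf]
                exact csInf_le ⟨0, fun t ht => ht.1⟩ ⟨(horizon_pos s').le, le_of_lt hf⟩
              rw [flightTime, if_pos hf] at this
              exact hcon this
            · exact le_rfl
          have := horizon_le_target (a := a) s'
          linarith
        · refine ⟨n, h7.symm, ?_⟩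
          rw [← h7, sub_self, mul_zero, add_zero] at h5
          exact Prod.ext (h5.symm.trans (by rw [h7]; exact hx)) (h6.symm.trans hv)
      · exact absurd (hx.symm.trans (h.stuck n s h4 h3)) ha
  · rintro ⟨n, rfl, hn⟩
    obtain ⟨h5, h6⟩ := h.flight n _ le_rfl (by linarith [h.flight_pos n])
    rw [h5, h6, hn]; simp

end FollowsChain

/-- The number of events until the first visit to `z`, which may take place at time zero. -/
def firstVisit (φ : ℝ → ℝ) (a : ℝ) (z : ℝ × ℝ) (q : (ℝ × ℝ) × ClockStream) : ℕ :=
  sInf {n | ((chainStep φ a)^[n] q).1 = z}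

lemma visits_iterate {z : ℝ × ℝ} {q : (ℝ × ℝ) × ClockStream} {n : ℕ} :
    Visits φ a z ((chainStep φ a)^[n] q) ↔ ∃ m, n < m ∧ ((chainStep φ a)^[m] q).1 = z := by
  unfold Visits
  constructor
  · rintro ⟨m, hm⟩
    refine ⟨m + 1 + n, by omega, ?_⟩
    rwa [Function.iterate_add_apply]
  · rintro ⟨m, hm, hz⟩
    obtain ⟨k, rfl⟩ := Nat.exists_eq_add_of_lt hm
    refine ⟨k, ?_⟩
    rw [← Function.iterate_add_apply, show k + 1 + n = n + k + 1 by omega]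
    exact hz

namespace FollowsChain

variable {Ω : Type*} {X Y : ℝ → Ω → ℝ} {ω : Ω} {θ : ℝ} {q : (ℝ × ℝ) × ClockStream} {b : ℝ}

lemma exists_of_regenTime₀ (h : FollowsChain φ a (fun t => X t ω) (fun t => Y t ω) θ q) (ha : a ≠ 0)
    (h0 : regenTime₀ X Y a b ω < ∞) : ∃ n, ((chainStep φ a)^[n] q).1 = (a, b) := by
  obtain ⟨t, ht0, ht⟩ := nonempty_of_firstTime_lt_top h0
  obtain ⟨n, -, hn⟩ := (h.visit_iff ha ht0).1 ht
  exact ⟨n, hn⟩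

lemma firstVisit_spec (hq : ∃ n, ((chainStep φ a)^[n] q).1 = (a, b)) :
    ((chainStep φ a)^[firstVisit φ a (a, b) q] q).1 = (a, b) :=
  Nat.sInf_mem hq

lemma regenTime₀_eq (h : FollowsChain φ a (fun t => X t ω) (fun t => Y t ω) θ q) (ha : a ≠ 0)
    (hq : ∃ n, ((chainStep φ a)^[n] q).1 = (a, b)) :
    regenTime₀ X Y a b ω = ENNReal.ofReal (eventTime φ a θ q (firstVisit φ a (a, b) q)) := by
  refine firstTime_eq ?_ ?_
  · exact ⟨h.eventTime_nonneg _, (h.visit_iff ha (h.eventTime_nonneg _)).2 ⟨_, rfl, firstVisit_spec hq⟩⟩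
  · rintro s ⟨hs0, hs⟩
    obtain ⟨n, rfl, hn⟩ := (h.visit_iff ha hs0).1 hs
    exact h.strictMono.monotone (Nat.sInf_le hn)

lemma visits_of_regenTime₁ (h : FollowsChain φ a (fun t => X t ω) (fun t => Y t ω) θ q) (ha : a ≠ 0)
    (hq : ∃ n, ((chainStep φ a)^[n] q).1 = (a, b)) (h1 : regenTime₁ X Y a b ω < ∞) :
    Visits φ a (a, b) ((chainStep φ a)^[firstVisit φ a (a, b) q] q) := by
  obtain ⟨t, ht0, ht1, ht⟩ := nonempty_of_firstTime_lt_top h1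
  obtain ⟨n, rfl, hn⟩ := (h.visit_iff ha ht0).1 ht
  rw [h.regenTime₀_eq ha hq, ENNReal.ofReal_lt_ofReal_iff_of_nonneg (h.eventTime_nonneg _)] at ht1
  exact visits_iterate.2 ⟨n, h.strictMono.lt_iff_lt.1 ht1, hn⟩

/-- Event times increase strictly, so the first later visit in time is the first later visit in the
chain. The index of the second is relative to the first, hence the sum. -/
lemma regenTime₁_eq (h : FollowsChain φ a (fun t => X t ω) (fun t => Y t ω) θ q) (ha : a ≠ 0)
    (hq : ∃ n, ((chainStep φ a)^[n] q).1 = (a, b))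
    (hv : Visits φ a (a, b) ((chainStep φ a)^[firstVisit φ a (a, b) q] q)) :
    regenTime₁ X Y a b ω = ENNReal.ofReal (eventTime φ a θ q (firstVisit φ a (a, b) q +
      visitIndex φ a (a, b) ((chainStep φ a)^[firstVisit φ a (a, b) q] q))) := by
  set N := firstVisit φ a (a, b) q
  set M := visitIndex φ a (a, b) ((chainStep φ a)^[N] q) with hM
  have hMpos : 0 < M := Nat.succ_pos _
  have hmem : ((chainStep φ a)^[N + M] q).1 = (a, b) := by
    rw [add_comm, Function.iterate_add_apply]
    exact iterate_visitIndex_fst hv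
  have hreg := h.regenTime₀_eq ha hq
  refine firstTime_eq ?_ ?_
  · refine ⟨h.eventTime_nonneg _, ?_, (h.visit_iff ha (h.eventTime_nonneg _)).2 ⟨_, rfl, hmem⟩⟩
    rw [hreg, ENNReal.ofReal_lt_ofReal_iff_of_nonneg (h.eventTime_nonneg _)]
    exact h.strictMono (by omega)
  · rintro s ⟨hs0, hs1, hs⟩
    obtain ⟨n, rfl, hn⟩ := (h.visit_iff ha hs0).1 hs
    rw [hreg, ENNReal.ofReal_lt_ofReal_iff_of_nonneg (h.eventTime_nonneg _)] at hs1
    have hlt := h.strictMono.lt_iff_lt.1 hs1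
    obtain ⟨k, rfl⟩ := Nat.exists_eq_add_of_lt hlt
    refine h.strictMono.monotone ?_
    have : M ≤ k + 1 := by
      refine Nat.succ_le_succ (Nat.sInf_le ?_)
      simp only [Set.mem_ofPred_eq]
      rw [← Function.iterate_add_apply, show k + 1 + N = N + k + 1 by omega]
      exact hn
    omega

end FollowsChain

/-! ### Integrals along a trajectory -/

namespace FollowsChain

variable {x v : ℝ → ℝ} {θ : ℝ} {q : (ℝ × ℝ) × ClockStream} {f : ℝ → ℝ}

lemma integral_start (h : FollowsChain φ a x v θ q) :
    IntervalIntegrable (fun s => f (x s)) volume 0 θ ∧ ∫ s in (0 : ℝ)..θ, f (x s) = f 0 * θ := by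
  have he : Set.EqOn (fun s => f (x s)) (fun _ => f 0) (Set.Ioo 0 θ) := fun s hs => by
    simp only [h.start_zero s hs.1.le hs.2]
  constructor
  · rw [intervalIntegrable_iff_integrableOn_Ioo_of_le h.start_nonneg,
      integrableOn_congr_fun he measurableSet_Ioo]
    simp
  · rw [intervalIntegral.integral_of_le h.start_nonneg, integral_Ioc_eq_integral_Ioo,
      setIntegral_congr_fun measurableSet_Ioo he]
    simp [h.start_nonneg]; ring

/-- The trajectory is an explicit ray during the flight and 0 while stuck; the pieces meet at null
sets and together make up `stepGain`. -/
lemma integral_step (h : FollowsChain φ a x v θ q) (hf : ∀ b c, IntervalIntegrable f volume b c) (n : ℕ) :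
    IntervalIntegrable (fun s => f (x s)) volume (eventTime φ a θ q n) (eventTime φ a θ q (n + 1)) ∧
    ∫ s in eventTime φ a θ q n..eventTime φ a θ q (n + 1), f (x s) =
      stepGain φ a (primitive f) (f 0) ((chainStep φ a)^[n] q) := by
  set r := (chainStep φ a)^[n] q with hr
  set t := eventTime φ a θ q n with ht
  set T := flightOf φ a r with hT
  have hrv : r.1.2 = 1 ∨ r.1.2 = -1 := iterate_chainStep_snd h.velocity n
  have hsucc : eventTime φ a θ q (n + 1) = t + T + stickOf φ a r := by
    rw [eventTime_succ θ h.velocity]; ring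
  have hT0 : 0 ≤ T := (h.flight_pos n).le
  have hD0 := h.stick_nonneg n
  have e1 : Set.EqOn (fun s => f (x s)) (fun s => f (r.1.1 + r.1.2 * (s - t))) (Set.Ioo t (t + T)) :=
    fun s hs => by simp only [(h.flight n s hs.1.le hs.2).1]; rfl
  have e2 : Set.EqOn (fun s => f (x s)) (fun _ => f 0) (Set.Ioo (t + T) (t + T + stickOf φ a r)) :=
    fun s hs => by simp only [h.stuck n s hs.1.le (by rw [hsucc]; exact hs.2)]
  have g1 : IntervalIntegrable (fun s => f (r.1.1 + r.1.2 * (s - t))) volume t (t + T) := by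
    have := (intervalIntegrable_ray hf hrv 0 T).comp_sub_right t
    simpa [add_comm] using this
  have i1 : IntervalIntegrable (fun s => f (x s)) volume t (t + T) := by
    rw [intervalIntegrable_iff_integrableOn_Ioo_of_le (by linarith),
      integrableOn_congr_fun e1 measurableSet_Ioo, ← intervalIntegrable_iff_integrableOn_Ioo_of_le (by linarith)]
    exact g1
  have i2 : IntervalIntegrable (fun s => f (x s)) volume (t + T) (t + T + stickOf φ a r) := by
    rw [intervalIntegrable_iff_integrableOn_Ioo_of_le (by linarith),
      integrableOn_congr_fun e2 measurableSet_Ioo]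
    simp
  rw [hsucc]
  refine ⟨i1.trans i2, ?_⟩
  rw [← intervalIntegral.integral_add_adjacent_intervals i1 i2, stepGain_primitive hf hrv]
  congr 1
  · rw [intervalIntegral.integral_of_le (by linarith), integral_Ioc_eq_integral_Ioo,
      setIntegral_congr_fun measurableSet_Ioo e1, ← integral_Ioc_eq_integral_Ioo,
      ← intervalIntegral.integral_of_le (by linarith),
      intervalIntegral.integral_comp_sub_right (fun s => f (r.1.1 + r.1.2 * s)) t]
    simp [hT, flightOf]
  · rw [intervalIntegral.integral_of_le (by linarith), integral_Ioc_eq_integral_Ioo,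
      setIntegral_congr_fun measurableSet_Ioo e2]
    simp only [integral_const, measureReal_restrict_apply_univ, smul_eq_mul]
    rw [Real.volume_real_Ioo_of_le (by linarith)]
    unfold stickOf; ring

lemma integral_steps (h : FollowsChain φ a x v θ q) (hf : ∀ b c, IntervalIntegrable f volume b c) (m n : ℕ) :
    IntervalIntegrable (fun s => f (x s)) volume (eventTime φ a θ q m) (eventTime φ a θ q (m + n)) ∧
    ∫ s in eventTime φ a θ q m..eventTime φ a θ q (m + n), f (x s) =
      totalGain φ a (primitive f) (f 0) n ((chainStep φ a)^[m] q) := by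
  induction n with
  | zero => simp [totalGain]
  | succ n ih =>
    have h1 := h.integral_step hf (m + n)
    refine ⟨ih.1.trans h1.1, ?_⟩
    rw [← add_assoc, ← intervalIntegral.integral_add_adjacent_intervals ih.1 h1.1, ih.2, h1.2]
    unfold totalGain
    rw [Finset.sum_range_succ, ← Function.iterate_add_apply, add_comm n m]

lemma intervalIntegrable (h : FollowsChain φ a x v θ q) (hf : ∀ b c, IntervalIntegrable f volume b c)
    {b c : ℝ} (hb : 0 ≤ b) (hc : 0 ≤ c) : IntervalIntegrable (fun s => f (x s)) volume b c := by
  have key : ∀ c, 0 ≤ c → IntervalIntegrable (fun s => f (x s)) volume 0 c := by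
    intro c hc
    obtain ⟨n, hn⟩ := (h.unbounded.eventually_ge_atTop c).exists
    have h1 := (h.integral_steps hf 0 n).1
    rw [zero_add, eventTime_zero] at h1
    refine ((h.integral_start (f := f)).1.trans h1).mono_set ?_
    rw [Set.uIcc_of_le hc, Set.uIcc_of_le (hc.trans hn)]
    exact Set.Icc_subset_Icc_right hn
  exact (key b hb).symm.trans (key c hc)

end FollowsChain

end

noncomputable section

/-! ### Velocities driven by exponential clocks -/

/-- The time of the `n`-th arrival. -/
def clockSum (e : ℕ → ℝ) (n : ℕ) : ℝ := ∑ j ∈ Finset.range n, e j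

lemma clockSum_succ (e : ℕ → ℝ) (n : ℕ) : clockSum e (n + 1) = clockSum e n + e n :=
  Finset.sum_range_succ _ _

lemma clockSum_zero (e : ℕ → ℝ) : clockSum e 0 = 0 := Finset.sum_range_zero _

lemma clockSum_strictMono {e : ℕ → ℝ} (he : ∀ j, 0 < e j) : StrictMono (clockSum e) :=
  strictMono_nat_of_lt_succ fun n => by rw [clockSum_succ]; linarith [he n]

/-- Positive clocks make the arrival times strictly increasing, so the set that is counted is an
initial segment. -/
lemma arrivalCount_eq {e : ℕ → ℝ} (he : ∀ j, 0 < e j) {n : ℕ} {c : ℝ} (h1 : clockSum e n ≤ c)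
    (h2 : c < clockSum e (n + 1)) : arrivalCount e c = n := by
  have hset : {k : ℕ | ∑ j ∈ Finset.range (k + 1), e j ≤ c} = Set.Iio n := by
    ext k
    simp only [Set.mem_ofPred_eq, Set.mem_Iio]
    have hm := (clockSum_strictMono he)
    constructor
    · intro hk
      have := hm.lt_iff_lt.1 (lt_of_le_of_lt hk h2)
      omega
    · intro hk
      exact (hm.monotone (show k + 1 ≤ n by omega)).trans h1
  unfold arrivalCount
  rw [hset, Set.ncard_Iio_nat]

/-- Divergence of the arrival times keeps the counted sets finite; an infinite set would have
`ncard` 0 and break the monotonicity. -/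
lemma monotone_arrivalCount {e : ℕ → ℝ} (he : ∀ j, 0 < e j)
    (hdiv : Tendsto (clockSum e) atTop atTop) : Monotone (arrivalCount e) := by
  intro c c' hcc
  refine Set.ncard_le_ncard (fun k hk => le_trans hk hcc) ?_
  obtain ⟨N, hN⟩ := (hdiv.eventually_gt_atTop c').exists
  refine (Set.finite_lt_nat N).subset fun k hk => ?_
  have : clockSum e (k + 1) < clockSum e N := lt_of_le_of_lt hk hN
  have := (clockSum_strictMono he).lt_iff_lt.1 this
  simp only [Set.mem_ofPred_eq]; omega

/-- The primitive of an arbitrary nonnegative function is measurable. -/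
lemma measurable_primitive_of_nonneg {g : ℝ → ℝ} (hg : ∀ s, 0 ≤ s → 0 ≤ g s) :
    Measurable fun t => ∫ s in (0 : ℝ)..max t 0, g s := by
  classical
  -- Integrability up to `t` holds for an interval of times, beyond which the integral has the
  -- default value 0. On this interval the primitive is a Lebesgue integral that is monotone in `t`,
  -- so nothing need be known about measurability of `g`.
  set A : Set ℝ := {t | IntervalIntegrable g volume 0 (max t 0)} with hA
  have hAm : MeasurableSet A := by
    refine Set.OrdConnected.measurableSet ⟨fun x hx y hy z hz => ?_⟩
    have hy' : IntervalIntegrable g volume 0 (max y 0) := hy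
    refine hy'.mono_set ?_
    rw [Set.uIcc_of_le (le_max_right _ _), Set.uIcc_of_le (le_max_right _ _)]
    exact Set.Icc_subset_Icc_right (max_le_max hz.2 le_rfl)
  have hL : Measurable fun t : ℝ => ∫⁻ s in Set.Ioc 0 (max t 0), ENNReal.ofReal (g s) := by
    refine Monotone.measurable fun t t' htt => ?_
    exact lintegral_mono_set (Set.Ioc_subset_Ioc_right (max_le_max htt le_rfl))
  have : (fun t => ∫ s in (0 : ℝ)..max t 0, g s) =
      fun t => if t ∈ A then (∫⁻ s in Set.Ioc 0 (max t 0), ENNReal.ofReal (g s)).toReal else 0 := by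
    ext t
    split_ifs with h
    · have hi : IntegrableOn g (Set.Ioc 0 (max t 0)) :=
        (intervalIntegrable_iff_integrableOn_Ioc_of_le (le_max_right _ _)).1 h
      rw [intervalIntegral.integral_of_le (le_max_right _ _),
        integral_eq_lintegral_of_nonneg_ae _ hi.1]
      exact (ae_restrict_mem measurableSet_Ioc).mono fun s hs => hg s hs.1.le
    · exact intervalIntegral.integral_undef h
  rw [this]
  exact Measurable.ite hAm hL.ennreal_toReal measurable_const

/-- Velocities that are flipped by clocks are measurable and bounded. -/
lemma intervalIntegrable_velocity {g v : ℝ → ℝ} {e : ℕ → ℝ} {v₀ : ℝ} (he : ∀ j, 0 < e j)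
    (hdiv : Tendsto (clockSum e) atTop atTop) (hg : ∀ s, 0 ≤ s → 0 ≤ g s)
    (hv₀ : v₀ = 1 ∨ v₀ = -1)
    (hv : ∀ t, 0 ≤ t → v t = v₀ * (-1) ^ arrivalCount e (∫ s in (0 : ℝ)..t, g s)) :
    (Measurable fun t => v (max t 0)) ∧ ∀ t, 0 ≤ t → v t = 1 ∨ v t = -1 := by
  constructor
  · have h1 : Measurable fun t => arrivalCount e (∫ s in (0 : ℝ)..max t 0, g s) :=
      (monotone_arrivalCount he hdiv).measurable.comp (measurable_primitive_of_nonneg hg)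
    have h2 : (fun t => v (max t 0)) =
        fun t => v₀ * (-1) ^ arrivalCount e (∫ s in (0 : ℝ)..max t 0, g s) := by
      ext t; exact hv _ (le_max_right _ _)
    rw [h2]
    exact ((measurable_from_nat (f := fun k : ℕ => (-1 : ℝ) ^ k)).comp h1).const_mul v₀
  · intro t ht
    rw [hv t ht]
    rcases neg_one_pow_eq_or ℝ (arrivalCount e (∫ s in (0 : ℝ)..t, g s)) with h | h <;>
      rcases hv₀ with h' | h' <;> simp [h, h']

/-! ### The motion between two arrivals -/

/-- The velocity `v` is flipped by the clocks `e` run at the rate `g`. -/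
structure ClockDriven (v g : ℝ → ℝ) (e : ℕ → ℝ) (v₀ : ℝ) : Prop where
  clock_pos : ∀ j, 0 < e j
  rate_nonneg : ∀ s, 0 ≤ s → 0 ≤ g s
  rate_integrable : ∀ b c, 0 ≤ b → 0 ≤ c → IntervalIntegrable g volume b c
  velocity : ∀ t, 0 ≤ t → v t = v₀ * (-1) ^ arrivalCount e (∫ s in (0 : ℝ)..t, g s)

namespace ClockDriven

variable {v g : ℝ → ℝ} {e : ℕ → ℝ} {v₀ : ℝ}

lemma integral_add (h : ClockDriven v g e v₀) {b c : ℝ} (hb : 0 ≤ b) (hc : 0 ≤ c) :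
    ∫ s in (0 : ℝ)..c, g s = (∫ s in (0 : ℝ)..b, g s) + ∫ s in b..c, g s :=
  (intervalIntegral.integral_add_adjacent_intervals (h.rate_integrable 0 b le_rfl hb)
    (h.rate_integrable b c hb hc)).symm

lemma integral_mono (h : ClockDriven v g e v₀) {b c : ℝ} (hb : 0 ≤ b) (hbc : b ≤ c) :
    ∫ s in (0 : ℝ)..b, g s ≤ ∫ s in (0 : ℝ)..c, g s := by
  rw [h.integral_add hb (hb.trans hbc)]
  have : 0 ≤ ∫ s in b..c, g s :=
    intervalIntegral.integral_nonneg hbc fun s hs => h.rate_nonneg s (hb.trans hs.1)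
  linarith

lemma continuousOn_integral (h : ClockDriven v g e v₀) :
    ContinuousOn (fun t => ∫ s in (0 : ℝ)..t, g s) (Set.Ici 0) := by
  intro t ht
  have ht' : (0 : ℝ) ≤ t + 1 := by linarith [Set.mem_Ici.1 ht]
  have h1 := intervalIntegral.continuousOn_primitive_interval
    ((intervalIntegrable_iff_integrableOn_Icc_of_le ht').1 (h.rate_integrable 0 (t + 1) le_rfl ht') |> fun h => by
      rwa [← Set.uIcc_of_le ht'] at h)
  rw [Set.uIcc_of_le ht'] at h1
  have h2 := h1 t ⟨ht, by linarith⟩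
  refine h2.mono_of_mem_nhdsWithin ?_
  rw [mem_nhdsWithin]
  exact ⟨Set.Iio (t + 1), isOpen_Iio, by simp, fun s hs => ⟨hs.2, le_of_lt hs.1⟩⟩

/-- As long as the integrated rate stays below the next arrival the velocity does not change. -/
lemma flight (h : ClockDriven v g e v₀) {φ : ℝ → ℝ} {s : ℝ × ℝ} {t T : ℝ}
    (ht : 0 ≤ t) {n : ℕ} (hn1 : clockSum e n ≤ ∫ s in (0 : ℝ)..t, g s) (hs : s.2 = v₀ * (-1) ^ n)
    (H : ∀ σ, t ≤ σ → σ ≤ t + T → (∀ r, t ≤ r → r < σ → v r = s.2) →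
      ∀ r, t < r → r < σ → g r = flipRate φ (s.1 + s.2 * (r - t)) s.2)
    (hT : ∀ c, 0 ≤ c → c < T → cumRate φ s c < clockSum e (n + 1) - ∫ s in (0 : ℝ)..t, g s) :
    (∀ r, t ≤ r → r < t + T → v r = s.2) ∧
    ∀ r, t ≤ r → r ≤ t + T → ∫ s in (0 : ℝ)..r, g s = (∫ s in (0 : ℝ)..t, g s) + cumRate φ s (r - t) := by
  set R : ℝ → ℝ := fun r => ∫ s in (0 : ℝ)..r, g s with hR
  have hcum : ∀ σ, t ≤ σ → σ ≤ t + T → (∀ r, t ≤ r → r < σ → v r = s.2) →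
      R σ = R t + cumRate φ s (σ - t) := by
    intro σ h1 h2 h3
    simp only [hR]
    rw [h.integral_add ht (ht.trans h1)]
    congr 1
    unfold cumRate
    have h4 := intervalIntegral.integral_comp_sub_right (a := t) (b := σ)
      (fun r => flipRate φ (s.1 + s.2 * r) s.2) t
    rw [sub_self] at h4
    rw [← h4, intervalIntegral.integral_of_le h1, intervalIntegral.integral_of_le h1,
      integral_Ioc_eq_integral_Ioo, integral_Ioc_eq_integral_Ioo]
    exact setIntegral_congr_fun measurableSet_Ioo fun r hr => H σ h1 h2 h3 r hr.1 hr.2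
  have hvel : ∀ r, t ≤ r → R r < clockSum e (n + 1) → v r = s.2 := by
    intro r h1 h2
    rw [h.velocity r (ht.trans h1), hs,
      arrivalCount_eq h.clock_pos (hn1.trans (h.integral_mono ht h1)) h2]
  -- The rate depends on the velocity it controls, so argue by a first violation σ. Before σ the
  -- velocity is constant and the integrated rate is `R t + cumRate`, which by `hT` is still below
  -- the next arrival at σ.
  have hlt : ∀ r, t ≤ r → r < t + T → R r < clockSum e (n + 1) := by
    by_contra hcon
    push Not at hcon
    obtain ⟨r, hr1, hr2, hr3⟩ := hcon
    set A : Set ℝ := Set.Icc t r ∩ {r' | clockSum e (n + 1) ≤ R r'} with hA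
    have hAclosed : IsClosed A := by
      have hc : ContinuousOn R (Set.Icc t r) :=
        h.continuousOn_integral.mono fun y hy => ht.trans hy.1
      exact hc.preimage_isClosed_of_isClosed isClosed_Icc isClosed_Ici
    have hAne : A.Nonempty := ⟨r, ⟨hr1, le_rfl⟩, hr3⟩
    have hAbdd : BddBelow A := ⟨t, fun y hy => hy.1.1⟩
    have hσ := hAclosed.csInf_mem hAne hAbdd
    set σ := sInf A
    have hbefore : ∀ r', t ≤ r' → r' < σ → v r' = s.2 := by
      intro r' h1 h2
      refine hvel r' h1 (not_le.1 fun h3 => ?_)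
      exact absurd (csInf_le hAbdd ⟨⟨h1, h2.le.trans hσ.1.2⟩, h3⟩) (not_le.2 h2)
    have h1 := hcum σ hσ.1.1 (hσ.1.2.trans hr2.le) hbefore
    have h2 := hT (σ - t) (by linarith [hσ.1.1]) (by linarith [hσ.1.2])
    have h3 : clockSum e (n + 1) ≤ R σ := hσ.2
    linarith
  have h1 : ∀ r, t ≤ r → r < t + T → v r = s.2 := fun r h1 h2 => hvel r h1 (hlt r h1 h2)
  exact ⟨h1, fun r h2 h3 => hcum r h2 h3 fun r' h4 h5 => h1 r' h4 (h5.trans_le h3)⟩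

end ClockDriven

/-! ### The event times do not accumulate -/

variable {φ : ℝ → ℝ} {a : ℝ}

open Classical in
/-- The number of flips in the first `m` steps. -/
def flipCount (φ : ℝ → ℝ) (a : ℝ) (q : (ℝ × ℝ) × ClockStream) (m : ℕ) : ℕ :=
  ∑ j ∈ Finset.range m, if FlipsFirst φ a ((chainStep φ a)^[j] q).1 (((chainStep φ a)^[j] q).2.1 0)
    then 1 else 0

open Classical in
/-- The number of sticking times in the first `m` steps. -/
def stickCount (φ : ℝ → ℝ) (a : ℝ) (q : (ℝ × ℝ) × ClockStream) (m : ℕ) : ℕ :=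
  ∑ j ∈ Finset.range m, if SticksAtZero φ a ((chainStep φ a)^[j] q).1 (((chainStep φ a)^[j] q).2.1 0)
    then 1 else 0

open Classical in
/-- The number of the points `0` and `a` that lie ahead. -/
def targetsAhead (a : ℝ) (s : ℝ × ℝ) : ℝ :=
  (if 0 < (0 - s.1) * s.2 then 1 else 0) + (if 0 < (a - s.1) * s.2 then 1 else 0)

lemma targetsAhead_nonneg (s : ℝ × ℝ) : 0 ≤ targetsAhead a s := by
  unfold targetsAhead; positivity

lemma targetsAhead_le (s : ℝ × ℝ) : targetsAhead a s ≤ 2 := by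
  unfold targetsAhead; split_ifs <;> norm_num

open Classical in
lemma ahead_horizon_le {s : ℝ × ℝ} (hs : s.2 = 1 ∨ s.2 = -1) (c : ℝ) :
    (if 0 < (c - (s.1 + s.2 * horizon a s)) * s.2 then (1 : ℝ) else 0) ≤
      if 0 < (c - s.1) * s.2 then 1 else 0 := by
  have h0 := horizon_pos (a := a) s
  have : (c - (s.1 + s.2 * horizon a s)) * s.2 = (c - s.1) * s.2 - horizon a s := by
    rcases hs with h | h <;> rw [h] <;> ring
  rw [this]
  split_ifs with h1 h2 <;> linarith

open Classical in
lemma ahead_horizon_eq {s : ℝ × ℝ} (hs : s.2 = 1 ∨ s.2 = -1) {c : ℝ} (hc : horizon a s = timeAhead s c)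
    (h1 : horizon a s < 1) :
    (if 0 < (c - (s.1 + s.2 * horizon a s)) * s.2 then (1 : ℝ) else 0) + 1 =
      if 0 < (c - s.1) * s.2 then 1 else 0 := by
  have : (c - (s.1 + s.2 * horizon a s)) * s.2 = (c - s.1) * s.2 - horizon a s := by
    rcases hs with h | h <;> rw [h] <;> ring
  rw [this]
  unfold timeAhead at hc
  split_ifs at hc with h2
  · rw [if_neg (by rw [hc]; simp), if_pos h2]; ring
  · linarith

/-- A step without a flip takes at least the time `1`, unless it passes `0` or `a`. -/
lemma one_le_horizon_add {s : ℝ × ℝ} (hs : s.2 = 1 ∨ s.2 = -1) :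
    targetsAhead a (s.1 + s.2 * horizon a s, s.2) + 1 ≤ targetsAhead a s + horizon a s := by
  have e1 := ahead_horizon_le (a := a) hs 0
  have e2 := ahead_horizon_le (a := a) hs a
  have h0 := horizon_pos (a := a) s
  unfold targetsAhead
  -- A horizon shorter than 1 is the distance to 0 or to `a`, and that point is no longer ahead
  -- after the step.
  rcases (horizon_le_one (a := a) s).lt_or_eq with h | h
  · rcases min_choice (timeAhead s 0) (timeAhead s a) with h2 | h2
    · have h3 : horizon a s = timeAhead s 0 := by
        unfold horizon at h ⊢
        rw [h2] at h ⊢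
        rcases min_choice 1 (timeAhead s 0) with h4 | h4
        · rw [h4] at h; exact absurd h (lt_irrefl _)
        · exact h4
      have := ahead_horizon_eq hs h3 h
      simp only at this e1 e2 ⊢
      linarith
    · have h3 : horizon a s = timeAhead s a := by
        unfold horizon at h ⊢
        rw [h2] at h ⊢
        rcases min_choice 1 (timeAhead s a) with h4 | h4
        · rw [h4] at h; exact absurd h (lt_irrefl _)
        · exact h4
      have := ahead_horizon_eq hs h3 h
      simp only at this e1 e2 ⊢
      linarith
  · simp only at e1 e2 ⊢
    linarith

/-- If the event times stayed bounded there would be a last flip. After it, each step raises the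
event time minus the number of points 0 and `a` ahead by at least 1 (`one_le_horizon_add`); as that
number is at most 2, the event times would diverge after all. -/
lemma tendsto_eventTime {θ : ℝ} {q : (ℝ × ℝ) × ClockStream} (hq : q.1.2 = 1 ∨ q.1.2 = -1)
    (hD : ∀ k, 0 ≤ q.2.2 k)
    (hbd : ∀ B, ∃ N, ∀ m, eventTime φ a θ q m ≤ B → flipCount φ a q m ≤ N) :
    Tendsto (eventTime φ a θ q) atTop atTop := by
  classical
  have hst : ∀ n, 0 ≤ stickOf φ a ((chainStep φ a)^[n] q) := fun n =>
    stickDuration_nonneg (iterate_chainStep_nonneg hD n 0)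
  have hmono : Monotone (eventTime φ a θ q) := by
    refine monotone_nat_of_le_succ fun n => ?_
    rw [eventTime_succ θ hq]
    have : 0 ≤ flightOf φ a ((chainStep φ a)^[n] q) := flightTime_nonneg _ _
    linarith [hst n]
  refine tendsto_atTop_atTop_of_monotone hmono fun B => ?_
  by_contra hcon
  push Not at hcon
  obtain ⟨N, hN⟩ := hbd B
  have hle : ∀ m, flipCount φ a q m ≤ N := fun m => hN m (hcon m).le
  -- The bounded count of flips attains its maximum at some `m₀`; from there on no step ends with a
  -- flip.
  obtain ⟨m₀, hm₀⟩ : ∃ m₀, ∀ m, flipCount φ a q m ≤ flipCount φ a q m₀ := by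
    have hfin : (Set.range (flipCount φ a q)).Finite :=
      (Set.finite_le_nat N).subset (by rintro _ ⟨m, rfl⟩; exact hle m)
    obtain ⟨y, ⟨m₀, rfl⟩, hy⟩ := hfin.exists_maximal (Set.range_nonempty _)
    refine ⟨m₀, fun m => ?_⟩
    by_contra hlt
    exact hlt (hy ⟨m, rfl⟩ (le_of_lt (not_le.1 hlt)))
  have hcmono : Monotone (flipCount φ a q) := by
    refine monotone_nat_of_le_succ fun n => ?_
    unfold flipCount
    rw [Finset.sum_range_succ]; omega
  have hno : ∀ m, m₀ ≤ m → ¬ FlipsFirst φ a ((chainStep φ a)^[m] q).1 (((chainStep φ a)^[m] q).2.1 0) := by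
    intro m hm hf
    have h1 : flipCount φ a q (m + 1) = flipCount φ a q m + 1 := by
      unfold flipCount
      rw [Finset.sum_range_succ, if_pos hf]
    have h2 := hm₀ (m + 1)
    have h3 := hcmono hm
    omega
  have hgrow : ∀ j : ℕ, eventTime φ a θ q m₀ - targetsAhead a ((chainStep φ a)^[m₀] q).1 + j ≤
      eventTime φ a θ q (m₀ + j) - targetsAhead a ((chainStep φ a)^[m₀ + j] q).1 := by
    intro j
    induction j with
    | zero => simp
    | succ j ih =>
      have hf := hno (m₀ + j) (by omega)
      rw [← add_assoc, eventTime_succ θ hq, Function.iterate_succ_apply']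
      set r := (chainStep φ a)^[m₀ + j] q
      have h1 : (chainStep φ a r).1 = (r.1.1 + r.1.2 * horizon a r.1, r.1.2) := by
        simp [chainStep, nextState, hf, flightTime_of_not_flipsFirst hf]
      have h2 : flightOf φ a r = horizon a r.1 := flightTime_of_not_flipsFirst hf
      rw [h1, h2]
      have h3 := one_le_horizon_add (a := a) (iterate_chainStep_snd hq (m₀ + j) : r.1.2 = 1 ∨ r.1.2 = -1)
      have h4 := hst (m₀ + j)
      push_cast
      linarith
  obtain ⟨j, hj⟩ := exists_nat_gt (B + 2 - eventTime φ a θ q m₀)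
  have h1 := hgrow j
  have h2 := targetsAhead_le (a := a) ((chainStep φ a)^[m₀] q).1
  have h3 := targetsAhead_nonneg (a := a) ((chainStep φ a)^[m₀ + j] q).1
  linarith [hcon (m₀ + j)]

end

noncomputable section

/-! ### The original sticky sampler follows the event chain -/

lemma continuousOn_primitive_Ici {h : ℝ → ℝ} (hi : ∀ t, 0 ≤ t → IntervalIntegrable h volume 0 t) :
    ContinuousOn (fun t => ∫ s in (0 : ℝ)..t, h s) (Set.Ici 0) := by
  intro t ht
  have ht' : (0 : ℝ) ≤ t + 1 := by linarith [Set.mem_Ici.1 ht]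
  have h0 : IntegrableOn h (Set.uIcc 0 (t + 1)) := by
    rw [Set.uIcc_of_le ht']
    exact (intervalIntegrable_iff_integrableOn_Icc_of_le ht').1 (hi _ ht')
  have h1 := intervalIntegral.continuousOn_primitive_interval h0
  rw [Set.uIcc_of_le ht'] at h1
  refine (h1 t ⟨ht, by linarith⟩).mono_of_mem_nhdsWithin ?_
  rw [mem_nhdsWithin]
  exact ⟨Set.Iio (t + 1), isOpen_Iio, by simp, fun s hs => ⟨hs.2, le_of_lt hs.1⟩⟩

lemma intervalIntegrable_of_measurable_bounded {h : ℝ → ℝ} (hm : Measurable fun t => h (max t 0))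
    {t K : ℝ} (ht : 0 ≤ t) (hK : ∀ s, 0 ≤ s → s ≤ t → |h s| ≤ K) :
    IntervalIntegrable h volume 0 t := by
  rw [intervalIntegrable_iff_integrableOn_Ioc_of_le ht]
  have he : Set.EqOn h (fun s => h (max s 0)) (Set.Ioc 0 t) := fun s hs => by
    simp only [max_eq_left hs.1.le]
  rw [integrableOn_congr_fun he measurableSet_Ioc]
  refine Measure.integrableOn_of_bounded (M := K) (by simp) hm.aestronglyMeasurable ?_
  refine (ae_restrict_mem measurableSet_Ioc).mono fun s hs => ?_
  rw [max_eq_left hs.1.le]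
  exact hK s hs.1.le hs.2

lemma abs_flipRate_le (ψ : ℝ → ℝ) (x : ℝ) {v : ℝ} (hv : v = 1 ∨ v = -1) :
    |flipRate ψ x v| ≤ |ψ x| := by
  rw [abs_of_nonneg (flipRate_nonneg _ _)]
  refine max_le (abs_nonneg _) ?_
  rcases hv with rfl | rfl
  · simpa using le_abs_self (ψ x)
  · simpa using neg_le_abs (ψ x)

/-- The regularity of a trajectory that moves with a velocity flipped by clocks. -/
lemma driven_regularity {ψ : ℝ → ℝ} (hψ : Measurable ψ) (hψb : ∀ B, ∃ K, ∀ y, |y| ≤ B → |ψ y| ≤ K)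
    {M : Set ℝ} (hM : MeasurableSet M) {x v : ℝ → ℝ} {x₀ v₀ : ℝ} {e : ℕ → ℝ} (he : ∀ j, 0 < e j)
    (hdiv : Tendsto (clockSum e) atTop atTop) (hv₀ : v₀ = 1 ∨ v₀ = -1)
    (hx : ∀ t, 0 ≤ t → x t = x₀ + ∫ s in (0 : ℝ)..t, M.indicator v s)
    (hv : ∀ t, 0 ≤ t → v t = v₀ * (-1) ^ arrivalCount e
      (∫ s in (0 : ℝ)..t, M.indicator (fun s => flipRate ψ (x s) (v s)) s)) :
    ContinuousOn x (Set.Ici 0) ∧ (∀ t, 0 ≤ t → IntervalIntegrable (M.indicator v) volume 0 t) ∧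
    (∀ t, 0 ≤ t → v t = 1 ∨ v t = -1) ∧
    ClockDriven v (M.indicator fun s => flipRate ψ (x s) (v s)) e v₀ := by
  classical
  have hg : ∀ s, 0 ≤ s → 0 ≤ M.indicator (fun s => flipRate ψ (x s) (v s)) s := fun s _ =>
    Set.indicator_nonneg (fun s _ => flipRate_nonneg _ _) s
  -- The order matters: the velocity is measurable before the rate is known to be integrable; then
  -- the position is continuous; then the rate is bounded on compact intervals and hence integrable.
  obtain ⟨hvm, hvu⟩ := intervalIntegrable_velocity he hdiv hg hv₀ hv
  have hmax : Measurable fun t : ℝ => max t 0 := measurable_id.max measurable_const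
  have hvi : ∀ t, 0 ≤ t → IntervalIntegrable (M.indicator v) volume 0 t := by
    intro t ht
    refine intervalIntegrable_of_measurable_bounded (K := 1) ?_ ht fun s hs _ => ?_
    · exact Measurable.ite (hmax hM) hvm measurable_const
    · rw [Set.indicator_apply]
      split_ifs
      · rcases hvu s hs with h | h <;> simp [h]
      · simp
  have hxc : ContinuousOn x (Set.Ici 0) :=
    (continuousOn_const.add (continuousOn_primitive_Ici hvi)).congr fun t ht => hx t ht
  refine ⟨hxc, hvi, hvu, ⟨he, hg, ?_, hv⟩⟩
  have hxm : Continuous fun t => x (max t 0) :=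
    hxc.comp_continuous (by fun_prop) fun t => le_max_right t 0
  have key : ∀ t, 0 ≤ t →
      IntervalIntegrable (M.indicator fun s => flipRate ψ (x s) (v s)) volume 0 t := by
    intro t ht
    obtain ⟨B, hB⟩ := (isCompact_Icc (a := (0 : ℝ)) (b := t)).exists_bound_of_continuousOn
      (hxc.mono fun y hy => hy.1)
    obtain ⟨K, hK⟩ := hψb B
    refine intervalIntegrable_of_measurable_bounded (K := max K 0) ?_ ht fun s hs hs' => ?_
    · refine Measurable.ite (hmax hM) ?_ measurable_const
      exact measurable_const.max (hvm.mul (hψ.comp hxm.measurable))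
    · rw [Set.indicator_apply]
      split_ifs
      · exact (abs_flipRate_le ψ _ (hvu s hs)).trans ((hK _ (hB s ⟨hs, hs'⟩)).trans (le_max_left _ _))
      · simp
  exact fun b c hb hc => (key b hb).symm.trans (key c hc)

lemma driven_motion {M : Set ℝ} {x v : ℝ → ℝ} {x₀ : ℝ}
    (hx : ∀ t, 0 ≤ t → x t = x₀ + ∫ s in (0 : ℝ)..t, M.indicator v s)
    (hvi : ∀ t, 0 ≤ t → IntervalIntegrable (M.indicator v) volume 0 t) {t r c : ℝ} (ht : 0 ≤ t)
    (htr : t ≤ r) (hc : ∀ r', t < r' → r' < r → M.indicator v r' = c) :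
    x r = x t + c * (r - t) := by
  rw [hx r (ht.trans htr), hx t ht, ← intervalIntegral.integral_add_adjacent_intervals (hvi t ht)
    ((hvi t ht).symm.trans (hvi r (ht.trans htr)))]
  have : ∫ s in t..r, M.indicator v s = c * (r - t) := by
    rw [intervalIntegral.integral_of_le htr, integral_Ioc_eq_integral_Ioo,
      setIntegral_congr_fun measurableSet_Ioo fun s hs => hc s hs.1 hs.2]
    simp [htr]; ring
  rw [this]; ring

/-- The streams of residual clocks and of unused sticking times. -/
def residualStream (e D : ℕ → ℝ) (c : ℝ) (n k : ℕ) : ClockStream :=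
  (seqCons (clockSum e (n + 1) - c) (fun j => e (n + 1 + j)), fun j => D (k + j))

lemma residualStream_zero (e D : ℕ → ℝ) (k : ℕ) :
    residualStream e D 0 0 k = (e, fun j => D (k + j)) := by
  unfold residualStream
  congr 1
  ext j
  cases j with
  | zero => simp [clockSum]
  | succ j => simp [seqCons, add_comm]

variable {φ : ℝ → ℝ} {a : ℝ}

-- Here `c` is the rate integrated so far. A flip exhausts the current clock and passes to the next
-- arrival; otherwise the clock is reduced by the rate integrated up to the horizon. In both cases
-- the chain agrees with the original clocks read at the new integrated rate.
open Classical in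
lemma nextStream_residualStream (hφ : Continuous φ) {e D : ℕ → ℝ} {c : ℝ} {n k : ℕ} {s : ℝ × ℝ}
    (hc : c ≤ clockSum e (n + 1)) :
    nextStream φ a s (residualStream e D c n k) =
      residualStream e D (c + cumRate φ s (flightOf φ a (s, residualStream e D c n k)))
        (n + if FlipsFirst φ a s ((residualStream e D c n k).1 0) then 1 else 0)
        (k + if SticksAtZero φ a s ((residualStream e D c n k).1 0) then 1 else 0) := by
  have h0 : (residualStream e D c n k).1 0 = clockSum e (n + 1) - c := rfl
  by_cases hf : FlipsFirst φ a s ((residualStream e D c n k).1 0)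
  · have hst : ¬ SticksAtZero φ a s ((residualStream e D c n k).1 0) := fun h => h.1 hf
    have hT : cumRate φ s (flightOf φ a (s, residualStream e D c n k)) = clockSum e (n + 1) - c :=
      cumRate_flightTime hφ (by rw [h0]; linarith) hf
    rw [hT]
    simp only [nextStream, nextClocks, hf, hst, if_true, if_false, add_zero]
    unfold residualStream
    congr 1
    ext j
    simp only [seqTail, seqCons_succ]
    cases j with
    | zero => rw [seqCons_zero, clockSum_succ e (n + 1)]; simp
    | succ j => rw [seqCons_succ]; congr 1; omega
  · have hT : flightOf φ a (s, residualStream e D c n k) = horizon a s := flightTime_of_not_flipsFirst hf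
    rw [hT]
    simp only [nextStream, nextClocks, hf, if_false, add_zero]
    unfold residualStream
    congr 1
    · ext j
      cases j with
      | zero => simp only [seqCons_zero]; ring
      | succ j => simp only [seqCons_succ, seqTail]
    · by_cases hst : SticksAtZero φ a s ((residualStream e D c n k).1 0)
      · have hst' : SticksAtZero φ a s (seqCons (clockSum e (n + 1) - c) (fun j => e (n + 1 + j)) 0) := hst
        simp only [hst', if_true]
        ext j; simp only [seqTail]; congr 1; omega
      · have hst' : ¬ SticksAtZero φ a s (seqCons (clockSum e (n + 1) - c) (fun j => e (n + 1 + j)) 0) := hst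
        simp only [hst', if_false, add_zero]

/-! ### Sticking intervals read off from a trajectory -/

/-- The zeros of `x` that are reached from outside of `0` after the time `t`. -/
def zerosAfter (x : ℝ → ℝ) (t : ℝ) : Set ℝ := {s | 0 ≤ s ∧ x s = 0 ∧ ∃ u, t < u ∧ u < s ∧ x u ≠ 0}

lemma stickTime_succ_eq {x : ℝ → ℝ} {D : ℕ → ℝ} {k : ℕ} {τ : ℝ} (hτ : 0 ≤ τ) (hD : 0 ≤ D k)
    (h : stickTime x D k = ENNReal.ofReal τ) :
    stickTime x D (k + 1) = firstTime (zerosAfter x (τ + D k)) := by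
  rw [stickTime, h, ← ENNReal.ofReal_add hτ hD]
  congr 1
  ext s
  simp only [zerosAfter, Set.mem_ofPred_eq]
  refine and_congr_right fun _ => and_congr_right fun _ => exists_congr fun u => ?_
  rw [ENNReal.ofReal_lt_ofReal_iff_of_nonneg (add_nonneg hτ hD)]
  tauto

lemma stickTime_add_le (x : ℝ → ℝ) (D : ℕ → ℝ) (k : ℕ) :
    stickTime x D k + ENNReal.ofReal (D k) ≤ stickTime x D (k + 1) := by
  conv_rhs => rw [stickTime]
  refine le_iInf₂ fun s hs => ?_
  obtain ⟨-, -, u, h1, h2, -⟩ := hs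
  exact h2.le.trans (ENNReal.ofReal_le_ofReal h1.le)

lemma monotone_stickTime (x : ℝ → ℝ) (D : ℕ → ℝ) : Monotone (stickTime x D) :=
  monotone_nat_of_le_succ fun k => le_self_add.trans (stickTime_add_le x D k)

lemma measurableSet_stuckSet (x : ℝ → ℝ) (D : ℕ → ℝ) : MeasurableSet (stuckSet x D) := by
  have : stuckSet x D = Set.Ici 0 ∩ ⋃ k, {t | stickTime x D k ≤ ENNReal.ofReal t ∧
      ENNReal.ofReal t < stickTime x D k + ENNReal.ofReal (D k)} := by
    ext t; simp [stuckSet]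
  rw [this]
  have hm : Measurable ENNReal.ofReal := ENNReal.measurable_ofReal
  exact measurableSet_Ici.inter (MeasurableSet.iUnion fun k =>
    (measurableSet_le measurable_const hm).inter (measurableSet_lt hm measurable_const))

/-- The situation of a trajectory with clocks `e` and sticking times `D` at an event. -/
structure StickySnapshot (x : ℝ → ℝ) (R : ℝ → ℝ) (e D : ℕ → ℝ) (v₀ t : ℝ) (s : ℝ × ℝ) (n k : ℕ) :
    Prop where
  time_nonneg : 0 ≤ t
  position : x t = s.1
  velocity : s.2 = v₀ * (-1) ^ n
  lower : clockSum e n ≤ R t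
  upper : R t < clockSum e (n + 1)
  past : ∀ j < k, stickTime x D j + ENNReal.ofReal (D j) ≤ ENNReal.ofReal t
  next : stickTime x D k = firstTime (zerosAfter x t)

/-- Earlier sticking intervals are over at `t`, and later ones start no earlier than the `k`-th. -/
lemma StickySnapshot.notMem_stuckSet {x R : ℝ → ℝ} {e D : ℕ → ℝ} {v₀ t : ℝ} {s : ℝ × ℝ} {n k : ℕ}
    (h : StickySnapshot x R e D v₀ t s n k) {r : ℝ} (htr : t ≤ r)
    (hr : ENNReal.ofReal r < stickTime x D k) : r ∉ stuckSet x D := by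
  rintro ⟨-, j, h1, h2⟩
  rcases lt_or_ge j k with hj | hj
  · exact absurd (h2.trans_le (h.past j hj)) (not_lt.2 (ENNReal.ofReal_le_ofReal htr))
  · exact absurd (hr.trans_le (monotone_stickTime x D hj)) (not_lt.2 h1)

/-! ### Trajectories of the original sampler from one event to the next -/

section Original

variable {x v : ℝ → ℝ} {x₀ v₀ : ℝ} {e D : ℕ → ℝ}

/-- The rate at which the clocks of the original sticky sampler run. -/
def stickyRate (φ x v : ℝ → ℝ) (D : ℕ → ℝ) : ℝ → ℝ :=
  (stuckSet x D)ᶜ.indicator fun s => flipRate φ (x s) (v s)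

/-- A trajectory of the original sticky sampler. -/
structure IsStickyPath (φ x v : ℝ → ℝ) (x₀ v₀ : ℝ) (e D : ℕ → ℝ) : Prop where
  clock_pos : ∀ j, 0 < e j
  diverges : Tendsto (clockSum e) atTop atTop
  stick_pos : ∀ j, 0 < D j
  unit : v₀ = 1 ∨ v₀ = -1
  position : ∀ t, 0 ≤ t → x t = x₀ + ∫ s in (0 : ℝ)..t, (stuckSet x D)ᶜ.indicator v s
  velocity : ∀ t, 0 ≤ t → v t = v₀ * (-1) ^ arrivalCount e (∫ s in (0 : ℝ)..t, stickyRate φ x v D s)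

namespace IsStickyPath

lemma regularity (hφ : Continuous φ) (h : IsStickyPath φ x v x₀ v₀ e D) :
    ContinuousOn x (Set.Ici 0) ∧
    (∀ t, 0 ≤ t → IntervalIntegrable ((stuckSet x D)ᶜ.indicator v) volume 0 t) ∧
    ClockDriven v (stickyRate φ x v D) e v₀ := by
  have hb : ∀ B, ∃ K, ∀ y, |y| ≤ B → |φ y| ≤ K := fun B => by
    obtain ⟨K, hK⟩ := (isCompact_Icc (a := -B) (b := B)).exists_bound_of_continuousOn hφ.continuousOn
    exact ⟨K, fun y hy => hK y (abs_le.1 hy)⟩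
  obtain ⟨h1, h2, -, h3⟩ := driven_regularity hφ.measurable hb (measurableSet_stuckSet x D).compl
    h.clock_pos h.diverges h.unit h.position h.velocity
  exact ⟨h1, h2, h3⟩

variable {t : ℝ} {s : ℝ × ℝ} {n k : ℕ}

/-- The motion after an event as long as the coordinate is not stuck. -/
lemma flight_of_notMem (hφ : Continuous φ) (h : IsStickyPath φ x v x₀ v₀ e D)
    (hs : StickySnapshot x (fun t => ∫ s in (0 : ℝ)..t, stickyRate φ x v D s) e D v₀ t s n k) {T : ℝ}
    (hT : ∀ c, 0 ≤ c → c < T → cumRate φ s c <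
      clockSum e (n + 1) - ∫ s in (0 : ℝ)..t, stickyRate φ x v D s)
    (hmov : ∀ r, t ≤ r → r < t + T → r ∉ stuckSet x D) :
    (∀ r, t ≤ r → r < t + T → v r = s.2) ∧
    (∀ r, t ≤ r → r ≤ t + T → x r = s.1 + s.2 * (r - t)) ∧
    ∀ r, t ≤ r → r ≤ t + T → ∫ s in (0 : ℝ)..r, stickyRate φ x v D s =
      (∫ s in (0 : ℝ)..t, stickyRate φ x v D s) + cumRate φ s (r - t) := by
  obtain ⟨-, hvi, hcd⟩ := h.regularity hφ
  have hlin : ∀ σ, t ≤ σ → σ ≤ t + T → (∀ r, t ≤ r → r < σ → v r = s.2) →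
      x σ = s.1 + s.2 * (σ - t) := by
    intro σ h1 h2 h3
    rw [driven_motion h.position hvi hs.time_nonneg h1 (c := s.2) fun r h4 h5 => ?_, hs.position]
    rw [Set.indicator_of_mem (hmov r h4.le (h5.trans_le h2)), h3 r h4.le h5]
  have hfl := hcd.flight hs.time_nonneg hs.lower hs.velocity (T := T) (fun σ h1 h2 h3 r h4 h5 => by
    have h6 : r ∈ (stuckSet x D)ᶜ := hmov r h4.le (h5.trans_le h2)
    unfold stickyRate
    rw [Set.indicator_of_mem h6, h3 r h4.le h5,
      hlin r h4.le (h5.le.trans h2) fun r' h7 h8 => h3 r' h7 (h8.trans h5)]) hT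
  exact ⟨hfl.1, fun r h1 h2 => hlin r h1 h2 fun r' h3 h4 => hfl.1 r' h3 (h4.trans_le h2), hfl.2⟩

/-- While the coordinate is stuck it does not move and its clocks do not run. -/
lemma rest_of_mem (hφ : Continuous φ) (h : IsStickyPath φ x v x₀ v₀ e D) {t T : ℝ} (ht : 0 ≤ t)
    (hst : ∀ r, t ≤ r → r < t + T → r ∈ stuckSet x D) :
    (∀ r, t ≤ r → r ≤ t + T → x r = x t) ∧
    ∀ r, t ≤ r → r ≤ t + T → ∫ s in (0 : ℝ)..r, stickyRate φ x v D s =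
      ∫ s in (0 : ℝ)..t, stickyRate φ x v D s := by
  obtain ⟨-, hvi, hcd⟩ := h.regularity hφ
  constructor
  · intro r h1 h2
    rw [driven_motion h.position hvi ht h1 (c := 0) fun r' h4 h5 => ?_]
    · ring
    · exact Set.indicator_of_notMem (fun h6 : r' ∈ (stuckSet x D)ᶜ => h6 (hst r' h4.le (h5.trans_le h2))) _
  · intro r h1 h2
    rw [hcd.integral_add ht (ht.trans h1)]
    have : ∫ s in t..r, stickyRate φ x v D s = 0 := by
      rw [intervalIntegral.integral_of_le h1, integral_Ioc_eq_integral_Ioo]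
      refine setIntegral_eq_zero_of_forall_eq_zero fun r' hr' => ?_
      exact Set.indicator_of_notMem (fun h6 : r' ∈ (stuckSet x D)ᶜ => h6 (hst r' hr'.1.le (hr'.2.trans_le h2))) _
    rw [this, add_zero]

/-- The coordinate does not reach `0` before the end of the flight. -/
lemma flight_le_of_mem_zerosAfter (hφ : Continuous φ) (h : IsStickyPath φ x v x₀ v₀ e D)
    (hs : StickySnapshot x (fun t => ∫ s in (0 : ℝ)..t, stickyRate φ x v D s) e D v₀ t s n k) {T : ℝ}
    (hTh : T ≤ horizon a s)
    (hT : ∀ c, 0 ≤ c → c < T → cumRate φ s c <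
      clockSum e (n + 1) - ∫ s in (0 : ℝ)..t, stickyRate φ x v D s)
    (hsu : s.2 = 1 ∨ s.2 = -1) {s₁ : ℝ} (hs₁ : s₁ ∈ zerosAfter x t) : t + T ≤ s₁ := by
  by_contra hcon
  push Not at hcon
  obtain ⟨hxc, -, -⟩ := h.regularity hφ
  set Z := zerosAfter x t with hZ
  have hbdd : BddBelow Z := ⟨t, fun y hy => by obtain ⟨-, -, u, h1, h2, -⟩ := hy; linarith⟩
  -- The infimum of the zeros need not belong to `Z`, but by continuity it is a zero, and it is the
  -- `k`-th sticking time.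
  set τ := sInf Z with hτ
  have hτt : t ≤ τ := le_csInf ⟨s₁, hs₁⟩ fun y hy => by obtain ⟨-, -, u, h1, h2, -⟩ := hy; linarith
  have hτ0 : 0 ≤ τ := hs.time_nonneg.trans hτt
  have hτs : τ ≤ s₁ := csInf_le hbdd hs₁
  have hxτ : x τ = 0 := by
    have hcl : τ ∈ closure Z := csInf_mem_closure ⟨s₁, hs₁⟩ hbdd
    have hcl2 : IsClosed (Set.Ici (0 : ℝ) ∩ x ⁻¹' {0}) :=
      hxc.preimage_isClosed_of_isClosed isClosed_Ici isClosed_singleton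
    have hsub : Z ⊆ Set.Ici (0 : ℝ) ∩ x ⁻¹' {0} := fun y hy => by
      obtain ⟨h1, h2, -⟩ := hy
      exact ⟨h1, h2⟩
    exact (closure_minimal hsub hcl2 hcl).2
  have hfirst : stickTime x D k = ENNReal.ofReal τ := by
    rw [hs.next]
    refine le_antisymm ?_ (le_iInf₂ fun y hy => ENNReal.ofReal_le_ofReal (csInf_le hbdd hy))
    by_contra hlt
    push Not at hlt
    obtain ⟨c, hc1, hc2⟩ := exists_between hlt
    have hctop : c ≠ ∞ := (hc2.trans_le le_top).ne
    have h1 : τ < c.toReal := by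
      rwa [← ENNReal.ofReal_lt_iff_lt_toReal hτ0 hctop]
    obtain ⟨y, hy, hyc⟩ := exists_lt_of_csInf_lt ⟨s₁, hs₁⟩ h1
    have h2 : firstTime Z ≤ ENNReal.ofReal y := iInf₂_le y hy
    have h3 : ENNReal.ofReal y ≤ c := ENNReal.ofReal_le_of_le_toReal hyc.le
    exact absurd (h2.trans h3) (not_le.2 hc2)
  -- If τ > t, the free flight reaches 0 at τ, so 0 lies ahead nearer than the horizon. If τ = t,
  -- the coordinate is stuck at 0 for the time `D k > 0`, which contradicts the nonzero values
  -- required just after `t`.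
  rcases hτt.lt_or_eq with hlt | heq
  · have hfl := h.flight_of_notMem hφ hs (T := τ - t) (fun c h1 h2 => hT c h1 (by linarith)) (fun r h1 h2 => by
      refine hs.notMem_stuckSet h1 ?_
      rw [hfirst]
      exact (ENNReal.ofReal_lt_ofReal_iff_of_nonneg (hs.time_nonneg.trans h1)).2 (by linarith))
    have h1 := hfl.2.1 τ hτt (by linarith)
    rw [hxτ] at h1
    have h2 : (0 - s.1) * s.2 = τ - t := by
      have : s.1 = -(s.2 * (τ - t)) := by linarith
      rw [this]; rcases hsu with h | h <;> rw [h] <;> ring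
    have h3 : timeAhead s 0 = τ - t := by rw [timeAhead, h2, if_pos (by linarith)]
    have h4 := horizon_le_zero (a := a) s
    linarith
  · have hst : ∀ r, t ≤ r → r < t + D k → r ∈ stuckSet x D := fun r h1 h2 => by
      refine ⟨hs.time_nonneg.trans h1, k, ?_, ?_⟩
      · rw [hfirst, ← heq]; exact ENNReal.ofReal_le_ofReal h1
      · rw [hfirst, ← heq, ← ENNReal.ofReal_add hs.time_nonneg (h.stick_pos k).le]
        exact (ENNReal.ofReal_lt_ofReal_iff_of_nonneg (hs.time_nonneg.trans h1)).2 h2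
    have hrest := (h.rest_of_mem hφ hs.time_nonneg hst).1
    obtain ⟨s₂, hs₂, hlt⟩ := exists_lt_of_csInf_lt (s := Z) ⟨s₁, hs₁⟩
      (show sInf Z < t + D k by rw [← hτ, ← heq]; linarith [h.stick_pos k])
    obtain ⟨-, -, u, h1, h2, h3⟩ := hs₂
    refine h3 ?_
    rw [hrest u h1.le (by linarith), heq, hxτ]

/-- The starting time may be advanced through a stretch without zeros; continuity supplies a nonzero
value just after the new time. -/
lemma zerosAfter_congr (hxc : ContinuousOn x (Set.Ici 0)) {t t' : ℝ} (ht : 0 ≤ t) (htt : t < t')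
    (hne : ∀ r, t < r → r ≤ t' → x r ≠ 0) : zerosAfter x t = zerosAfter x t' := by
  ext s
  simp only [zerosAfter, Set.mem_ofPred_eq]
  refine and_congr_right fun hs0 => and_congr_right fun hxs => ⟨?_, ?_⟩
  · rintro ⟨u, h1, h2, h3⟩
    have hst : t' < s := not_le.1 fun h4 => hne s (h1.trans h2) h4 hxs
    have hc : ContinuousAt x t' := hxc.continuousAt (Ici_mem_nhds (by linarith))
    have hev : ∀ᶠ u in 𝓝[>] t', x u ≠ 0 :=
      (hc.eventually_ne (hne t' htt le_rfl)).filter_mono nhdsWithin_le_nhds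
    obtain ⟨u', h6, h4, h5⟩ := (hev.and (Ioo_mem_nhdsGT hst)).exists
    exact ⟨u', h4, h5, h6⟩
  · rintro ⟨u, h1, h2, h3⟩
    exact ⟨u, htt.trans h1, h2, h3⟩

open Classical in
/-- The motion from one event to the next. -/
lemma step (hφ : Continuous φ) (h : IsStickyPath φ x v x₀ v₀ e D)
    (hs : StickySnapshot x (fun t => ∫ s in (0 : ℝ)..t, stickyRate φ x v D s) e D v₀ t s n k)
    {ξ : ClockStream} (hξ : ξ = residualStream e D (∫ s in (0 : ℝ)..t, stickyRate φ x v D s) n k)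
    (hgood : ξ.1 0 ≠ cumRate φ s (horizon a s)) :
    (∀ r, t ≤ r → r < t + flightOf φ a (s, ξ) → x r = s.1 + s.2 * (r - t) ∧ v r = s.2) ∧
    (∀ r, t + flightOf φ a (s, ξ) ≤ r → r < t + flightOf φ a (s, ξ) + stickOf φ a (s, ξ) → x r = 0) ∧
    StickySnapshot x (fun t => ∫ s in (0 : ℝ)..t, stickyRate φ x v D s) e D v₀
      (t + flightOf φ a (s, ξ) + stickOf φ a (s, ξ)) (chainStep φ a (s, ξ)).1
      (n + if FlipsFirst φ a s (ξ.1 0) then 1 else 0) (k + if SticksAtZero φ a s (ξ.1 0) then 1 else 0) ∧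
    (chainStep φ a (s, ξ)).2 = residualStream e D
      (∫ s in (0 : ℝ)..(t + flightOf φ a (s, ξ) + stickOf φ a (s, ξ)), stickyRate φ x v D s)
      (n + if FlipsFirst φ a s (ξ.1 0) then 1 else 0)
      (k + if SticksAtZero φ a s (ξ.1 0) then 1 else 0) ∧
    0 < flightOf φ a (s, ξ) := by
  obtain ⟨hxc, -, hcd⟩ := h.regularity hφ
  have hsu : s.2 = 1 ∨ s.2 = -1 := by
    rw [hs.velocity]
    rcases neg_one_pow_eq_or ℝ n with h1 | h1 <;> rcases h.unit with h2 | h2 <;> simp [h1, h2]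
  set R : ℝ → ℝ := fun t => ∫ s in (0 : ℝ)..t, stickyRate φ x v D s with hR
  set T := flightOf φ a (s, ξ) with hTdef
  have he0 : ξ.1 0 = clockSum e (n + 1) - R t := by rw [hξ]; rfl
  have he0pos : 0 < ξ.1 0 := by rw [he0]; linarith [hs.upper]
  have hTpos : 0 < T := flightTime_pos hφ he0pos
  have hTh : T ≤ horizon a s := flightTime_le_horizon hφ _ _
  have hT : ∀ c, 0 ≤ c → c < T → cumRate φ s c < clockSum e (n + 1) - R t := fun c h1 h2 => by
    rw [← he0]
    exact (lt_flightTime_iff hφ h1 (h2.trans_le hTh) (Or.inl hgood)).1 h2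
  have hzero : ∀ s₁ ∈ zerosAfter x t, t + T ≤ s₁ := fun s₁ h1 =>
    h.flight_le_of_mem_zerosAfter hφ hs hTh hT hsu h1
  -- The next sticking interval begins no earlier than the end of the flight, so the coordinate
  -- moves during the whole flight.
  have hfirst : ENNReal.ofReal (t + T) ≤ stickTime x D k := by
    rw [hs.next]
    exact le_iInf₂ fun s₁ h1 => ENNReal.ofReal_le_ofReal (hzero s₁ h1)
  obtain ⟨f1, f2, f3⟩ := h.flight_of_notMem hφ hs hT fun r h1 h2 => hs.notMem_stuckSet h1
    (((ENNReal.ofReal_lt_ofReal_iff_of_nonneg (hs.time_nonneg.trans h1)).2 h2).trans_le hfirst)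
  have hRT : R (t + T) = R t + cumRate φ s T := by
    have := f3 (t + T) (by linarith) le_rfl
    rwa [add_sub_cancel_left] at this
  have hxT : x (t + T) = s.1 + s.2 * T := by
    have := f2 (t + T) (by linarith) le_rfl
    rwa [add_sub_cancel_left] at this
  have htT : 0 ≤ t + T := by linarith [hs.time_nonneg]
  have hne : ∀ r, t < r → r < t + T → x r ≠ 0 := by
    intro r h1 h2
    rw [f2 r h1.le h2.le]
    rcases ray_sign hsu (show 0 < r - t by linarith) (show r - t < horizon a s by linarith) with h3 | h3
    · exact h3.1.ne'
    · exact h3.1.ne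
  have hnext : (chainStep φ a (s, ξ)).2 = residualStream e D (R (t + T))
      (n + if FlipsFirst φ a s (ξ.1 0) then 1 else 0)
      (k + if SticksAtZero φ a s (ξ.1 0) then 1 else 0) := by
    have h1 := nextStream_residualStream (a := a) hφ (D := D) (k := k) (s := s) hs.upper.le
    rw [← hξ] at h1
    rw [hRT]
    exact h1
  refine ⟨fun r h1 h2 => ⟨f2 r h1 h2.le, f1 r h1 h2⟩, ?_, ?_, ?_, hTpos⟩
  -- Each remaining claim is checked for the three ways in which a step ends: a flip, an arrival at
  -- 0, or a plain horizon.
  all_goals by_cases hf : FlipsFirst φ a s (ξ.1 0)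
  · have hst : ¬ SticksAtZero φ a s (ξ.1 0) := fun h => h.1 hf
    have h0 : stickOf φ a (s, ξ) = 0 := if_neg hst
    intro r h1 h2; rw [h0] at h2; linarith
  · have hTe : T = horizon a s := flightTime_of_not_flipsFirst hf
    by_cases hst : SticksAtZero φ a s (ξ.1 0)
    · have h0 : stickOf φ a (s, ξ) = D k := by
        unfold stickOf stickDuration
        rw [if_pos hst, hξ]; rfl
      have hx0 : x (t + T) = 0 := by rw [hxT, hTe]; exact hst.2
      -- The arrival at 0 comes from nonzero positions inside the flight, such as the one at `t + T
      -- / 2`, so it realizes the `k`-th sticking time.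
      have hk : stickTime x D k = ENNReal.ofReal (t + T) := by
        refine le_antisymm ?_ hfirst
        rw [hs.next]
        exact iInf₂_le (t + T) ⟨htT, hx0, t + T / 2, by linarith, by linarith,
          hne _ (by linarith) (by linarith)⟩
      have hstuck : ∀ r, t + T ≤ r → r < t + T + D k → r ∈ stuckSet x D := fun r h1 h2 => by
        refine ⟨htT.trans h1, k, ?_, ?_⟩
        · rw [hk]; exact ENNReal.ofReal_le_ofReal h1
        · rw [hk, ← ENNReal.ofReal_add htT (h.stick_pos k).le]
          exact (ENNReal.ofReal_lt_ofReal_iff_of_nonneg (htT.trans h1)).2 h2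
      intro r h1 h2
      rw [h0] at h2
      rw [(h.rest_of_mem hφ htT hstuck).1 r h1 h2.le, hx0]
    · have h0 : stickOf φ a (s, ξ) = 0 := if_neg hst
      intro r h1 h2; rw [h0] at h2; linarith
  · have hst : ¬ SticksAtZero φ a s (ξ.1 0) := fun h => h.1 hf
    have h0 : stickOf φ a (s, ξ) = 0 := if_neg hst
    have hcum : cumRate φ s T = ξ.1 0 := cumRate_flightTime hφ he0pos.le hf
    have hTlt : T < horizon a s := flightTime_lt_horizon hφ he0pos.le hf
    have hRn : R (t + T) = clockSum e (n + 1) := by rw [hRT, hcum, he0]; ring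
    rw [h0, add_zero, if_pos hf, if_neg hst]
    refine ⟨htT, ?_, ?_, hRn.ge, ?_, fun j hj => ?_, ?_⟩
    · rw [hxT]; rfl
    · simp only [chainStep, nextState, if_pos hf, hs.velocity]; ring
    · rw [hRn, clockSum_succ e (n + 1)]; linarith [h.clock_pos (n + 1)]
    · exact (hs.past j hj).trans (ENNReal.ofReal_le_ofReal (by linarith))
    · have hxne : ∀ r, t < r → r ≤ t + T → x r ≠ 0 := by
        intro r h1 h2
        rw [f2 r h1.le h2]
        rcases ray_sign hsu (show 0 < r - t by linarith) (show r - t < horizon a s by linarith) with h3 | h3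
        · exact h3.1.ne'
        · exact h3.1.ne
      rw [add_zero, hs.next, zerosAfter_congr hxc hs.time_nonneg (by linarith) hxne]
  · have hTe : T = horizon a s := flightTime_of_not_flipsFirst hf
    have hlt : R (t + T) < clockSum e (n + 1) := by
      have h1 : cumRate φ s T < ξ.1 0 := by
        rw [hTe]; exact lt_of_le_of_ne (not_lt.1 hf) (Ne.symm hgood)
      rw [hRT]; linarith
    have hge : clockSum e n ≤ R (t + T) := hs.lower.trans (hcd.integral_mono hs.time_nonneg (by linarith))
    by_cases hst : SticksAtZero φ a s (ξ.1 0)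
    · have h0 : stickOf φ a (s, ξ) = D k := by
        unfold stickOf stickDuration
        rw [if_pos hst, hξ]; rfl
      have hx0 : x (t + T) = 0 := by rw [hxT, hTe]; exact hst.2
      have hk : stickTime x D k = ENNReal.ofReal (t + T) := by
        refine le_antisymm ?_ hfirst
        rw [hs.next]
        exact iInf₂_le (t + T) ⟨htT, hx0, t + T / 2, by linarith, by linarith,
          hne _ (by linarith) (by linarith)⟩
      have hstuck : ∀ r, t + T ≤ r → r < t + T + D k → r ∈ stuckSet x D := fun r h1 h2 => by
        refine ⟨htT.trans h1, k, ?_, ?_⟩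
        · rw [hk]; exact ENNReal.ofReal_le_ofReal h1
        · rw [hk, ← ENNReal.ofReal_add htT (h.stick_pos k).le]
          exact (ENNReal.ofReal_lt_ofReal_iff_of_nonneg (htT.trans h1)).2 h2
      have hDk := h.stick_pos k
      obtain ⟨r1, r2⟩ := h.rest_of_mem hφ htT hstuck
      rw [h0, if_neg hf, if_pos hst, add_zero]
      have hRD : R (t + T + D k) = R (t + T) := r2 _ (by linarith) le_rfl
      refine ⟨by linarith, ?_, ?_, by rwa [hRD],
        by rwa [hRD], fun j hj => ?_, ?_⟩
      · rw [r1 _ (by linarith) le_rfl, hxT]; rfl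
      · simp only [chainStep, nextState, if_neg hf, hs.velocity]
      · rcases Nat.lt_succ_iff_lt_or_eq.1 hj with hj' | rfl
        · exact (hs.past j hj').trans (ENNReal.ofReal_le_ofReal (by linarith))
        · rw [hk, ENNReal.ofReal_add htT hDk.le]
      · exact stickTime_succ_eq htT hDk.le hk
    · have h0 : stickOf φ a (s, ξ) = 0 := if_neg hst
      rw [h0, add_zero, if_neg hf, if_neg hst, add_zero, add_zero]
      refine ⟨htT, ?_, ?_, hge, hlt, fun j hj => ?_, ?_⟩
      · rw [hxT]; rfl
      · simp only [chainStep, nextState, if_neg hf, hs.velocity]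
      · exact (hs.past j hj).trans (ENNReal.ofReal_le_ofReal (by linarith))
      · have hxne : ∀ r, t < r → r ≤ t + T → x r ≠ 0 := by
          intro r h1 h2
          rcases h2.lt_or_eq with h3 | rfl
          · exact hne r h1 h3
          · rw [hxT]
            intro h4
            exact hst ⟨hf, by rw [← hTe]; exact h4⟩
        rw [hs.next, zerosAfter_congr hxc hs.time_nonneg (by linarith) hxne]
  · have hst : ¬ SticksAtZero φ a s (ξ.1 0) := fun h => h.1 hf
    have h0 : stickOf φ a (s, ξ) = 0 := if_neg hst
    rw [h0, add_zero]; exact hnext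
  · have hTe : T = horizon a s := flightTime_of_not_flipsFirst hf
    by_cases hst : SticksAtZero φ a s (ξ.1 0)
    · have h0 : stickOf φ a (s, ξ) = D k := by
        unfold stickOf stickDuration
        rw [if_pos hst, hξ]; rfl
      have hx0 : x (t + T) = 0 := by rw [hxT, hTe]; exact hst.2
      have hk : stickTime x D k = ENNReal.ofReal (t + T) := by
        refine le_antisymm ?_ hfirst
        rw [hs.next]
        exact iInf₂_le (t + T) ⟨htT, hx0, t + T / 2, by linarith, by linarith,
          hne _ (by linarith) (by linarith)⟩
      have hstuck : ∀ r, t + T ≤ r → r < t + T + D k → r ∈ stuckSet x D := fun r h1 h2 => by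
        refine ⟨htT.trans h1, k, ?_, ?_⟩
        · rw [hk]; exact ENNReal.ofReal_le_ofReal h1
        · rw [hk, ← ENNReal.ofReal_add htT (h.stick_pos k).le]
          exact (ENNReal.ofReal_lt_ofReal_iff_of_nonneg (htT.trans h1)).2 h2
      have hRD : R (t + T + D k) = R (t + T) :=
        (h.rest_of_mem hφ htT hstuck).2 _ (by linarith [h.stick_pos k]) le_rfl
      rw [h0]
      rw [hnext, ← hRD]
    · have h0 : stickOf φ a (s, ξ) = 0 := if_neg hst
      rw [h0, add_zero]; exact hnext

/-- A trajectory of the original sticky sampler follows the event chain once it has left its initial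
position at `0`. -/
theorem followsChain_of_snapshot (hφ : Continuous φ) (h : IsStickyPath φ x v x₀ v₀ e D) {θ : ℝ}
    {s : ℝ × ℝ} {k : ℕ} {ξ : ClockStream}
    (hs : StickySnapshot x (fun t => ∫ s in (0 : ℝ)..t, stickyRate φ x v D s) e D v₀ θ s 0 k)
    (hξ : ξ = residualStream e D (∫ s in (0 : ℝ)..θ, stickyRate φ x v D s) 0 k)
    (hstart : ∀ r, 0 ≤ r → r < θ → x r = 0)
    (hgood : ∀ m, ((chainStep φ a)^[m] (s, ξ)).2.1 0 ≠
      cumRate φ ((chainStep φ a)^[m] (s, ξ)).1 (horizon a ((chainStep φ a)^[m] (s, ξ)).1)) :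
    FollowsChain φ a x v θ (s, ξ) := by
  obtain ⟨hxc, -, hcd⟩ := h.regularity hφ
  have hsu : s.2 = 1 ∨ s.2 = -1 := by
    rw [hs.velocity, pow_zero, mul_one]; exact h.unit
  classical
  have hsnap : ∀ m, StickySnapshot x (fun t => ∫ s in (0 : ℝ)..t, stickyRate φ x v D s) e D v₀
      (eventTime φ a θ (s, ξ) m) ((chainStep φ a)^[m] (s, ξ)).1 (flipCount φ a (s, ξ) m)
      (k + stickCount φ a (s, ξ) m) ∧ ((chainStep φ a)^[m] (s, ξ)).2 = residualStream e D
        (∫ s in (0 : ℝ)..eventTime φ a θ (s, ξ) m, stickyRate φ x v D s) (flipCount φ a (s, ξ) m)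
        (k + stickCount φ a (s, ξ) m) := by
    intro m
    induction m with
    | zero =>
      have : eventTime φ a θ (s, ξ) 0 = θ := FollowsChain.eventTime_zero
      rw [this]
      exact ⟨hs, hξ⟩
    | succ m ih =>
      obtain ⟨-, -, h3, h4, -⟩ := h.step (a := a) hφ ih.1 ih.2 (hgood m)
      have e1 : eventTime φ a θ (s, ξ) (m + 1) = eventTime φ a θ (s, ξ) m +
          flightOf φ a ((chainStep φ a)^[m] (s, ξ)) + stickOf φ a ((chainStep φ a)^[m] (s, ξ)) := by
        rw [eventTime_succ θ (q := (s, ξ)) hsu, add_assoc]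
      have e2 : flipCount φ a (s, ξ) (m + 1) = flipCount φ a (s, ξ) m +
          if FlipsFirst φ a ((chainStep φ a)^[m] (s, ξ)).1 (((chainStep φ a)^[m] (s, ξ)).2.1 0)
          then 1 else 0 := by
        unfold flipCount; rw [Finset.sum_range_succ]
      have e3 : k + stickCount φ a (s, ξ) (m + 1) = k + stickCount φ a (s, ξ) m +
          if SticksAtZero φ a ((chainStep φ a)^[m] (s, ξ)).1 (((chainStep φ a)^[m] (s, ξ)).2.1 0)
          then 1 else 0 := by
        unfold stickCount; rw [Finset.sum_range_succ, add_assoc]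
      rw [e1, e2, e3, Function.iterate_succ_apply']
      exact ⟨h3, h4⟩
  have hstep := fun m => h.step (a := a) hφ (hsnap m).1 (hsnap m).2 (hgood m)
  have hD : ∀ j, 0 ≤ (s, ξ).2.2 j := fun j => by
    rw [hξ]; exact (h.stick_pos _).le
  refine ⟨hs.time_nonneg, hsu, hstart, fun m r h1 h2 => (hstep m).1 r h1 h2, fun m r h1 h2 => ?_,
    fun m => (hstep m).2.2.2.2, fun m => stickDuration_nonneg (iterate_chainStep_nonneg hD m 0), ?_⟩
  · rw [eventTime_succ θ (q := (s, ξ)) hsu, ← add_assoc] at h2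
    exact (hstep m).2.1 r h1 h2
  · refine tendsto_eventTime (q := (s, ξ)) hsu hD fun B => ?_
    -- Each flip before `B` has used up a clock, and the sum of the first `N` clocks exceeds the
    -- rate integrated up to `B`.
    obtain ⟨N, hN⟩ := (h.diverges.eventually_gt_atTop
      (∫ s in (0 : ℝ)..max B 0, stickyRate φ x v D s)).exists
    refine ⟨N, fun m hm => ?_⟩
    have h1 := (hsnap m).1.lower
    have h2 := hcd.integral_mono (hsnap m).1.time_nonneg (hm.trans (le_max_left B 0))
    have h3 : clockSum e (flipCount φ a (s, ξ) m) < clockSum e N := lt_of_le_of_lt (h1.trans h2) hN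
    exact ((clockSum_strictMono h.clock_pos).lt_iff_lt.1 h3).le

/-- The time at which a trajectory of the original sticky sampler leaves its initial position at `0`. -/
def _root_.initialStick (x₀ : ℝ) (D : ℕ → ℝ) : ℝ := if x₀ = 0 then D 0 else 0

/-- The streams of a trajectory of the original sticky sampler after it has left its initial position
at `0`. -/
def _root_.initialStream (x₀ : ℝ) (e D : ℕ → ℝ) : ClockStream := (e, if x₀ = 0 then seqTail D else D)

/-- A coordinate that starts at 0 is stuck at once, since time 0 counts as an arrival. This uses up
the first sticking time, and the chain starts afterwards. -/
theorem followsChain (hφ : Continuous φ) (h : IsStickyPath φ x v x₀ v₀ e D)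
    (hgood : ∀ m, ((chainStep φ a)^[m] ((x₀, v₀), initialStream x₀ e D)).2.1 0 ≠
      cumRate φ ((chainStep φ a)^[m] ((x₀, v₀), initialStream x₀ e D)).1
        (horizon a ((chainStep φ a)^[m] ((x₀, v₀), initialStream x₀ e D)).1)) :
    FollowsChain φ a x v (initialStick x₀ D) ((x₀, v₀), initialStream x₀ e D) := by
  obtain ⟨hxc, -, hcd⟩ := h.regularity hφ
  have hx0 : x 0 = x₀ := by rw [h.position 0 le_rfl]; simp
  have he0 : 0 < clockSum e (0 + 1) := by rw [clockSum_succ, clockSum_zero]; linarith [h.clock_pos 0]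
  by_cases h0 : x₀ = 0
  · have hk : stickTime x D 0 = ENNReal.ofReal 0 := by
      rw [ENNReal.ofReal_zero, stickTime]
      refine le_antisymm ?_ zero_le
      refine (iInf₂_le (0 : ℝ) ⟨le_rfl, by rw [hx0, h0]⟩).trans (by simp)
    have hD0 := h.stick_pos 0
    have hstuck : ∀ r, 0 ≤ r → r < 0 + D 0 → r ∈ stuckSet x D := fun r h1 h2 => by
      refine ⟨h1, 0, ?_, ?_⟩
      · rw [hk]; exact ENNReal.ofReal_le_ofReal h1
      · rw [hk, ← ENNReal.ofReal_add le_rfl hD0.le]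
        exact (ENNReal.ofReal_lt_ofReal_iff_of_nonneg h1).2 h2
    obtain ⟨r1, r2⟩ := h.rest_of_mem hφ le_rfl hstuck
    have hRD := r2 (D 0) hD0.le (by rw [zero_add])
    rw [intervalIntegral.integral_same] at hRD
    have hθ : initialStick x₀ D = D 0 := if_pos h0
    refine h.followsChain_of_snapshot (k := 1) hφ ?_ ?_ ?_ hgood
    · rw [hθ]
      refine ⟨hD0.le, ?_, by simp, ?_, ?_, fun j hj => ?_, ?_⟩
      · rw [r1 (D 0) hD0.le (by rw [zero_add]), hx0]
      · simp only [hRD, clockSum_zero]; exact le_rfl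
      · simp only [hRD]; exact he0
      · obtain rfl : j = 0 := by omega
        rw [hk, ← ENNReal.ofReal_add le_rfl hD0.le, zero_add]
      · have := stickTime_succ_eq le_rfl hD0.le hk
        rwa [zero_add, zero_add] at this
    · rw [hθ, hRD, residualStream_zero, initialStream, if_pos h0]
      congr 1
      ext j; simp only [seqTail]; congr 1; omega
    · intro r h1 h2
      rw [hθ] at h2
      rw [r1 r h1 (by linarith), hx0, h0]
  · have hθ : initialStick x₀ D = 0 := if_neg h0
    refine h.followsChain_of_snapshot (k := 0) hφ ?_ ?_ ?_ hgood
    · rw [hθ]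
      refine ⟨le_rfl, hx0, by simp, by simp [clockSum_zero], by simpa using he0, fun j hj => by omega, ?_⟩
      -- Since `x₀ ≠ 0`, every zero is preceded by nonzero values close to time 0, so the first
      -- arrival has the form of the later ones.
      rw [stickTime]
      congr 1
      ext r
      simp only [zerosAfter, Set.mem_ofPred_eq]
      refine and_congr_right fun hr0 => ⟨fun hxr => ⟨hxr, ?_⟩, fun h => h.1⟩
      have hrpos : 0 < r := by
        refine lt_of_le_of_ne hr0 fun h1 => h0 ?_
        rw [← hx0]; rwa [← h1] at hxr
      have hc : ContinuousWithinAt x (Set.Ici 0) 0 := hxc 0 (Set.mem_Ici.2 le_rfl)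
      have hev := ((hc.mono Set.Ioi_subset_Ici_self).eventually_ne (by rw [hx0]; exact h0) :
        ∀ᶠ z in 𝓝[Set.Ioi 0] (0 : ℝ), x z ≠ 0)
      obtain ⟨u, h1, h2⟩ := (hev.and (Ioo_mem_nhdsGT hrpos)).exists
      exact ⟨u, h2.1, h2.2, h1⟩
    · rw [hθ, intervalIntegral.integral_same, residualStream_zero, initialStream, if_neg h0]
      congr 1
      ext j; congr 1; omega
    · intro r h1 h2; rw [hθ] at h2; linarith

end IsStickyPath

end Original

end

noncomputable section

/-! ### The latent sticky sampler follows the event chain -/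

section Collapse

variable {w : ℝ}

lemma collapse_of_abs_le {y : ℝ} (h : |y| ≤ w / 2) : collapse w y = 0 := if_pos h

lemma collapse_add_half (hw : 0 ≤ w) {r : ℝ} (hr : 0 ≤ r) : collapse w (r + w / 2) = r := by
  rcases hr.eq_or_lt with rfl | hr
  · exact collapse_of_abs_le (by rw [zero_add, abs_of_nonneg (by linarith)])
  · have h : 0 < r + w / 2 := by linarith
    rw [collapse, abs_of_pos h, if_neg (by linarith), Real.sign_of_pos h]; ring

lemma collapse_sub_half (hw : 0 ≤ w) {r : ℝ} (hr : r ≤ 0) : collapse w (r - w / 2) = r := by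
  rcases hr.eq_or_lt with rfl | hr
  · exact collapse_of_abs_le (by rw [zero_sub, abs_neg, abs_of_nonneg (by linarith)])
  · have h : r - w / 2 < 0 := by linarith
    rw [collapse, abs_of_neg h, if_neg (by linarith), Real.sign_of_neg h]; ring

lemma abs_collapse_le (hw : 0 ≤ w) (y : ℝ) : |collapse w y| ≤ |y| := by
  rcases le_or_gt |y| (w / 2) with h | h
  · rw [collapse_of_abs_le h]; simp
  · rcases le_or_gt 0 y with h0 | h0
    · rw [abs_of_nonneg h0] at h
      have := collapse_add_half hw (show 0 ≤ y - w / 2 by linarith)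
      rw [sub_add_cancel] at this
      rw [this, abs_of_nonneg h0, abs_of_nonneg (by linarith)]; linarith
    · rw [abs_of_neg h0] at h
      have := collapse_sub_half hw (show y + w / 2 ≤ 0 by linarith)
      rw [add_sub_cancel_right] at this
      rw [this, abs_of_neg h0, abs_of_nonpos (by linarith)]; linarith

open Classical in
/-- The latent position of a state. -/
def latentLift (w : ℝ) (s : ℝ × ℝ) : ℝ := if OnRight s then s.1 + w / 2 else s.1 - w / 2

lemma latentLift_of_pos {x v : ℝ} (hx : 0 < x) : latentLift w (x, v) = x + w / 2 :=
  if_pos (Or.inl hx)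

lemma latentLift_of_neg {x v : ℝ} (hx : x < 0) : latentLift w (x, v) = x - w / 2 :=
  if_neg (by rintro (h | ⟨h, -⟩) <;> simp only at h <;> linarith)

/-- A state at 0 in the chain has finished sticking, so it sits at the end of the plateau through
which its velocity leaves. -/
lemma latentLift_zero {v : ℝ} (hv : v = 1 ∨ v = -1) : latentLift w (0, v) = v * (w / 2) := by
  rcases hv with rfl | rfl
  · rw [latentLift, if_pos (show OnRight (0, 1) from Or.inr ⟨rfl, one_pos⟩)]; ring
  · rw [latentLift, if_neg]
    · ring
    · rintro (h | ⟨-, h⟩) <;> simp only at h <;> linarith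

lemma latentLift_collapse (hw : 0 ≤ w) {y v : ℝ} (hy : w / 2 < |y|) :
    latentLift w (collapse w y, v) = y := by
  rcases le_or_gt 0 y with h0 | h0
  · rw [abs_of_nonneg h0] at hy
    have := collapse_add_half hw (show 0 ≤ y - w / 2 by linarith)
    rw [sub_add_cancel] at this
    rw [this, latentLift_of_pos (by linarith)]; ring
  · rw [abs_of_neg h0] at hy
    have := collapse_sub_half hw (show y + w / 2 ≤ 0 by linarith)
    rw [add_sub_cancel_right] at this
    rw [this, latentLift_of_neg (by linarith)]; ring

lemma collapse_latentLift (hw : 0 ≤ w) {s : ℝ × ℝ} :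
    collapse w (latentLift w s) = s.1 := by
  unfold latentLift OnRight
  split_ifs with h
  · exact collapse_add_half hw (h.elim le_of_lt fun h => h.1.ge)
  · exact collapse_sub_half hw (not_lt.1 fun h1 => h (Or.inl h1))

end Collapse

/-- `ψ` is the derivative of the latent potential of a coordinate whose potential has the derivative
`φ`; the values at the two ends of the latent universe do not matter. -/
structure IsLatentSlope (φ ψ : ℝ → ℝ) (w : ℝ) : Prop where
  measurable : Measurable ψ
  outside : ∀ y, w / 2 < |y| → ψ y = φ (collapse w y)
  inside : ∀ y, |y| < w / 2 → ψ y = 0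

/-- The rate at which the clocks of the latent sampler run. -/
def latentRate (ψ y v : ℝ → ℝ) (s : ℝ) : ℝ := flipRate ψ (y s) (v s)

/-- A trajectory of the zig-zag process of a latent coordinate. -/
structure IsLatentPath (ψ y v : ℝ → ℝ) (y₀ v₀ : ℝ) (e : ℕ → ℝ) : Prop where
  clock_pos : ∀ j, 0 < e j
  diverges : Tendsto (clockSum e) atTop atTop
  unit : v₀ = 1 ∨ v₀ = -1
  position : ∀ t, 0 ≤ t → y t = y₀ + ∫ s in (0 : ℝ)..t, v s
  velocity : ∀ t, 0 ≤ t → v t = v₀ * (-1) ^ arrivalCount e (∫ s in (0 : ℝ)..t, latentRate ψ y v s)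

/-- The situation of a latent trajectory with clocks `e` at an event. -/
structure LatentSnapshot (w : ℝ) (y : ℝ → ℝ) (R : ℝ → ℝ) (e : ℕ → ℝ) (v₀ t : ℝ) (s : ℝ × ℝ) (n : ℕ) :
    Prop where
  time_nonneg : 0 ≤ t
  position : y t = latentLift w s
  velocity : s.2 = v₀ * (-1) ^ n
  lower : clockSum e n ≤ R t
  upper : R t < clockSum e (n + 1)

variable {φ ψ : ℝ → ℝ} {a w : ℝ}

/-- The slope may have any value at the two ends of the plateau, whence the two extra terms. -/
lemma IsLatentSlope.exists_bound (hψ : IsLatentSlope φ ψ w) (hφ : Continuous φ) (hw : 0 ≤ w) (B : ℝ) :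
    ∃ K, ∀ y, |y| ≤ B → |ψ y| ≤ K := by
  obtain ⟨K, hK⟩ := (isCompact_Icc (a := -B) (b := B)).exists_bound_of_continuousOn hφ.continuousOn
  refine ⟨max K 0 + |ψ (w / 2)| + |ψ (-(w / 2))|, fun y hy => ?_⟩
  have h1 := abs_nonneg (ψ (w / 2))
  have h2 := abs_nonneg (ψ (-(w / 2)))
  have h3 := le_max_right K 0
  rcases lt_trichotomy |y| (w / 2) with h | h | h
  · rw [hψ.inside y h, abs_zero]; positivity
  · rcases abs_choice y with h4 | h4
    · rw [h4] at h; rw [h]; linarith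
    · have : y = -(w / 2) := by linarith
      rw [this]; linarith
  · rw [hψ.outside y h]
    have := hK (collapse w y) (abs_le.1 ((abs_collapse_le hw y).trans hy))
    rw [Real.norm_eq_abs] at this
    linarith [le_max_left K 0]

namespace IsLatentPath

variable {y v : ℝ → ℝ} {y₀ v₀ : ℝ} {e : ℕ → ℝ}

lemma regularity (hφ : Continuous φ) (hw : 0 ≤ w) (hψ : IsLatentSlope φ ψ w)
    (h : IsLatentPath ψ y v y₀ v₀ e) :
    ContinuousOn y (Set.Ici 0) ∧ (∀ t, 0 ≤ t → IntervalIntegrable v volume 0 t) ∧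
    ClockDriven v (latentRate ψ y v) e v₀ := by
  have h0 := driven_regularity (M := Set.univ) hψ.measurable (hψ.exists_bound hφ hw) MeasurableSet.univ
    h.clock_pos h.diverges h.unit (by simpa only [Set.indicator_univ] using h.position)
    (by simpa only [Set.indicator_univ, latentRate] using h.velocity)
  simp only [Set.indicator_univ] at h0
  exact ⟨h0.1, h0.2.1, h0.2.2.2⟩

lemma motion (hvi : ∀ t, 0 ≤ t → IntervalIntegrable v volume 0 t) (h : IsLatentPath ψ y v y₀ v₀ e)
    {t r c : ℝ} (ht : 0 ≤ t) (htr : t ≤ r) (hc : ∀ r', t < r' → r' < r → v r' = c) :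
    y r = y t + c * (r - t) :=
  driven_motion (M := Set.univ) (by simpa only [Set.indicator_univ] using h.position)
    (by simpa only [Set.indicator_univ] using hvi) ht htr (by simpa only [Set.indicator_univ] using hc)

/-- The motion inside the latent universe. -/
lemma cross (hφ : Continuous φ) (hw : 0 ≤ w) (hψ : IsLatentSlope φ ψ w)
    (h : IsLatentPath ψ y v y₀ v₀ e) {t T ν : ℝ} {n : ℕ} (ht : 0 ≤ t)
    (hlow : clockSum e n ≤ ∫ s in (0 : ℝ)..t, latentRate ψ y v s)
    (hup : ∫ s in (0 : ℝ)..t, latentRate ψ y v s < clockSum e (n + 1)) (hν : ν = v₀ * (-1) ^ n)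
    (hin : ∀ r, t < r → r < t + T → |y t + ν * (r - t)| < w / 2) :
    (∀ r, t ≤ r → r < t + T → v r = ν) ∧ (∀ r, t ≤ r → r ≤ t + T → y r = y t + ν * (r - t)) ∧
    ∀ r, t ≤ r → r ≤ t + T → ∫ s in (0 : ℝ)..r, latentRate ψ y v s =
      ∫ s in (0 : ℝ)..t, latentRate ψ y v s := by
  obtain ⟨-, hvi, hcd⟩ := h.regularity hφ hw hψ
  have hzero : ∀ s c, cumRate (fun _ => 0) s c = 0 := fun s c => by simp [cumRate, flipRate]
  -- On the plateau the flip rate vanishes, so the flight lemma applies with slope 0; the position 0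
  -- in the state is a dummy.
  have hfl := hcd.flight (φ := fun _ => 0) (s := (0, ν)) ht hlow hν (T := T)
    (fun σ h1 h2 h3 r h4 h5 => by
      have h6 := h.motion hvi ht h4.le fun r' h7 h8 => h3 r' h7.le (h8.trans h5)
      simp only at h6
      simp only [latentRate, flipRate, h6, hψ.inside _ (hin r h4 (h5.trans_le h2)), mul_zero])
    (fun c _ _ => by rw [hzero]; linarith)
  refine ⟨hfl.1, fun r h1 h2 => h.motion hvi ht h1 fun r' h3 h4 => hfl.1 r' h3.le (h4.trans_le h2),
    fun r h1 h2 => ?_⟩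
  rw [hfl.2 r h1 h2, hzero, add_zero]

variable {t : ℝ} {s : ℝ × ℝ} {n : ℕ}

/-- The lift shifts the ray away from 0 by half of the width on its own side, and the ray does not
change sides before the horizon; so the latent ray avoids the plateau. -/
lemma ray_outside (hw : 0 ≤ w) (hs : s.2 = 1 ∨ s.2 = -1) {c : ℝ} (hc0 : 0 < c) (hc : c < horizon a s) :
    w / 2 < |latentLift w s + s.2 * c| ∧ collapse w (latentLift w s + s.2 * c) = s.1 + s.2 * c ∧
      s.1 + s.2 * c ≠ 0 ∧ ∀ ν, latentLift w (s.1 + s.2 * c, ν) = latentLift w s + s.2 * c := by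
  rcases ray_sign hs hc0 hc with ⟨h1, h2⟩ | ⟨h1, h2⟩
  · rw [latentLift, if_pos h2, show s.1 + w / 2 + s.2 * c = s.1 + s.2 * c + w / 2 by ring]
    exact ⟨by rw [abs_of_pos (by linarith)]; linarith, collapse_add_half hw h1.le, h1.ne',
      fun ν => latentLift_of_pos h1⟩
  · rw [latentLift, if_neg h2, show s.1 - w / 2 + s.2 * c = s.1 + s.2 * c - w / 2 by ring]
    exact ⟨by rw [abs_of_neg (by linarith)]; linarith, collapse_sub_half hw h1.le, h1.ne,
      fun ν => latentLift_of_neg h1⟩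

/-- The motion outside of the latent universe. -/
lemma flight (hφ : Continuous φ) (hw : 0 ≤ w) (hψ : IsLatentSlope φ ψ w)
    (h : IsLatentPath ψ y v y₀ v₀ e) (hsu : s.2 = 1 ∨ s.2 = -1)
    (hs : LatentSnapshot w y (fun t => ∫ s in (0 : ℝ)..t, latentRate ψ y v s) e v₀ t s n) {T : ℝ}
    (hTh : T ≤ horizon a s)
    (hT : ∀ c, 0 ≤ c → c < T → cumRate φ s c <
      clockSum e (n + 1) - ∫ s in (0 : ℝ)..t, latentRate ψ y v s) :
    (∀ r, t ≤ r → r < t + T → v r = s.2) ∧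
    (∀ r, t ≤ r → r ≤ t + T → y r = latentLift w s + s.2 * (r - t)) ∧
    ∀ r, t ≤ r → r ≤ t + T → ∫ s in (0 : ℝ)..r, latentRate ψ y v s =
      (∫ s in (0 : ℝ)..t, latentRate ψ y v s) + cumRate φ s (r - t) := by
  obtain ⟨-, hvi, hcd⟩ := h.regularity hφ hw hψ
  have hlin : ∀ σ, t ≤ σ → (∀ r, t ≤ r → r < σ → v r = s.2) → y σ = latentLift w s + s.2 * (σ - t) := by
    intro σ h1 h3
    rw [h.motion hvi hs.time_nonneg h1 fun r h4 h5 => h3 r h4.le h5, hs.position]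
  have hfl := hcd.flight hs.time_nonneg hs.lower hs.velocity (T := T)
    (fun σ h1 h2 h3 r h4 h5 => by
      have h6 := hlin r h4.le fun r' h7 h8 => h3 r' h7 (h8.trans h5)
      obtain ⟨h7, h8, -⟩ := ray_outside hw hsu (show 0 < r - t by linarith)
        (show r - t < horizon a s by linarith)
      simp only [latentRate, flipRate, h6, h3 r h4.le h5, hψ.outside _ h7, h8]) hT
  exact ⟨hfl.1, fun r h1 h2 => hlin r h1 fun r' h3 h4 => hfl.1 r' h3 (h4.trans_le h2), hfl.2⟩

open Classical in
/-- The motion from one event to the next. -/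
lemma step (hφ : Continuous φ) (hw : 0 < w) (hψ : IsLatentSlope φ ψ w)
    (h : IsLatentPath ψ y v y₀ v₀ e)
    (hs : LatentSnapshot w y (fun t => ∫ s in (0 : ℝ)..t, latentRate ψ y v s) e v₀ t s n)
    {k : ℕ} {ξ : ClockStream}
    (hξ : ξ = residualStream e (fun _ => w) (∫ s in (0 : ℝ)..t, latentRate ψ y v s) n k)
    (hgood : ξ.1 0 ≠ cumRate φ s (horizon a s)) :
    (∀ r, t ≤ r → r < t + flightOf φ a (s, ξ) →
      collapse w (y r) = s.1 + s.2 * (r - t) ∧ v r = s.2) ∧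
    (∀ r, t + flightOf φ a (s, ξ) ≤ r → r < t + flightOf φ a (s, ξ) + stickOf φ a (s, ξ) →
      collapse w (y r) = 0) ∧
    LatentSnapshot w y (fun t => ∫ s in (0 : ℝ)..t, latentRate ψ y v s) e v₀
      (t + flightOf φ a (s, ξ) + stickOf φ a (s, ξ)) (chainStep φ a (s, ξ)).1
      (n + if FlipsFirst φ a s (ξ.1 0) then 1 else 0) ∧
    (chainStep φ a (s, ξ)).2 = residualStream e (fun _ => w)
      (∫ s in (0 : ℝ)..(t + flightOf φ a (s, ξ) + stickOf φ a (s, ξ)), latentRate ψ y v s)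
      (n + if FlipsFirst φ a s (ξ.1 0) then 1 else 0)
      (k + if SticksAtZero φ a s (ξ.1 0) then 1 else 0) ∧
    0 < flightOf φ a (s, ξ) := by
  obtain ⟨-, -, hcd⟩ := h.regularity hφ hw.le hψ
  have hsu : s.2 = 1 ∨ s.2 = -1 := by
    rw [hs.velocity]
    rcases neg_one_pow_eq_or ℝ n with h1 | h1 <;> rcases h.unit with h2 | h2 <;> simp [h1, h2]
  set R : ℝ → ℝ := fun t => ∫ s in (0 : ℝ)..t, latentRate ψ y v s with hR
  set T := flightOf φ a (s, ξ) with hTdef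
  have he0 : ξ.1 0 = clockSum e (n + 1) - R t := by rw [hξ]; rfl
  have he0pos : 0 < ξ.1 0 := by rw [he0]; linarith [hs.upper]
  have hTpos : 0 < T := flightTime_pos hφ he0pos
  have hTh : T ≤ horizon a s := flightTime_le_horizon hφ _ _
  have hT : ∀ c, 0 ≤ c → c < T → cumRate φ s c < clockSum e (n + 1) - R t := fun c h1 h2 => by
    rw [← he0]
    exact (lt_flightTime_iff hφ h1 (h2.trans_le hTh) (Or.inl hgood)).1 h2
  obtain ⟨f1, f2, f3⟩ := h.flight hφ hw.le hψ hsu hs hTh hT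
  have hRT : R (t + T) = R t + cumRate φ s T := by
    have := f3 (t + T) (by linarith) le_rfl
    rwa [add_sub_cancel_left] at this
  have hyT : y (t + T) = latentLift w s + s.2 * T := by
    have := f2 (t + T) (by linarith) le_rfl
    rwa [add_sub_cancel_left] at this
  have htT : 0 ≤ t + T := by linarith [hs.time_nonneg]
  have hnext : (chainStep φ a (s, ξ)).2 = residualStream e (fun _ => w) (R (t + T))
      (n + if FlipsFirst φ a s (ξ.1 0) then 1 else 0)
      (k + if SticksAtZero φ a s (ξ.1 0) then 1 else 0) := by
    have h1 := nextStream_residualStream (a := a) hφ (D := fun _ => w) (k := k) (s := s) hs.upper.le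
    rw [← hξ] at h1
    rw [hRT]
    exact h1
  have hfly : ∀ r, t ≤ r → r < t + T → collapse w (y r) = s.1 + s.2 * (r - t) ∧ v r = s.2 := by
    refine fun r h1 h2 => ⟨?_, f1 r h1 h2⟩
    rw [f2 r h1 h2.le]
    rcases h1.eq_or_lt with rfl | h1
    · rw [sub_self, mul_zero, add_zero, add_zero, collapse_latentLift hw.le]
    · exact (ray_outside hw.le hsu (show 0 < r - t by linarith)
        (show r - t < horizon a s by linarith)).2.1
  refine ⟨hfly, ?_⟩
  by_cases hf : FlipsFirst φ a s (ξ.1 0)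
  · have hst : ¬ SticksAtZero φ a s (ξ.1 0) := fun h => h.1 hf
    have h0 : stickOf φ a (s, ξ) = 0 := if_neg hst
    have hcum : cumRate φ s T = ξ.1 0 := cumRate_flightTime hφ he0pos.le hf
    have hTlt : T < horizon a s := flightTime_lt_horizon hφ he0pos.le hf
    have hRn : R (t + T) = clockSum e (n + 1) := by rw [hRT, hcum, he0]; ring
    rw [h0, add_zero]
    refine ⟨fun r h1 h2 => by linarith, ?_, hnext, hTpos⟩
    rw [if_pos hf]
    refine ⟨htT, ?_, ?_, hRn.ge, ?_⟩
    · rw [hyT, ← (ray_outside hw.le hsu hTpos hTlt).2.2.2 (-s.2)]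
      simp only [chainStep, nextState, if_pos hf]; rfl
    · simp only [chainStep, nextState, if_pos hf, hs.velocity]; ring
    · rw [hRn, clockSum_succ e (n + 1)]; linarith [h.clock_pos (n + 1)]
  · have hTe : T = horizon a s := flightTime_of_not_flipsFirst hf
    have hlt : R (t + T) < clockSum e (n + 1) := by
      have h1 : cumRate φ s T < ξ.1 0 := by
        rw [hTe]; exact lt_of_le_of_ne (not_lt.1 hf) (Ne.symm hgood)
      rw [hRT]; linarith
    have hge : clockSum e n ≤ R (t + T) := hs.lower.trans (hcd.integral_mono hs.time_nonneg (by linarith))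
    have hstate : (chainStep φ a (s, ξ)).1 = (s.1 + s.2 * T, s.2) := by
      simp only [chainStep, nextState, if_neg hf]; rfl
    by_cases hst : SticksAtZero φ a s (ξ.1 0)
    · have h0 : stickOf φ a (s, ξ) = w := by
        unfold stickOf stickDuration
        rw [if_pos hst, hξ]; rfl
      have hx0 : s.1 + s.2 * T = 0 := by rw [hTe]; exact hst.2
      -- An arrival at 0 is an entry into the plateau at the end behind the velocity. The crossing
      -- takes the time `w` and ends at the opposite end, the lift of the next state.
      have hyT' : y (t + T) = -(s.2 * (w / 2)) := by
        rw [hyT, latentLift]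
        rcases horizon_sign (a := a) hsu with h1 | h1 | ⟨-, ⟨h1, h2⟩ | ⟨h1, h2⟩⟩
        · rw [← hTe] at h1; linarith [h1.1]
        · rw [← hTe] at h1; linarith [h1.1]
        · rw [if_neg h2]; rw [h1] at hx0 ⊢; linarith
        · rw [if_pos h2]; rw [h1] at hx0 ⊢; linarith
      obtain ⟨-, c2, c3⟩ := h.cross (t := t + T) (T := w) hφ hw.le hψ htT hge hlt hs.velocity
        fun r h1 h2 => by
          rw [hyT']
          rcases hsu with h | h <;> rw [h, abs_lt] <;> constructor <;> linarith
      rw [h0]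
      have hRD : R (t + T + w) = R (t + T) := c3 _ (by linarith) le_rfl
      refine ⟨fun r h1 h2 => ?_, ?_, by rw [hnext, ← hRD], hTpos⟩
      · rw [c2 r h1 h2.le, hyT']
        refine collapse_of_abs_le ?_
        rcases hsu with h | h <;> rw [h, abs_le] <;> constructor <;> linarith
      · rw [if_neg hf, add_zero]
        refine ⟨by linarith, ?_, by rw [hstate]; exact hs.velocity, by rwa [hRD], by rwa [hRD]⟩
        rw [c2 _ (by linarith) le_rfl, hyT', hstate, hx0, latentLift_zero hsu]
        ring
    · have h0 : stickOf φ a (s, ξ) = 0 := if_neg hst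
      rw [h0, add_zero]
      refine ⟨fun r h1 h2 => by linarith, ?_, hnext, hTpos⟩
      rw [if_neg hf, add_zero]
      refine ⟨htT, ?_, by rw [hstate]; exact hs.velocity, hge, hlt⟩
      rw [hyT, hstate]
      rcases horizon_sign (a := a) hsu with ⟨h1, h2⟩ | ⟨h1, h2⟩ | ⟨h1, -⟩
      · rw [← hTe] at h1
        rw [latentLift_of_pos h1, latentLift, if_pos h2]; ring
      · rw [← hTe] at h1
        rw [latentLift_of_neg h1, latentLift, if_neg h2]; ring
      · exact absurd ⟨hf, h1⟩ hst

/-- The time at which a latent trajectory leaves the latent universe for the first time. -/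
def _root_.latentExit (w y₀ v₀ : ℝ) : ℝ := if |y₀| ≤ w / 2 then w / 2 - v₀ * y₀ else 0

/-- The image of a latent trajectory follows the event chain. -/
theorem followsChain (hφ : Continuous φ) (hw : 0 < w) (hψ : IsLatentSlope φ ψ w)
    (h : IsLatentPath ψ y v y₀ v₀ e)
    (hgood : ∀ m, ((chainStep φ a)^[m] ((collapse w y₀, v₀), (e, fun _ => w))).2.1 0 ≠
      cumRate φ ((chainStep φ a)^[m] ((collapse w y₀, v₀), (e, fun _ => w))).1
        (horizon a ((chainStep φ a)^[m] ((collapse w y₀, v₀), (e, fun _ => w))).1)) :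
    FollowsChain φ a (fun t => collapse w (y t)) v (latentExit w y₀ v₀)
      ((collapse w y₀, v₀), (e, fun _ => w)) := by
  classical
  obtain ⟨-, -, hcd⟩ := h.regularity hφ hw.le hψ
  have hy0 : y 0 = y₀ := by rw [h.position 0 le_rfl]; simp
  have he0 : 0 < clockSum e (0 + 1) := by rw [clockSum_succ, clockSum_zero]; linarith [h.clock_pos 0]
  set θ := latentExit w y₀ v₀ with hθ
  set s : ℝ × ℝ := (collapse w y₀, v₀) with hs
  set ξ : ClockStream := (e, fun _ => w) with hξ
  -- A start on the plateau moves at unit speed without a flip and leaves after the time `w / 2 - v₀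
  -- * y₀`, which plays the part of an initial sticking time.
  have hstart : LatentSnapshot w y (fun t => ∫ s in (0 : ℝ)..t, latentRate ψ y v s) e v₀ θ s 0 ∧
      ξ = residualStream e (fun _ => w) (∫ s in (0 : ℝ)..θ, latentRate ψ y v s) 0 0 ∧
      ∀ r, 0 ≤ r → r < θ → collapse w (y r) = 0 := by
    by_cases h0 : |y₀| ≤ w / 2
    · have hθ' : θ = w / 2 - v₀ * y₀ := if_pos h0
      have hb := abs_le.1 h0
      have hθ0 : 0 ≤ θ := by rw [hθ']; rcases h.unit with h | h <;> rw [h] <;> linarith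
      obtain ⟨-, c2, c3⟩ := h.cross (t := 0) (T := θ) (n := 0) (ν := v₀) hφ hw.le hψ le_rfl
        (by simp [clockSum_zero]) (by simpa using he0) (by simp) fun r h1 h2 => by
          rw [hy0, sub_zero]
          rw [zero_add, hθ'] at h2
          rcases h.unit with h | h <;> rw [h] at h2 ⊢ <;> rw [abs_lt] <;> constructor <;> linarith
      have hRθ := c3 θ hθ0 (by rw [zero_add])
      rw [intervalIntegral.integral_same] at hRθ
      refine ⟨⟨hθ0, ?_, by simp [hs], ?_, ?_⟩, ?_, fun r h1 h2 => ?_⟩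
      · rw [c2 θ hθ0 (by rw [zero_add]), hy0, hs, collapse_of_abs_le h0, latentLift_zero h.unit, hθ']
        rcases h.unit with h | h <;> rw [h] <;> ring
      · simp only [hRθ, clockSum_zero]; exact le_rfl
      · simpa only [hRθ] using he0
      · rw [hRθ, residualStream_zero]
      · rw [c2 r h1 (by linarith), hy0]
        refine collapse_of_abs_le ?_
        rw [hθ'] at h2
        rcases h.unit with h | h <;> rw [h] at h2 ⊢ <;> rw [abs_le] <;> constructor <;> linarith
    · have hθ' : θ = 0 := if_neg h0
      rw [hθ']
      refine ⟨⟨le_rfl, ?_, by simp [hs], by simp [clockSum_zero], by simpa using he0⟩, ?_,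
        fun r h1 h2 => by linarith⟩
      · rw [hy0, hs, latentLift_collapse hw.le (not_le.1 h0)]
      · rw [intervalIntegral.integral_same, residualStream_zero]
  obtain ⟨hsnap0, hξ0, hzero⟩ := hstart
  have hsu : s.2 = 1 ∨ s.2 = -1 := h.unit
  have hsnap : ∀ m, LatentSnapshot w y (fun t => ∫ s in (0 : ℝ)..t, latentRate ψ y v s) e v₀
      (eventTime φ a θ (s, ξ) m) ((chainStep φ a)^[m] (s, ξ)).1 (flipCount φ a (s, ξ) m) ∧
      ((chainStep φ a)^[m] (s, ξ)).2 = residualStream e (fun _ => w)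
        (∫ s in (0 : ℝ)..eventTime φ a θ (s, ξ) m, latentRate ψ y v s) (flipCount φ a (s, ξ) m)
        (stickCount φ a (s, ξ) m) := by
    intro m
    induction m with
    | zero =>
      have : eventTime φ a θ (s, ξ) 0 = θ := FollowsChain.eventTime_zero
      rw [this]
      exact ⟨hsnap0, hξ0⟩
    | succ m ih =>
      obtain ⟨-, -, h3, h4, -⟩ := h.step (a := a) hφ hw hψ ih.1 ih.2 (hgood m)
      have e1 : eventTime φ a θ (s, ξ) (m + 1) = eventTime φ a θ (s, ξ) m +
          flightOf φ a ((chainStep φ a)^[m] (s, ξ)) + stickOf φ a ((chainStep φ a)^[m] (s, ξ)) := by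
        rw [eventTime_succ θ (q := (s, ξ)) hsu, add_assoc]
      have e2 : flipCount φ a (s, ξ) (m + 1) = flipCount φ a (s, ξ) m +
          if FlipsFirst φ a ((chainStep φ a)^[m] (s, ξ)).1 (((chainStep φ a)^[m] (s, ξ)).2.1 0)
          then 1 else 0 := by
        unfold flipCount; rw [Finset.sum_range_succ]
      have e3 : stickCount φ a (s, ξ) (m + 1) = stickCount φ a (s, ξ) m +
          if SticksAtZero φ a ((chainStep φ a)^[m] (s, ξ)).1 (((chainStep φ a)^[m] (s, ξ)).2.1 0)
          then 1 else 0 := by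
        unfold stickCount; rw [Finset.sum_range_succ]
      rw [e1, e2, e3, Function.iterate_succ_apply']
      exact ⟨h3, h4⟩
  have hstep := fun m => h.step (a := a) hφ hw hψ (hsnap m).1 (hsnap m).2 (hgood m)
  have hD : ∀ j, 0 ≤ (s, ξ).2.2 j := fun j => hw.le
  refine ⟨hsnap0.time_nonneg, hsu, hzero, fun m r h1 h2 => (hstep m).1 r h1 h2, fun m r h1 h2 => ?_,
    fun m => (hstep m).2.2.2.2, fun m => stickDuration_nonneg (iterate_chainStep_nonneg hD m 0), ?_⟩
  · rw [eventTime_succ θ (q := (s, ξ)) hsu, ← add_assoc] at h2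
    exact (hstep m).2.1 r h1 h2
  · refine tendsto_eventTime (q := (s, ξ)) hsu hD fun B => ?_
    obtain ⟨N, hN⟩ := (h.diverges.eventually_gt_atTop
      (∫ s in (0 : ℝ)..max B 0, latentRate ψ y v s)).exists
    refine ⟨N, fun m hm => ?_⟩
    have h1 := (hsnap m).1.lower
    have h2 := hcd.integral_mono (hsnap m).1.time_nonneg (hm.trans (le_max_left B 0))
    have h3 : clockSum e (flipCount φ a (s, ξ) m) < clockSum e N := lt_of_le_of_lt (h1.trans h2) hN
    exact ((clockSum_strictMono h.clock_pos).lt_iff_lt.1 h3).le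

end IsLatentPath

end

noncomputable section

/-! ### Exchanging one coordinate -/

section Exchange

variable {ι : Type*} [DecidableEq ι]

/-- Exchanging the `i`-th coordinates of two points. -/
def exchange (i : ι) (q : (ι → ℝ) × (ι → ℝ)) : (ι → ℝ) × (ι → ℝ) :=
  (Function.update q.1 i (q.2 i), Function.update q.2 i (q.1 i))

/-- If a pair of points is viewed as a point with paired coordinates, the exchange is the swap in
the `i`-th factor and the identity in the others. -/
lemma measurePreserving_exchange [Fintype ι] (μ : ι → Measure ℝ) [∀ j, SigmaFinite (μ j)] (i : ι) :
    MeasurePreserving (exchange i) ((Measure.pi μ).prod (Measure.pi μ))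
      ((Measure.pi μ).prod (Measure.pi μ)) := by
  have he := measurePreserving_arrowProdEquivProdArrow ℝ ℝ ι μ μ
  have hg : ∀ j, MeasurePreserving (if j = i then Prod.swap else id : ℝ × ℝ → ℝ × ℝ)
      ((μ j).prod (μ j)) ((μ j).prod (μ j)) := fun j => by
    split_ifs
    · exact Measure.measurePreserving_swap
    · exact MeasurePreserving.id _
  have h := (he.comp (measurePreserving_pi _ _ hg)).comp he.symm
  convert h using 1
  ext q j <;> simp only [exchange, Function.comp_apply, Function.update_apply,
    MeasurableEquiv.arrowProdEquivProdArrow, Equiv.arrowProdEquivProdArrow] <;>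
    by_cases hj : j = i <;> simp [hj, MeasurableEquiv.symm]

lemma exchange_exchange (i : ι) (q : (ι → ℝ) × (ι → ℝ)) : exchange i (exchange i q) = q := by
  simp [exchange]

/-- A positive continuous density with independent coordinates factorizes. -/
theorem density_mul_density_exchange [Fintype ι] {μ : ι → Measure ℝ} [∀ j, IsFiniteMeasure (μ j)]
    [∀ j, (μ j).IsOpenPosMeasure] {G : (ι → ℝ) → ℝ} (hG : Continuous G) (hG0 : ∀ x, 0 < G x)
    (hGi : Integrable G (Measure.pi μ)) {c : ℝ≥0∞} (hc0 : c ≠ 0) (hct : c ≠ ∞)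
    [IsProbabilityMeasure (c • (Measure.pi μ).withDensity fun x => ENNReal.ofReal (G x))]
    (hind : iIndepFun (fun (j : ι) (x : ι → ℝ) => x j)
      (c • (Measure.pi μ).withDensity fun x => ENNReal.ofReal (G x))) (i : ι) (x y : ι → ℝ) :
    G x * G y = G (Function.update x i (y i)) * G (Function.update y i (x i)) := by
  set m := Measure.pi μ with hm
  set π := c • m.withDensity fun x => ENNReal.ofReal (G x) with hπ
  have hmeas : Measurable fun x => ENNReal.ofReal (G x) := hG.measurable.ennreal_ofReal
  have hpi : π = Measure.pi fun j => π.map fun x : ι → ℝ => x j := by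
    have := hind.map_fun_eq_pi_map fun j => (measurable_pi_apply j).aemeasurable
    rwa [Measure.map_id' ] at this
  have hprob : ∀ j, IsProbabilityMeasure (π.map fun x : ι → ℝ => x j) := fun j =>
    Measure.isProbabilityMeasure_map (measurable_pi_apply j).aemeasurable
  -- Independence makes `π` a product measure, so the exchange preserves the law of two independent
  -- copies. It also preserves the square of the reference measure, so the joint density must be
  -- invariant almost everywhere.
  have hex : MeasurePreserving (exchange i) (π.prod π) (π.prod π) := by
    have := measurePreserving_exchange (fun j => π.map fun x : ι → ℝ => x j) i
    rwa [← hpi] at this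
  have hexm : MeasurePreserving (exchange i) (m.prod m) (m.prod m) := measurePreserving_exchange μ i
  set F : (ι → ℝ) × (ι → ℝ) → ℝ≥0∞ := fun q => ENNReal.ofReal (G q.1) * ENNReal.ofReal (G q.2) with hF
  have hFm : Measurable F := (hmeas.comp measurable_fst).mul (hmeas.comp measurable_snd)
  have hprod : π.prod π = (c * c) • (m.prod m).withDensity F := by
    have hfin : IsFiniteMeasure (m.withDensity fun x => ENNReal.ofReal (G x)) :=
      ⟨by rw [withDensity_apply _ MeasurableSet.univ, Measure.restrict_univ]
          exact hGi.lintegral_lt_top⟩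
    rw [hπ, Measure.prod_smul_left, Measure.prod_smul_right, smul_smul, prod_withDensity hmeas hmeas]
  have hdens : (m.prod m).withDensity F = (m.prod m).withDensity (F ∘ exchange i) := by
    have h1 : (π.prod π).map (exchange i) = π.prod π := hex.map_eq
    rw [hprod, Measure.map_smul] at h1
    have hcc : c * c ≠ 0 := mul_ne_zero hc0 hc0
    have hcct : c * c ≠ ∞ := ENNReal.mul_ne_top hct hct
    have h2 : ((m.prod m).withDensity F).map (exchange i) = (m.prod m).withDensity F := by
      ext s hs
      have := congrArg (fun ν => ν s) h1
      simp only [Measure.smul_apply, smul_eq_mul] at this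
      exact (ENNReal.mul_right_inj hcc hcct).1 this
    rw [← h2]
    ext s hs
    rw [Measure.map_apply hexm.measurable hs, withDensity_apply _ (hexm.measurable hs),
      withDensity_apply _ hs, ← hexm.setLIntegral_comp_preimage hs (hFm.comp hexm.measurable)]
    refine setLIntegral_congr_fun (hexm.measurable hs) fun q _ => ?_
    simp only [Function.comp_apply, exchange_exchange]
  have hfin2 : ∫⁻ q, F q ∂m.prod m ≠ ∞ := by
    rw [hF, lintegral_prod_mul hmeas.aemeasurable hmeas.aemeasurable]
    exact ENNReal.mul_ne_top hGi.lintegral_lt_top.ne hGi.lintegral_lt_top.ne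
  have hae := (withDensity_eq_iff hFm.aemeasurable (hFm.comp hexm.measurable).aemeasurable hfin2).1 hdens
  have hae' : (fun q : (ι → ℝ) × (ι → ℝ) => G q.1 * G q.2) =ᵐ[m.prod m]
      fun q => G (exchange i q).1 * G (exchange i q).2 := by
    filter_upwards [hae] with q hq
    simp only [hF, Function.comp_apply] at hq
    rw [← ENNReal.ofReal_mul (hG0 _).le, ← ENNReal.ofReal_mul (hG0 _).le,
      ENNReal.ofReal_eq_ofReal_iff (mul_pos (hG0 _) (hG0 _)).le (mul_pos (hG0 _) (hG0 _)).le] at hq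
    exact hq
  have hexc : Continuous (exchange i) :=
    (continuous_fst.update i ((continuous_apply i).comp continuous_snd)).prodMk
      (continuous_snd.update i ((continuous_apply i).comp continuous_fst))
  have hop : m.IsOpenPosMeasure := by rw [hm]; infer_instance
  have hfm : IsFiniteMeasure m := by rw [hm]; infer_instance
  have hop2 : (m.prod m).IsOpenPosMeasure := inferInstance
  -- The reference measure charges every open set, so continuous functions that agree almost
  -- everywhere agree everywhere.
  have := (Continuous.ae_eq_iff_eq (m.prod m)
    ((hG.comp continuous_fst).mul (hG.comp continuous_snd))
    ((hG.comp (continuous_fst.comp hexc)).mul (hG.comp (continuous_snd.comp hexc)))).1 hae'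
  exact congrFun this (x, y)

/-- The integral of a function of a product measure after resampling one coordinate. -/
lemma lintegral_resample [Fintype ι] (μ : ι → Measure ℝ) [∀ j, IsProbabilityMeasure (μ j)] (i : ι)
    {H : (ι → ℝ) → ℝ≥0∞} (hH : Measurable H) :
    ∫⁻ x, H x ∂Measure.pi μ = ∫⁻ x, ∫⁻ t, H (Function.update x i t) ∂μ i ∂Measure.pi μ := by
  have hex := measurePreserving_exchange μ i
  have hm : Measurable fun q : (ι → ℝ) × ℝ => H (Function.update q.1 i q.2) := by
    refine hH.comp ?_
    exact measurable_pi_iff.2 fun j => by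
      by_cases hj : j = i
      · subst hj; simpa using measurable_snd
      · simp only [Function.update_of_ne hj]
        exact (measurable_pi_apply j).comp measurable_fst
  calc ∫⁻ x, H x ∂Measure.pi μ = ∫⁻ q, H q.1 ∂(Measure.pi μ).prod (Measure.pi μ) := by
        rw [lintegral_prod (fun q : (ι → ℝ) × (ι → ℝ) => H q.1) (hH.comp measurable_fst).aemeasurable]; simp
    _ = ∫⁻ q, H (exchange i q).1 ∂(Measure.pi μ).prod (Measure.pi μ) :=
        (hex.lintegral_comp (hH.comp measurable_fst)).symm
    _ = ∫⁻ x, ∫⁻ y, H (Function.update x i (y i)) ∂Measure.pi μ ∂Measure.pi μ :=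
        lintegral_prod _ ((hH.comp measurable_fst).comp hex.measurable).aemeasurable
    _ = _ := by
        refine lintegral_congr fun x => ?_
        exact (measurePreserving_eval μ i).lintegral_comp (hm.comp measurable_prodMk_left)

end Exchange

end

noncomputable section

/-! ### One coordinate of the spike-and-slab posterior -/

section Model

variable {d : ℕ} {p : ℝ} {slab : ℝ → ℝ} {L : (Fin d → ℝ) → ℝ}

namespace IsSpikeSlabModel

lemma isProbabilityMeasure_prior (h : IsSpikeSlabModel p slab L) :
    IsProbabilityMeasure (spikeSlabPrior p slab) := by
  have h1 : ∫⁻ y, ENNReal.ofReal (slab y) = 1 := by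
    rw [← ofReal_integral_eq_lintegral_ofReal h.slab_integrable (.of_forall fun y => (h.slab_pos y).le),
      h.slab_integral, ENNReal.ofReal_one]
  refine ⟨?_⟩
  rw [spikeSlabPrior, Measure.add_apply, Measure.smul_apply, Measure.smul_apply,
    withDensity_apply _ MeasurableSet.univ, Measure.restrict_univ, h1, measure_univ, smul_eq_mul,
    smul_eq_mul, mul_one, mul_one, ← ENNReal.ofReal_add h.p_pos.le (by linarith [h.p_lt_one])]
  simp

/-- The slab is positive, so Lebesgue measure is absolutely continuous with respect to the prior;
this allows the passage from almost all points to all points in the factorization. -/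
lemma isOpenPosMeasure_prior (h : IsSpikeSlabModel p slab L) :
    (spikeSlabPrior p slab).IsOpenPosMeasure := by
  have hm : Measurable fun y => ENNReal.ofReal (slab y) :=
    h.slab_contDiff.continuous.measurable.ennreal_ofReal
  have h1 : (volume : Measure ℝ) ≪ volume.withDensity fun y => ENNReal.ofReal (slab y) :=
    withDensity_absolutelyContinuous' hm.aemeasurable
      (.of_forall fun y => by simpa using h.slab_pos y)
  have h2 : (volume.withDensity fun y => ENNReal.ofReal (slab y)) ≪ spikeSlabPrior p slab := by
    refine Measure.AbsolutelyContinuous.mk fun s _ hs => ?_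
    rw [spikeSlabPrior, Measure.add_apply, add_eq_zero, Measure.smul_apply, smul_eq_mul,
      mul_eq_zero] at hs
    exact hs.1.resolve_left (by simpa using h.p_pos)
  exact (h1.trans h2).isOpenPosMeasure

lemma stickWidth_pos (h : IsSpikeSlabModel p slab L) : 0 < stickWidth p slab :=
  div_pos (by linarith [h.p_lt_one]) (mul_pos h.p_pos (h.slab_pos 0))

lemma normalization_ne_zero (h : IsSpikeSlabModel p slab L) :
    unnormalizedSpikeSlab p slab L Set.univ ≠ 0 := by
  have := h.isProbabilityMeasure_prior
  rw [unnormalizedSpikeSlab, productPrior, withDensity_apply _ MeasurableSet.univ, Measure.restrict_univ,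
    Ne, lintegral_eq_zero_iff h.likelihood_contDiff.continuous.measurable.ennreal_ofReal]
  intro h0
  obtain ⟨x, hx⟩ := h0.exists
  simp only [Pi.zero_apply, ENNReal.ofReal_eq_zero] at hx
  exact absurd (h.likelihood_pos x) (not_lt.2 hx)

lemma normalization_ne_top (h : IsSpikeSlabModel p slab L) :
    unnormalizedSpikeSlab p slab L Set.univ ≠ ∞ := by
  rw [unnormalizedSpikeSlab, withDensity_apply _ MeasurableSet.univ, Measure.restrict_univ]
  exact h.likelihood_integrable.lintegral_lt_top.ne

lemma isProbabilityMeasure_posterior (h : IsSpikeSlabModel p slab L) :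
    IsProbabilityMeasure (spikeSlabPosterior p slab L) :=
  ⟨by rw [spikeSlabPosterior, Measure.smul_apply, smul_eq_mul,
        ENNReal.inv_mul_cancel h.normalization_ne_zero h.normalization_ne_top]⟩

end IsSpikeSlabModel

/-! ### Factorization of the likelihood and autonomy of the flip rates -/

/-- The likelihood as a function of one coordinate. -/
def likelihoodSlice (L : (Fin d → ℝ) → ℝ) (i : Fin d) (z : ℝ) : ℝ := L (Function.update 0 i z)

/-- The potential of the density part of one coordinate of the posterior. -/
def coordPotential (slab : ℝ → ℝ) (L : (Fin d → ℝ) → ℝ) (i : Fin d) (z : ℝ) : ℝ :=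
  -Real.log (likelihoodSlice L i z * slab z)

variable (i : Fin d)

lemma contDiff_coordPotential (h : IsSpikeSlabModel p slab L) :
    ContDiff ℝ 1 (coordPotential slab L i) := by
  have h1 : ContDiff ℝ 1 (likelihoodSlice L i) :=
    h.likelihood_contDiff.comp (contDiff_update 1 (0 : Fin d → ℝ) i)
  exact ((h1.mul h.slab_contDiff).log fun z =>
    (mul_pos (h.likelihood_pos _) (h.slab_pos z)).ne').neg

lemma hasDerivAt_coordPotential (h : IsSpikeSlabModel p slab L) (z : ℝ) :
    HasDerivAt (coordPotential slab L i) (deriv (coordPotential slab L i) z) z :=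
  ((contDiff_coordPotential i h).differentiable one_ne_zero z).hasDerivAt

lemma continuous_deriv_coordPotential (h : IsSpikeSlabModel p slab L) :
    Continuous (deriv (coordPotential slab L i)) :=
  (contDiff_coordPotential i h).continuous_deriv le_rfl

lemma exp_neg_coordPotential (h : IsSpikeSlabModel p slab L) (z : ℝ) :
    Real.exp (-coordPotential slab L i z) = likelihoodSlice L i z * slab z := by
  rw [coordPotential, neg_neg, Real.exp_log (mul_pos (show 0 < likelihoodSlice L i z from h.likelihood_pos _) (h.slab_pos z))]

/-- With independent coordinates the likelihood factorizes. -/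
lemma likelihood_update (h : IsSpikeSlabModel p slab L)
    (hindep : iIndepFun (fun (j : Fin d) (x : Fin d → ℝ) => x j) (spikeSlabPosterior p slab L))
    (x : Fin d → ℝ) (z : ℝ) :
    L (Function.update x i z) = L (Function.update x i 0) / L 0 * likelihoodSlice L i z := by
  have := h.isProbabilityMeasure_prior
  have := h.isOpenPosMeasure_prior
  have : IsProbabilityMeasure ((unnormalizedSpikeSlab p slab L Set.univ)⁻¹ •
      (Measure.pi fun _ : Fin d => spikeSlabPrior p slab).withDensity fun x => ENNReal.ofReal (L x)) :=
    h.isProbabilityMeasure_posterior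
  -- Exchanging coordinate `i` with the origin isolates the dependence of the likelihood on `z`.
  have key := density_mul_density_exchange (μ := fun _ : Fin d => spikeSlabPrior p slab)
    h.likelihood_contDiff.continuous h.likelihood_pos h.likelihood_integrable
    (ENNReal.inv_ne_zero.2 h.normalization_ne_top) (ENNReal.inv_ne_top.2 h.normalization_ne_zero)
    hindep i (Function.update x i z) 0
  simp only [Function.update_idem, Function.update_self, Pi.zero_apply] at key
  have h0 := (h.likelihood_pos 0).ne'
  rw [likelihoodSlice, div_mul_eq_mul_div, eq_div_iff h0]
  exact key

lemma prod_update (g : ℝ → ℝ) (x : Fin d → ℝ) (z : ℝ) :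
    ∏ j, g (Function.update x i z j) = g z * ∏ j ∈ Finset.univ.erase i, g (x j) := by
  rw [← Finset.mul_prod_erase _ _ (Finset.mem_univ i), Function.update_self]
  congr 1
  exact Finset.prod_congr rfl fun j hj => by rw [Function.update_of_ne (Finset.ne_of_mem_erase hj)]

lemma slabPotential_update (h : IsSpikeSlabModel p slab L)
    (hindep : iIndepFun (fun (j : Fin d) (x : Fin d → ℝ) => x j) (spikeSlabPosterior p slab L))
    (x : Fin d → ℝ) (z : ℝ) :
    slabPotential slab L (Function.update x i z) = coordPotential slab L i z -
      Real.log (L (Function.update x i 0) / L 0 * ∏ j ∈ Finset.univ.erase i, slab (x j)) := by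
  have h1 : 0 < L (Function.update x i 0) / L 0 * ∏ j ∈ Finset.univ.erase i, slab (x j) :=
    mul_pos (div_pos (h.likelihood_pos _) (h.likelihood_pos _)) (Finset.prod_pos fun j _ => h.slab_pos _)
  have h2 : 0 < likelihoodSlice L i z * slab z := mul_pos (h.likelihood_pos _) (h.slab_pos z)
  rw [slabPotential, coordPotential, likelihood_update i h hindep, prod_update i slab, ← neg_add',
    ← Real.log_mul h2.ne' h1.ne']
  congr 2; ring

/-- The other coordinates enter the potential as an additive constant only, so the flip rate of
coordinate `i` does not depend on them. -/
lemma deriv_slabPotential (h : IsSpikeSlabModel p slab L)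
    (hindep : iIndepFun (fun (j : Fin d) (x : Fin d → ℝ) => x j) (spikeSlabPosterior p slab L))
    (x : Fin d → ℝ) :
    deriv (fun y => slabPotential slab L (Function.update x i y)) =
      deriv (coordPotential slab L i) := by
  simp_rw [slabPotential_update i h hindep x]
  ext z
  exact deriv_sub_const _

lemma latentPotential_eq (h : IsSpikeSlabModel p slab L) (y : Fin d → ℝ) :
    latentPotential p slab L y = slabPotential slab L (fun j => collapse (stickWidth p slab) (y j)) -
      Real.log (p ^ d) := by
  have h1 : 0 < L (fun j => collapse (stickWidth p slab) (y j)) *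
      ∏ j, slab (collapse (stickWidth p slab) (y j)) :=
    mul_pos (h.likelihood_pos _) (Finset.prod_pos fun j _ => h.slab_pos _)
  rw [latentPotential, latentDensity, slabPotential, ← neg_add',
    ← Real.log_mul h1.ne' (pow_pos h.p_pos d).ne']
  simp only [latentPrior, Finset.prod_mul_distrib, Finset.prod_const, Finset.card_univ, Fintype.card_fin]
  congr 2; ring

/-- As for the original potential; the powers of `p` and the collapsed other coordinates contribute
an additive constant. -/
lemma deriv_latentPotential (h : IsSpikeSlabModel p slab L)
    (hindep : iIndepFun (fun (j : Fin d) (x : Fin d → ℝ) => x j) (spikeSlabPosterior p slab L))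
    (x : Fin d → ℝ) :
    deriv (fun y => latentPotential p slab L (Function.update x i y)) =
      deriv (fun y => coordPotential slab L i (collapse (stickWidth p slab) y)) := by
  have h1 : ∀ y, (fun j => collapse (stickWidth p slab) (Function.update x i y j)) =
      Function.update (fun j => collapse (stickWidth p slab) (x j)) i
        (collapse (stickWidth p slab) y) := fun y => by
    ext j
    by_cases hj : j = i
    · subst hj; simp
    · simp [hj]
  simp_rw [latentPotential_eq h, h1, slabPotential_update i h hindep, sub_sub]
  ext z
  exact deriv_sub_const _

/-- Off the two ends of the plateau the collapse is locally a translation or constant. At the ends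
the potential may have a kink, where `deriv` has no useful value. -/
lemma isLatentSlope_coordPotential (h : IsSpikeSlabModel p slab L) :
    IsLatentSlope (deriv (coordPotential slab L i))
      (deriv fun y => coordPotential slab L i (collapse (stickWidth p slab) y)) (stickWidth p slab) := by
  have hw := h.stickWidth_pos
  set w := stickWidth p slab
  refine ⟨measurable_deriv _, fun y hy => ?_, fun y hy => ?_⟩
  · rcases lt_or_ge 0 y with h0 | h0
    · rw [abs_of_pos h0] at hy
      have he : (fun y => coordPotential slab L i (collapse w y)) =ᶠ[𝓝 y]
          fun y => coordPotential slab L i (y - w / 2) := by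
        filter_upwards [Ioi_mem_nhds hy] with r hr
        have hr' : w / 2 < r := hr
        have := collapse_add_half hw.le (show 0 ≤ r - w / 2 by linarith)
        rw [sub_add_cancel] at this
        rw [this]
      have hc := collapse_add_half hw.le (show 0 ≤ y - w / 2 by linarith)
      rw [sub_add_cancel] at hc
      rw [he.deriv_eq, hc]
      exact deriv_comp_sub_const _ _ _
    · rw [abs_of_nonpos h0] at hy
      have he : (fun y => coordPotential slab L i (collapse w y)) =ᶠ[𝓝 y]
          fun y => coordPotential slab L i (y + w / 2) := by
        filter_upwards [Iio_mem_nhds (show y < -(w / 2) by linarith)] with r hr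
        have hr' : r < -(w / 2) := hr
        have := collapse_sub_half hw.le (show r + w / 2 ≤ 0 by linarith)
        rw [add_sub_cancel_right] at this
        rw [this]
      have hc := collapse_sub_half hw.le (show y + w / 2 ≤ 0 by linarith)
      rw [add_sub_cancel_right] at hc
      rw [he.deriv_eq, hc]
      exact deriv_comp_add_const _ _ _
  · have he : (fun y => coordPotential slab L i (collapse w y)) =ᶠ[𝓝 y]
        fun _ => coordPotential slab L i 0 := by
      filter_upwards [(continuous_abs.isOpen_preimage _ isOpen_Iio).mem_nhds hy] with r hr
      rw [collapse_of_abs_le (le_of_lt hr)]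
    rw [he.deriv_eq, deriv_const]

/-! ### The marginal of the posterior -/

/-- The posterior density of one coordinate. -/
lemma prior_withDensity_slice (h : IsSpikeSlabModel p slab L) :
    (spikeSlabPrior p slab).withDensity (fun z => ENNReal.ofReal (likelihoodSlice L i z)) =
      ENNReal.ofReal p • densityWithAtom (coordPotential slab L i) (stickWidth p slab) := by
  have hsm : Measurable fun y => ENNReal.ofReal (slab y) :=
    h.slab_contDiff.continuous.measurable.ennreal_ofReal
  have hlc : Continuous (likelihoodSlice L i) :=
    h.likelihood_contDiff.continuous.comp (continuous_const.update i continuous_id)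
  have hlm : Measurable fun z => ENNReal.ofReal (likelihoodSlice L i z) := hlc.measurable.ennreal_ofReal
  have hl0 : ∀ z, 0 < likelihoodSlice L i z := fun z => h.likelihood_pos _
  have hdir : (Measure.dirac (0 : ℝ)).withDensity (fun z => ENNReal.ofReal (likelihoodSlice L i z)) =
      ENNReal.ofReal (likelihoodSlice L i 0) • Measure.dirac 0 := by
    ext s hs
    rw [withDensity_apply _ hs, ← lintegral_indicator hs, lintegral_dirac' _ (hlm.indicator hs),
      Measure.smul_apply, Measure.dirac_apply' _ hs, smul_eq_mul]
    by_cases h0 : (0 : ℝ) ∈ s <;> simp [h0]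
  rw [spikeSlabPrior, withDensity_add_measure, withDensity_smul_measure, withDensity_smul_measure,
    ← withDensity_mul _ hsm hlm, hdir, densityWithAtom, smul_add, smul_smul, smul_smul,
    ← ENNReal.ofReal_mul (by linarith [h.p_lt_one]), ← ENNReal.ofReal_mul h.p_pos.le]
  congr 2
  · congr 1
    ext z
    rw [exp_neg_coordPotential i h, Pi.mul_apply, ← ENNReal.ofReal_mul (h.slab_pos z).le, mul_comm]
  -- The width is chosen so that `p * w * slab 0 = 1 - p`: the atom of `densityWithAtom` is the
  -- spike.
  · rw [exp_neg_coordPotential i h, stickWidth]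
    have h1 := h.p_pos.ne'
    have h2 := (h.slab_pos 0).ne'
    congr 1
    field_simp

/-- Resampling coordinate `i` from the prior and factorizing the likelihood separates the marginal
from an integral over the other coordinates. The value of the factor is irrelevant, since total
masses fix it. -/
lemma exists_map_posterior (h : IsSpikeSlabModel p slab L)
    (hindep : iIndepFun (fun (j : Fin d) (x : Fin d → ℝ) => x j) (spikeSlabPosterior p slab L)) :
    ∃ C : ℝ≥0∞, (spikeSlabPosterior p slab L).map (fun x => x i) =
      C • densityWithAtom (coordPotential slab L i) (stickWidth p slab) := by
  have := h.isProbabilityMeasure_prior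
  have hlc : Continuous (likelihoodSlice L i) :=
    h.likelihood_contDiff.continuous.comp (continuous_const.update i continuous_id)
  have hlm : Measurable fun z => ENNReal.ofReal (likelihoodSlice L i z) := hlc.measurable.ennreal_ofReal
  have hLm : Measurable fun x => ENNReal.ofReal (L x) :=
    h.likelihood_contDiff.continuous.measurable.ennreal_ofReal
  have hr : ∀ x, 0 < L (Function.update x i 0) / L 0 := fun x =>
    div_pos (h.likelihood_pos _) (h.likelihood_pos _)
  set K := ∫⁻ x, ENNReal.ofReal (L (Function.update x i 0) / L 0) ∂productPrior d p slab with hK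
  refine ⟨(unnormalizedSpikeSlab p slab L Set.univ)⁻¹ * (K * ENNReal.ofReal p), ?_⟩
  ext s hs
  have hpre : MeasurableSet ((fun x : Fin d → ℝ => x i) ⁻¹' s) := measurable_pi_apply i hs
  rw [Measure.map_apply (measurable_pi_apply i) hs, spikeSlabPosterior, Measure.smul_apply,
    Measure.smul_apply, smul_eq_mul, smul_eq_mul, mul_assoc, mul_assoc]
  congr 1
  have h1 := congrArg (fun ν => ν s) (prior_withDensity_slice i h)
  simp only [Measure.smul_apply, smul_eq_mul] at h1
  rw [← h1, unnormalizedSpikeSlab, withDensity_apply _ hpre, ← lintegral_indicator hpre, productPrior,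
    lintegral_resample (fun _ : Fin d => spikeSlabPrior p slab) i (hLm.indicator hpre),
    withDensity_apply _ hs, ← lintegral_indicator hs, hK, productPrior, ← lintegral_mul_const'']
  · refine lintegral_congr fun x => ?_
    rw [← lintegral_const_mul _ (hlm.indicator hs)]
    refine lintegral_congr fun t => ?_
    by_cases ht : t ∈ s
    · rw [Set.indicator_of_mem (by simpa using ht), Set.indicator_of_mem ht,
        likelihood_update i h hindep, ENNReal.ofReal_mul (hr x).le]
    · rw [Set.indicator_of_notMem (by simpa using ht), Set.indicator_of_notMem ht, mul_zero]
  · have hc : Continuous fun x : Fin d → ℝ => L (Function.update x i 0) / L 0 :=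
      (h.likelihood_contDiff.continuous.comp (continuous_id.update i continuous_const)).div_const _
    exact hc.measurable.ennreal_ofReal.aemeasurable

/-- The expectation of a function of one coordinate. -/
theorem integral_coordinate (h : IsSpikeSlabModel p slab L)
    (hindep : iIndepFun (fun (j : Fin d) (x : Fin d → ℝ) => x j) (spikeSlabPosterior p slab L))
    {f : ℝ → ℝ} (hf : Measurable f)
    (hfint : Integrable (fun x : Fin d → ℝ => f (x i)) (spikeSlabPosterior p slab L)) :
    IsFiniteMeasure (densityWithAtom (coordPotential slab L i) (stickWidth p slab)) ∧
    0 < (densityWithAtom (coordPotential slab L i) (stickWidth p slab)).real Set.univ ∧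
    Integrable f (densityWithAtom (coordPotential slab L i) (stickWidth p slab)) ∧
    (densityWithAtom (coordPotential slab L i) (stickWidth p slab)).real Set.univ *
      ∫ x, f (x i) ∂spikeSlabPosterior p slab L =
      ∫ x, f x ∂densityWithAtom (coordPotential slab L i) (stickWidth p slab) := by
  obtain ⟨C, hC⟩ := exists_map_posterior i h hindep
  set m := densityWithAtom (coordPotential slab L i) (stickWidth p slab) with hm
  have hprob := h.isProbabilityMeasure_posterior
  have hmap : IsProbabilityMeasure ((spikeSlabPosterior p slab L).map fun x => x i) :=
    Measure.isProbabilityMeasure_map (measurable_pi_apply i).aemeasurable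
  have h1 : C * m Set.univ = 1 := by
    have := hmap.measure_univ
    rwa [hC, Measure.smul_apply, smul_eq_mul] at this
  have hC0 : C ≠ 0 := by rintro rfl; simp at h1
  have hm0 : m Set.univ ≠ 0 := fun h0 => by simp [h0] at h1
  have hmt : m Set.univ ≠ ∞ := fun h0 => by rw [h0, ENNReal.mul_top hC0] at h1; simp at h1
  have hCt : C ≠ ∞ := fun h0 => by rw [h0, ENNReal.top_mul hm0] at h1; simp at h1
  have hfi : Integrable f ((spikeSlabPosterior p slab L).map fun x => x i) :=
    (integrable_map_measure hf.aestronglyMeasurable (measurable_pi_apply i).aemeasurable).2 hfint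
  have h2 : ∫ x, f (x i) ∂spikeSlabPosterior p slab L = C.toReal * ∫ x, f x ∂m := by
    rw [← integral_map (φ := fun x : Fin d → ℝ => x i) (measurable_pi_apply i).aemeasurable
      hf.aestronglyMeasurable, hC, integral_smul_measure, smul_eq_mul]
  refine ⟨⟨hmt.lt_top⟩, ENNReal.toReal_pos hm0 hmt, ?_, ?_⟩
  · rw [hC] at hfi
    exact (integrable_smul_measure hC0 hCt).1 hfi
  · have h3 : m.real Set.univ * C.toReal = 1 := by
      rw [Measure.real, ← ENNReal.toReal_mul, mul_comm, h1, ENNReal.toReal_one]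
    rw [h2, ← mul_assoc, h3, one_mul]

/-- Multiplication by the continuous function exp(u) undoes the density on bounded intervals. -/
lemma intervalIntegrable_of_densityWithAtom {u : ℝ → ℝ} (hu : Continuous u) {w : ℝ} {f : ℝ → ℝ}
    (hf : Integrable f (densityWithAtom u w)) (b c : ℝ) : IntervalIntegrable f volume b c := by
  have hd : Measurable fun x => ENNReal.ofReal (Real.exp (-u x)) := hu.neg.rexp.measurable.ennreal_ofReal
  have h1 : Integrable f (volume.withDensity fun x => ENNReal.ofReal (Real.exp (-u x))) :=
    hf.mono_measure (Measure.le_add_right le_rfl)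
  rw [integrable_withDensity_iff_integrable_smul' hd (.of_forall fun x => ENNReal.ofReal_lt_top)] at h1
  have h2 : IntervalIntegrable (fun x => (ENNReal.ofReal (Real.exp (-u x))).toReal • f x) volume b c :=
    h1.intervalIntegrable
  have h3 := h2.mul_continuousOn (g := fun x => Real.exp (u x)) hu.rexp.continuousOn
  refine h3.congr fun x _ => ?_
  rw [ENNReal.toReal_ofReal (Real.exp_pos _).le, smul_eq_mul, mul_right_comm, ← Real.exp_add]
  simp

end Model

end

noncomputable section

/-! ### Sequences of cycles -/

section Regeneration

variable {S E Ω : Type*} [MeasurableSpace S] [MeasurableSpace E] [MeasurableSpace Ω] {Q : Measure S}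
  [IsProbabilityMeasure Q] {P : Measure Ω} [IsProbabilityMeasure P] {W : S → E} {R : S → S}

lemma iIndepFun_of_range {V : ℕ → Ω → E} (h : ∀ (n : ℕ) (t : ℕ → Set E), (∀ i, MeasurableSet (t i)) →
    P (⋂ i ∈ Finset.range n, V i ⁻¹' t i) = ∏ i ∈ Finset.range n, P (V i ⁻¹' t i)) : iIndepFun V P := by
  classical
  refine (iIndepFun_iff_measure_inter_preimage_eq_mul).2 fun s t ht => ?_
  obtain ⟨n, hn⟩ := s.exists_nat_subset_range
  set t' : ℕ → Set E := fun i => if i ∈ s then t i else Set.univ with ht'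
  have ht'm : ∀ i, MeasurableSet (t' i) := fun i => by
    simp only [ht']; split_ifs with h
    · exact ht i h
    · exact MeasurableSet.univ
  have h1 : ⋂ i ∈ s, V i ⁻¹' t i = ⋂ i ∈ Finset.range n, V i ⁻¹' t' i := by
    ext ω
    simp only [Set.mem_iInter, ht', Set.mem_preimage]
    refine ⟨fun h i _ => ?_, fun h i hi => ?_⟩
    · split_ifs with his
      · exact h i his
      · trivial
    · simpa [hi] using h i (hn hi)
  have h2 : ∏ i ∈ s, P (V i ⁻¹' t i) = ∏ i ∈ Finset.range n, P (V i ⁻¹' t' i) := by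
    rw [← Finset.prod_subset hn (f := fun i => P (V i ⁻¹' t' i))]
    · refine Finset.prod_congr rfl fun i hi => by simp [ht', hi]
    · intro i _ hi; simp [ht', hi]
  rw [h1, h2, h n t' ht'm]

lemma measurePreserving_of_lintegral (hR : Measurable R)
    (h : ∀ G : E × S → ℝ≥0∞, Measurable G →
      ∫⁻ ξ, G (W ξ, R ξ) ∂Q = ∫⁻ ξ, ∫⁻ ξ', G (W ξ, ξ') ∂Q ∂Q) : MeasurePreserving R Q Q := by
  refine ⟨hR, Measure.ext_of_lintegral _ fun g hg => ?_⟩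
  rw [lintegral_map hg hR]
  refine (h (fun p => g p.2) (hg.comp measurable_snd)).trans ?_
  simp

/-- The sequence that starts with `A` and continues with the values of `W` along the iterates of
`R`. -/
def cycleSeq (W : S → E) (R : S → S) (A : Ω → E) (η : Ω → S) : ℕ → Ω → E
  | 0 => A
  | n + 1 => fun ω => W (R^[n] (η ω))

/-- The first term may have another law than the cycles; it only has to be independent of the stream
η from which all cycles are computed. -/
theorem iIndepFun_cycleSeq (hW : Measurable W) (hR : Measurable R)
    (h : ∀ G : E × S → ℝ≥0∞, Measurable G →
      ∫⁻ ξ, G (W ξ, R ξ) ∂Q = ∫⁻ ξ, ∫⁻ ξ', G (W ξ, ξ') ∂Q ∂Q)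
    {A : Ω → E} {η : Ω → S} (hA : Measurable A) (hη : MeasurePreserving η P Q)
    (hlaw : ∀ G : E × S → ℝ≥0∞, Measurable G →
      ∫⁻ ω, G (A ω, η ω) ∂P = ∫⁻ ω, ∫⁻ ξ, G (A ω, ξ) ∂Q ∂P) :
    iIndepFun (cycleSeq W R A η) P ∧ (∀ n, Measurable (cycleSeq W R A η n)) ∧
      ∀ n, P.map (cycleSeq W R A η (n + 1)) = Q.map W := by
  have hRp := measurePreserving_of_lintegral hR h
  have hmap : ∀ n, P.map (cycleSeq W R A η (n + 1)) = Q.map W := fun n => by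
    have h1 := (hRp.iterate n).comp hη
    have h2 : cycleSeq W R A η (n + 1) = W ∘ (R^[n] ∘ η) := rfl
    rw [h2, ← Measure.map_map hW h1.measurable, h1.map_eq]
  have hm : ∀ n, Measurable (cycleSeq W R A η n) := fun n => by
    cases n with
    | zero => exact hA
    | succ n => exact hW.comp ((hR.iterate n).comp hη.measurable)
  refine ⟨iIndepFun_of_range fun n t ht => ?_, hm, hmap⟩
  cases n with
  | zero => simp
  | succ n =>
    have := Measure.isProbabilityMeasure_map (μ := Q) hW.aemeasurable
    set B : Set S := ⋂ i ∈ Finset.range n, (fun ξ => W (R^[i] ξ)) ⁻¹' t (i + 1) with hB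
    have hBm : MeasurableSet B := Finset.measurableSet_biInter _ fun i _ =>
      (hW.comp (hR.iterate i)) (ht (i + 1))
    have hset : ⋂ i ∈ Finset.range (n + 1), cycleSeq W R A η i ⁻¹' t i = A ⁻¹' t 0 ∩ η ⁻¹' B := by
      ext ω
      simp only [Set.mem_iInter, Finset.mem_range, Set.mem_inter_iff, Set.mem_preimage, hB]
      refine ⟨fun h => ⟨h 0 (Nat.succ_pos _), fun i hi => h (i + 1) (by omega)⟩, fun h i hi => ?_⟩
      cases i with
      | zero => exact h.1
      | succ i => exact h.2 i (by omega)
    have hQB : Q B = ∏ i ∈ Finset.range n, Q.map W (t (i + 1)) := by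
      have h1 := map_iterate_eq_infinitePi hW hR h
      have h2 := Measure.infinitePi_pi (μ := fun _ : ℕ => Q.map W) (s := Finset.range n)
        (t := fun i => t (i + 1)) fun i _ => ht (i + 1)
      have h3 : Measurable fun ξ => fun j => W (R^[j] ξ) :=
        measurable_pi_lambda _ fun j => hW.comp (hR.iterate j)
      rw [← h2, ← h1, Measure.map_apply h3
        (MeasurableSet.pi (Finset.countable_toSet _) fun i _ => ht (i + 1))]
      congr 1
      ext ξ; simp [hB, Set.mem_pi]
    have hG : Measurable ((t 0 ×ˢ B).indicator (1 : E × S → ℝ≥0∞)) :=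
      measurable_one.indicator ((ht 0).prod hBm)
    have key := hlaw _ hG
    have e1 : ∫⁻ ω, (t 0 ×ˢ B).indicator (1 : E × S → ℝ≥0∞) (A ω, η ω) ∂P =
        P (A ⁻¹' t 0 ∩ η ⁻¹' B) := by
      rw [← lintegral_indicator_one ((hA (ht 0)).inter (hη.measurable hBm))]
      rfl
    have e2 : ∀ ω, ∫⁻ ξ, (t 0 ×ˢ B).indicator (1 : E × S → ℝ≥0∞) (A ω, ξ) ∂Q =
        (A ⁻¹' t 0).indicator (fun _ => Q B) ω := by
      intro ω
      by_cases hω : A ω ∈ t 0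
      · rw [Set.indicator_of_mem (by exact hω), ← lintegral_indicator_one hBm]
        refine lintegral_congr fun ξ' => ?_
        by_cases hh : ξ' ∈ B
        · rw [Set.indicator_of_mem hh, Set.indicator_of_mem (by exact ⟨hω, hh⟩)]; rfl
        · rw [Set.indicator_of_notMem hh, Set.indicator_of_notMem fun h => hh h.2]
      · rw [Set.indicator_of_notMem (by exact hω)]
        simp [hω]
    rw [hset, ← e1, key]
    simp only [e2]
    rw [lintegral_indicator (hA (ht 0)), setLIntegral_const, hQB, Finset.prod_range_succ']
    congr 1
    refine Finset.prod_congr rfl fun i _ => ?_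
    rw [← hmap i, Measure.map_apply (hm (i + 1)) (ht (i + 1))]

end Regeneration

/-! ### The first visit -/

variable {φ : ℝ → ℝ} {a : ℝ}

lemma measurable_firstVisit (hφ : Continuous φ) (z : ℝ × ℝ) : Measurable (firstVisit φ a z) := by
  refine measurable_to_countable' fun n => ?_
  have : firstVisit φ a z ⁻¹' {n} = ({q | ((chainStep φ a)^[n] q).1 = z} ∩
      ⋂ k ∈ Finset.range n, {q | ((chainStep φ a)^[k] q).1 = z}ᶜ) ∪
      ((⋂ k, {q | ((chainStep φ a)^[k] q).1 = z}ᶜ) ∩ {_q | n = 0}) := by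
    ext q
    simp only [Set.mem_preimage, Set.mem_singleton_iff, Set.mem_union, Set.mem_inter_iff,
      Set.mem_iInter, Finset.mem_range, Set.mem_compl_iff, Set.mem_ofPred_eq]
    constructor
    · rintro rfl
      by_cases hex : {n | ((chainStep φ a)^[n] q).1 = z}.Nonempty
      · exact Or.inl ⟨Nat.sInf_mem hex, fun k hk => Nat.notMem_of_lt_sInf hk⟩
      · rw [Set.not_nonempty_iff_eq_empty] at hex
        refine Or.inr ⟨fun k hk => ?_, ?_⟩
        · have : k ∈ {n | ((chainStep φ a)^[n] q).1 = z} := hk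
          rw [hex] at this; exact this
        · rw [firstVisit, hex, Nat.sInf_empty]
    · rintro (⟨h1, h2⟩ | ⟨h1, rfl⟩)
      · refine le_antisymm (Nat.sInf_le h1) ?_
        by_contra hlt
        exact h2 _ (not_le.1 hlt) (Nat.sInf_mem (s := {n | ((chainStep φ a)^[n] q).1 = z}) ⟨n, h1⟩)
      · have : {n | ((chainStep φ a)^[n] q).1 = z} = ∅ := by ext k; simpa using h1 k
        rw [firstVisit, this, Nat.sInf_empty]
  rw [this]
  exact ((measurableSet_visit hφ z n).inter (Finset.measurableSet_biInter _ fun k _ =>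
    (measurableSet_visit hφ z k).compl)).union
    ((MeasurableSet.iInter fun k => (measurableSet_visit hφ z k).compl).inter (MeasurableSet.const _))

/-- The streams that remain after the first visit to `z`. -/
def streamAtFirstVisit (φ : ℝ → ℝ) (a : ℝ) (z : ℝ × ℝ) (q : (ℝ × ℝ) × ClockStream) : ClockStream :=
  ((chainStep φ a)^[firstVisit φ a z q] q).2

/-- The gain until the first visit to `z`. -/
def delayGain (φ : ℝ → ℝ) (a : ℝ) (z : ℝ × ℝ) (Φ : ℝ → ℝ) (c : ℝ) (q : (ℝ × ℝ) × ClockStream) : ℝ :=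
  totalGain φ a Φ c (firstVisit φ a z q) q

lemma measurable_streamAtFirstVisit (hφ : Continuous φ) (z : ℝ × ℝ) :
    Measurable (streamAtFirstVisit φ a z) :=
  measurable_eval_index (measurable_firstVisit hφ z) fun n => (measurable_iterate_chainStep hφ n).snd

lemma measurable_delayGain (hφ : Continuous φ) (z : ℝ × ℝ) {Φ : ℝ → ℝ} (hΦ : Measurable Φ) (c : ℝ) :
    Measurable (delayGain φ a z Φ c) :=
  measurable_eval_index (measurable_firstVisit hφ z) fun n => measurable_totalGain hφ hΦ c n

lemma firstVisit_self (z : ℝ × ℝ) (ξ : ClockStream) : firstVisit φ a z (z, ξ) = 0 :=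
  Nat.sInf_eq_zero.2 (Or.inl rfl)

/-- The two indices differ only in whether the start counts as a visit. -/
lemma firstVisit_eq_visitIndex {s z : ℝ × ℝ} (hs : s ≠ z) {ξ : ClockStream}
    (hex : ∃ n, ((chainStep φ a)^[n] (s, ξ)).1 = z) :
    Visits φ a z (s, ξ) ∧ firstVisit φ a z (s, ξ) = visitIndex φ a z (s, ξ) := by
  obtain ⟨n, hn⟩ := hex
  have hv : Visits φ a z (s, ξ) := by
    cases n with
    | zero => exact absurd hn hs
    | succ n => exact ⟨n, hn⟩
  refine ⟨hv, le_antisymm (Nat.sInf_le (iterate_visitIndex_fst hv)) ?_⟩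
  have hmem : ((chainStep φ a)^[firstVisit φ a z (s, ξ)] (s, ξ)).1 = z :=
    Nat.sInf_mem (s := {n | ((chainStep φ a)^[n] (s, ξ)).1 = z}) ⟨n, hn⟩
  generalize firstVisit φ a z (s, ξ) = m at hmem
  cases m with
  | zero => exact absurd hmem hs
  | succ m => exact Nat.succ_le_succ (Nat.sInf_le hmem)

/-- A start at `z` has no delay and an untouched stream; otherwise the first visit takes at least
one step and `lintegral_cycle` applies. -/
theorem lintegral_delay (κ : Measure ℝ) [IsProbabilityMeasure κ] (hφ : Continuous φ) (s z : ℝ × ℝ)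
    {ι : Type*} {Φ : ι → ℝ → ℝ} (hΦ : ∀ i, Measurable (Φ i)) (c : ι → ℝ)
    (hex : ∀ᵐ ξ ∂streamLaw κ, ∃ n, ((chainStep φ a)^[n] (s, ξ)).1 = z)
    {G : (ι → ℝ) × ClockStream → ℝ≥0∞} (hG : Measurable G) :
    ∫⁻ ξ, G (fun i => delayGain φ a z (Φ i) (c i) (s, ξ), streamAtFirstVisit φ a z (s, ξ)) ∂streamLaw κ =
      ∫⁻ ξ, ∫⁻ ξ', G (fun i => delayGain φ a z (Φ i) (c i) (s, ξ), ξ') ∂streamLaw κ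
        ∂streamLaw κ := by
  by_cases hs : s = z
  · subst hs
    simp [delayGain, streamAtFirstVisit, firstVisit_self, totalGain]
  · have h1 : ∀ᵐ ξ ∂streamLaw κ, Visits φ a z (s, ξ) ∧
        firstVisit φ a z (s, ξ) = visitIndex φ a z (s, ξ) :=
      hex.mono fun ξ hξ => firstVisit_eq_visitIndex hs hξ
    have h2 := lintegral_cycle κ hφ s z hΦ c (h1.mono fun ξ h => h.1) hG
    refine Eq.trans ?_ (h2.trans ?_)
    · refine lintegral_congr_ae (h1.mono fun ξ hξ => ?_)
      simp only [delayGain, streamAtFirstVisit, hξ.2]; rfl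
    · refine lintegral_congr_ae (h1.mono fun ξ hξ => ?_)
      simp only [delayGain, hξ.2]; rfl

lemma totalGain_add (Φ : ℝ → ℝ) (c : ℝ) (m n : ℕ) (q : (ℝ × ℝ) × ClockStream) :
    totalGain φ a Φ c (m + n) q = totalGain φ a Φ c m q + totalGain φ a Φ c n ((chainStep φ a)^[m] q) := by
  unfold totalGain
  rw [Finset.sum_range_add]
  congr 1
  refine Finset.sum_congr rfl fun k _ => ?_
  rw [← Function.iterate_add_apply, add_comm]

end

noncomputable section

/-! ### The central limit theorem for a process that follows the event chain -/

variable {φ : ℝ → ℝ} {a : ℝ}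

namespace FollowsChain

variable {x v : ℝ → ℝ} {θ : ℝ} {q : (ℝ × ℝ) × ClockStream} {f : ℝ → ℝ}

/-- Bounds all partial integrals of a cycle by the integral of the absolute value over the whole
cycle; this is the third component of the cycles fed to `regenerative_clt`. -/
lemma abs_integral_steps_le (h : FollowsChain φ a x v θ q) (hf : ∀ b c, IntervalIntegrable f volume b c)
    (m n : ℕ) {τ : ℝ} (h1 : eventTime φ a θ q m ≤ τ) (h2 : τ ≤ eventTime φ a θ q (m + n)) :
    |∫ s in eventTime φ a θ q m..τ, f (x s)| ≤
      totalGain φ a (primitive fun y => |f y|) |f 0| n ((chainStep φ a)^[m] q) := by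
  have ha : ∀ b c, IntervalIntegrable (fun y => |f y|) volume b c := fun b c => (hf b c).abs
  rw [← (h.integral_steps ha m n).2]
  refine (intervalIntegral.abs_integral_le_integral_abs h1).trans ?_
  refine intervalIntegral.integral_mono_interval le_rfl h1 h2 (.of_forall fun s => abs_nonneg _) ?_
  exact (h.integral_steps ha m n).1

lemma abs_integral_start_le (h : FollowsChain φ a x v θ q) (hf : ∀ b c, IntervalIntegrable f volume b c)
    (n : ℕ) : |∫ s in (0 : ℝ)..eventTime φ a θ q n, f (x s)| ≤
      |f 0| * θ + totalGain φ a (primitive fun y => |f y|) |f 0| n q := by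
  have ha : ∀ b c, IntervalIntegrable (fun y => |f y|) volume b c := fun b c => (hf b c).abs
  have h0 := h.integral_start (f := fun y => |f y|)
  have h1 := h.integral_steps ha 0 n
  rw [zero_add, eventTime_zero] at h1
  refine (intervalIntegral.abs_integral_le_integral_abs (h.eventTime_nonneg n)).trans (le_of_eq ?_)
  rw [← intervalIntegral.integral_add_adjacent_intervals h0.1 h1.1, h0.2, h1.2]
  rfl

lemma integral_sub (h : FollowsChain φ a x v θ q) (hf : ∀ b c, IntervalIntegrable f volume b c)
    {b c : ℝ} (hb : 0 ≤ b) (hc : 0 ≤ c) :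
    (∫ s in (0 : ℝ)..c, f (x s)) - ∫ s in (0 : ℝ)..b, f (x s) = ∫ s in b..c, f (x s) :=
  intervalIntegral.integral_interval_sub_left (h.intervalIntegrable hf le_rfl hc)
    (h.intervalIntegrable hf le_rfl hb)

end FollowsChain

/-- Integrals along the trajectories of a continuous process are measurable. -/
lemma aemeasurable_integral_of_continuous {Ω : Type*} [MeasurableSpace Ω] {P : Measure Ω}
    {X : ℝ → Ω → ℝ} (hX : ∀ t, Measurable (X t))
    (hc : ∀ᵐ ω ∂P, ContinuousOn (fun t => X t ω) (Set.Ici 0)) {f : ℝ → ℝ} (hf : Measurable f) {τ : ℝ}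
    (hτ : 0 ≤ τ) : AEMeasurable (fun ω => ∫ t in (0 : ℝ)..τ, f (X t ω)) P := by
  classical
  obtain ⟨G, hGsub, hGm, hG⟩ := exists_measurable_superset_of_null (ae_iff.1 hc)
  -- After a change on a null set, and with time truncated at 0, all paths are continuous, which
  -- makes the process jointly measurable.
  set X' : ℝ → Ω → ℝ := fun t ω => if ω ∈ G then 0 else X (max t 0) ω with hX'
  have hX'm : ∀ t, Measurable (X' t) := fun t => Measurable.ite hGm measurable_const (hX _)
  have hX'c : ∀ ω, Continuous fun t => X' t ω := fun ω => by
    by_cases hω : ω ∈ G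
    · simp only [hX', hω, if_true]; exact continuous_const
    · simp only [hX', hω, if_false]
      have : ContinuousOn (fun t => X t ω) (Set.Ici 0) := by
        by_contra hcon; exact hω (hGsub hcon)
      exact this.comp_continuous (by fun_prop) fun t => le_max_right t 0
  have hmeas : Measurable (Function.uncurry X') :=
    measurable_uncurry_of_continuous_of_measurable hX'c hX'm
  have hint : StronglyMeasurable fun ω => ∫ t in Set.Ioc 0 τ, f (X' t ω) := by
    have h1 : StronglyMeasurable (Function.uncurry fun (ω : Ω) (t : ℝ) => f (X' t ω)) :=
      (hf.comp (hmeas.comp measurable_swap)).stronglyMeasurable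
    exact h1.integral_prod_right
  refine ⟨_, hint.measurable, ?_⟩
  have hnull : ∀ᵐ ω ∂P, ω ∉ G := measure_eq_zero_iff_ae_notMem.1 hG
  filter_upwards [hnull] with ω hω
  rw [intervalIntegral.integral_of_le hτ]
  refine setIntegral_congr_fun measurableSet_Ioc fun t ht => ?_
  simp only [hX', hω, if_false, max_eq_left ht.1.le]

variable {u : ℝ → ℝ} {κ : Measure ℝ} [IsProbabilityMeasure κ]

/-- The centered integral over a cycle. -/
def centeredCycle (φ : ℝ → ℝ) (a b : ℝ) (f : ℝ → ℝ) (m : ℝ) (ξ : ClockStream) : ℝ :=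
  cycleGain φ a (a, b) (primitive f) (f 0) ((a, b), ξ) - m * cycleGain φ a (a, b) id 1 ((a, b), ξ)

/-- The central limit theorem for a process that follows the event chain. -/
theorem followsChain_clt (hφ : Continuous φ) (hu : ∀ x, HasDerivAt u (φ x) x) {w : ℝ} (hw : 0 < w)
    (hκ : Integrable id κ) (hκw : ∫ D, D ∂κ = w) (hκ0 : ∀ᵐ D ∂κ, 0 ≤ D)
    [IsFiniteMeasure (densityWithAtom u w)] (hDpos : 0 < (densityWithAtom u w).real Set.univ)
    {f : ℝ → ℝ} (hfm : Measurable f) (hfi : Integrable f (densityWithAtom u w)) {m : ℝ}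
    (hm : (densityWithAtom u w).real Set.univ * m = ∫ x, f x ∂densityWithAtom u w)
    {b : ℝ} (ha : a ≠ 0) {Ω : Type*} [MeasurableSpace Ω] {P : Measure Ω} [IsProbabilityMeasure P]
    {X Y : ℝ → Ω → ℝ} (hX : ∀ t, Measurable (X t))
    (hXc : ∀ᵐ ω ∂P, ContinuousOn (fun t => X t ω) (Set.Ici 0)) {ρ : Measure ℝ}
    [IsProbabilityMeasure ρ] {θ : Ω → ℝ} {ξ : Ω → ClockStream}
    (hlaw : MeasurePreserving (fun ω => (θ ω, ξ ω)) P (ρ.prod (streamLaw κ))) {s : ℝ × ℝ}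
    (hfol : ∀ᵐ ω ∂P, FollowsChain φ a (fun t => X t ω) (fun t => Y t ω) (θ ω) (s, ξ ω))
    (hreg : RegenerationConditions P f X Y a b) :
    0 < ∫ ξ, cycleGain φ a (a, b) id 1 ((a, b), ξ) ∂streamLaw κ ∧
    Integrable (fun ξ => cycleGain φ a (a, b) id 1 ((a, b), ξ)) (streamLaw κ) ∧
    MemLp (centeredCycle φ a b f m) 2 (streamLaw κ) ∧
    ∫ ξ, centeredCycle φ a b f m ξ ∂streamLaw κ = 0 ∧
    HasAsymptoticVariance P f X m (Var[centeredCycle φ a b f m; streamLaw κ] /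
      ∫ ξ, cycleGain φ a (a, b) id 1 ((a, b), ξ) ∂streamLaw κ).toNNReal := by
  have hf : ∀ b c, IntervalIntegrable f volume b c := intervalIntegrable_of_densityWithAtom
    (continuous_iff_continuousAt.2 fun t => (hu t).continuousAt) hfi
  have hfa : ∀ b c, IntervalIntegrable (fun y => |f y|) volume b c := fun b c => (hf b c).abs
  set z : ℝ × ℝ := (a, b) with hz
  set Q := streamLaw κ with hQ
  have hpf : Measurable (primitive f) := measurable_primitive hf
  have hpa : Measurable (primitive fun y => |f y|) := measurable_primitive hfa
  have hθm : Measurable θ := hlaw.measurable.fst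
  have hξm : Measurable ξ := hlaw.measurable.snd
  have hξ : MeasurePreserving ξ P Q := measurePreserving_snd.comp hlaw
  set η : Ω → ClockStream := fun ω => streamAtFirstVisit φ a z (s, ξ ω) with hη
  set Nω : Ω → ℕ := fun ω => firstVisit φ a z (s, ξ ω) with hN
  -- the first visit
  have hexω : ∀ᵐ ω ∂P, ∃ n, ((chainStep φ a)^[n] (s, ξ ω)).1 = z := by
    filter_upwards [hfol, hreg.time₀_finite] with ω h h0
    exact h.exists_of_regenTime₀ ha h0
  have hexm : MeasurableSet {ξ : ClockStream | ∃ n, ((chainStep φ a)^[n] (s, ξ)).1 = z} := by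
    have : {ξ : ClockStream | ∃ n, ((chainStep φ a)^[n] (s, ξ)).1 = z} =
        ⋃ n, Prod.mk s ⁻¹' {q | ((chainStep φ a)^[n] q).1 = z} := by ext ξ; simp
    rw [this]
    exact MeasurableSet.iUnion fun n => measurable_prodMk_left (measurableSet_visit hφ z n)
  have hex : ∀ᵐ ξ ∂Q, ∃ n, ((chainStep φ a)^[n] (s, ξ)).1 = z := by
    rw [← hξ.map_eq, ae_map_iff hξm.aemeasurable hexm]; exact hexω
  have hηm : Measurable η := (measurable_streamAtFirstVisit hφ z).comp (measurable_prodMk_left.comp hξm)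
  have hchain : ∀ ω, (∃ n, ((chainStep φ a)^[n] (s, ξ ω)).1 = z) →
      (chainStep φ a)^[Nω ω] (s, ξ ω) = (z, η ω) := fun ω h =>
    Prod.ext (FollowsChain.firstVisit_spec h) rfl
  -- the delay is independent of the stream at the first visit
  set Φ : Fin 3 → ℝ → ℝ := ![id, primitive f, primitive fun y => |f y|] with hΦ
  set cc : Fin 3 → ℝ := ![1, f 0, |f 0|] with hcc
  have hΦm : ∀ i, Measurable (Φ i) := fun i => by
    fin_cases i
    · exact measurable_id
    · exact hpf
    · exact hpa
  -- The end of the delay, an entry that plays no role, and a bound for the integral over the delay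
  -- including the initial rest at 0.
  set A₀ : ℝ × (Fin 3 → ℝ) → ℝ × ℝ × ℝ := fun p => (p.1 + p.2 0, 0, |f 0| * p.1 + p.2 2) with hA₀
  have hA₀m : Measurable A₀ := by
    have h0 : Measurable fun p : ℝ × (Fin 3 → ℝ) => p.2 0 := (measurable_pi_apply 0).comp measurable_snd
    have h2 : Measurable fun p : ℝ × (Fin 3 → ℝ) => p.2 2 := (measurable_pi_apply 2).comp measurable_snd
    exact (measurable_fst.add h0).prodMk (measurable_const.prodMk ((measurable_fst.const_mul _).add h2))
  set δ : ClockStream → Fin 3 → ℝ := fun ξ i => delayGain φ a z (Φ i) (cc i) (s, ξ) with hδ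
  have hδm : Measurable δ := measurable_pi_lambda _ fun i =>
    (measurable_delayGain hφ z (hΦm i) (cc i)).comp measurable_prodMk_left
  set A : Ω → ℝ × ℝ × ℝ := fun ω => A₀ (θ ω, δ (ξ ω)) with hA
  have hAm : Measurable A := hA₀m.comp (hθm.prodMk (hδm.comp hξm))
  have hσm : Measurable fun ξ : ClockStream => streamAtFirstVisit φ a z (s, ξ) :=
    (measurable_streamAtFirstVisit hφ z).comp measurable_prodMk_left
  have hlaw1 : ∀ G : (ℝ × ℝ × ℝ) × ClockStream → ℝ≥0∞, Measurable G →
      ∫⁻ ω, G (A ω, η ω) ∂P = ∫⁻ ω, ∫⁻ ξ', G (A ω, ξ') ∂Q ∂P := by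
    intro G hG
    have hG1 : Measurable fun p : ℝ × ClockStream =>
        G (A₀ (p.1, δ p.2), streamAtFirstVisit φ a z (s, p.2)) :=
      hG.comp ((hA₀m.comp (measurable_fst.prodMk (hδm.comp measurable_snd))).prodMk
        (hσm.comp measurable_snd))
    have hG2 : Measurable fun p : ℝ × ClockStream => ∫⁻ ξ', G (A₀ (p.1, δ p.2), ξ') ∂Q :=
      Measurable.lintegral_prod_right' (f := fun r : (ℝ × ClockStream) × ClockStream =>
        G (A₀ (r.1.1, δ r.1.2), r.2))
        (hG.comp ((hA₀m.comp (measurable_fst.fst.prodMk (hδm.comp measurable_fst.snd))).prodMk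
          measurable_snd))
    have e1 := hlaw.lintegral_comp hG1
    have e2 := hlaw.lintegral_comp hG2
    refine e1.trans (Eq.trans ?_ e2.symm)
    rw [lintegral_prod _ hG1.aemeasurable, lintegral_prod _ hG2.aemeasurable]
    refine lintegral_congr fun t => ?_
    exact lintegral_delay κ hφ s z hΦm cc hex (G := fun p => G (A₀ (t, p.1), p.2))
      (hG.comp ((hA₀m.comp (measurable_const.prodMk measurable_fst)).prodMk measurable_snd))
  have hηp : MeasurePreserving η P Q := ⟨hηm, Measure.ext_of_lintegral _ fun g hg => by
    rw [lintegral_map hg hηm]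
    refine (hlaw1 (fun p => g p.2) (hg.comp measurable_snd)).trans ?_
    simp⟩
  -- the cycles
  have hvisω : ∀ᵐ ω ∂P, Visits φ a z (z, η ω) := by
    filter_upwards [hfol, hexω, hreg.time₁_finite] with ω h h0 h1
    have := h.visits_of_regenTime₁ ha h0 h1
    rwa [hchain ω h0] at this
  have hvism : MeasurableSet {ξ : ClockStream | Visits φ a z (z, ξ)} :=
    measurable_prodMk_left (measurableSet_visits hφ z)
  have hvis : ∀ᵐ ξ ∂Q, Visits φ a z (z, ξ) := by
    rw [← hηp.map_eq, ae_map_iff hηm.aemeasurable hvism]; exact hvisω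
  set R : ClockStream → ClockStream := fun ξ => streamAtVisit φ a z (z, ξ) with hR
  have hRm : Measurable R := (measurable_streamAtVisit hφ z).comp measurable_prodMk_left
  set Γ : ClockStream → Fin 3 → ℝ := fun ξ i => cycleGain φ a z (Φ i) (cc i) (z, ξ) with hΓ
  have hΓm : Measurable Γ := measurable_pi_lambda _ fun i =>
    (measurable_cycleGain hφ z (hΦm i) (cc i)).comp measurable_prodMk_left
  set W₀ : (Fin 3 → ℝ) → ℝ × ℝ × ℝ := fun y => (y 0, y 1, y 2) with hW₀
  have hW₀m : Measurable W₀ := (measurable_pi_apply 0).prodMk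
    ((measurable_pi_apply 1).prodMk (measurable_pi_apply 2))
  set W : ClockStream → ℝ × ℝ × ℝ := fun ξ => W₀ (Γ ξ) with hW
  have hWm : Measurable W := hW₀m.comp hΓm
  have hcyc : ∀ G : (ℝ × ℝ × ℝ) × ClockStream → ℝ≥0∞, Measurable G →
      ∫⁻ ξ, G (W ξ, R ξ) ∂Q = ∫⁻ ξ, ∫⁻ ξ', G (W ξ, ξ') ∂Q ∂Q := fun G hG =>
    lintegral_cycle κ hφ z z hΦm cc hvis (G := fun p => G (W₀ p.1, p.2))
      (hG.comp ((hW₀m.comp measurable_fst).prodMk measurable_snd))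
  have hRp : MeasurePreserving R Q Q := measurePreserving_of_lintegral hRm hcyc
  set V := cycleSeq W R A η with hV
  obtain ⟨hind, hVm, hVlaw⟩ := iIndepFun_cycleSeq hWm hRm hcyc hAm hηp hlaw1
  -- The chain has velocities ±1 and does visit `(a, b)`.
  have hb : b = 1 ∨ b = -1 := by
    obtain ⟨ω, h, h0⟩ := (hfol.and hexω).exists
    have h1 := iterate_chainStep_snd (φ := φ) (a := a) h.velocity (Nω ω)
    rw [hchain ω h0] at h1; exact h1
  have hzv : z.2 = 1 ∨ z.2 = -1 := hb
  -- the identification of the regeneration times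
  have hvisn : ∀ᵐ ω ∂P, ∀ n, Visits φ a z (z, R^[n] (η ω)) := by
    refine ae_all_iff.2 fun n => ?_
    exact ((hRp.iterate n).comp hηp).quasiMeasurePreserving.ae hvis
  -- `K ω n` is the number of chain steps up to the `n`-th regeneration, the first visit having the
  -- number 0.
  set K : Ω → ℕ → ℕ := fun ω n => Nat.rec (Nω ω) (fun j k => k + visitIndex φ a z (z, R^[j] (η ω))) n
    with hK
  have hKs : ∀ ω n, K ω (n + 1) = K ω n + visitIndex φ a z (z, R^[n] (η ω)) := fun ω n => rfl
  have hKchain : ∀ᵐ ω ∂P, ∀ n, (chainStep φ a)^[K ω n] (s, ξ ω) = (z, R^[n] (η ω)) := by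
    filter_upwards [hexω, hvisn] with ω h0 hv n
    induction n with
    | zero => exact hchain ω h0
    | succ n ih =>
      rw [hKs, add_comm, Function.iterate_add_apply, ih, Function.iterate_succ_apply']
      exact Prod.ext (iterate_visitIndex_fst (hv n)) rfl
  have hVs : ∀ n ω, V (n + 1) ω = W (R^[n] (η ω)) := fun n ω => rfl
  have hren : ∀ᵐ ω ∂P, ∀ n, renewalTime V n ω = eventTime φ a (θ ω) (s, ξ ω) (K ω n) := by
    filter_upwards [hKchain] with ω hc n
    induction n with
    | zero => simp only [renewalTime, zero_add, Finset.sum_range_one]; rfl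
    | succ n ih =>
      rw [renewalTime_succ, ih, hKs, eventTime, eventTime, totalGain_add, hc n, add_assoc]
      rfl
  have hreg0 : ∀ᵐ ω ∂P, cycleLength X Y a b ω = cycleGain φ a z id 1 (z, η ω) ∧
      cycleIntegral f X Y a b ω = cycleGain φ a z (primitive f) (f 0) (z, η ω) := by
    filter_upwards [hfol, hexω, hvisω] with ω h h0 hv
    have hv' : Visits φ a (a, b) ((chainStep φ a)^[firstVisit φ a (a, b) (s, ξ ω)] (s, ξ ω)) := by
      have := hchain ω h0
      rw [show firstVisit φ a (a, b) (s, ξ ω) = Nω ω from rfl, this]; exact hv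
    have e0 := h.regenTime₀_eq ha h0
    have e1 := h.regenTime₁_eq ha h0 hv'
    have e2 : (chainStep φ a)^[firstVisit φ a (a, b) (s, ξ ω)] (s, ξ ω) = (z, η ω) := hchain ω h0
    rw [e2] at e1
    unfold cycleLength cycleIntegral
    rw [e0, e1, ENNReal.toReal_ofReal (h.eventTime_nonneg _), ENNReal.toReal_ofReal (h.eventTime_nonneg _),
      (h.integral_steps hf _ _).2, e2]
    refine ⟨?_, rfl⟩
    rw [eventTime, eventTime, totalGain_add, e2]
    simp only [cycleGain]; ring
  have hLm : Measurable fun ξ : ClockStream => cycleGain φ a z id 1 (z, ξ) :=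
    (measurable_cycleGain hφ z measurable_id 1).comp measurable_prodMk_left
  have hIm : Measurable fun ξ : ClockStream => cycleGain φ a z (primitive f) (f 0) (z, ξ) :=
    (measurable_cycleGain hφ z hpf (f 0)).comp measurable_prodMk_left
  have hC : Integrable (fun ξ => cycleGain φ a z id 1 (z, ξ)) Q := by
    rw [← hηp.integrable_comp hLm.aestronglyMeasurable]
    exact hreg.length_integrable.congr (hreg0.mono fun ω h => h.1)
  obtain ⟨hF, hFeq⟩ := integral_cycleGain_eq (a := a) κ hφ hu hw hκ hκw hκ0 hzv hvis hC hfm hf hfi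
  have hmeanF : ∫ ξ, cycleGain φ a z (primitive f) (f 0) (z, ξ) ∂Q =
      m * ∫ ξ, cycleGain φ a z id 1 (z, ξ) ∂Q := by
    have h1 : (densityWithAtom u w).real Set.univ *
        (∫ ξ, cycleGain φ a z (primitive f) (f 0) (z, ξ) ∂Q) = (densityWithAtom u w).real Set.univ *
        (m * ∫ ξ, cycleGain φ a z id 1 (z, ξ) ∂Q) := by
      rw [hFeq, ← hm]; ring
    exact mul_left_cancel₀ hDpos.ne' h1
  have hpos : ∀ᵐ ω ∂P, 0 < cycleGain φ a z id 1 (z, η ω) := by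
    filter_upwards [hfol, hKchain, hren] with ω h hc hr
    have h1 := hr 1
    rw [renewalTime_succ, hr 0] at h1
    have h2 : eventTime φ a (θ ω) (s, ξ ω) (K ω 0) < eventTime φ a (θ ω) (s, ξ ω) (K ω 1) :=
      h.strictMono (by
        rw [show K ω 1 = K ω 0 + visitIndex φ a z (z, R^[0] (η ω)) from rfl]
        exact Nat.lt_add_of_pos_right (Nat.succ_pos _))
    have h3 : (V 1 ω).1 = cycleGain φ a z id 1 (z, η ω) := rfl
    rw [zero_add] at h1
    linarith
  have hposC : 0 < ∫ ξ, cycleGain φ a z id 1 (z, ξ) ∂Q := by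
    rw [← hηp.map_eq, integral_map hηm.aemeasurable hLm.aestronglyMeasurable,
      integral_pos_iff_support_of_nonneg_ae (hpos.mono fun ω h => h.le)
        ((hηp.integrable_comp hLm.aestronglyMeasurable).2 hC), pos_iff_ne_zero]
    intro h
    obtain ⟨ω, h3, h4⟩ := (hpos.and (measure_eq_zero_iff_ae_notMem.1 h)).exists
    exact h4 (Function.mem_support.2 h3.ne')
  -- The centring constant of the regularity conditions is the stationary mean, so their moment
  -- condition concerns `centeredCycle`.
  have hcm : cycleMean P f X Y a b = m := by
    have e1 : ∫ ω, cycleIntegral f X Y a b ω ∂P = ∫ ξ, cycleGain φ a z (primitive f) (f 0) (z, ξ) ∂Q := by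
      rw [integral_congr_ae (hreg0.mono fun ω h => h.2), ← hηp.map_eq,
        integral_map hηm.aemeasurable hIm.aestronglyMeasurable]
    have e2 : ∫ ω, cycleLength X Y a b ω ∂P = ∫ ξ, cycleGain φ a z id 1 (z, ξ) ∂Q := by
      rw [integral_congr_ae (hreg0.mono fun ω h => h.1), ← hηp.map_eq,
        integral_map hηm.aemeasurable hLm.aestronglyMeasurable]
    rw [cycleMean, e1, e2, hmeanF, mul_div_assoc, div_self hposC.ne', mul_one]
  have hcent : ∀ ξ, centeredCycle φ a b f m ξ = cycleGain φ a z (primitive f) (f 0) (z, ξ) -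
      m * cycleGain φ a z id 1 (z, ξ) := fun ξ => rfl
  have hcentm : Measurable (centeredCycle φ a b f m) := hIm.sub (hLm.const_mul m)
  have hL2P : MemLp (fun ω => centeredCycle φ a b f m (η ω)) 2 P := by
    refine (memLp_congr_ae (hreg0.mono fun ω h => ?_)).1 hreg.memLp_two
    simp only [h.1, h.2, hcm, hcent]
  have hL2 : MemLp (centeredCycle φ a b f m) 2 Q := by
    rw [← hηp.map_eq, memLp_map_measure_iff (by
      rw [hηp.map_eq]; exact hcentm.aestronglyMeasurable) hηm.aemeasurable]
    exact hL2P
  have hmean0 : ∫ ξ, centeredCycle φ a b f m ξ ∂Q = 0 := by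
    simp only [hcent]
    rw [integral_sub hF (hC.const_mul m), integral_const_mul, hmeanF, sub_self]
  refine ⟨hposC, hC, hL2, hmean0, ?_⟩
  have hVc : ∀ ω, (V 1 ω).2.1 - m * (V 1 ω).1 = centeredCycle φ a b f m (η ω) := fun ω => rfl
  have hVl : ∀ ω, (V 1 ω).1 = cycleGain φ a z id 1 (z, η ω) := fun ω => rfl
  -- Truncation at 0 gives measurability for all τ; for negative τ the factor √τ is 0 and the
  -- integral does not matter.
  set I : ℝ → Ω → ℝ := fun τ ω => ∫ t in (0 : ℝ)..max τ 0, f (X t ω) with hI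
  have key := regenerative_clt (V := V) hVm hind (fun n => ⟨(hVm _).aemeasurable, (hVm _).aemeasurable, by
    rw [hVlaw, show V 1 = cycleSeq W R A η (0 + 1) from rfl, hVlaw]⟩) (μ := m) (I := I)
    (by simpa only [hVl] using hpos)
    (by simp only [hVl]; exact (hηp.integrable_comp hLm.aestronglyMeasurable).2 hC)
    (by simpa only [hVc] using hL2P)
    (by
      simp only [hVc]
      rw [← hmean0, ← hηp.map_eq, integral_map hηm.aemeasurable (by
        rw [hηp.map_eq]; exact hcentm.aestronglyMeasurable)])
    (fun τ => aemeasurable_integral_of_continuous hX hXc hfm (le_max_right τ 0))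
    (by
      filter_upwards [hfol, hren] with ω h hr
      rw [hr 0]
      simp only [hI, max_eq_left (h.eventTime_nonneg _)]
      exact h.abs_integral_start_le hf _)
    (by
      filter_upwards [hfol, hren, hKchain] with ω h hr hc n
      rw [hr n, hr (n + 1)]
      simp only [hI, max_eq_left (h.eventTime_nonneg _)]
      rw [h.integral_sub hf (h.eventTime_nonneg _) (h.eventTime_nonneg _), hKs,
        (h.integral_steps hf _ _).2, hc n]
      rfl)
    (by
      filter_upwards [hfol, hren, hKchain] with ω h hr hc n τ h1 h2
      rw [hr n] at h1 ⊢
      rw [hr (n + 1), hKs] at h2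
      have hτ : 0 ≤ τ := (h.eventTime_nonneg _).trans h1
      simp only [hI, max_eq_left (h.eventTime_nonneg _), max_eq_left hτ]
      rw [h.integral_sub hf (h.eventTime_nonneg _) hτ]
      refine (h.abs_integral_steps_le hf _ _ h1 h2).trans (le_of_eq ?_)
      rw [hc n]
      rfl)
  have hvar : Var[fun ω => (V 1 ω).2.1 - m * (V 1 ω).1; P] = Var[centeredCycle φ a b f m; Q] := by
    simp only [hVc]
    rw [← hηp.map_eq, variance_map (by
      rw [hηp.map_eq]; exact hcentm.aemeasurable) hηm.aemeasurable]
    rfl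
  have hlen : ∫ ω, (V 1 ω).1 ∂P = ∫ ξ, cycleGain φ a z id 1 (z, ξ) ∂Q := by
    simp only [hVl]
    rw [← hηp.map_eq, integral_map hηm.aemeasurable hLm.aestronglyMeasurable]
  rw [hvar, hlen] at key
  have hfun : (fun (τ : ℝ) ω => √τ * (τ⁻¹ * I τ ω - m)) =
      fun (τ : ℝ) ω => √τ * (τ⁻¹ * (∫ t in (0 : ℝ)..τ, f (X t ω)) - m) := by
    ext τ ω
    rcases le_or_gt 0 τ with h | h
    · simp only [hI, max_eq_left h]
    · rw [Real.sqrt_eq_zero_of_nonpos h.le, zero_mul, zero_mul]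
  rw [hfun] at key
  exact key

end

noncomputable section

/-! ### The laws of the clocks -/

lemma ae_pos_expMeasure : ∀ᵐ x ∂expMeasure 1, 0 < x := by
  have h : expMeasure 1 (Set.Ici 0) = 1 := by rw [expMeasure_Ici le_rfl]; simp
  have h1 : ∀ᵐ x ∂expMeasure 1, x ∈ Set.Ici (0 : ℝ) := (mem_ae_iff_prob_eq_one measurableSet_Ici).2 h
  have h2 : ∀ᵐ x ∂expMeasure 1, x ∉ ({0} : Set ℝ) := measure_eq_zero_iff_ae_notMem.1 (expMeasure_singleton 0)
  filter_upwards [h1, h2] with x h3 h4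
  exact lt_of_le_of_ne h3 fun h5 => h4 h5.symm

lemma integral_expMeasure : Integrable id (expMeasure 1) ∧ ∫ x, x ∂expMeasure 1 = 1 := by
  have hnn : 0 ≤ᵐ[expMeasure 1] (id : ℝ → ℝ) := ae_pos_expMeasure.mono fun x h => h.le
  have h1 : ∫⁻ x, ENNReal.ofReal (id x) ∂expMeasure 1 = 1 := by
    rw [lintegral_eq_lintegral_meas_le _ hnn aemeasurable_id]
    have h2 : ∀ t ∈ Set.Ioi (0 : ℝ), expMeasure 1 {x | t ≤ id x} = ENNReal.ofReal (Real.exp (-t)) :=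
      fun t ht => expMeasure_Ici (le_of_lt ht)
    rw [setLIntegral_congr_fun measurableSet_Ioi h2,
      ← ofReal_integral_eq_lintegral_ofReal (integrableOn_exp_neg_Ioi 0)
        (.of_forall fun t => (Real.exp_pos _).le), integral_exp_neg_Ioi_zero, ENNReal.ofReal_one]
  have hi : Integrable id (expMeasure 1) := by
    refine ⟨aestronglyMeasurable_id, ?_⟩
    rw [hasFiniteIntegral_iff_ofReal hnn, h1]; exact ENNReal.one_lt_top
  refine ⟨hi, ?_⟩
  have := integral_eq_lintegral_of_nonneg_ae hnn aestronglyMeasurable_id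
  rw [h1] at this
  simpa using this

/-- The clocks are positive and their sum diverges. -/
lemma ae_clocks : ∀ᵐ e ∂seqLaw (expMeasure 1), (∀ j, 0 < e j) ∧ Tendsto (clockSum e) atTop atTop := by
  have hm : ∀ k, Measure.map (fun e : ℕ → ℝ => e k) (seqLaw (expMeasure 1)) = expMeasure 1 :=
    fun k => Measure.infinitePi_map_eval (μ := fun _ : ℕ => expMeasure 1) k
  have hint := integral_seqLaw_eval (expMeasure 1) integral_expMeasure.1 0
  have hind : iIndepFun (fun (k : ℕ) (e : ℕ → ℝ) => e k) (seqLaw (expMeasure 1)) :=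
    iIndepFun_infinitePi (X := fun _ x => x) fun _ => measurable_id
  have hslln := strong_law_ae_real (μ := seqLaw (expMeasure 1)) (fun k (e : ℕ → ℝ) => e k) hint.1
    (fun j k hjk => hind.indepFun hjk) (fun k => ⟨(measurable_pi_apply k).aemeasurable,
      (measurable_pi_apply 0).aemeasurable, by rw [hm, hm]⟩)
  filter_upwards [hslln, ae_seqLaw _ ae_pos_expMeasure] with e h1 h2
  refine ⟨h2, ?_⟩
  rw [hint.2, integral_expMeasure.2] at h1
  have h3 := h1.pos_mul_atTop one_pos
    (tendsto_natCast_atTop_atTop : Tendsto (fun n : ℕ => (n : ℝ)) atTop atTop)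
  refine h3.congr' ?_
  filter_upwards [eventually_gt_atTop 0] with n hn
  rw [div_mul_cancel₀ _ (by exact_mod_cast hn.ne')]
  rfl

variable {φ : ℝ → ℝ} {a : ℝ}

/-- A flip never takes place exactly at the end of a step. -/
lemma ae_clock_ne (κ : Measure ℝ) [IsProbabilityMeasure κ] (hφ : Continuous φ) (s : ℝ × ℝ) :
    ∀ᵐ ξ ∂streamLaw κ, ∀ m, ((chainStep φ a)^[m] (s, ξ)).2.1 0 ≠
      cumRate φ ((chainStep φ a)^[m] (s, ξ)).1 (horizon a ((chainStep φ a)^[m] (s, ξ)).1) := by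
  refine ae_all_iff.2 fun m => ?_
  -- The current clock is exponential and independent of the state, so it equals a number determined
  -- by the state with probability 0.
  set B : Set (((ℝ × ℝ) × ℕ × (Fin 0 → ℝ)) × ClockStream) :=
    {p | p.2.1 0 = cumRate φ p.1.1 (horizon a p.1.1)} with hB
  have hBm : MeasurableSet B := by
    refine measurableSet_eq_fun ((measurable_pi_apply 0).comp measurable_snd.fst) ?_
    exact (measurable_cumRate_horizon hφ).comp measurable_fst.fst
  have key := lintegral_chainRecord (a := a) κ hφ s s (Φ := fun _ : Fin 0 => id) (fun _ => measurable_id)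
    (fun _ => 1) m (G := B.indicator 1) (measurable_one.indicator hBm)
  have h0 : ∀ c : ℝ, streamLaw κ {ξ | ξ.1 0 = c} = 0 := fun c => by
    have h1 : MeasurePreserving (fun ξ : ClockStream => ξ.1 0) (streamLaw κ) (expMeasure 1) :=
      (measurePreserving_eval_infinitePi (fun _ : ℕ => expMeasure 1) 0).comp measurePreserving_fst
    have h2 := h1.measure_preimage (measurableSet_singleton c).nullMeasurableSet
    rw [expMeasure_singleton] at h2
    exact h2
  have hz : ∀ r : (ℝ × ℝ) × ℕ × (Fin 0 → ℝ),
      ∫⁻ ξ', B.indicator (1 : ((ℝ × ℝ) × ℕ × (Fin 0 → ℝ)) × ClockStream → ℝ≥0∞) (r, ξ') ∂streamLaw κ = 0 :=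
    fun r => by
    have h3 : MeasurableSet {ξ' : ClockStream | (r, ξ') ∈ B} := measurable_prodMk_left hBm
    have h4 : (fun ξ' => B.indicator (1 : ((ℝ × ℝ) × ℕ × (Fin 0 → ℝ)) × ClockStream → ℝ≥0∞) (r, ξ')) =
        {ξ' : ClockStream | (r, ξ') ∈ B}.indicator 1 := rfl
    rw [h4, lintegral_indicator_one h3]
    exact h0 (cumRate φ r.1 (horizon a r.1))
  simp only [hz, lintegral_zero] at key
  have hGm : Measurable fun ξ : ClockStream => B.indicator (1 : ((ℝ × ℝ) × ℕ × (Fin 0 → ℝ)) × ClockStream → ℝ≥0∞)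
      (chainRecord φ a s (fun _ : Fin 0 => id) (fun _ => 1) m (s, ξ), ((chainStep φ a)^[m] (s, ξ)).2) :=
    (measurable_one.indicator hBm).comp
      (((measurable_chainRecord hφ s (fun _ => measurable_id) _ m).comp measurable_prodMk_left).prodMk
        ((measurable_iterate_chainStep hφ m).comp measurable_prodMk_left).snd)
  rw [lintegral_eq_zero_iff hGm] at key
  filter_upwards [key] with ξ hξ hcon
  have hmem : (chainRecord φ a s (fun _ : Fin 0 => id) (fun _ => 1) m (s, ξ),
      ((chainStep φ a)^[m] (s, ξ)).2) ∈ B := hcon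
  rw [Set.indicator_of_mem hmem] at hξ
  exact one_ne_zero hξ

/-! ### Joint laws of the clocks and the sticking times -/

section Joint

variable {Ω : Type*} [MeasurableSpace Ω] {P : Measure Ω}
  {μ κ : Measure ℝ} [IsProbabilityMeasure μ] [IsProbabilityMeasure κ]

/-- Independent identically distributed variables have a measurable version with the law of a
sequence. -/
lemma exists_measurePreserving_seq {E : ℕ → Ω → ℝ} (hE : ∀ k, HasLaw (E k) μ P) (hind : iIndepFun E P) :
    ∃ e : Ω → ℕ → ℝ, MeasurePreserving e P (seqLaw μ) ∧ ∀ᵐ ω ∂P, (fun k => E k ω) = e ω := by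
  have hm : AEMeasurable (fun ω k => E k ω) P := aemeasurable_pi_iff.2 fun k => (hE k).aemeasurable
  refine ⟨hm.mk, ⟨hm.measurable_mk, ?_⟩, hm.ae_eq_mk⟩
  rw [← Measure.map_congr hm.ae_eq_mk]
  exact (hind.hasLaw_infinitePi hE hm).map_eq

/-- Translates independence over a disjoint union of index sets into a product of two sequence laws,
the form of `streamLaw`. -/
lemma map_sumElim :
    ((seqLaw μ).prod (seqLaw κ)).map (fun p (j : ℕ ⊕ ℕ) => (Sum.elim p.1 p.2 j : ℝ)) =
      Measure.infinitePi fun j : ℕ ⊕ ℕ => (Sum.elim (fun _ => μ) (fun _ => κ) j : Measure ℝ) := by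
  have hp : ∀ j : ℕ ⊕ ℕ, IsProbabilityMeasure (Sum.elim (fun _ => μ) (fun _ => κ) j : Measure ℝ) := by
    rintro (j | j)
    · exact ‹IsProbabilityMeasure μ›
    · exact ‹IsProbabilityMeasure κ›
  have hm : Measurable fun (p : (ℕ → ℝ) × (ℕ → ℝ)) (j : ℕ ⊕ ℕ) => (Sum.elim p.1 p.2 j : ℝ) := by
    refine measurable_pi_iff.2 ?_
    rintro (j | j)
    · exact (measurable_pi_apply j).comp measurable_fst
    · exact (measurable_pi_apply j).comp measurable_snd
  refine Measure.eq_infinitePi (μ := fun j : ℕ ⊕ ℕ => (Sum.elim (fun _ => μ) (fun _ => κ) j : Measure ℝ))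
    fun s t ht => ?_
  rw [Measure.map_apply hm (MeasurableSet.pi (Finset.countable_toSet _) fun i _ => ht i)]
  have hset : (fun (p : (ℕ → ℝ) × (ℕ → ℝ)) (j : ℕ ⊕ ℕ) => (Sum.elim p.1 p.2 j : ℝ)) ⁻¹'
      (Set.pi (s : Set (ℕ ⊕ ℕ)) t) = (Set.pi (s.toLeft : Set ℕ) fun j => t (Sum.inl j)) ×ˢ
        (Set.pi (s.toRight : Set ℕ) fun j => t (Sum.inr j)) := by
    ext p
    simp [Set.mem_pi]
  rw [hset, Measure.prod_prod, seqLaw, seqLaw, Measure.infinitePi_pi _ fun j _ => ht _,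
    Measure.infinitePi_pi _ fun j _ => ht _, Finset.prod_sum_eq_prod_toLeft_mul_prod_toRight]
  rfl

lemma exists_measurePreserving_pair {E F : ℕ → Ω → ℝ} (hE : ∀ k, HasLaw (E k) μ P)
    (hF : ∀ k, HasLaw (F k) κ P) (hind : iIndepFun (Sum.elim E F) P) :
    ∃ e D : Ω → ℕ → ℝ, MeasurePreserving (fun ω => (e ω, D ω)) P ((seqLaw μ).prod (seqLaw κ)) ∧
      ∀ᵐ ω ∂P, (fun k => E k ω) = e ω ∧ (fun k => F k ω) = D ω := by
  have hp : ∀ j : ℕ ⊕ ℕ, IsProbabilityMeasure (Sum.elim (fun _ => μ) (fun _ => κ) j : Measure ℝ) := by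
    rintro (j | j)
    · exact ‹IsProbabilityMeasure μ›
    · exact ‹IsProbabilityMeasure κ›
  have hlaw : ∀ j, HasLaw (Sum.elim E F j) (Sum.elim (fun _ => μ) (fun _ => κ) j : Measure ℝ) P := by
    rintro (j | j)
    · exact hE j
    · exact hF j
  have hm : AEMeasurable (fun ω j => Sum.elim E F j ω) P :=
    aemeasurable_pi_iff.2 fun j => (hlaw j).aemeasurable
  have hmap := (hind.hasLaw_infinitePi (μ := fun j : ℕ ⊕ ℕ =>
    (Sum.elim (fun _ => μ) (fun _ => κ) j : Measure ℝ)) hlaw hm).map_eq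
  rw [Measure.map_congr hm.ae_eq_mk, ← map_sumElim] at hmap
  set split : (ℕ ⊕ ℕ → ℝ) → (ℕ → ℝ) × (ℕ → ℝ) := fun g => (fun k => g (Sum.inl k), fun k => g (Sum.inr k))
    with hsplit
  have hsm : Measurable split :=
    (measurable_pi_lambda _ fun k => measurable_pi_apply _).prodMk
      (measurable_pi_lambda _ fun k => measurable_pi_apply _)
  have hem : Measurable fun (p : (ℕ → ℝ) × (ℕ → ℝ)) (j : ℕ ⊕ ℕ) => (Sum.elim p.1 p.2 j : ℝ) := by
    refine measurable_pi_iff.2 ?_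
    rintro (j | j)
    · exact (measurable_pi_apply j).comp measurable_fst
    · exact (measurable_pi_apply j).comp measurable_snd
  refine ⟨fun ω => (split (hm.mk _ ω)).1, fun ω => (split (hm.mk _ ω)).2,
    ⟨hsm.comp hm.measurable_mk, ?_⟩, ?_⟩
  · have h1 := congrArg (Measure.map split) hmap
    rw [Measure.map_map hsm hm.measurable_mk, Measure.map_map hsm hem] at h1
    refine Eq.trans h1 ?_
    exact Measure.map_id
  · filter_upwards [hm.ae_eq_mk] with ω hω
    simp only [hsplit, ← hω]
    exact ⟨rfl, rfl⟩

/-- The law of the initial sticking time and of the remaining streams. -/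
lemma measurePreserving_initial {e D : Ω → ℕ → ℝ}
    (h : MeasurePreserving (fun ω => (e ω, D ω)) P ((seqLaw (expMeasure 1)).prod (seqLaw κ))) (x₀ : ℝ) :
    ∃ ρ : Measure ℝ, IsProbabilityMeasure ρ ∧
      MeasurePreserving (fun ω => (initialStick x₀ (D ω), initialStream x₀ (e ω) (D ω))) P
        (ρ.prod (streamLaw κ)) := by
  -- At 0 the first sticking time becomes the delay and the tail remains a fresh sequence; elsewhere
  -- the delay is 0.
  by_cases hx : x₀ = 0
  · refine ⟨κ, inferInstance, ?_⟩
    simp only [initialStick, initialStream, if_pos hx]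
    have hm : Measurable fun p : (ℕ → ℝ) × (ℕ → ℝ) => (p.2 0, ((p.1, seqTail p.2) : ClockStream)) :=
      ((measurable_pi_apply 0).comp measurable_snd).prodMk
        (measurable_fst.prodMk (measurable_seqTail.comp measurable_snd))
    refine MeasurePreserving.comp (μb := (seqLaw (expMeasure 1)).prod (seqLaw κ))
      (g := fun p : (ℕ → ℝ) × (ℕ → ℝ) => (p.2 0, ((p.1, seqTail p.2) : ClockStream))) ⟨hm, ?_⟩ h
    refine Measure.ext_of_lintegral _ fun g hg => ?_
    have hg' : Measurable fun p : ((ℕ → ℝ) × ℝ) × (ℕ → ℝ) => g (p.1.2, (p.1.1, p.2)) :=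
      hg.comp (measurable_fst.snd.prodMk (measurable_fst.fst.prodMk measurable_snd))
    rw [lintegral_map hg hm, lintegral_prod (fun p : (ℕ → ℝ) × (ℕ → ℝ) => g (p.2 0, (p.1, seqTail p.2)))
      (by exact (hg.comp hm).aemeasurable), lintegral_prod _ hg.aemeasurable]
    calc ∫⁻ e, ∫⁻ D, g (D 0, (e, seqTail D)) ∂seqLaw κ ∂seqLaw (expMeasure 1)
        = ∫⁻ e, ∫⁻ x, ∫⁻ D, g (x, (e, D)) ∂seqLaw κ ∂κ ∂seqLaw (expMeasure 1) :=
          lintegral_congr fun e => lintegral_seqLaw κ (g := fun D => g (D 0, (e, seqTail D)))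
            ((hg.comp hm).comp measurable_prodMk_left)
      _ = ∫⁻ x, ∫⁻ e, ∫⁻ D, g (x, (e, D)) ∂seqLaw κ ∂seqLaw (expMeasure 1) ∂κ :=
          lintegral_lintegral_swap hg'.lintegral_prod_right'.aemeasurable
      _ = _ := lintegral_congr fun x => by
          unfold streamLaw
          rw [lintegral_prod _ (by exact (hg.comp measurable_prodMk_left).aemeasurable)]
  · refine ⟨Measure.dirac 0, inferInstance, ?_⟩
    simp only [initialStick, initialStream, if_neg hx]
    have hm : Measurable fun p : ClockStream => ((0 : ℝ), p) := measurable_prodMk_left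
    refine MeasurePreserving.comp (μb := streamLaw κ) (g := fun p : ClockStream => ((0 : ℝ), p)) ⟨hm, ?_⟩ h
    rw [Measure.dirac_prod]

/-- The law of the streams with deterministic sticking times. -/
lemma measurePreserving_deterministic {e : Ω → ℕ → ℝ}
    (h : MeasurePreserving e P (seqLaw (expMeasure 1))) (θ w : ℝ) :
    MeasurePreserving (fun ω => (θ, ((e ω, fun _ => w) : ClockStream))) P
      ((Measure.dirac θ).prod (streamLaw (Measure.dirac w))) := by
  have hm : Measurable fun e : ℕ → ℝ => (θ, ((e, fun _ => w) : ClockStream)) :=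
    measurable_const.prodMk (measurable_id.prodMk measurable_const)
  refine MeasurePreserving.comp (μb := seqLaw (expMeasure 1))
    (g := fun e : ℕ → ℝ => (θ, ((e, fun _ => w) : ClockStream))) ⟨hm, ?_⟩ h
  refine Measure.ext_of_lintegral _ fun g hg => ?_
  rw [lintegral_map hg hm, Measure.dirac_prod, lintegral_map hg measurable_prodMk_left,
    lintegral_streamLaw_dirac w (g := fun ξ => g (θ, ξ)) (by exact hg.comp measurable_prodMk_left)]

end Joint

end

noncomputable section

/-! ### The coordinate processes of the two samplers -/

/-- The collapse is soft thresholding at half of the width, which positive and negative parts make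
visibly continuous. -/
lemma continuous_collapse {w : ℝ} (hw : 0 ≤ w) : Continuous (collapse w) := by
  have h : collapse w = fun y => max (y - w / 2) 0 + min (y + w / 2) 0 := by
    funext y
    unfold collapse
    split_ifs with h1
    · obtain ⟨h2, h3⟩ := abs_le.1 h1
      rw [max_eq_right (by linarith), min_eq_right (by linarith), add_zero]
    · rcases lt_or_ge 0 y with h2 | h2
      · rw [abs_of_pos h2, not_le] at h1
        rw [Real.sign_of_pos h2, max_eq_left (by linarith), min_eq_right (by linarith)]; ring
      · rw [abs_of_nonpos h2, not_le] at h1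
        rw [Real.sign_of_neg (by linarith), max_eq_right (by linarith), min_eq_left (by linarith)]; ring
  rw [h]
  fun_prop

/-- The exponential law with mean `w`. -/
def stickLaw (w : ℝ) : Measure ℝ := (expMeasure 1).map fun x => w * x

instance (w : ℝ) : IsProbabilityMeasure (stickLaw w) :=
  Measure.isProbabilityMeasure_map (measurable_const_mul w).aemeasurable

lemma integral_stickLaw (w : ℝ) : Integrable id (stickLaw w) ∧ ∫ x, x ∂stickLaw w = w := by
  have hm : Measurable fun x : ℝ => w * x := measurable_const_mul w
  constructor
  · refine (integrable_map_measure aestronglyMeasurable_id hm.aemeasurable).2 ?_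
    exact integral_expMeasure.1.const_mul w
  · rw [stickLaw, integral_map (f := fun x => x) hm.aemeasurable aestronglyMeasurable_id,
      integral_const_mul, integral_expMeasure.2, mul_one]

lemma ae_pos_stickLaw {w : ℝ} (hw : 0 < w) : ∀ᵐ x ∂stickLaw w, 0 < x := by
  rw [stickLaw, ae_map_iff (measurable_const_mul w).aemeasurable measurableSet_Ioi]
  exact ae_pos_expMeasure.mono fun x hx => mul_pos hw hx

section Samplers

variable {d : ℕ} {p : ℝ} {slab : ℝ → ℝ} {L : (Fin d → ℝ) → ℝ} (i : Fin d)
  {Ω : Type*} [MeasurableSpace Ω] {P : Measure Ω}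
  {x₀ v₀ : Fin d → ℝ} {X V : ℝ → Ω → Fin d → ℝ}

/-- A coordinate of the original sampler follows the chain with exponential sticking times. -/
lemma IsOriginalStickySampler.exists_followsChain (h : IsSpikeSlabModel p slab L)
    (hindep : iIndepFun (fun (j : Fin d) (x : Fin d → ℝ) => x j) (spikeSlabPosterior p slab L))
    (hO : IsOriginalStickySampler P p slab L x₀ v₀ X V) (a : ℝ) :
    ∃ (ρ : Measure ℝ) (_ : IsProbabilityMeasure ρ) (θ : Ω → ℝ) (ξ : Ω → ClockStream) (s : ℝ × ℝ),
      MeasurePreserving (fun ω => (θ ω, ξ ω)) P (ρ.prod (streamLaw (stickLaw (stickWidth p slab)))) ∧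
      ∀ᵐ ω ∂P, ContinuousOn (fun t => X t ω i) (Set.Ici 0) ∧
        FollowsChain (deriv (coordPotential slab L i)) a (fun t => X t ω i) (fun t => V t ω i) (θ ω)
          (s, ξ ω) := by
  obtain ⟨hv, -, -, E, F, hE, hF, hind, hpath⟩ := hO
  have hw := h.stickWidth_pos
  set w := stickWidth p slab with hwdef
  set φ := deriv (coordPotential slab L i) with hφdef
  have hφ : Continuous φ := continuous_deriv_coordPotential i h
  have hF' : ∀ k, HasLaw (fun ω => w * F i k ω) (stickLaw w) P := fun k =>
    ⟨(hF i k).aemeasurable.const_mul w, by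
      rw [stickLaw, ← (hF i k).map_eq, AEMeasurable.map_map_of_aemeasurable
        (measurable_const_mul w).aemeasurable (hF i k).aemeasurable]; rfl⟩
  -- Select the clocks of coordinate `i` and scale its sticking clocks to mean `w`.
  have hind' : iIndepFun (Sum.elim (E i) fun k ω => w * F i k ω) P := by
    have h1 := hind.precomp (g := Sum.map (fun k : ℕ => (i, k)) (fun k : ℕ => (i, k)))
      (Function.Injective.sumMap (fun j k hjk => (Prod.ext_iff.1 hjk).2)
        (fun j k hjk => (Prod.ext_iff.1 hjk).2))
    have h2 := h1.comp (Sum.elim (fun _ => id) fun _ x => w * x) (by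
      rintro (j | j)
      · exact measurable_id
      · exact measurable_const_mul w)
    convert h2 using 1
    ext (j | j) ω <;> rfl
  obtain ⟨e, D, heD, hae⟩ := exists_measurePreserving_pair (hE i) hF' hind'
  obtain ⟨ρ, hρ, hini⟩ := measurePreserving_initial heD (x₀ i)
  refine ⟨ρ, hρ, _, _, (x₀ i, v₀ i), hini, ?_⟩
  have hclk := (measurePreserving_fst.comp heD).quasiMeasurePreserving.ae ae_clocks
  have hstk := (measurePreserving_snd.comp heD).quasiMeasurePreserving.ae
    (ae_seqLaw _ (ae_pos_stickLaw hw))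
  have hgood := (measurePreserving_snd.comp hini).quasiMeasurePreserving.ae
    (ae_clock_ne (a := a) (stickLaw w) hφ (x₀ i, v₀ i))
  filter_upwards [hclk, hstk, hgood, hae, hpath] with ω h1 h2 h3 h4 h5
  have h6 : IsStickyPath φ (fun t => X t ω i) (fun t => V t ω i) (x₀ i) (v₀ i) (e ω) (D ω) := by
    refine ⟨h1.1, h1.2, h2, hv i, fun t ht => ?_, fun t ht => ?_⟩
    · have h7 := (h5 t ht i).1
      rw [h4.2] at h7
      exact h7
    · have h7 := (h5 t ht i).2
      rw [h4.1, h4.2] at h7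
      refine h7.trans ?_
      -- Independence under the posterior enters here: the flip rate becomes a function of
      -- coordinate `i` alone.
      simp only [zigzagRate, deriv_slabPotential i h hindep]
      rfl
  exact ⟨(h6.regularity hφ).1, h6.followsChain hφ h3⟩

/-- A coordinate of the latent sampler follows the chain with deterministic sticking times. -/
lemma IsLatentStickySampler.exists_followsChain (h : IsSpikeSlabModel p slab L)
    (hindep : iIndepFun (fun (j : Fin d) (x : Fin d → ℝ) => x j) (spikeSlabPosterior p slab L))
    (hL : IsLatentStickySampler P p slab L x₀ v₀ X V) (a : ℝ) :
    ∃ (ρ : Measure ℝ) (_ : IsProbabilityMeasure ρ) (θ : Ω → ℝ) (ξ : Ω → ClockStream) (s : ℝ × ℝ),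
      MeasurePreserving (fun ω => (θ ω, ξ ω)) P
        (ρ.prod (streamLaw (Measure.dirac (stickWidth p slab)))) ∧
      ∀ᵐ ω ∂P, ContinuousOn (fun t => X t ω i) (Set.Ici 0) ∧
        FollowsChain (deriv (coordPotential slab L i)) a (fun t => X t ω i) (fun t => V t ω i) (θ ω)
          (s, ξ ω) := by
  obtain ⟨Y, ⟨hv, -, -, E, hE, hind, hpath⟩, hXY⟩ := hL
  have hw := h.stickWidth_pos
  set w := stickWidth p slab with hwdef
  set φ := deriv (coordPotential slab L i) with hφdef
  have hφ : Continuous φ := continuous_deriv_coordPotential i h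
  have hψ := isLatentSlope_coordPotential i h
  obtain ⟨e, he, hae⟩ := exists_measurePreserving_seq (hE i)
    (hind.precomp (g := fun k : ℕ => (i, k)) fun j k hjk => (Prod.ext_iff.1 hjk).2)
  have hini := measurePreserving_deterministic he (latentExit w (x₀ i) (v₀ i)) w
  refine ⟨_, inferInstance, _, _, (collapse w (x₀ i), v₀ i), hini, ?_⟩
  have hclk := he.quasiMeasurePreserving.ae ae_clocks
  have hgood := (measurePreserving_snd.comp hini).quasiMeasurePreserving.ae
    (ae_clock_ne (a := a) (Measure.dirac w) hφ (collapse w (x₀ i), v₀ i))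
  filter_upwards [hclk, hgood, hae, hpath] with ω h1 h3 h4 h5
  have h6 : IsLatentPath (deriv fun y => coordPotential slab L i (collapse w y)) (fun t => Y t ω i)
      (fun t => V t ω i) (x₀ i) (v₀ i) (e ω) := by
    refine ⟨h1.1, h1.2, hv i, fun t ht => (h5 t ht i).1, fun t ht => ?_⟩
    have h7 := (h5 t ht i).2
    rw [h4] at h7
    refine h7.trans ?_
    simp only [zigzagRate, deriv_latentPotential i h hindep]
    rfl
  simp only [hXY]
  exact ⟨(continuous_collapse hw.le).comp_continuousOn (h6.regularity hφ hw.le hψ).1,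
    h6.followsChain hφ hw hψ h3⟩

end Samplers

/-- Replacing the sticking times by their mean does not increase the asymptotic variance. -/
lemma variance_centeredCycle_dirac_le {φ : ℝ → ℝ} {a b m : ℝ} {κ : Measure ℝ} [IsProbabilityMeasure κ]
    (hφ : Continuous φ) (hκ : Integrable id κ) {f : ℝ → ℝ} (hf : Measurable (primitive f))
    (h1 : MemLp (centeredCycle φ a b f m) 2 (streamLaw κ))
    (h1' : MemLp (centeredCycle φ a b f m) 2 (streamLaw (Measure.dirac (∫ x, x ∂κ))))
    (h2 : ∫ ξ, centeredCycle φ a b f m ξ ∂streamLaw κ = 0)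
    (h2' : ∫ ξ, centeredCycle φ a b f m ξ ∂streamLaw (Measure.dirac (∫ x, x ∂κ)) = 0) :
    Var[centeredCycle φ a b f m; streamLaw (Measure.dirac (∫ x, x ∂κ))] ≤
      Var[centeredCycle φ a b f m; streamLaw κ] := by
  have key := lintegral_sq_cycleGain_dirac_le (a := a) κ hφ hκ (a, b) hf (f 0) m
  rw [← ENNReal.ofReal_le_ofReal_iff (variance_nonneg _ _), h1.ofReal_variance_eq, h1'.ofReal_variance_eq,
    evariance, evariance, h2, h2']
  simp only [sub_zero]
  exact key

end

/-! ### Comparison of the two asymptotic variances -/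

theorem theorem2 {d : ℕ} {p : ℝ} {slab : ℝ → ℝ} {L : (Fin d → ℝ) → ℝ}
    (hmodel : IsSpikeSlabModel p slab L)
    -- the posterior has independent coordinates
    (hindep : iIndepFun (fun (j : Fin d) (x : Fin d → ℝ) => x j) (spikeSlabPosterior p slab L))
    -- the coordinate and the function of interest
    (i : Fin d) {f : ℝ → ℝ} (hf : Measurable f)
    (hfint : Integrable (fun x : Fin d → ℝ => f (x i)) (spikeSlabPosterior p slab L))
    -- the latent sticky sampler
    {ΩL : Type*} [MeasurableSpace ΩL] (PL : Measure ΩL) [IsProbabilityMeasure PL]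
    {yL vL : Fin d → ℝ} {XL VL : ℝ → ΩL → Fin d → ℝ}
    (hL : IsLatentStickySampler PL p slab L yL vL XL VL)
    -- the original sticky sampler
    {ΩO : Type*} [MeasurableSpace ΩO] (PO : Measure ΩO) [IsProbabilityMeasure PO]
    {xO vO : Fin d → ℝ} {XO VO : ℝ → ΩO → Fin d → ℝ}
    (hO : IsOriginalStickySampler PO p slab L xO vO XO VO)
    -- regularity of the regeneration times at a state `(a, b)` away from the spike
    {a b : ℝ} (ha : a ≠ 0)
    (hregL : RegenerationConditions PL f (fun t ω => XL t ω i) (fun t ω => VL t ω i) a b)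
    (hregO : RegenerationConditions PO f (fun t ω => XO t ω i) (fun t ω => VO t ω i) a b) :
    ∃ σ2L σ2O : ℝ≥0,
      HasAsymptoticVariance PL f (fun t ω => XL t ω i) (∫ x, f (x i) ∂(spikeSlabPosterior p slab L)) σ2L ∧
      HasAsymptoticVariance PO f (fun t ω => XO t ω i) (∫ x, f (x i) ∂(spikeSlabPosterior p slab L)) σ2O ∧
      σ2L ≤ σ2O := by
  have hw := hmodel.stickWidth_pos
  obtain ⟨hD, hDpos, hfi, hm⟩ := integral_coordinate i hmodel hindep hf hfint
  have hφ := continuous_deriv_coordPotential i hmodel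
  have hu := hasDerivAt_coordPotential i hmodel
  have hXO : ∀ t, Measurable fun ω => XO t ω i := fun t => (measurable_pi_apply i).comp (hO.2.1 t)
  have hXL : ∀ t, Measurable fun ω => XL t ω i := fun t => by
    obtain ⟨Y, hY, hXY⟩ := hL
    simp only [hXY]
    exact (continuous_collapse hw.le).measurable.comp ((measurable_pi_apply i).comp (hY.2.1 t))
  obtain ⟨ρO, _, θO, ξO, sO, hlawO, hfolO⟩ := hO.exists_followsChain i hmodel hindep a
  obtain ⟨ρL, _, θL, ξL, sL, hlawL, hfolL⟩ := hL.exists_followsChain i hmodel hindep a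
  obtain ⟨hκi, hκw⟩ := integral_stickLaw (stickWidth p slab)
  obtain ⟨hpos, hCO, hMO, hZO, hVO⟩ := followsChain_clt hφ hu hw hκi hκw
    ((ae_pos_stickLaw hw).mono fun x hx => hx.le) hDpos hf hfi hm ha hXO (hfolO.mono fun ω h => h.1)
    hlawO (hfolO.mono fun ω h => h.2) hregO
  -- The same limit theorem with the Dirac mass at the width as law of the sticking times; it has
  -- the same mean.
  obtain ⟨-, -, hML, hZL, hVL⟩ := followsChain_clt hφ hu hw
    (integrable_dirac (by exact enorm_lt_top)) (integral_dirac _ _)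
    (ae_dirac_iff measurableSet_Ici |>.2 hw.le) hDpos hf hfi hm ha hXL (hfolL.mono fun ω h => h.1)
    hlawL (hfolL.mono fun ω h => h.2) hregL
  refine ⟨_, _, hVL, hVO, ?_⟩
  -- Both variances have the same denominator, the mean cycle length, so only the variances of the
  -- centred cycles remain to be compared.
  have hC := integral_cycleGain_dirac (a := a) _ hφ hκi (a, b) measurable_id 1 hCO
  have hprim : Measurable (primitive f) := measurable_primitive (intervalIntegrable_of_densityWithAtom
    (continuous_iff_continuousAt.2 fun t => (hu t).continuousAt) hfi)
  have hVar := variance_centeredCycle_dirac_le (a := a) (b := b) (f := f) hφ hκi hprim hMO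
    (by rw [hκw]; exact hML) hZO (by rw [hκw]; exact hZL)
  rw [hκw] at hC hVar
  refine Real.toNNReal_le_toNNReal ?_
  rw [hC]
  refine div_le_div_of_nonneg_right hVar hpos.le
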